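/- There are a constant $C$ and a single algorithm (a program for a unit-cost random access machine with addition and subtraction, whose registers hold non-negative integers) with the following property. Let $G=(V,E)$ be a finite simple undirected graph with $m=|E|$ edges and $i$ isolated vertices, let $d(v)\ge 0$ be an integer demand for each $v\in V$, let $d^*=\max_{v\in V}d(v)$, and let $(T,\tau)$ be a branch decomposition of $G$: $T$ is a finite tree whose non-leaf nodes all have degree $3$, and $\tau$ is a bijection from $E$ to the set of leaves of $T$ (the node of a one-node tree counts as a leaf). For an edge $f$ of $T$ let $w(f)$ be the set of vertices $v$ of $G$ that are incident to two edges of $G$ which $\tau$ maps into different components of $T-f$, and let $b=\max_{f\in E(T)}|w(f)|$ be the width of $(T,\tau)$ (with $b=0$ if $T$ has no edge). Then, given $G$ (as a list of edges), $d$ and $(T,\tau)$, the algorithm finds a minimum $d$-vector dominating set of $G$, that is, a set $S\subseteq V$ of minimum cardinality such that every $v\in V\setminus S$ has at least $d(v)$ neighbours in $S$, in at most $$C\left((d^*+2)^{b}\,\bigl((d^*+1)^2+1\bigr)^{b/2}\,m+i\right)$$ steps. In particular, the running time is $O\bigl((d^*+2)^{b}((d^*+1)^2+1)^{b/2}\,m\bigr)$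 on graphs without isolated vertices. -/

import Mathlib

namespace VectorDomination

/-! ### Branch decompositions -/

/-- A leaf of a finite tree: a node of degree at most one. In a tree with at least two nodes these
are the nodes of degree one; the only node of a one-node tree also counts as a leaf, so that a
graph with a single edge has a branch decomposition. -/
def IsLeaf {W : Type*} (T : SimpleGraph W) (x : W) : Prop :=
  (T.neighborSet x).ncard ≤ 1

/-- A branch decomposition `(T, τ)` of a finite graph `G`: `T` is a finite tree all of whose
non-leaf nodes have degree three, and `τ` is a bijection from the edges of `G` to the leaves of `T`
(the values of `τ` at pairs that are not edges are irrelevant). -/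
structure BranchDecomposition {V : Type*} [Finite V] (G : SimpleGraph V)
    (W : Type*) [Finite W] where
  /-- the tree -/
  T : SimpleGraph W
  isTree : T.IsTree
  degree_eq_three : ∀ x, ¬ IsLeaf T x → (T.neighborSet x).ncard = 3
  /-- the map from the edges of the graph to the leaves of the tree -/
  τ : Sym2 V → W
  bijOn : Set.BijOn τ G.edgeSet {x | IsLeaf T x}

namespace BranchDecomposition

variable {V : Type*} [Finite V] {G : SimpleGraph V} {W : Type*} [Finite W]

/-- For one of the two components `K` of `T - f`, the set of edges of `G` mapped into `K`. -/
def edgesOn (B : BranchDecomposition G W) (f : Sym2 W)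
    (K : (B.T.deleteEdges {f}).ConnectedComponent) : Set (Sym2 V) :=
  {e | e ∈ G.edgeSet ∧ B.τ e ∈ K.supp}

/-- The order function: `v` belongs to `w(f)` when `v` is incident both to an edge of `E_f` and to
an edge of `E - E_f`, where `E_f` is the set of edges mapped to one of the two components of
`T - f` (the condition does not depend on which one). -/
def order (B : BranchDecomposition G W) (f : Sym2 W) : Set V :=
  {v | ∃ K : (B.T.deleteEdges {f}).ConnectedComponent,
    (∃ e ∈ B.edgesOn f K, v ∈ e) ∧ (∃ e ∈ G.edgeSet \ B.edgesOn f K, v ∈ e)}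

/-- The width: the maximum of `|w(f)|` over the edges `f` of `T` (zero if `T` has no edge). -/
noncomputable def width (B : BranchDecomposition G W) : ℕ :=
  ⨆ f : B.T.edgeSet, (B.order f).ncard

end BranchDecomposition

/-! ### Vector domination -/

/-- `S` is a `d`-vector dominating set of `G`: every vertex `v` outside `S` has at least `d v`
neighbours in `S`. -/
def IsVectorDominating {V : Type*} (G : SimpleGraph V) (d : V → ℕ) (S : Finset V) : Prop :=
  ∀ v, v ∉ S → d v ≤ (G.neighborSet v ∩ (S : Set V)).ncard

/-- `S` is a `d`-vector dominating set of minimum cardinality. -/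
def IsMinimumVectorDominating {V : Type*} (G : SimpleGraph V) (d : V → ℕ) (S : Finset V) : Prop :=
  IsVectorDominating G d S ∧ ∀ S' : Finset V, IsVectorDominating G d S' → S.card ≤ S'.card

/-! ### Random access machines

A unit-cost random access machine with registers `X 0, X 1, …` holding natural numbers, a
one-way input tape and a one-way output tape. There is no multiplication. -/

/-- The instructions of the machine. -/
inductive Instr where
  /-- `X i ← c` -/
  | const (i c : ℕ)
  /-- `X i ← X j + X k` -/
  | add (i j k : ℕ)
  /-- `X i ← max (X j - X k) 0` -/
  | sub (i j k : ℕ)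
  /-- `X i ← X (X j)` -/
  | load (i j : ℕ)
  /-- `X (X i) ← X j` -/
  | store (i j : ℕ)
  /-- if `X i > 0`, continue with instruction number `l` -/
  | jump (i l : ℕ)
  /-- move the next number of the input to `X i` (`0` if the input is exhausted) -/
  | read (i : ℕ)
  /-- append `X i` to the output -/
  | print (i : ℕ)

/-- A configuration of the machine. -/
structure Config where
  /-- number of the next instruction -/
  pc : ℕ
  /-- contents of the registers -/
  reg : ℕ → ℕ
  /-- unread part of the input -/
  inp : List ℕ
  /-- what has been printed so far -/
  out : List ℕ

/-- The initial configuration on a given input: all registers are zero. -/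
def Config.init (I : List ℕ) : Config where
  pc := 0
  reg := fun _ => 0
  inp := I
  out := []

/-- The effect of one instruction. -/
def Instr.exec : Instr → Config → Config
  | .const i c, s => { s with pc := s.pc + 1, reg := Function.update s.reg i c }
  | .add i j k, s => { s with pc := s.pc + 1, reg := Function.update s.reg i (s.reg j + s.reg k) }
  | .sub i j k, s => { s with pc := s.pc + 1, reg := Function.update s.reg i (s.reg j - s.reg k) }
  | .load i j, s => { s with pc := s.pc + 1, reg := Function.update s.reg i (s.reg (s.reg j)) }
  | .store i j, s => { s with pc := s.pc + 1, reg := Function.update s.reg (s.reg i) (s.reg j) }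
  | .jump i l, s => { s with pc := if 0 < s.reg i then l else s.pc + 1 }
  | .read i, s => { s with
      pc := s.pc + 1, reg := Function.update s.reg i (s.inp.headD 0), inp := s.inp.tail }
  | .print i, s => { s with pc := s.pc + 1, out := s.out ++ [s.reg i] }

/-- A program is a finite list of instructions. -/
abbrev Program := List Instr

/-- One step; a configuration whose program counter points to no instruction does not change. -/
def Program.step (P : Program) (s : Config) : Config :=
  match P[s.pc]? with
  | some a => a.exec s
  | none => s

/-- On input `I`, the program `P` halts after at most `t` steps, with output `O`. The machine halts
when the program counter points to no instruction. -/
def Program.HaltsWithin (P : Program) (I : List ℕ) (t : ℕ) (O : List ℕ) : Prop :=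
  P.length ≤ (P.step^[t] (Config.init I)).pc ∧ (P.step^[t] (Config.init I)).out = O

/-! ### Input and output -/

/-- `L` lists the edges of `G`, each exactly once, each by its two ends in some order. -/
def ListsEdges {V : Type*} (G : SimpleGraph V) (L : List (V × V)) : Prop :=
  (L.map fun p => s(p.1, p.2)).Nodup ∧ ∀ e, e ∈ (L.map fun p => s(p.1, p.2)) ↔ e ∈ G.edgeSet

/-- `I` is an encoding of the graph `G`, the demands `d` and the branch decomposition `(T, τ)`: the
numbers `|V(G)|`, `|E(G)|`, `|V(T)|`, then the demands of the vertices `0, 1, …`, then for each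
edge `e = uv` of `G`, in some order, the three numbers `u, v, τ(e)`, then for each edge of `T`, in
some order, its two ends. -/
def Encodes {n N : ℕ} (G : SimpleGraph (Fin n)) (d : Fin n → ℕ)
    (B : BranchDecomposition G (Fin N)) (I : List ℕ) : Prop :=
  ∃ (LG : List (Fin n × Fin n)) (LT : List (Fin N × Fin N)),
    ListsEdges G LG ∧ ListsEdges B.T LT ∧
    I = [n, LG.length, N] ++ List.ofFn d
      ++ (LG.flatMap fun p => [(p.1 : ℕ), (p.2 : ℕ), (B.τ s(p.1, p.2) : ℕ)])
      ++ (LT.flatMap fun p => [(p.1 : ℕ), (p.2 : ℕ)])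

/-- The number of isolated vertices of a graph. -/
noncomputable def numIsolated {V : Type*} (G : SimpleGraph V) : ℕ :=
  {v : V | G.neighborSet v = ∅}.ncard

/-- The maximum demand `d*`. -/
def maxDemand {n : ℕ} (d : Fin n → ℕ) : ℕ :=
  Finset.univ.sup d

end VectorDomination

set_option linter.constructorNameAsVariable false
set_option linter.unusedSimpArgs false

namespace VectorDomination

/-! ### A structured language with bounded loops -/

/-! The proof is a dynamic programme over the branch decomposition. For a set `A` of edges, `bd A`
consists of the vertices that meet edges both inside and outside `A`. The rest of the graph only
needs to know, for each vertex of `bd A`, either that it is chosen (value `0`) or a number `j` of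
chosen neighbours that it is guaranteed along `A` (value `j + 1`). No demand exceeds `d*`, so `d* +
2` values per vertex suffice. A table holds, for every assignment of values to `bd A`, one more than
the least size of a partial solution, or `0` if there is none (`Net.EntryOK`).

Tables of disjoint sets `A` and `B` are joined by treating the vertices of `bd A ∪ bd B`
independently (`Net.Opt`): a vertex is chosen on both sides, or its requirement is split as a sum of
two. Requirements are lower bounds, so exact splittings lose nothing; this is `Net.join_sound` and
`Net.join_complete`. A vertex in just one of the boundaries can be treated in at most `d* + 2` ways,
a vertex in both in at most `(d* + 1)^2 + 1` ways.

Let `r` be the number of vertices of the first kind and `c` that of the second. Vertices of the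
first kind stay in the boundary of `A ∪ B`, so `r ≤ b`, and `r + 2c = |bd A| + |bd B| ≤ 2b`. Since
`√((d* + 1)^2 + 1) ≤ d* + 2`, the number of combinations is largest in the extreme case `r = b`, `2c
= b`, which gives the bound `(d* + 2)^b ((d* + 1)^2 + 1)^(b/2)` (`pow_mul_pow_le`, `bound_floor`).
The program lists the combinations vertex by vertex; each vertex at least doubles the list, so the
total work is proportional to the final length (`allVertices_spec`).

The tree is not rooted. A leaf of what remains of it is merged into its only neighbour, and the
tables of the two nodes are joined, until one node is left. That every part occurring on the way has
boundary at most `b` is the content of `Deco.Contracted.merge` and `Deco.Contracted.card_bd_le`.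
There are fewer than `N ≤ 3m` joins and `m` tables of single edges. Each entry stores pointers to
the entries it came from, always at smaller addresses, so one downward sweep over the memory
recovers a solution (`trace_spec`). Isolated vertices are handled separately: they are chosen
exactly when their demand is positive. Together with `n ≤ 2m + i` this yields the running time.

The algorithm is written in a small structured language whose semantics counts time.
`exists_program` compiles it to the machine with a constant factor loss, so that all remaining
reasoning concerns the structured program, through `loop_rule` and `exec_frame`. -/

/-- The scalar variables of the program. -/
inductive Var where
  | n | m | N | dst | D | k | i | t | x | y | u | w | free | lf | sz | e1 | e2 | j1 | j2
  | pa | na | pb | nb | ba | bb | nu | v | lo | hi | lp | ea | eb | ec | c | fc | nx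
  | oa | ob | oc | od | oo | la | lb | p | l | r | a1 | a2 | nc | qe | rt | z | z2
  deriving DecidableEq

/-- The arrays of the program. -/
inductive Arr where
  | dem | deg | eu | ev | et | tdeg | tsum | base | wp | wn | lv | lc | ls
  | cst | el | er | eU | eV | q | ca | sa | cb | sb | uu | gA | gB | gC | gO | mark | ins
  deriving DecidableEq

/-- The number of an array. -/
def Arr.idx : Arr → ℕ
  | dem => 0 | deg => 1 | eu => 2 | ev => 3 | et => 4 | tdeg => 5 | tsum => 6 | base => 7
  | wp => 8 | wn => 9 | lv => 10 | lc => 11 | ls => 12 | cst => 13 | el => 14 | er => 15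
  | eU => 16 | eV => 17 | q => 18 | ca => 19 | sa => 20 | cb => 21 | sb => 22 | uu => 23
  | gA => 24 | gB => 25 | gC => 26 | gO => 27 | mark => 28 | ins => 29

theorem Arr.idx_lt (A : Arr) : A.idx < 30 := by cases A <;> decide

theorem Arr.idx_inj {A B : Arr} (h : A.idx = B.idx) : A = B := by
  revert h; cases A <;> cases B <;> decide

/-- The number of a variable. -/
def Var.idx : Var → ℕ := Var.ctorIdx

theorem Var.idx_inj {x y : Var} (h : x.idx = y.idx) : x = y := by
  revert h; cases x <;> cases y <;> decide

/-- Expressions. -/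
inductive Ex where
  | c (n : ℕ)
  | v (x : Var)
  | a (A : Arr) (e : Ex)
  | add (e f : Ex)
  | sub (e f : Ex)
  | ite (e f g : Ex)

/-- Commands. -/
inductive Cmd where
  | set (x : Var) (e : Ex)
  | put (A : Arr) (e f : Ex)
  | seq (c d : Cmd)
  | ite (e : Ex) (c d : Cmd)
  | loop (x : Var) (e : Ex) (c : Cmd)
  | read (x : Var)
  | print (e : Ex)
  | skip

/-- States of the structured language; `tm` counts the elapsed time. -/
structure St where
  v : Var → ℕ
  a : Arr → ℕ → ℕ
  inp : List ℕ
  out : List ℕ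
  tm : ℕ

/-- Assignment to a variable. -/
def St.setv (s : St) (x : Var) (n : ℕ) : St := { s with v := Function.update s.v x n }
/-- Assignment to an array cell. -/
def St.seta (s : St) (A : Arr) (i n : ℕ) : St :=
  { s with a := Function.update s.a A (Function.update (s.a A) i n) }
/-- One unit of time passes. -/
def St.tick (s : St) : St := { s with tm := s.tm + 1 }

section simps
variable (s : St) (x y : Var) (A B : Arr) (i n : ℕ)
@[simp] theorem setv_v : (s.setv x n).v y = if y = x then n else s.v y := by
  simp [St.setv, Function.update_apply]
@[simp] theorem setv_a : (s.setv x n).a = s.a := rfl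
@[simp] theorem setv_inp : (s.setv x n).inp = s.inp := rfl
@[simp] theorem setv_out : (s.setv x n).out = s.out := rfl
@[simp] theorem setv_tm : (s.setv x n).tm = s.tm := rfl
@[simp] theorem seta_v : (s.seta A i n).v = s.v := rfl
@[simp] theorem seta_a : (s.seta A i n).a B =
    if B = A then Function.update (s.a A) i n else s.a B := by
  by_cases h : B = A
  · subst h; simp [St.seta]
  · simp [St.seta, h]
@[simp] theorem seta_inp : (s.seta A i n).inp = s.inp := rfl
@[simp] theorem seta_out : (s.seta A i n).out = s.out := rfl
@[simp] theorem seta_tm : (s.seta A i n).tm = s.tm := rfl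
@[simp] theorem tick_v : s.tick.v = s.v := rfl
@[simp] theorem tick_a : s.tick.a = s.a := rfl
@[simp] theorem tick_inp : s.tick.inp = s.inp := rfl
@[simp] theorem tick_out : s.tick.out = s.out := rfl
@[simp] theorem tick_tm : s.tick.tm = s.tm + 1 := rfl
end simps

/-- Value of an expression. -/
@[simp] def Ex.eval : Ex → St → ℕ
  | .c n, _ => n
  | .v x, s => s.v x
  | .a A e, s => s.a A (e.eval s)
  | .add e f, s => e.eval s + f.eval s
  | .sub e f, s => e.eval s - f.eval s
  | .ite e f g, s => if 0 < e.eval s then f.eval s else g.eval s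

/-- `n` iterations of a loop body, the variable `x` counting from zero. -/
def iter (f : St → St) (x : Var) (s : St) : ℕ → St
  | 0 => s
  | n + 1 => f ((iter f x s n).setv x n).tick

/-- Execution of a command. -/
def Cmd.exec : Cmd → St → St
  | .set x e, s => (s.setv x (e.eval s)).tick
  | .put A e f, s => (s.seta A (e.eval s) (f.eval s)).tick
  | .seq c d, s => d.exec (c.exec s)
  | .ite e c d, s => if 0 < e.eval s then c.exec s.tick else d.exec s.tick
  | .loop x e c, s => iter c.exec x s.tick (e.eval s)
  | .read x, s => ({ s with inp := s.inp.tail }.setv x (s.inp.headD 0)).tick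
  | .print e, s => { s with out := s.out ++ [e.eval s] }.tick
  | .skip, s => s.tick

/-- Elapsed times are written with truncated subtraction; monotonicity makes them add up over
consecutive commands. -/
theorem exec_mono (c : Cmd) : ∀ s : St, s.tm ≤ (c.exec s).tm := by
  induction c with
  | set | put | read | print | skip => intro s; simp [Cmd.exec]
  | seq c d hc hd => intro s; exact (hc s).trans (hd _)
  | ite e c d hc hd =>
    intro s; simp only [Cmd.exec]; split
    · exact le_trans (by simp) (hc _)
    · exact le_trans (by simp) (hd _)
  | loop x e c hc =>
    intro s
    simp only [Cmd.exec]
    generalize e.eval s = n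
    induction n with
    | zero => simp [iter]
    | succ n ih => exact ih.trans (le_trans (by simp) (hc _))

/-! ### Compilation -/

/-- Hidden registers. -/
def hid (j : ℕ) : ℕ := 64 * j + 63
/-- The register of a variable. -/
def va (x : Var) : ℕ := 64 * x.idx + 62
/-- The register of an array cell. -/
def aa (A : Arr) (i : ℕ) : ℕ := 64 * i + A.idx

/-- Code that turns the index in register `h` into the address of the cell of `A`; `h'` is a
scratch register. -/
def addrCode (A : Arr) (h h' : ℕ) : List Instr :=
  [.add h h h, .add h h h, .add h h h, .add h h h, .add h h h, .add h h h,
    .const h' A.idx, .add h h h']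

/-- Code evaluating an expression into hidden register `t`. -/
def compE (off t : ℕ) : Ex → List Instr
  | .c n => [.const (hid t) n]
  | .v x => [.const (hid t) 0, .add (hid t) (hid t) (va x)]
  | .a A e => compE off t e ++ (addrCode A (hid t) (hid (t + 1)) ++ [.load (hid t) (hid t)])
  | .add e f => compE off t e ++ (compE (off + (compE off t e).length) (t + 1) f ++
      [.add (hid t) (hid t) (hid (t + 1))])
  | .sub e f => compE off t e ++ (compE (off + (compE off t e).length) (t + 1) f ++
      [.sub (hid t) (hid t) (hid (t + 1))])
  | .ite e f g =>
    let ce := compE off t e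
    let cg := compE (off + ce.length + 1) t g
    let cf := compE (off + ce.length + 1 + cg.length + 2) t f
    ce ++ ([.jump (hid t) (off + ce.length + 1 + cg.length + 2)] ++ (cg ++
      ([.const (hid (t + 1)) 1,
        .jump (hid (t + 1)) (off + ce.length + 1 + cg.length + 2 + cf.length)] ++ cf)))

/-- Code of a command; hidden registers from `h` on are used. -/
def compC (off h : ℕ) : Cmd → List Instr
  | .set x e => compE off h e ++ [.const (va x) 0, .add (va x) (va x) (hid h)]
  | .put A e f => compE off h e ++ (addrCode A (hid h) (hid (h + 1)) ++
      (compE (off + (compE off h e).length + 8) (h + 1) f ++ [.store (hid h) (hid (h + 1))]))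
  | .seq c d => compC off h c ++ compC (off + (compC off h c).length) h d
  | .ite e c d =>
    let ce := compE off h e
    let cd := compC (off + ce.length + 1) h d
    let cc := compC (off + ce.length + 1 + cd.length + 2) h c
    ce ++ ([.jump (hid h) (off + ce.length + 1 + cd.length + 2)] ++ (cd ++
      ([.const (hid (h + 1)) 1,
        .jump (hid (h + 1)) (off + ce.length + 1 + cd.length + 2 + cc.length)] ++ cc)))
  | .loop x e c =>
    let ce := compE off h e
    let cc := compC (off + ce.length + 6) (h + 2) c
    ce ++ ([.const (hid (h + 1)) 0, .jump (hid h) (off + ce.length + 4),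
      .const (hid (h + 2)) 1, .jump (hid (h + 2)) (off + ce.length + 6 + cc.length + 4),
      .const (va x) 0, .add (va x) (va x) (hid (h + 1))] ++ (cc ++
      [.const (hid (h + 2)) 1, .add (hid (h + 1)) (hid (h + 1)) (hid (h + 2)),
        .sub (hid h) (hid h) (hid (h + 2)), .jump (hid (h + 2)) (off + ce.length + 1)]))
  | .read x => [.read (va x)]
  | .print e => compE off h e ++ [.print (hid h)]
  | .skip => []

/-! ### Running compiled code -/

/-- The code `c` occurs in `P` at position `off`. -/
def At (P : Program) (off : ℕ) (c : List Instr) : Prop :=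
  ∃ pre post, P = pre ++ (c ++ post) ∧ pre.length = off

theorem At.left {P : Program} {off : ℕ} {c d : List Instr} (h : At P off (c ++ d)) :
    At P off c := by
  obtain ⟨pre, post, rfl, rfl⟩ := h
  exact ⟨pre, d ++ post, by simp, rfl⟩

theorem At.right {P : Program} {off : ℕ} {c d : List Instr} (h : At P off (c ++ d)) :
    At P (off + c.length) d := by
  obtain ⟨pre, post, rfl, rfl⟩ := h
  exact ⟨pre ++ c, post, by simp, by simp⟩

theorem At.head {P : Program} {off : ℕ} {a : Instr} {c : List Instr} (h : At P off (a :: c)) :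
    P[off]? = some a := by
  obtain ⟨pre, post, rfl, rfl⟩ := h
  simp

theorem At.tail {P : Program} {off : ℕ} {a : Instr} {c : List Instr} (h : At P off (a :: c)) :
    At P (off + 1) c := At.right (c := [a]) h

theorem step_of_at {P : Program} {off : ℕ} {a : Instr} {c : List Instr} (h : At P off (a :: c))
    {s : Config} (hs : s.pc = off) : P.step s = a.exec s := by
  simp [Program.step, hs, h.head]

/-- In at most `T` steps, `P` gets from `s` to a configuration satisfying `Q`. -/
def Gets (P : Program) (T : ℕ) (s : Config) (Q : Config → Prop) : Prop :=
  ∃ t ≤ T, Q (P.step^[t] s)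

theorem Gets.of {P : Program} {s : Config} {Q : Config → Prop} (T : ℕ) (h : Q s) :
    Gets P T s Q := ⟨0, Nat.zero_le _, h⟩

theorem Gets.bind {P : Program} {s : Config} {Q R : Config → Prop} {T T' U : ℕ}
    (h : Gets P T s Q) (h' : ∀ s', Q s' → Gets P T' s' R) (hT : T + T' ≤ U) : Gets P U s R := by
  obtain ⟨t, ht, hQ⟩ := h
  obtain ⟨t', ht', hR⟩ := h' _ hQ
  exact ⟨t' + t, by omega, by rwa [Function.iterate_add_apply]⟩

theorem Gets.step {P : Program} {off : ℕ} {a : Instr} {c : List Instr} {s : Config}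
    {Q : Config → Prop} {T : ℕ} (h : At P off (a :: c))
    (hs : s.pc = off) (h' : Gets P T (a.exec s) Q) : Gets P (T + 1) s Q := by
  obtain ⟨t, ht, hQ⟩ := h'
  refine ⟨t + 1, by omega, ?_⟩
  rw [Function.iterate_succ_apply, step_of_at h hs]
  exact hQ

theorem Gets.mono {P : Program} {s : Config} {Q R : Config → Prop} {T U : ℕ}
    (h : Gets P T s Q) (hT : T ≤ U) (hQ : ∀ s', Q s' → R s') : Gets P U s R := by
  obtain ⟨t, ht, hq⟩ := h
  exact ⟨t, ht.trans hT, hQ _ hq⟩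

/-- The configuration `s` of the machine represents the state `σ`. -/
structure Rep (σ : St) (s : Config) : Prop where
  v : ∀ x, s.reg (va x) = σ.v x
  a : ∀ A i, s.reg (aa A i) = σ.a A i
  inp : s.inp = σ.inp
  out : s.out = σ.out

/-- `s'` differs from `s` only in hidden registers from `h` on and in the program counter. -/
structure Same (h : ℕ) (s s' : Config) : Prop where
  reg : ∀ r, (∀ j, h ≤ j → r ≠ hid j) → s'.reg r = s.reg r
  inp : s'.inp = s.inp
  out : s'.out = s.out

theorem Same.trans {h : ℕ} {s s' s'' : Config} (h1 : Same h s s') (h2 : Same h s' s'') :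
    Same h s s'' :=
  ⟨fun r hr => (h2.reg r hr).trans (h1.reg r hr), h2.inp.trans h1.inp, h2.out.trans h1.out⟩

theorem Same.mono {h h' : ℕ} {s s' : Config} (H : Same h' s s') (hh : h ≤ h') : Same h s s' :=
  ⟨fun r hr => H.reg r fun j hj => hr j (hh.trans hj), H.inp, H.out⟩

/-- The three kinds of registers are separated by their residues modulo 64: arrays use residues
below 30, variables the residue 62, hidden registers the residue 63. -/
theorem va_ne_hid (x : Var) (j : ℕ) : va x ≠ hid j := by unfold va hid; omega

theorem aa_ne_hid (A : Arr) (i j : ℕ) : aa A i ≠ hid j := by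
  have := A.idx_lt; unfold aa hid; omega

theorem aa_ne_va (A : Arr) (i : ℕ) (x : Var) : aa A i ≠ va x := by
  have := A.idx_lt; unfold aa va; omega

theorem va_inj {x y : Var} : va x = va y ↔ x = y :=
  ⟨fun h => Var.idx_inj (by unfold va at h; omega), fun h => h ▸ rfl⟩

theorem aa_inj {A B : Arr} {i j : ℕ} : aa A i = aa B j ↔ A = B ∧ i = j := by
  refine ⟨fun h => ?_, fun h => h.1 ▸ h.2 ▸ rfl⟩
  have hA := A.idx_lt
  have hB := B.idx_lt
  unfold aa at h
  exact ⟨Arr.idx_inj (by omega), by omega⟩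

theorem hid_inj {i j : ℕ} : hid i = hid j ↔ i = j := by unfold hid; omega

theorem Rep.same {σ : St} {s s' : Config} {h : ℕ} (H : Rep σ s) (hs : Same h s s') : Rep σ s' :=
  ⟨fun x => (hs.reg _ fun j _ => va_ne_hid x j).trans (H.v x),
    fun A i => (hs.reg _ fun j _ => aa_ne_hid A i j).trans (H.a A i),
    hs.inp.trans H.inp, hs.out.trans H.out⟩

theorem Rep.tick {σ : St} {s : Config} (H : Rep σ s) : Rep σ.tick s := ⟨H.v, H.a, H.inp, H.out⟩

/-- Six doublings multiply the index by 64, and the number of the array is then added; the machine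
has no multiplication. -/
theorem addrCode_gets {P : Program} {off : ℕ} {A : Arr} {t i : ℕ} {s : Config}
    (hP : At P off (addrCode A (hid t) (hid (t + 1)))) (hs : s.pc = off)
    (hi : s.reg (hid t) = i) :
    Gets P 8 s fun s' => s'.pc = off + 8 ∧ s'.reg (hid t) = aa A i ∧ Same t s s' := by
  have ht : hid t ≠ hid (t + 1) := by simp [hid_inj]
  unfold addrCode at hP
  refine .step hP (by simp [hs]) (.step hP.tail (by simp [Instr.exec, hs])
    (.step hP.tail.tail (by simp [Instr.exec, hs]) (.step hP.tail.tail.tail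
      (by simp [Instr.exec, hs]) (.step hP.tail.tail.tail.tail (by simp [Instr.exec, hs])
      (.step hP.tail.tail.tail.tail.tail (by simp [Instr.exec, hs])
      (.step hP.tail.tail.tail.tail.tail.tail (by simp [Instr.exec, hs])
      (.step hP.tail.tail.tail.tail.tail.tail.tail (by simp [Instr.exec, hs])
      (.of 0 ⟨by simp [Instr.exec, hs], ?_, ?_, rfl, rfl⟩))))))))
  · simp [Instr.exec, ht, hi, aa]; ring
  · intro r hr
    simp [Instr.exec, Function.update_apply, hr t le_rfl, hr (t + 1) (Nat.le_succ t)]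

/-- The hidden registers form an evaluation stack: the result appears in register `t`, and pending
operands below `t` are untouched. The code only jumps forward, so its length bounds the number of
steps. -/
theorem compE_gets {P : Program} (e : Ex) : ∀ {off t : ℕ} {σ : St} {s : Config},
    At P off (compE off t e) → s.pc = off → Rep σ s →
    Gets P (compE off t e).length s fun s' => s'.pc = off + (compE off t e).length ∧
      s'.reg (hid t) = e.eval σ ∧ Same t s s' := by
  induction e with
  | c n =>
    intro off t σ s hP hs hR
    refine .step hP hs (.of 0 ⟨by simp [Instr.exec, hs, compE], by simp [Instr.exec],
      fun r hr => ?_, rfl, rfl⟩)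
    simp [Instr.exec, Function.update_apply, hr t le_rfl]
  | v x =>
    intro off t σ s hP hs hR
    refine .step hP hs (.step hP.tail (by simp [Instr.exec, hs])
      (.of 0 ⟨by simp [Instr.exec, hs, compE], ?_, fun r hr => ?_, rfl, rfl⟩))
    · simp [Instr.exec, va_ne_hid, hR.v]
    · simp [Instr.exec, Function.update_apply, hr t le_rfl]
  | a A e ih =>
    intro off t σ s hP hs hR
    simp only [compE] at hP
    refine (ih hP.left hs hR).bind (T' := 9) (fun s1 ⟨h1, h2, h3⟩ => ?_) (by simp [compE, addrCode])
    refine (addrCode_gets hP.right.left h1 h2).bind (T' := 1)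
      (fun s2 ⟨h4, h5, h6⟩ => ?_) (by simp)
    refine .step hP.right.right (by simp [h4, addrCode]) (.of 0 ⟨?_, ?_, ?_⟩)
    · simp [Instr.exec, h4, compE, addrCode]; ring
    · simp [Instr.exec, h5, ((hR.same h3).same h6).a]
    · refine (h3.trans h6).trans ⟨fun r hr => ?_, rfl, rfl⟩
      simp [Instr.exec, Function.update_apply, hr t le_rfl]
  | add e f ihe ihf =>
    intro off t σ s hP hs hR
    simp only [compE] at hP
    refine (ihe hP.left hs hR).bind (T' := (compE (off + (compE off t e).length) (t + 1) f).length + 1)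
      (fun s1 ⟨h1, h2, h3⟩ => ?_) (by simp [compE])
    refine (ihf hP.right.left h1 (hR.same h3)).bind (T' := 1)
      (fun s2 ⟨h4, h5, h6⟩ => ?_) (by simp)
    refine .step hP.right.right h4 (.of 0 ⟨?_, ?_, ?_⟩)
    · simp [Instr.exec, h4, compE]; ring
    · have := h6.reg (hid t) (fun j hj => by rw [Ne, hid_inj]; omega)
      simp [Instr.exec, h5, this, h2]
    · refine (h3.trans (h6.mono (by omega))).trans ⟨fun r hr => ?_, rfl, rfl⟩
      simp [Instr.exec, Function.update_apply, hr t le_rfl]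
  | sub e f ihe ihf =>
    intro off t σ s hP hs hR
    simp only [compE] at hP
    refine (ihe hP.left hs hR).bind (T' := (compE (off + (compE off t e).length) (t + 1) f).length + 1)
      (fun s1 ⟨h1, h2, h3⟩ => ?_) (by simp [compE])
    refine (ihf hP.right.left h1 (hR.same h3)).bind (T' := 1)
      (fun s2 ⟨h4, h5, h6⟩ => ?_) (by simp)
    refine .step hP.right.right h4 (.of 0 ⟨?_, ?_, ?_⟩)
    · simp [Instr.exec, h4, compE]; ring
    · have := h6.reg (hid t) (fun j hj => by rw [Ne, hid_inj]; omega)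
      simp [Instr.exec, h5, this, h2]
    · refine (h3.trans (h6.mono (by omega))).trans ⟨fun r hr => ?_, rfl, rfl⟩
      simp [Instr.exec, Function.update_apply, hr t le_rfl]
  | ite e f g ihe ihf ihg =>
    intro off t σ s hP hs hR
    simp only [compE] at hP ⊢
    set ce := compE off t e with hce
    set cg := compE (off + ce.length + 1) t g with hcg
    set cf := compE (off + ce.length + 1 + cg.length + 2) t f with hcf
    have ie := @ihe off t σ s
    have jf := fun s' => @ihf (off + ce.length + 1 + cg.length + 2) t σ s'
    have jg := fun s' => @ihg (off + ce.length + 1) t σ s'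
    rw [← hce] at ie
    rw [← hcf] at jf
    rw [← hcg] at jg
    clear_value ce cg cf
    refine (ie hP.left hs hR).bind (T' := 1 + (cg.length + 2 + cf.length))
      (fun s1 ⟨h1, h2, h3⟩ => ?_) (by simp; omega)
    rw [Nat.add_comm 1]
    refine .step hP.right.left h1 ?_
    have hR1 := hR.same h3
    have h4 : Same t s1 (Instr.exec (.jump (hid t)
        (off + ce.length + 1 + cg.length + 2)) s1) := ⟨fun _ _ => rfl, rfl, rfl⟩
    by_cases hpos : 0 < e.eval σ
    · refine (jf _ ?_
        (by simp [Instr.exec, h2, hpos]) (hR1.same h4)).mono (by omega) ?_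
      · have := hP.right.right.right.right; simpa [Nat.add_assoc] using this
      · rintro s' ⟨h5, h6, h7⟩
        refine ⟨?_, by simp [hpos, h6], h3.trans (h4.trans h7)⟩
        rw [h5]; simp only [List.length_append, List.length_cons, List.length_nil]; omega
    · refine (jg _ hP.right.right.left
        (by simp [Instr.exec, h2, hpos, h1]) (hR1.same h4)).bind (T' := 2) ?_ (by omega)
      rintro s' ⟨h5, h6, h7⟩
      refine .step hP.right.right.right h5 (.step hP.right.right.right.tail
        (by simp [Instr.exec, h5]) (.of 0 ⟨?_, ?_, ?_⟩))
      · simp only [Instr.exec, Function.update_self]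
        simp only [List.length_append, List.length_cons, List.length_nil]
        simp; omega
      · simp [Instr.exec, hid_inj, h6, hpos]
      · refine h3.trans (h4.trans (h7.trans ⟨fun r hr => ?_, rfl, rfl⟩))
        simp [Instr.exec, Function.update_apply, hr (t + 1) (Nat.le_succ t)]

/-- Hidden registers below `h` agree. -/
def Keep (h : ℕ) (s s' : Config) : Prop := ∀ j < h, s'.reg (hid j) = s.reg (hid j)

theorem Same.keep {h : ℕ} {s s' : Config} (H : Same h s s') : Keep h s s' :=
  fun j hj => H.reg _ fun i hi => by rw [Ne, hid_inj]; omega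

theorem Keep.trans {h : ℕ} {s s' s'' : Config} (h1 : Keep h s s') (h2 : Keep h s' s'') :
    Keep h s s'' := fun j hj => (h2 j hj).trans (h1 j hj)

theorem Keep.mono {h h' : ℕ} {s s' : Config} (H : Keep h' s s') (hh : h ≤ h') : Keep h s s' :=
  fun j hj => H j (by omega)

theorem Rep.setv {σ : St} {s : Config} (H : Rep σ s) (x : Var) (n : ℕ) (pc : ℕ) :
    Rep (σ.setv x n) { s with pc := pc, reg := Function.update s.reg (va x) n } :=
  ⟨fun y => by simp [Function.update_apply, va_inj, H.v],
    fun A i => by simp [Function.update_apply, aa_ne_va, H.a], H.inp, H.out⟩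

theorem Rep.seta {σ : St} {s : Config} (H : Rep σ s) (A : Arr) (i n : ℕ) (pc : ℕ) :
    Rep (σ.seta A i n) { s with pc := pc, reg := Function.update s.reg (aa A i) n } := by
  refine ⟨fun y => ?_, fun B j => ?_, H.inp, H.out⟩
  · simp [Function.update_apply, (aa_ne_va A i y).symm, H.v]
  · by_cases h : B = A
    · subst h; simp [Function.update_apply, aa_inj, H.a]
    · simp [Function.update_apply, aa_inj, h, H.a]

/-- The constant is fixed before the state: expressions cost at most their code length, and every
tick of the structured semantics pays for a bounded number of instructions. Hidden registers below
`h` must survive because they hold the counters of enclosing loops. -/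
theorem compC_gets (c : Cmd) : ∀ off h, ∃ K, ∀ {P : Program} {σ : St} {s : Config},
    At P off (compC off h c) → s.pc = off → Rep σ s →
    Gets P (K * ((c.exec σ).tm - σ.tm)) s fun s' =>
      s'.pc = off + (compC off h c).length ∧ Rep (c.exec σ) s' ∧ Keep h s s' := by
  induction c with
  | set x e =>
    intro off h
    refine ⟨(compE off h e).length + 2, fun {P σ s} hP hs hR => ?_⟩
    unfold compC at hP
    refine (compE_gets e hP.left hs hR).bind (T' := 2) (fun s1 ⟨h1, h2, h3⟩ => ?_)
      (by simp [Cmd.exec])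
    refine .step hP.right h1 (.step hP.right.tail (by simp [Instr.exec, h1]) (.of 0 ⟨?_, ?_, ?_⟩))
    · simp [Instr.exec, h1, compC]; ring
    · have := (((hR.same h3).setv x (e.eval σ) (s1.pc + 1 + 1))).tick
      rw [show (Cmd.set x e).exec σ = (σ.setv x (e.eval σ)).tick from rfl]
      convert this using 1
      simp [Instr.exec, (va_ne_hid x h).symm, h2]
    · refine h3.keep.trans fun j hj => ?_
      simp [Instr.exec, (va_ne_hid x j).symm]
  | put A e f =>
    intro off h
    refine ⟨(compE off h e).length + 8 + (compE (off + (compE off h e).length + 8) (h + 1) f).length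
      + 1, fun {P σ s} hP hs hR => ?_⟩
    unfold compC at hP
    refine (compE_gets e hP.left hs hR).bind (T' := 8 +
      ((compE (off + (compE off h e).length + 8) (h + 1) f).length + 1))
      (fun s1 ⟨h1, h2, h3⟩ => ?_) (by simp [Cmd.exec]; omega)
    refine (addrCode_gets hP.right.left h1 h2).bind (fun s2 ⟨h4, h5, h6⟩ => ?_) le_rfl
    refine (compE_gets f hP.right.right.left h4 ((hR.same h3).same h6)).bind (T' := 1)
      (fun s3 ⟨h7, h8, h9⟩ => ?_) le_rfl
    refine .step hP.right.right.right h7 (.of 0 ⟨?_, ?_, ?_⟩)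
    · simp [Instr.exec, h7, compC, addrCode]; ring
    · have := ((((hR.same h3).same h6).same h9).seta A (e.eval σ) (f.eval σ) (s3.pc + 1)).tick
      rw [show (Cmd.put A e f).exec σ = (σ.seta A (e.eval σ) (f.eval σ)).tick from rfl]
      convert this using 1
      have := h9.reg (hid h) (fun j hj => by rw [Ne, hid_inj]; omega)
      simp [Instr.exec, h8, this, h5]
    · refine (h3.keep.trans h6.keep).trans ((h9.keep.mono (by omega)).trans fun j hj => ?_)
      have := h9.reg (hid h) (fun j hj => by rw [Ne, hid_inj]; omega)
      simp [Instr.exec, this, h5, (aa_ne_hid _ _ _).symm]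
  | seq c d hc hd =>
    intro off h
    obtain ⟨K1, h1⟩ := hc off h
    obtain ⟨K2, h2⟩ := hd (off + (compC off h c).length) h
    refine ⟨K1 + K2, fun {P σ s} hP hs hR => ?_⟩
    simp only [compC] at hP
    refine (h1 hP.left hs hR).bind (fun s1 ⟨h3, h4, h5⟩ =>
      (h2 hP.right h3 h4).mono le_rfl fun s2 ⟨h6, h7, h8⟩ => ⟨?_, h7, h5.trans h8⟩) ?_
    · rw [h6]; simp [compC]; ring
    · have := exec_mono c σ
      have := exec_mono d (c.exec σ)
      simp only [Cmd.exec]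
      obtain ⟨a, ha⟩ := Nat.exists_eq_add_of_le (exec_mono c σ)
      obtain ⟨b, hb⟩ := Nat.exists_eq_add_of_le (exec_mono d (c.exec σ))
      have e1 : (c.exec σ).tm - σ.tm = a := by omega
      have e2 : (d.exec (c.exec σ)).tm - (c.exec σ).tm = b := by omega
      have e3 : (d.exec (c.exec σ)).tm - σ.tm = a + b := by omega
      rw [e1, e2, e3]; nlinarith [Nat.zero_le (K1 * b), Nat.zero_le (K2 * a)]
  | ite e c d hc hd =>
    intro off h
    simp only [compC]
    set ce := compE off h e with hce
    obtain ⟨K2, h2⟩ := hd (off + ce.length + 1) h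
    set cd := compC (off + ce.length + 1) h d with hcd
    obtain ⟨K1, h1⟩ := hc (off + ce.length + 1 + cd.length + 2) h
    set cc := compC (off + ce.length + 1 + cd.length + 2) h c with hcc
    refine ⟨ce.length + 1 + 2 + K1 + K2, fun {P σ s} hP hs hR => ?_⟩
    simp only [Cmd.exec]
    -- The tick of the conditional pays for the test, the jump, and the two instructions that skip
    -- the other branch.
    have key : ∀ (f : Cmd) (K : ℕ), K ≤ K1 + K2 →
        ce.length + (K * ((f.exec σ.tick).tm - σ.tick.tm) + 2 + 1) ≤
        (ce.length + 1 + 2 + K1 + K2) * ((f.exec σ.tick).tm - σ.tm) := by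
      intro f K hK
      obtain ⟨a, ha⟩ := Nat.exists_eq_add_of_le (exec_mono f σ.tick)
      have e1 : (f.exec σ.tick).tm - σ.tick.tm = a := by omega
      have e2 : (f.exec σ.tick).tm - σ.tm = a + 1 := by simp at ha; omega
      rw [e1, e2]
      calc _ ≤ ce.length + ((K1 + K2) * a + 2 + 1) := by gcongr
        _ ≤ _ := by ring_nf; nlinarith [Nat.zero_le (ce.length * a), Nat.zero_le (K1 + K2)]
    have ie := @compE_gets P e off h σ s
    rw [← hce] at ie
    clear_value ce cd cc
    refine (ie hP.left hs hR).bind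
      (T' := (if 0 < e.eval σ then K1 * ((c.exec σ.tick).tm - σ.tick.tm) else
        K2 * ((d.exec σ.tick).tm - σ.tick.tm)) + 2 + 1)
      (fun s1 ⟨h4, h5, h6⟩ => ?_) ?_
    swap
    · split
      · exact key _ _ (by omega)
      · exact key _ _ (by omega)
    refine .step hP.right.left h4 ?_
    have hR1 := hR.same h6
    have h7 : Same h s1 (Instr.exec (.jump (hid h)
        (off + ce.length + 1 + cd.length + 2)) s1) := ⟨fun _ _ => rfl, rfl, rfl⟩
    by_cases hpos : 0 < e.eval σ
    · simp only [hpos, if_true]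
      refine (h1 ?_ (by simp [Instr.exec, h5, hpos]) (hR1.same h7).tick).mono (by omega) ?_
      · have := hP.right.right.right.right; simpa [Nat.add_assoc] using this
      · rintro s' ⟨h8, h9, h10⟩
        refine ⟨?_, h9, h6.keep.trans (h7.keep.trans h10)⟩
        rw [h8]; simp only [List.length_append, List.length_cons, List.length_nil]; omega
    · simp only [hpos, if_false]
      refine (h2 hP.right.right.left
        (by simp [Instr.exec, h5, hpos, h4]) (hR1.same h7).tick).bind (T' := 2) ?_ le_rfl
      rintro s' ⟨h8, h9, h10⟩
      have h11 : Same h s' ((Instr.jump (hid (h + 1)) (off + ce.length + 1 + cd.length + 2 +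
          cc.length)).exec ((Instr.const (hid (h + 1)) 1).exec s')) := by
        refine ⟨fun r hr => ?_, rfl, rfl⟩
        simp [Instr.exec, Function.update_apply, hr (h + 1) (Nat.le_succ h)]
      refine .step hP.right.right.right h8 (.step hP.right.right.right.tail
        (by simp [Instr.exec, h8]) (.of 0 ⟨?_, h9.same h11,
          h6.keep.trans (h7.keep.trans (h10.trans h11.keep))⟩))
      simp only [Instr.exec, Function.update_self]
      simp only [List.length_append, List.length_cons, List.length_nil]
      simp; omega
  | loop x e c hc =>
    intro off h
    simp only [compC]
    set ce := compE off h e with hce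
    obtain ⟨K1, h1⟩ := hc (off + ce.length + 6) (h + 2)
    set cc := compC (off + ce.length + 6) (h + 2) c with hcc
    refine ⟨ce.length + 4 + K1 + 7, fun {P σ s} hP hs hR => ?_⟩
    have ie := @compE_gets P e off h σ s
    rw [← hce] at ie
    clear_value ce cc
    -- Register `h` holds the number `r` of iterations still to come, register `h + 1` the number
    -- `i` of those completed. The summand `3` pays for leaving the loop.
    have hloop : ∀ (r i : ℕ) (σ' : St) (s' : Config),
        s'.pc = off + ce.length + 1 → Rep σ' s' → s'.reg (hid h) = r →
        s'.reg (hid (h + 1)) = i → σ' = iter c.exec x σ.tick i →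
        Gets P ((K1 + 7) * ((iter c.exec x σ.tick (i + r)).tm - σ'.tm) + 3) s' fun s'' =>
          s''.pc = off + ce.length + 6 + cc.length + 4 ∧
          Rep (iter c.exec x σ.tick (i + r)) s'' ∧ Keep h s' s'' := by
      intro r
      have hP1 := hP.right.left.tail
      have hP2 := hP.right.right.right
      induction r with
      | zero =>
        intro i σ' s' h2 h3 h4 h5 h6
        have h11 : Same h s' ((Instr.jump (hid (h + 2)) (off + ce.length + 6 +
            cc.length + 4)).exec ((Instr.const (hid (h + 2)) 1).exec
              ((Instr.jump (hid h) (off + ce.length + 4)).exec s'))) := by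
          refine ⟨fun r hr => ?_, rfl, rfl⟩
          simp [Instr.exec, Function.update_apply, hr (h + 2) (by omega)]
        refine (Gets.step hP1 h2 (.step hP1.tail (by simp [Instr.exec, h2, h4])
          (.step hP1.tail.tail (by simp [Instr.exec, h2, h4]) (.of 0 ⟨?_, ?_, h11.keep⟩)))).mono
            (by omega) fun _ h => h
        · simp [Instr.exec]
        · rw [Nat.add_zero, ← h6]; exact h3.same h11
      | succ r ih =>
        intro i σ' s' h2 h3 h4 h5 h6
        set s1 := (Instr.const (va x) 0).exec ((Instr.jump (hid h) (off + ce.length + 4)).exec s')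
          with hs1
        set s2 := (Instr.add (va x) (va x) (hid (h + 1))).exec s1 with hs2
        have hk2 : Keep (h + 2) s' s2 := by
          intro j hj
          simp [hs2, hs1, Instr.exec, (va_ne_hid x j).symm]
        have hr2 : Rep (σ'.setv x i).tick s2 := by
          convert (h3.setv x i s2.pc).tick using 1
          simp [hs2, hs1, Instr.exec, (va_ne_hid x _).symm, h5]
        have hp2 : s2.pc = off + ce.length + 6 := by simp [hs2, hs1, Instr.exec, h4]
        have hi1 : iter c.exec x σ.tick (i + 1) = c.exec (σ'.setv x i).tick := by
          rw [h6]; rfl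
        have hmono : ∀ a b, (iter c.exec x σ.tick a).tm ≤ (iter c.exec x σ.tick (a + b)).tm := by
          intro a b
          induction b with
          | zero => exact le_rfl
          | succ b ihb => exact ihb.trans (le_trans (by simp) (exec_mono c _))
        have hm1 := exec_mono c (σ'.setv x i).tick
        have hm2 := hmono (i + 1) r
        have hidx : i + (r + 1) = i + 1 + r := by omega
        rw [hidx]
        obtain ⟨a, ha⟩ := Nat.exists_eq_add_of_le hm1
        obtain ⟨b, hb⟩ := Nat.exists_eq_add_of_le hm2
        rw [hi1] at hb
        have e1 : (iter c.exec x σ.tick (i + 1 + r)).tm - σ'.tm = 1 + a + b := by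
          simp at ha; omega
        have e2 : (iter c.exec x σ.tick (i + 1 + r)).tm - (c.exec (σ'.setv x i).tick).tm = b := by
          omega
        have e3 : (c.exec (σ'.setv x i).tick).tm - (σ'.setv x i).tick.tm = a := by omega
        -- Seven instructions surround each execution of the body, three before and four after it;
        -- the tick at the start of the iteration pays for them.
        have eT : (K1 + 7) * (1 + a + b) + 3 =
            (K1 * a + (4 + ((K1 + 7) * b + 3)) + 7 * a + K1) + 1 + 1 + 1 := by ring
        rw [e1, eT]
        refine .step hP1 h2 (.step hP1.tail.tail.tail (by simp [Instr.exec, h4]) (.step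
          hP1.tail.tail.tail.tail (by simp [Instr.exec, h4]) ?_))
        have hc' := h1 (P := P) (by have := hP.right.right.left; simpa using this) hp2 hr2
        rw [e3] at hc'
        refine (hc'.bind (T' := 4 + ((K1 + 7) * b + 3)) ?_ le_rfl).mono (by omega) fun _ h => h
        rintro s3 ⟨h8, h9, h10⟩
        set s4 := (Instr.jump (hid (h + 2)) (off + ce.length + 1)).exec
          ((Instr.sub (hid h) (hid h) (hid (h + 2))).exec
          ((Instr.add (hid (h + 1)) (hid (h + 1)) (hid (h + 2))).exec
          ((Instr.const (hid (h + 2)) 1).exec s3))) with hs4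
        have h12 : Same h s3 s4 := by
          refine ⟨fun r hr => ?_, rfl, rfl⟩
          simp [hs4, Instr.exec, Function.update_apply, hr (h + 2) (by omega),
            hr (h + 1) (by omega), hr h le_rfl]
        have h13 := h10 h (by omega)
        have h14 := h10 (h + 1) (by omega)
        have h15 := hk2 h (by omega)
        have h16 := hk2 (h + 1) (by omega)
        have hg := ih (i + 1) (c.exec (σ'.setv x i).tick) s4 (by simp [hs4, Instr.exec, hid_inj])
          (h9.same h12) (by simp [hs4, Instr.exec, hid_inj, h13, h15, h4])
          (by simp [hs4, Instr.exec, hid_inj, h14, h16, h5]) hi1.symm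
        rw [e2] at hg
        rw [Nat.add_comm 4]
        have hP3 : At P (off + ce.length + 6 + cc.length) _ := hP2
        refine .step hP3 h8 (.step hP3.tail (by simp [Instr.exec, h8])
          (.step hP3.tail.tail (by simp [Instr.exec, h8]) (.step hP3.tail.tail.tail
            (by simp [Instr.exec, h8]) (hg.mono le_rfl ?_))))
        rintro s5 ⟨ha, hb, hc⟩
        exact ⟨ha, hb, (hk2.mono (by omega)).trans ((h10.mono (by omega)).trans
          (h12.keep.trans hc))⟩
    refine (ie hP.left hs hR).bind (fun s1 ⟨h4, h5, h6⟩ => ?_) (T' := 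
      (K1 + 7) * (((Cmd.loop x e c).exec σ).tm - σ.tick.tm) + 3 + 1) ?_
    · have h7 : Same h s1 ((Instr.const (hid (h + 1)) 0).exec s1) := by
        refine ⟨fun r hr => ?_, rfl, rfl⟩
        simp [Instr.exec, Function.update_apply, hr (h + 1) (by omega)]
      refine .step hP.right.left h4 ?_
      refine (hloop (e.eval σ) 0 σ.tick _ (by simp [Instr.exec, h4]) ((hR.same h6).same h7).tick
        (by simp [Instr.exec, hid_inj, h5]) (by simp [Instr.exec]) rfl).mono ?_ ?_
      · rw [Nat.zero_add]; rfl
      · rintro s2 ⟨h8, h9, h10⟩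
        rw [Nat.zero_add] at h9
        refine ⟨?_, h9, h6.keep.trans (h7.keep.trans h10)⟩
        rw [h8]; simp only [List.length_append, List.length_cons, List.length_nil]; omega
    · have hm : σ.tick.tm ≤ ((Cmd.loop x e c).exec σ).tm := by
        simp only [Cmd.exec]
        generalize e.eval σ = n
        induction n with
        | zero => exact le_rfl
        | succ n ih => exact ih.trans (le_trans (by simp) (exec_mono c _))
      obtain ⟨a, ha⟩ := Nat.exists_eq_add_of_le hm
      have e1 : ((Cmd.loop x e c).exec σ).tm - σ.tick.tm = a := by omega
      have e2 : ((Cmd.loop x e c).exec σ).tm - σ.tm = a + 1 := by simp at ha; omega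
      rw [e1, e2]
      ring_nf; nlinarith [Nat.zero_le (ce.length * a)]
  | read x =>
    intro off h
    refine ⟨1, fun {P σ s} hP hs hR => ?_⟩
    simp only [compC] at hP
    refine (Gets.step hP hs (.of 0 ⟨?_, ?_, ?_⟩)).mono (by simp [Cmd.exec]) fun _ h => h
    · simp [Instr.exec, hs, compC]
    · refine ⟨fun y => ?_, fun A i => ?_, ?_, hR.out⟩
      · simp [Instr.exec, Cmd.exec, Function.update_apply, va_inj, hR.v, hR.inp]
      · simp [Instr.exec, Cmd.exec, Function.update_apply, aa_ne_va, hR.a]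
      · simp [Instr.exec, Cmd.exec, hR.inp]
    · intro j hj
      simp [Instr.exec, (va_ne_hid x j).symm]
  | print e =>
    intro off h
    refine ⟨(compE off h e).length + 1, fun {P σ s} hP hs hR => ?_⟩
    simp only [compC] at hP
    refine (compE_gets e hP.left hs hR).bind (T' := 1) (fun s1 ⟨h1, h2, h3⟩ => ?_)
      (by simp [Cmd.exec])
    have hR1 := hR.same h3
    refine .step hP.right h1 (.of 0 ⟨?_, ⟨hR1.v, hR1.a, hR1.inp, ?_⟩, h3.keep⟩)
    · simp [Instr.exec, h1, compC]; ring
    · simp [Instr.exec, Cmd.exec, h2, hR1.out]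
  | skip =>
    intro off h
    exact ⟨0, fun {P σ s} hP hs hR => .of _ ⟨by simp [compC, hs], hR.tick, fun _ _ => rfl⟩⟩

/-- The initial state on a given input. -/
def St.init (I : List ℕ) : St := ⟨fun _ => 0, fun _ _ => 0, I, [], 0⟩

/-- The machine program of a command runs within a constant factor of the time of the command. -/
theorem exists_program (c : Cmd) : ∃ (P : Program) (K : ℕ), ∀ I : List ℕ,
    ∃ t ≤ K * (c.exec (St.init I)).tm, P.HaltsWithin I t (c.exec (St.init I)).out := by
  obtain ⟨K, hK⟩ := compC_gets c 0 0
  refine ⟨compC 0 0 c, K, fun I => ?_⟩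
  obtain ⟨t, ht, h1, h2, -⟩ := hK (P := compC 0 0 c) (σ := St.init I) (s := Config.init I)
    ⟨[], [], by simp, rfl⟩ rfl ⟨fun _ => rfl, fun _ _ => rfl, rfl, rfl⟩
  exact ⟨t, by simpa [St.init] using ht, by rw [h1]; simp, h2.out⟩

/-! ### Partial solutions -/

/-- A finite loopless multigraph on the vertices `0, …, n - 1`, with edges `0, …, m - 1`, where
edge `k` joins `eu k` and `ev k`, and demands `d` bounded by `ds`. -/
structure Net where
  n : ℕ
  m : ℕ
  ds : ℕ
  d : ℕ → ℕ
  eu : ℕ → ℕ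
  ev : ℕ → ℕ
  eu_lt : ∀ k < m, eu k < n
  ev_lt : ∀ k < m, ev k < n
  ne : ∀ k < m, eu k ≠ ev k
  d_le : ∀ v, d v ≤ ds

namespace Net

variable (G : Net)

/-- The number of edges in `A` at the vertex `v`. -/
def degA (A : Finset ℕ) (v : ℕ) : ℕ := (A.filter fun k => G.eu k = v ∨ G.ev k = v).card

/-- The number of edges in `A` that join `v` to a vertex of `S`. -/
def cnt (A S : Finset ℕ) (v : ℕ) : ℕ :=
  (A.filter fun k => G.eu k = v ∧ G.ev k ∈ S ∨ G.ev k = v ∧ G.eu k ∈ S).card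

/-- The degree of a vertex. -/
def dg (v : ℕ) : ℕ := G.degA (Finset.range G.m) v

/-- The vertices incident to an edge in `A`. -/
def supp (A : Finset ℕ) : Finset ℕ := (Finset.range G.n).filter fun v => 0 < G.degA A v

/-- The vertices incident both to an edge in `A` and to an edge outside `A`. -/
def bd (A : Finset ℕ) : Finset ℕ :=
  (Finset.range G.n).filter fun v => 0 < G.degA A v ∧ G.degA A v < G.dg v

/-- `S` is a partial solution on the edges in `A` for the boundary condition `σ`: the value `0`
means membership in `S`, and the value `j + 1` means at least `j` neighbours in `S`. -/
structure Feas (A : Finset ℕ) (σ : ℕ → ℕ) (S : Finset ℕ) : Prop where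
  mem : ∀ v ∈ G.bd A, σ v = 0 ↔ v ∈ S
  le : ∀ v ∈ G.bd A, σ v ≤ G.cnt A S v + 1
  inner : ∀ v ∈ G.supp A, v ∉ G.bd A → v ∉ S → G.d v ≤ G.cnt A S v

/-- A table entry `c` with partial solution `S` is correct for the boundary condition `σ`. -/
structure EntryOK (A : Finset ℕ) (σ : ℕ → ℕ) (c : ℕ) (S : Finset ℕ) : Prop where
  sub : 0 < c → S ⊆ G.supp A
  feas : 0 < c → G.Feas A σ S
  card : 0 < c → S.card + 1 = c
  opt : ∀ S' ⊆ G.supp A, G.Feas A σ S' → 0 < c ∧ c ≤ S'.card + 1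

/-- The ways in which a vertex can be treated when partial solutions for `A` and for `B` are
combined. -/
def Opt (A B : Finset ℕ) (v x y z : ℕ) : Prop :=
  (x = 0 ∧ y = 0 ∧ z = 0) ∨
  (0 < x ∧ 0 < y ∧ x + y = z + 1 ∧ (v ∉ G.bd A → x = 1) ∧ (v ∉ G.bd B → y = 1) ∧
    x ≤ G.ds + 1 ∧ y ≤ G.ds + 1 ∧ if v ∈ G.bd (A ∪ B) then z ≤ G.ds + 1 else z = G.d v + 1)

variable {G} {A B : Finset ℕ}

theorem Opt.le {v x y z : ℕ} (h : G.Opt A B v x y z) :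
    x ≤ G.ds + 1 ∧ y ≤ G.ds + 1 ∧ z ≤ G.ds + 1 := by
  rcases h with h | ⟨-, -, -, -, -, h1, h2, h3⟩
  · omega
  · refine ⟨h1, h2, ?_⟩
    split_ifs at h3
    · exact h3
    · have := G.d_le v; omega

theorem degA_union (h : Disjoint A B) (v : ℕ) :
    G.degA (A ∪ B) v = G.degA A v + G.degA B v := by
  unfold degA
  rw [Finset.filter_union, Finset.card_union_of_disjoint (Finset.disjoint_filter_filter h)]

theorem cnt_union (h : Disjoint A B) (S : Finset ℕ) (v : ℕ) :
    G.cnt (A ∪ B) S v = G.cnt A S v + G.cnt B S v := by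
  unfold cnt
  rw [Finset.filter_union, Finset.card_union_of_disjoint (Finset.disjoint_filter_filter h)]

theorem degA_mono (h : A ⊆ B) (v : ℕ) : G.degA A v ≤ G.degA B v :=
  Finset.card_le_card (Finset.filter_subset_filter _ h)

theorem degA_le_dg (h : A ⊆ Finset.range G.m) (v : ℕ) : G.degA A v ≤ G.dg v := degA_mono h v

theorem cnt_le_degA (S : Finset ℕ) (v : ℕ) : G.cnt A S v ≤ G.degA A v := by
  refine Finset.card_le_card fun k hk => ?_
  simp only [Finset.mem_filter] at hk ⊢
  tauto

theorem mem_supp_of_edge {k : ℕ} (hA : A ⊆ Finset.range G.m) (hk : k ∈ A) :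
    G.eu k ∈ G.supp A ∧ G.ev k ∈ G.supp A := by
  have hkm := Finset.mem_range.1 (hA hk)
  simp only [supp, Finset.mem_filter, Finset.mem_range, degA, Finset.card_pos]
  exact ⟨⟨G.eu_lt k hkm, k, by simp [hk]⟩, ⟨G.ev_lt k hkm, k, by simp [hk]⟩⟩

/-- Both ends of an edge in `A` lie in `supp A`, so only the trace of `S` on `supp A` is seen. -/
theorem cnt_congr (hA : A ⊆ Finset.range G.m) {S S' : Finset ℕ}
    (h : ∀ v ∈ G.supp A, v ∈ S ↔ v ∈ S') (v : ℕ) : G.cnt A S v = G.cnt A S' v := by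
  unfold cnt
  congr 1
  refine Finset.filter_congr fun k hk => ?_
  have := mem_supp_of_edge hA hk
  rw [h _ this.1, h _ this.2]

theorem bd_subset_supp : G.bd A ⊆ G.supp A := fun v hv => by
  simp only [bd, supp, Finset.mem_filter] at hv ⊢; tauto

theorem mem_supp_of_pos (hA : A ⊆ Finset.range G.m) {v : ℕ} (h : 0 < G.degA A v) :
    v ∈ G.supp A := by
  obtain ⟨k, hk⟩ := Finset.card_pos.1 h
  simp only [Finset.mem_filter] at hk
  rcases hk.2 with rfl | rfl
  · exact (mem_supp_of_edge hA hk.1).1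
  · exact (mem_supp_of_edge hA hk.1).2

theorem mem_supp (hA : A ⊆ Finset.range G.m) {v : ℕ} : v ∈ G.supp A ↔ 0 < G.degA A v :=
  ⟨fun h => (Finset.mem_filter.1 h).2, mem_supp_of_pos hA⟩

theorem mem_bd (hA : A ⊆ Finset.range G.m) {v : ℕ} :
    v ∈ G.bd A ↔ 0 < G.degA A v ∧ G.degA A v < G.dg v :=
  ⟨fun h => (Finset.mem_filter.1 h).2, fun h =>
    Finset.mem_filter.2 ⟨(Finset.mem_filter.1 (mem_supp_of_pos hA h.1)).1, h⟩⟩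

/-! ### Soundness and completeness of joining partial solutions -/

section join

variable (hA : A ⊆ Finset.range G.m) (hB : B ⊆ Finset.range G.m) (hd : Disjoint A B)
include hA hB hd

theorem degA_add_le (v : ℕ) : G.degA A v + G.degA B v ≤ G.dg v := by
  rw [← degA_union hd]; exact degA_le_dg (Finset.union_subset hA hB) v

/-- By disjointness an edge of `B` at `v` is an edge outside `A`. Hence two parts can only interact
through vertices of both boundaries. -/
theorem mem_bd_left_of_both {v : ℕ} (h1 : v ∈ G.supp A) (h2 : v ∈ G.supp B) : v ∈ G.bd A := by
  rw [mem_supp hA] at h1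
  rw [mem_supp hB] at h2
  rw [mem_bd hA]
  have := degA_add_le hA hB hd v
  omega

theorem supp_union : G.supp (A ∪ B) = G.supp A ∪ G.supp B := by
  ext v
  simp only [Finset.mem_union, mem_supp hA, mem_supp hB, mem_supp (Finset.union_subset hA hB),
    degA_union hd]
  omega

theorem bd_union_subset : G.bd (A ∪ B) ⊆ G.bd A ∪ G.bd B := by
  intro v hv
  simp only [Finset.mem_union, mem_bd hA, mem_bd hB, mem_bd (Finset.union_subset hA hB),
    degA_union hd] at hv ⊢
  omega

/-- Such a vertex meets no edge of `B` at all, so the edge outside `A` that it meets is also outside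
`A ∪ B`. This is the inequality `r ≤ b` of the running time analysis. -/
theorem mem_bd_union_of_left {v : ℕ} (h1 : v ∈ G.bd A) (h2 : v ∉ G.bd B) : v ∈ G.bd (A ∪ B) := by
  have := degA_le_dg hB v
  simp only [mem_bd hA, mem_bd hB, mem_bd (Finset.union_subset hA hB), degA_union hd] at *
  have := degA_add_le hA hB hd v
  omega

/-- The two partial solutions agree on vertices met by both parts, since these lie in both
boundaries and the values fix membership there. So the union is seen from `A` as `S1` and from `B`
as `S2`, and neighbour counts add. The overlap `S1 ∩ S2` consists of the common boundary vertices
with value `0`, which gives the size of the union. -/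
theorem join_sound {σ1 σ2 σ : ℕ → ℕ} {S1 S2 : Finset ℕ}
    (h : ∀ v ∈ G.bd A ∪ G.bd B, G.Opt A B v (σ1 v) (σ2 v) (σ v))
    (hS1 : S1 ⊆ G.supp A) (hS2 : S2 ⊆ G.supp B) (hf1 : G.Feas A σ1 S1) (hf2 : G.Feas B σ2 S2) :
    S1 ∪ S2 ⊆ G.supp (A ∪ B) ∧ G.Feas (A ∪ B) σ (S1 ∪ S2) ∧
      (S1 ∪ S2).card + ((G.bd A ∩ G.bd B).filter fun v => σ1 v = 0).card = S1.card + S2.card := by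
  have hC := Finset.union_subset hA hB
  have both : ∀ v, v ∈ G.supp A → v ∈ G.supp B → v ∈ G.bd A ∧ v ∈ G.bd B := fun v h1 h2 =>
    ⟨mem_bd_left_of_both hA hB hd h1 h2, mem_bd_left_of_both hB hA hd.symm h2 h1⟩
  have zero : ∀ v, v ∈ G.bd A ∪ G.bd B → (σ1 v = 0 ↔ σ2 v = 0) := fun v hv => by
    rcases h v hv with h | h <;> omega
  have agree : ∀ v, v ∈ G.supp A → v ∈ G.supp B → (v ∈ S1 ↔ v ∈ S2) := fun v h1 h2 => by
    obtain ⟨b1, b2⟩ := both v h1 h2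
    rw [← hf1.mem v b1, ← hf2.mem v b2, zero v (Finset.mem_union_left _ b1)]
  have c1 : ∀ v, G.cnt A (S1 ∪ S2) v = G.cnt A S1 v := cnt_congr hA fun v hv => by
    rw [Finset.mem_union]
    exact ⟨fun h => h.elim id fun h => (agree v hv (hS2 h)).2 h, Or.inl⟩
  have c2 : ∀ v, G.cnt B (S1 ∪ S2) v = G.cnt B S2 v := cnt_congr hB fun v hv => by
    rw [Finset.mem_union]
    exact ⟨fun h => h.elim (fun h => (agree v (hS1 h) hv).1 h) id, Or.inr⟩
  have cc : ∀ v, G.cnt (A ∪ B) (S1 ∪ S2) v = G.cnt A S1 v + G.cnt B S2 v := fun v => by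
    rw [cnt_union hd, c1, c2]
  have memS : ∀ v ∈ G.bd A ∪ G.bd B, σ1 v = 0 ↔ v ∈ S1 ∪ S2 := fun v hv => by
    rw [Finset.mem_union]
    by_cases ha : v ∈ G.bd A
    · rw [hf1.mem v ha]
      exact ⟨Or.inl, fun h => h.elim id fun h => (agree v (bd_subset_supp ha) (hS2 h)).2 h⟩
    · have hb : v ∈ G.bd B := (Finset.mem_union.1 hv).resolve_left ha
      rw [zero v hv, hf2.mem v hb]
      exact ⟨Or.inr, fun h => h.elim (fun h => (agree v (hS1 h) (bd_subset_supp hb)).1 h) id⟩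
  -- At a vertex outside `bd A` an unchosen treatment has `σ1 v = 1`, which asks for no neighbour
  -- along `A`, so the requirement falls entirely on `B`; likewise with the roles exchanged.
  have key : ∀ v ∈ G.bd A ∪ G.bd B, σ v ≤ G.cnt A S1 v + G.cnt B S2 v + 1 := fun v hv => by
    have la : v ∈ G.bd A → σ1 v ≤ G.cnt A S1 v + 1 := hf1.le v
    have lb : v ∈ G.bd B → σ2 v ≤ G.cnt B S2 v + 1 := hf2.le v
    rcases h v hv with h | ⟨h1, h2, h3, h4, h5, -⟩
    · omega
    · by_cases ha : v ∈ G.bd A <;> by_cases hb : v ∈ G.bd B <;> simp only [ha, hb, not_true,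
        not_false_iff, forall_true_left, false_imp_iff, true_imp_iff] at * <;> omega
  refine ⟨?_, ⟨fun v hv => ?_, fun v hv => ?_, fun v hv hb hS => ?_⟩, ?_⟩
  · rw [supp_union hA hB hd]; exact Finset.union_subset_union hS1 hS2
  · have hv' := bd_union_subset hA hB hd hv
    rw [← memS v hv']
    rcases h v hv' with h | h <;> omega
  · rw [cc]; exact key v (bd_union_subset hA hB hd hv)
  · rw [cc]
    by_cases hv' : v ∈ G.bd A ∪ G.bd B
    · rcases h v hv' with h | ⟨h1, h2, h3, h4, h5, -, -, h6⟩
      · exact absurd ((memS v hv').1 h.1) hS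
      · rw [if_neg hb] at h6
        have := key v hv'
        omega
    · simp only [Finset.mem_union, not_or] at hv' hS
      rw [supp_union hA hB hd, Finset.mem_union] at hv
      rcases hv with hv | hv
      · exact (hf1.inner v hv hv'.1 hS.1).trans (Nat.le_add_right _ _)
      · exact (hf2.inner v hv hv'.2 hS.2).trans (Nat.le_add_left _ _)
  -- A vertex in `S1 ∩ S2` lies in both supports, hence in both boundaries.
  · have : (G.bd A ∩ G.bd B).filter (fun v => σ1 v = 0) = S1 ∩ S2 := by
      ext v
      simp only [Finset.mem_filter, Finset.mem_inter]
      constructor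
      · rintro ⟨⟨ha, hb⟩, h0⟩
        exact ⟨(hf1.mem v ha).1 h0, (hf2.mem v hb).1
          ((zero v (Finset.mem_union_left _ ha)).1 h0)⟩
      · rintro ⟨h1, h2⟩
        have := both v (hS1 h1) (hS2 h2)
        exact ⟨this, (hf1.mem v this.1).2 h1⟩
    rw [this, Finset.card_union_add_card_inter]

/-- A partial solution on the union is restricted to the two supports. An unchosen vertex lets `A`
supply as much of its requirement as it can, and `B` supplies the rest. -/
theorem join_complete {σ : ℕ → ℕ} {S : Finset ℕ} (hσ : ∀ v, σ v ≤ G.ds + 1)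
    (hS : S ⊆ G.supp (A ∪ B)) (hf : G.Feas (A ∪ B) σ S) :
    ∃ σ1 σ2 σ' : ℕ → ℕ, (∀ v, G.Opt A B v (σ1 v) (σ2 v) (σ' v) ∨ v ∉ G.bd A ∪ G.bd B) ∧
      (∀ v, σ1 v ≤ G.ds + 1) ∧ (∀ v, σ2 v ≤ G.ds + 1) ∧
      (∀ v ∈ G.bd (A ∪ B), σ' v = σ v) ∧
      ∃ S1 S2, S1 ⊆ G.supp A ∧ S2 ⊆ G.supp B ∧ G.Feas A σ1 S1 ∧ G.Feas B σ2 S2 ∧ S = S1 ∪ S2 := by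
  classical
  have hC := Finset.union_subset hA hB
  -- The requirement at `v`: what `σ` prescribes if `v` stays in the boundary, and the full demand
  -- if `v` is about to leave it.
  set tg : ℕ → ℕ := fun v => if v ∈ G.bd (A ∪ B) then σ v - 1 else G.d v with htg
  have htg_le : ∀ v, tg v ≤ G.ds := fun v => by
    simp only [htg]; split_ifs
    · have := hσ v; omega
    · exact G.d_le v
  set σ1 : ℕ → ℕ := fun v => if v ∈ S then 0 else min (G.cnt A S v) (tg v) + 1 with h1
  set σ2 : ℕ → ℕ := fun v => if v ∈ S then 0 else tg v - min (G.cnt A S v) (tg v) + 1 with h2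
  have c1 : ∀ v, G.cnt A (S ∩ G.supp A) v = G.cnt A S v := cnt_congr hA fun v hv => by simp [hv]
  have c2 : ∀ v, G.cnt B (S ∩ G.supp B) v = G.cnt B S v := cnt_congr hB fun v hv => by simp [hv]
  have ht : ∀ v ∈ G.supp (A ∪ B), v ∉ S → tg v ≤ G.cnt A S v + G.cnt B S v := fun v hv hvS => by
    rw [← cnt_union hd]
    simp only [htg]; split_ifs with hb
    · have := hf.le v hb; omega
    · exact hf.inner v hv hb hvS
  have za : ∀ v, v ∉ G.supp A → G.cnt A S v = 0 := fun v hv => by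
    rw [mem_supp hA] at hv; have := cnt_le_degA (G := G) (A := A) S v; omega
  have zb : ∀ v, v ∉ G.supp B → G.cnt B S v = 0 := fun v hv => by
    rw [mem_supp hB] at hv; have := cnt_le_degA (G := G) (A := B) S v; omega
  have sA : ∀ v, v ∈ G.supp A → v ∈ G.supp (A ∪ B) := fun v hv => by
    rw [supp_union hA hB hd]; exact Finset.mem_union_left _ hv
  have sB : ∀ v, v ∈ G.supp B → v ∈ G.supp (A ∪ B) := fun v hv => by
    rw [supp_union hA hB hd]; exact Finset.mem_union_right _ hv
  -- The value of `σ` off the new boundary is arbitrary, while `Opt` insists on `d v + 1` at an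
  -- unchosen vertex that leaves it; hence the third function in place of `σ`.
  refine ⟨σ1, σ2, fun v => if v ∈ S then 0 else tg v + 1, fun v => ?_, fun v => ?_, fun v => ?_,
    fun v hv => ?_, S ∩ G.supp A, S ∩ G.supp B, Finset.inter_subset_right,
    Finset.inter_subset_right, ⟨fun v hv => ?_, fun v hv => ?_, fun v hv hb hvS => ?_⟩,
    ⟨fun v hv => ?_, fun v hv => ?_, fun v hv hb hvS => ?_⟩, ?_⟩
  · rw [or_iff_not_imp_right, not_not]
    intro hv
    by_cases hvS : v ∈ S
    · left; simp [h1, h2, hvS]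
    · right
      have hvC : v ∈ G.supp (A ∪ B) := by
        rcases Finset.mem_union.1 hv with hv | hv
        · exact sA v (bd_subset_supp hv)
        · exact sB v (bd_subset_supp hv)
      have l1 := ht v hvC hvS
      have l2 := htg_le v
      simp only [h1, h2, hvS, if_false]
      refine ⟨by omega, by omega, by omega, fun ha => ?_, fun hb => ?_, by omega, by omega, ?_⟩
      · have hb : v ∈ G.bd B := (Finset.mem_union.1 hv).resolve_left ha
        rw [za v fun h => ha (mem_bd_left_of_both hA hB hd h (bd_subset_supp hb))]
        simp
      · have ha : v ∈ G.bd A := (Finset.mem_union.1 hv).resolve_right hb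
        have := zb v fun h => hb (mem_bd_left_of_both hB hA hd.symm h (bd_subset_supp ha))
        omega
      · split_ifs with hc
        · omega
        · simp [htg, hc]
  · simp only [h1]; split_ifs
    · omega
    · have := htg_le v; omega
  · simp only [h2]; split_ifs
    · omega
    · have := htg_le v; omega
  · have := hf.mem v hv
    by_cases hvS : v ∈ S
    · simp [hvS, this.2 hvS]
    · have h0 : σ v ≠ 0 := fun h => hvS (this.1 h)
      simp [hvS, htg, hv]; omega
  · simp only [h1, Finset.mem_inter, bd_subset_supp hv, and_true]
    split_ifs with h <;> simp [h]
  · rw [c1]; simp only [h1]; split_ifs <;> omega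
  · rw [c1]
    have hvS' : v ∉ S := fun h => hvS (Finset.mem_inter.2 ⟨h, hv⟩)
    have hvB : v ∉ G.supp B := fun h => hb (mem_bd_left_of_both hA hB hd hv h)
    have l := ht v (sA v hv) hvS'
    rw [zb v hvB] at l
    have hbc : v ∉ G.bd (A ∪ B) := fun h => by
      rcases Finset.mem_union.1 (bd_union_subset hA hB hd h) with h | h
      · exact hb h
      · exact hvB (bd_subset_supp h)
    simpa [htg, hbc] using l
  · simp only [h2, Finset.mem_inter, bd_subset_supp hv, and_true]
    split_ifs with h <;> simp [h]
  · rw [c2]; simp only [h2]; split_ifs with h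
    · omega
    · have := ht v (sB v (bd_subset_supp hv)) h; omega
  · rw [c2]
    have hvS' : v ∉ S := fun h => hvS (Finset.mem_inter.2 ⟨h, hv⟩)
    have hvB : v ∉ G.supp A := fun h => hb (mem_bd_left_of_both hB hA hd.symm hv h)
    have l := ht v (sB v hv) hvS'
    rw [za v hvB] at l
    have hbc : v ∉ G.bd (A ∪ B) := fun h => by
      rcases Finset.mem_union.1 (bd_union_subset hA hB hd h) with h | h
      · exact hvB (bd_subset_supp h)
      · exact hb h
    simpa [htg, hbc] using l
  · rw [← Finset.inter_union_distrib_left, ← supp_union hA hB hd]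
    exact (Finset.inter_eq_left.2 hS).symm

end join

/-! ### Base cases: no edge and a single edge -/

/-- The table entry at `σ` of the empty set of edges. -/
theorem entryOK_empty (σ : ℕ → ℕ) : G.EntryOK ∅ σ 1 ∅ := by
  have h0 : ∀ v, G.degA ∅ v = 0 := fun v => by simp [degA]
  exact ⟨fun _ => by simp, fun _ => ⟨by simp [bd, h0], by simp [bd, h0], by simp [supp, h0]⟩,
    fun _ => by simp, fun _ _ _ => by simp⟩

theorem degA_singleton (k v : ℕ) :
    G.degA {k} v = if G.eu k = v ∨ G.ev k = v then 1 else 0 := by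
  unfold degA; rw [Finset.filter_singleton]; split_ifs <;> simp

theorem supp_singleton {k : ℕ} (hk : k < G.m) : G.supp {k} = {G.eu k, G.ev k} := by
  ext v
  rw [mem_supp (by simpa using hk), degA_singleton]
  split_ifs with h
  · simp; tauto
  · simp; tauto

theorem mem_bd_singleton {k : ℕ} (hk : k < G.m) {v : ℕ} :
    v ∈ G.bd {k} ↔ (v = G.eu k ∨ v = G.ev k) ∧ 1 < G.dg v := by
  rw [mem_bd (by simpa using hk), degA_singleton]
  split_ifs with h
  · have : v = G.eu k ∨ v = G.ev k := by omega
    simp only [this, true_and]; omega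
  · have : ¬ (v = G.eu k ∨ v = G.ev k) := by omega
    simp [this]

/-- The admissible pairs of values at the two ends of a single edge `k`. -/
def LeafOpt (G : Net) (k x y : ℕ) : Prop :=
  x < 3 ∧ y < 3 ∧ (1 < x → y = 0) ∧ (1 < y → x = 0) ∧
  (if 1 < G.dg (G.eu k) then x ≤ G.ds + 1 else x = 0 ∨ G.d (G.eu k) < x) ∧
  (if 1 < G.dg (G.ev k) then y ≤ G.ds + 1 else y = 0 ∨ G.d (G.ev k) < y)

/-- The partial solution of a single edge with values `x` and `y` at its two ends. -/
def leafSol (G : Net) (k x y : ℕ) : Finset ℕ :=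
  (if x = 0 then {G.eu k} else ∅) ∪ (if y = 0 then {G.ev k} else ∅)

theorem cnt_singleton_eu {k : ℕ} (hk : k < G.m) (S : Finset ℕ) :
    G.cnt {k} S (G.eu k) = if G.ev k ∈ S then 1 else 0 := by
  have := G.ne k hk
  unfold cnt; rw [Finset.filter_singleton]; simp [this.symm]; split_ifs <;> simp

theorem cnt_singleton_ev {k : ℕ} (hk : k < G.m) (S : Finset ℕ) :
    G.cnt {k} S (G.ev k) = if G.eu k ∈ S then 1 else 0 := by
  have := G.ne k hk
  unfold cnt; rw [Finset.filter_singleton]; simp [this]; split_ifs <;> simp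

/-- Each end has at most one neighbour along the edge, and it has one exactly when the other end is
chosen; so the value `2` forces the value `0` at the other end. At an end of degree one the whole
demand must already be met. -/
theorem leaf_sound {k x y : ℕ} (hk : k < G.m) {σ : ℕ → ℕ} (h : G.LeafOpt k x y)
    (hx : 1 < G.dg (G.eu k) → σ (G.eu k) = x) (hy : 1 < G.dg (G.ev k) → σ (G.ev k) = y) :
    G.leafSol k x y ⊆ G.supp {k} ∧ G.Feas {k} σ (G.leafSol k x y) ∧
      (G.leafSol k x y).card = (if x = 0 then 1 else 0) + (if y = 0 then 1 else 0) := by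
  obtain ⟨h1, h2, h3, h4, h5, h6⟩ := h
  have hne := G.ne k hk
  have mu : G.eu k ∈ G.leafSol k x y ↔ x = 0 := by
    unfold leafSol; split_ifs <;> simp_all
  have mv : G.ev k ∈ G.leafSol k x y ↔ y = 0 := by
    unfold leafSol; split_ifs <;> simp_all [eq_comm]
  have cu := cnt_singleton_eu hk (G.leafSol k x y)
  have cv := cnt_singleton_ev hk (G.leafSol k x y)
  simp only [mv] at cu
  simp only [mu] at cv
  refine ⟨?_, ⟨fun v hv => ?_, fun v hv => ?_, fun v hv hb hS => ?_⟩, ?_⟩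
  · rw [supp_singleton hk]; unfold leafSol
    split_ifs <;> simp
  · rw [mem_bd_singleton hk] at hv
    rcases hv with ⟨rfl | rfl, hv⟩
    · rw [mu, hx hv]
    · rw [mv, hy hv]
  · rw [mem_bd_singleton hk] at hv
    rcases hv with ⟨rfl | rfl, hv⟩
    · rw [cu, hx hv]; split_ifs <;> omega
    · rw [cv, hy hv]; split_ifs <;> omega
  · rw [supp_singleton hk] at hv
    rw [mem_bd_singleton hk] at hb
    simp only [Finset.mem_insert, Finset.mem_singleton] at hv
    rcases hv with rfl | rfl
    · simp only [true_or, true_and] at hb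
      rw [mu] at hS
      rw [if_neg hb] at h5
      rw [cu]; split_ifs <;> omega
    · simp only [or_true, true_and] at hb
      rw [mv] at hS
      rw [if_neg hb] at h6
      rw [cv]; split_ifs <;> omega
  · unfold leafSol; split_ifs <;> simp [hne]

/-- The values are read off from `S`; only an unchosen end of degree one is not governed by `σ`, and
it is given the largest value that `S` supports. -/
theorem leaf_complete {k : ℕ} (hk : k < G.m) {σ : ℕ → ℕ} (hσ : ∀ v, σ v ≤ G.ds + 1)
    {S : Finset ℕ} (hS : S ⊆ G.supp {k}) (hf : G.Feas {k} σ S) :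
    ∃ x y, G.LeafOpt k x y ∧ (1 < G.dg (G.eu k) → σ (G.eu k) = x) ∧
      (1 < G.dg (G.ev k) → σ (G.ev k) = y) ∧
      (if x = 0 then 1 else 0) + (if y = 0 then 1 else 0) = S.card := by
  have hne := G.ne k hk
  have cu := cnt_singleton_eu hk S
  have cv := cnt_singleton_ev hk S
  have hcard : (if G.eu k ∈ S then 1 else 0) + (if G.ev k ∈ S then 1 else 0) = S.card := by
    rw [supp_singleton hk] at hS
    have : S = (if G.eu k ∈ S then {G.eu k} else ∅) ∪ (if G.ev k ∈ S then {G.ev k} else ∅) := by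
      ext v
      constructor
      · intro hv
        have := hS hv
        simp only [Finset.mem_insert, Finset.mem_singleton] at this
        rcases this with rfl | rfl <;> simp [hv]
      · intro hv
        split_ifs at hv with h1 h2 h2 <;> simp at hv
        · rcases hv with rfl | rfl <;> assumption
        · rwa [hv]
        · rwa [hv]
    conv_rhs => rw [this]
    split_ifs <;> simp [hne]
  -- Here `v'` is the other end of the edge.
  set f : ℕ → ℕ → ℕ := fun v v' => if v ∈ S then 0 else if 1 < G.dg v then σ v else
    if v' ∈ S then 2 else 1 with hfd
  have f0 : ∀ v v', v = G.eu k ∨ v = G.ev k → (f v v' = 0 ↔ v ∈ S) := fun v v' hv => by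
    simp only [hfd]
    split_ifs with h1 h2 h3
    · simpa using h1
    · have := hf.mem v ((mem_bd_singleton hk).2 ⟨hv, h2⟩)
      exact this
    · simpa using h1
    · simpa using h1
  have fσ : ∀ v v', v = G.eu k ∨ v = G.ev k → 1 < G.dg v → σ v = f v v' := fun v v' hv h => by
    have := hf.mem v ((mem_bd_singleton hk).2 ⟨hv, h⟩)
    simp only [hfd]
    split_ifs with h1
    · exact this.2 h1
    · rfl
  have u0 := f0 (G.eu k) (G.ev k) (Or.inl rfl)
  have v0 := f0 (G.ev k) (G.eu k) (Or.inr rfl)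
  have bnd : ∀ v v', v = G.eu k ∨ v = G.ev k → G.cnt {k} S v = (if v' ∈ S then 1 else 0) →
      f v v' ≤ (if v' ∈ S then 1 else 0) + 1 ∧
      (if 1 < G.dg v then f v v' ≤ G.ds + 1 else f v v' = 0 ∨ G.d v < f v v') := by
    intro v v' hv hc
    by_cases hd : 1 < G.dg v
    · have := hf.le v ((mem_bd_singleton hk).2 ⟨hv, hd⟩)
      rw [← fσ v v' hv hd, if_pos hd]
      exact ⟨hc ▸ this, hσ v⟩
    · rw [if_neg hd]
      by_cases hvS : v ∈ S
      · simp [hfd, hvS]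
      · have hi := hf.inner v (by rw [supp_singleton hk]; simpa using hv)
          (fun h => hd ((mem_bd_singleton hk).1 h).2) hvS
        rw [hc] at hi
        simp only [hfd, hvS, hd, if_false]
        split_ifs at hi ⊢ <;> omega
  obtain ⟨b1, b2⟩ := bnd _ _ (Or.inl rfl) cu
  obtain ⟨b3, b4⟩ := bnd _ _ (Or.inr rfl) cv
  refine ⟨f (G.eu k) (G.ev k), f (G.ev k) (G.eu k), ⟨?_, ?_, ?_, ?_, b2, b4⟩, fσ _ _ (Or.inl rfl),
    fσ _ _ (Or.inr rfl), ?_⟩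
  · split_ifs at b1 <;> omega
  · split_ifs at b3 <;> omega
  · intro h; rw [v0]; by_contra h'; rw [if_neg h'] at b1; omega
  · intro h; rw [u0]; by_contra h'; rw [if_neg h'] at b3; omega
  · rw [← hcard]; simp only [u0, v0]

end Net

/-! ### Reasoning about commands -/

/-- The variables that a command may change. -/
def Cmd.mv : Cmd → List Var
  | .set x _ => [x]
  | .put _ _ _ => []
  | .seq c d => c.mv ++ d.mv
  | .ite _ c d => c.mv ++ d.mv
  | .loop x _ c => x :: c.mv
  | .read x => [x]
  | .print _ => []
  | .skip => []

/-- The arrays that a command may change. -/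
def Cmd.ma : Cmd → List Arr
  | .put A _ _ => [A]
  | .seq c d => c.ma ++ d.ma
  | .ite _ c d => c.ma ++ d.ma
  | .loop _ _ c => c.ma
  | _ => []

/-- Whether a command may read input. -/
def Cmd.rd : Cmd → Bool
  | .seq c d => c.rd || d.rd
  | .ite _ c d => c.rd || d.rd
  | .loop _ _ c => c.rd
  | .read _ => true
  | _ => false

/-- Whether a command may print. -/
def Cmd.pr : Cmd → Bool
  | .seq c d => c.pr || d.pr
  | .ite _ c d => c.pr || d.pr
  | .loop _ _ c => c.pr
  | .print _ => true
  | _ => false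

/-- The part of the state that the command `c` cannot change is the same in `s` and `s'`. -/
structure Frame (c : Cmd) (s s' : St) : Prop where
  v : ∀ x, x ∉ c.mv → s'.v x = s.v x
  a : ∀ A, A ∉ c.ma → s'.a A = s.a A
  inp : c.rd = false → s'.inp = s.inp
  out : c.pr = false → s'.out = s.out

theorem Frame.trans {c : Cmd} {s s' s'' : St} (h : Frame c s s') (h' : Frame c s' s'') :
    Frame c s s'' :=
  ⟨fun x hx => (h'.v x hx).trans (h.v x hx), fun x hx => (h'.a x hx).trans (h.a x hx),
    fun hx => (h'.inp hx).trans (h.inp hx), fun hx => (h'.out hx).trans (h.out hx)⟩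

theorem Frame.sub {c d : Cmd} {s s' : St} (h : Frame c s s') (hv : c.mv ⊆ d.mv)
    (ha : c.ma ⊆ d.ma) (hr : c.rd = true → d.rd = true) (hp : c.pr = true → d.pr = true) :
    Frame d s s' :=
  ⟨fun x hx => h.v x fun hx' => hx (hv hx'), fun x hx => h.a x fun hx' => hx (ha hx'),
    fun hx => h.inp (by simpa [hx] using hr), fun hx => h.out (by simpa [hx] using hp)⟩

/-- The sets of variables and arrays that may change are computed from the syntax, so that each fact
of non-interference in the verification is settled by `decide`. -/
theorem exec_frame (c : Cmd) : ∀ s, Frame c s (c.exec s) := by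
  induction c with
  | set x e =>
    intro s
    refine ⟨fun y hy => ?_, fun _ _ => rfl, fun _ => rfl, fun _ => rfl⟩
    simp only [Cmd.mv, List.mem_singleton] at hy
    simp [Cmd.exec, hy]
  | put A e f =>
    intro s
    refine ⟨fun _ _ => rfl, fun B hB => ?_, fun _ => rfl, fun _ => rfl⟩
    simp only [Cmd.ma, List.mem_singleton] at hB
    simp [Cmd.exec, hB]
  | seq c d hc hd =>
    intro s
    refine ((hc s).sub ?_ ?_ ?_ ?_).trans ((hd _).sub ?_ ?_ ?_ ?_) <;>
      simp +contextual [Cmd.mv, Cmd.ma, Cmd.rd, Cmd.pr]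
  | ite e c d hc hd =>
    intro s
    simp only [Cmd.exec]
    split
    · refine Frame.trans (s' := s.tick)
        (Frame.mk (fun _ _ => rfl) (fun _ _ => rfl) (fun _ => rfl) (fun _ => rfl))
        ((hc s.tick).sub ?_ ?_ ?_ ?_) <;> simp +contextual [Cmd.mv, Cmd.ma, Cmd.rd, Cmd.pr]
    · refine Frame.trans (s' := s.tick)
        (Frame.mk (fun _ _ => rfl) (fun _ _ => rfl) (fun _ => rfl) (fun _ => rfl))
        ((hd s.tick).sub ?_ ?_ ?_ ?_) <;> simp +contextual [Cmd.mv, Cmd.ma, Cmd.rd, Cmd.pr]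
  | loop x e c hc =>
    intro s
    simp only [Cmd.exec]
    generalize e.eval s = n
    induction n with
    | zero => exact ⟨fun _ _ => rfl, fun _ _ => rfl, fun _ => rfl, fun _ => rfl⟩
    | succ n ih =>
      refine ih.trans (Frame.trans (s' := ((iter c.exec x s.tick n).setv x n).tick) (Frame.mk (fun y hy => ?_) (fun _ _ => rfl) (fun _ => rfl)
        (fun _ => rfl)) ((hc ((iter c.exec x s.tick n).setv x n).tick).sub ?_ ?_ ?_ ?_)) <;>
        simp_all +contextual [Cmd.mv, Cmd.ma, Cmd.rd, Cmd.pr]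
  | read x =>
    intro s
    refine ⟨fun y hy => ?_, fun _ _ => rfl, fun h => by simp [Cmd.rd] at h, fun _ => rfl⟩
    simp only [Cmd.mv, List.mem_singleton] at hy
    simp [Cmd.exec, hy]
  | print e =>
    intro s
    exact ⟨fun _ _ => rfl, fun _ _ => rfl, fun _ => rfl, fun h => by simp [Cmd.pr] at h⟩
  | skip =>
    intro s
    exact ⟨fun _ _ => rfl, fun _ _ => rfl, fun _ => rfl, fun _ => rfl⟩

/-- The bound of the loop is evaluated once, at the start. The step may also use that the current
state agrees with the initial one on everything the loop cannot change, so invariants need not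
mention constants. -/
theorem loop_rule {x : Var} {e : Ex} {c : Cmd} {s : St} (I : ℕ → St → Prop) (h0 : I 0 s.tick)
    (hs : ∀ k < e.eval s, ∀ s', Frame (.loop x e c) s s' → I k s' →
      I (k + 1) (c.exec (s'.setv x k).tick)) :
    I (e.eval s) ((Cmd.loop x e c).exec s) := by
  have key : ∀ k ≤ e.eval s, I k (iter c.exec x s.tick k) ∧
      Frame (.loop x e c) s (iter c.exec x s.tick k) := by
    intro k
    induction k with
    | zero => exact fun _ => ⟨h0, fun _ _ => rfl, fun _ _ => rfl, fun _ => rfl, fun _ => rfl⟩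
    | succ k ih =>
      intro hk
      obtain ⟨h1, h2⟩ := ih (by omega)
      refine ⟨hs k (by omega) _ h2 h1, h2.trans (Frame.trans
        (s' := ((iter c.exec x s.tick k).setv x k).tick) (Frame.mk (fun y hy => ?_)
        (fun _ _ => rfl) (fun _ => rfl) (fun _ => rfl))
        ((exec_frame c ((iter c.exec x s.tick k).setv x k).tick).sub ?_ ?_ ?_ ?_))⟩ <;>
        simp_all +contextual [Cmd.mv, Cmd.ma, Cmd.rd, Cmd.pr]
  exact (key _ le_rfl).1

/-- A sequence of commands. -/
def block : List Cmd → Cmd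
  | [] => .skip
  | c :: cs => .seq c (block cs)

theorem exec_seq (c d : Cmd) (s : St) : (Cmd.seq c d).exec s = d.exec (c.exec s) := rfl
theorem exec_set (x : Var) (e : Ex) (s : St) :
    (Cmd.set x e).exec s = (s.setv x (e.eval s)).tick := rfl
theorem exec_put (A : Arr) (e f : Ex) (s : St) :
    (Cmd.put A e f).exec s = (s.seta A (e.eval s) (f.eval s)).tick := rfl
theorem exec_ite (e : Ex) (c d : Cmd) (s : St) :
    (Cmd.ite e c d).exec s = if 0 < e.eval s then c.exec s.tick else d.exec s.tick := rfl
theorem exec_skip (s : St) : Cmd.skip.exec s = s.tick := rfl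
theorem exec_print (e : Ex) (s : St) :
    (Cmd.print e).exec s = { s with out := s.out ++ [e.eval s] }.tick := rfl
theorem exec_read (x : Var) (s : St) :
    (Cmd.read x).exec s = ({ s with inp := s.inp.tail }.setv x (s.inp.headD 0)).tick := rfl
theorem exec_nil (s : St) : (block []).exec s = s.tick := rfl
theorem exec_cons (c : Cmd) (cs : List Cmd) (s : St) :
    (block (c :: cs)).exec s = (block cs).exec (c.exec s) := rfl

/-! ### The program -/

/-- Add one to a variable. -/
abbrev inc (x : Var) : Cmd := .set x (.add (.v x) (.c 1))

/-- Add one to an array cell. -/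
abbrev bump (A : Arr) (e : Ex) : Cmd := .put A e (.add (.a A e) (.c 1))

/-- Conjunction. -/
abbrev andE (e f : Ex) : Ex := .ite e f (.c 0)

/-- Test for the value one. -/
abbrev isOne (e : Ex) : Ex := .ite e (.sub (.c 2) e) (.c 0)

/-- Read the demands. -/
def readDemands : Cmd := .loop .k (.v .n) (block [.read .t, .put .dem (.v .k) (.v .t),
  .set .dst (.ite (.sub (.v .t) (.v .dst)) (.v .t) (.v .dst))])

/-- Read the edges of the graph. -/
def readEdges : Cmd := .loop .k (.v .m) (block [.read .u, .read .w, .read .t,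
  .put .eu (.v .k) (.v .u), .put .ev (.v .k) (.v .w), .put .et (.v .k) (.v .t),
  bump .deg (.v .u), bump .deg (.v .w)])

/-- Read the edges of the tree. -/
def readTree : Cmd := .loop .k (.sub (.v .N) (.c 1)) (block [.read .x, .read .y,
  bump .tdeg (.v .x), bump .tdeg (.v .y),
  .put .tsum (.v .x) (.add (.a .tsum (.v .x)) (.v .y)),
  .put .tsum (.v .y) (.add (.a .tsum (.v .y)) (.v .x))])

/-- Make a table with a single entry for every tree node. -/
def emptyTables : Cmd := .loop .k (.v .N) (block [.put .base (.v .k) (.v .free),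
  .put .cst (.v .free) (.c 1), inc .free])

/-- Multiply the current stride by the number of values. -/
def growStride : Cmd := .loop .z (.v .D) (.set .t (.add (.v .t) (.v .sz)))

/-- Append the vertex `v` with edge count `c` to the list of boundary vertices under
construction. -/
def append : Cmd := block [.put .lv (.v .lf) (.v .v), .put .lc (.v .lf) (.v .c),
  .put .ls (.v .lf) (.v .sz), inc .lf, .set .t (.c 0), growStride, .set .sz (.v .t)]

/-- Improve the table entry `p` to the cost `nc`. -/
def relax : Cmd := .ite (.ite (.a .cst (.v .p)) (.sub (.a .cst (.v .p)) (.v .nc)) (.c 1))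
  (block [.put .cst (.v .p) (.v .nc), .put .el (.v .p) (.v .l), .put .er (.v .p) (.v .r),
    .put .eU (.v .p) (.v .a1), .put .eV (.v .p) (.v .a2)]) .skip

/-- The product of a value `j` at most two and an expression. -/
abbrev mul2 (j : Var) (e : Var) : Ex :=
  .ite (.sub (.v j) (.c 1)) (.add (.v e) (.v e)) (.ite (.v j) (.v e) (.c 0))

/-- The condition under which the values `j1` and `j2` at the ends of an edge are admissible. -/
def leafCond : Ex :=
  andE (.ite (.sub (.v .j1) (.c 1)) (.sub (.c 1) (.v .j2)) (.c 1))
  (andE (.ite (.sub (.v .j2) (.c 1)) (.sub (.c 1) (.v .j1)) (.c 1))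
  (andE (.ite (.v .e1) (.sub (.v .D) (.v .j1))
      (.ite (.v .j1) (.sub (.v .j1) (.a .dem (.v .u))) (.c 1)))
    (.ite (.v .e2) (.sub (.v .D) (.v .j2))
      (.ite (.v .j2) (.sub (.v .j2) (.a .dem (.v .w))) (.c 1)))))

/-- Enter one admissible pair of values into the table of an edge. -/
def leafEntry : Cmd := .ite leafCond (block [
  .set .p (.add (.v .free) (.add (mul2 .j1 .e1) (mul2 .j2 .e2))),
  .set .nc (.add (.c 1) (.add (.ite (.v .j1) (.c 0) (.c 1)) (.ite (.v .j2) (.c 0) (.c 1)))),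
  .set .a1 (.ite (.v .j1) (.c 0) (.add (.v .u) (.c 1))),
  .set .a2 (.ite (.v .j2) (.c 0) (.add (.v .w) (.c 1))), relax]) .skip

/-- Fill the table of an edge. -/
def leafFill : Cmd := .loop .j1 (.c 3) (.loop .j2 (.c 3) leafEntry)

/-- Append the vertex `v` to the boundary of an edge, if it has another edge. -/
def leafEnd (e : Var) : Cmd := block [.set e (.c 0),
  .ite (.sub (.a .deg (.v .v)) (.c 1)) (block [.set e (.v .sz), append]) .skip]

/-- Make the table of the edge `k`. -/
def leafTable : Cmd := block [.set .u (.a .eu (.v .k)), .set .w (.a .ev (.v .k)),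
  .set .x (.a .et (.v .k)), .put .base (.v .x) (.v .free), .put .wp (.v .x) (.v .lf),
  .set .sz (.c 1), .set .c (.c 1), .set .v (.v .u), leafEnd .e1, .set .v (.v .w), leafEnd .e2,
  .put .wn (.v .x) (.sub (.v .lf) (.a .wp (.v .x))), .set .l (.c 0), .set .r (.c 0),
  leafFill, .set .free (.add (.v .free) (.v .sz))]

/-- Make the tables of all edges. -/
def leafTables : Cmd := .loop .k (.v .m) leafTable

/-- Load the boundary of the first table. -/
def loadA : Cmd := .loop .i (.v .na) (block [.set .v (.a .lv (.add (.v .pa) (.v .i))),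
  .put .ca (.v .v) (.a .lc (.add (.v .pa) (.v .i))),
  .put .sa (.v .v) (.a .ls (.add (.v .pa) (.v .i))), .put .uu (.v .nu) (.v .v), inc .nu])

/-- Load the boundary of the second table. -/
def loadB : Cmd := .loop .i (.v .nb) (block [.set .v (.a .lv (.add (.v .pb) (.v .i))),
  .put .cb (.v .v) (.a .lc (.add (.v .pb) (.v .i))),
  .put .sb (.v .v) (.a .ls (.add (.v .pb) (.v .i))),
  .ite (.a .sa (.v .v)) .skip (block [.put .uu (.v .nu) (.v .v), inc .nu])])

/-- Append a shifted copy of the last generation of combinations. -/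
def copyGen : Cmd := .loop .t (.sub (.v .hi) (.v .lo)) (block [
  .put .gA (.v .nx) (.add (.a .gA (.add (.v .lo) (.v .t))) (.v .oa)),
  .put .gB (.v .nx) (.add (.a .gB (.add (.v .lo) (.v .t))) (.v .ob)),
  .put .gC (.v .nx) (.add (.a .gC (.add (.v .lo) (.v .t))) (.v .oc)),
  .put .gO (.v .nx) (.add (.a .gO (.add (.v .lo) (.v .t))) (.v .oo)), inc .nx])

/-- Whether the pair of values `j1`, `j2` is admissible at the vertex `v`. -/
def pairCond : Ex := .ite (.v .fc) (.sub (.add (.v .dst) (.c 1)) (.add (.v .j1) (.v .j2)))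
  (.sub (.c 1) (.add (.sub (.add (.v .j1) (.v .j2)) (.a .dem (.v .v)))
    (.sub (.a .dem (.v .v)) (.add (.v .j1) (.v .j2)))))

/-- The pairs of values with given `j1`. -/
def pairsInner : Cmd := .loop .j2 (.v .lb) (block [.set .ob (.add (.v .ob) (.v .eb)),
  .set .oc (.add (.v .oc) (.v .ec)), .ite pairCond copyGen .skip])

/-- All pairs of values. -/
def pairsOuter : Cmd := .loop .j1 (.v .la) (block [.set .oa (.add (.v .oa) (.v .ea)),
  .set .ob (.c 0), .set .oc (.v .od), pairsInner, .set .od (.add (.v .od) (.v .ec))])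

/-- Determine the strides of the vertex `v`, and whether it is in the new boundary. -/
def vertexStart : Cmd := block [.set .ea (.a .sa (.v .v)), .set .eb (.a .sb (.v .v)),
  .set .c (.add (.a .ca (.v .v)) (.a .cb (.v .v))), .set .ec (.c 0), .set .fc (.c 0),
  .ite (.sub (.a .deg (.v .v)) (.v .c)) (block [.set .ec (.v .sz), .set .fc (.c 1), append]) .skip]

/-- Extend the combinations by the values at the vertex `v`. -/
def vertexGen : Cmd := block [.set .nx (.v .hi), .set .oa (.c 0), .set .ob (.c 0), .set .oc (.c 0),
  .set .oo (.ite (.v .ea) (.ite (.v .eb) (.c 1) (.c 0)) (.c 0)), copyGen, .set .oo (.c 0),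
  .set .od (.c 0),
  .set .la (.ite (.v .ea) (.add (.v .dst) (.c 1)) (.c 1)),
  .set .lb (.ite (.v .eb) (.add (.v .dst) (.c 1)) (.c 1)), pairsOuter,
  .set .lo (.v .hi), .set .hi (.v .nx)]

/-- Process all vertices of the two boundaries. -/
def allVertices : Cmd :=
  .loop .i (.v .nu) (block [.set .v (.a .uu (.v .i)), vertexStart, vertexGen])

/-- Enter the combinations into the new table. -/
def joinFill : Cmd := .loop .t (.sub (.v .hi) (.v .lo)) (block [
  .set .l (.add (.v .ba) (.a .gA (.add (.v .lo) (.v .t)))),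
  .set .r (.add (.v .bb) (.a .gB (.add (.v .lo) (.v .t)))),
  .ite (andE (.a .cst (.v .l)) (.a .cst (.v .r))) (block [
    .set .p (.add (.v .free) (.a .gC (.add (.v .lo) (.v .t)))),
    .set .nc (.sub (.add (.a .cst (.v .l)) (.a .cst (.v .r)))
      (.add (.a .gO (.add (.v .lo) (.v .t))) (.c 1))),
    relax]) .skip])

/-- Forget the boundaries of the two tables. -/
def clearMarks : Cmd := .loop .i (.v .nu) (block [.set .v (.a .uu (.v .i)),
  .put .ca (.v .v) (.c 0), .put .sa (.v .v) (.c 0), .put .cb (.v .v) (.c 0),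
  .put .sb (.v .v) (.c 0)])

/-- Preparations for joining two tables. -/
def joinStart : Cmd := block [.set .pa (.a .wp (.v .y)), .set .na (.a .wn (.v .y)),
  .set .pb (.a .wp (.v .x)), .set .nb (.a .wn (.v .x)), .set .ba (.a .base (.v .y)),
  .set .bb (.a .base (.v .x)), .set .nu (.c 0)]

/-- The list of combinations for the empty set of vertices. -/
def firstGen : Cmd := block [.set .lo (.c 0), .set .hi (.c 1), .put .gA (.c 0) (.c 0),
  .put .gB (.c 0) (.c 0), .put .gC (.c 0) (.c 0), .put .gO (.c 0) (.c 0), .set .sz (.c 1),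
  .set .lp (.v .lf), .set .a1 (.c 0), .set .a2 (.c 0)]

/-- Register the new table at the node `y`. -/
def joinEnd : Cmd := block [.put .base (.v .y) (.v .free), .put .wp (.v .y) (.v .lp),
  .put .wn (.v .y) (.sub (.v .lf) (.v .lp)), .set .free (.add (.v .free) (.v .sz))]

/-- Compute all combinations for the join of the tables of `x` and `y`. -/
def joinPrep : Cmd := block [joinStart, loadA, loadB, firstGen, allVertices]

/-- Replace the table of the node `y` by the join of the tables of `x` and `y`. -/
def join : Cmd := block [joinPrep, joinFill, clearMarks, joinEnd]

/-- Put the node `e` in the queue if it has one remaining neighbour. -/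
def enqueue (x : Var) : Cmd := .ite (isOne (.a .tdeg (.v x)))
  (block [.put .q (.v .qe) (.v x), inc .qe]) .skip

/-- Fill the queue with the leaves of the tree. -/
def startQueue : Cmd := .loop .k (.v .N) (enqueue .k)

/-- Dismantle the tree from its leaves, joining tables. -/
def peel : Cmd := .loop .k (.sub (.v .N) (.c 1)) (block [.set .x (.a .q (.v .k)),
  .set .y (.a .tsum (.v .x)), join,
  .put .tsum (.v .y) (.sub (.a .tsum (.v .y)) (.v .x)),
  .put .tdeg (.v .y) (.sub (.a .tdeg (.v .y)) (.c 1)), enqueue .y, .set .rt (.v .y)])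

/-- Find the vertices of the partial solution in the last table. -/
def trace : Cmd := .loop .k (.v .free) (block [
  .set .p (.sub (.v .free) (.add (.v .k) (.c 1))),
  .ite (.a .mark (.v .p)) (block [.put .mark (.a .el (.v .p)) (.c 1),
    .put .mark (.a .er (.v .p)) (.c 1), .put .ins (.a .eU (.v .p)) (.c 1),
    .put .ins (.a .eV (.v .p)) (.c 1)]) .skip])

/-- Print the solution. -/
def output : Cmd := .loop .k (.v .n) (.ite (.a .deg (.v .k))
  (.ite (.a .ins (.add (.v .k) (.c 1))) (.print (.v .k)) .skip)
  (.ite (.a .dem (.v .k)) (.print (.v .k)) .skip))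

/-- The whole algorithm. -/
def algorithm : Cmd := block [.read .n, .read .m, .read .N, readDemands, readEdges, readTree,
  .set .D (.add (.v .dst) (.c 2)), .set .free (.c 1), emptyTables, leafTables, startQueue, peel,
  .put .mark (.a .base (.v .rt)) (.c 1), trace, output]

/-! ### Simple loops -/

/-- The combination stored at position `p`. -/
def St.g (s : St) (p : ℕ) : ℕ × ℕ × ℕ × ℕ := (s.a .gA p, s.a .gB p, s.a .gC p, s.a .gO p)

/-- The copies are written from `nx ≥ hi` on, so the segment being read is never overwritten. -/
theorem copyGen_spec (s : St) (hnx : s.v .hi ≤ s.v .nx) (hlo : s.v .lo ≤ s.v .hi) :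
    (copyGen.exec s).v .nx = s.v .nx + (s.v .hi - s.v .lo) ∧
    (∀ p < s.v .nx, (copyGen.exec s).g p = s.g p) ∧
    (∀ t < s.v .hi - s.v .lo, (copyGen.exec s).g (s.v .nx + t) =
      s.g (s.v .lo + t) + (s.v .oa, s.v .ob, s.v .oc, s.v .oo)) ∧
    (copyGen.exec s).tm ≤ s.tm + 1 + 7 * (s.v .hi - s.v .lo) := by
  refine loop_rule (fun k s' => s'.v .nx = s.v .nx + k ∧ (∀ p < s.v .nx, s'.g p = s.g p) ∧
    (∀ t < k, s'.g (s.v .nx + t) = s.g (s.v .lo + t) + (s.v .oa, s.v .ob, s.v .oc, s.v .oo)) ∧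
    s'.tm ≤ s.tm + 1 + 7 * k) ⟨rfl, fun _ _ => rfl, by simp, by simp⟩ ?_
  rintro k hk s' hf ⟨h1, h2, h3, h4⟩
  have hlo' : s'.v .lo = s.v .lo := hf.v _ (by decide)
  have hoa : s'.v .oa = s.v .oa := hf.v _ (by decide)
  have hob : s'.v .ob = s.v .ob := hf.v _ (by decide)
  have hoc : s'.v .oc = s.v .oc := hf.v _ (by decide)
  have hoo : s'.v .oo = s.v .oo := hf.v _ (by decide)
  simp only [Ex.eval] at hk
  have hlt : s.v .lo + k < s.v .nx := by omega
  have h2' := h2 _ hlt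
  simp only [St.g, Prod.mk.injEq] at h2 h2'
  refine ⟨?_, fun p hp => ?_, fun t ht => ?_, ?_⟩
  · simp [exec_cons, exec_put, exec_set, exec_nil, h1]; omega
  · have := h2 p hp
    simp [exec_cons, exec_put, exec_set, exec_nil, h1, St.g, Function.update_apply,
      show p ≠ s.v .nx + k by omega, this]
  · by_cases htk : t = k
    · subst htk
      simp [exec_cons, exec_put, exec_set, exec_nil, h1, St.g, Function.update_apply,
        hlo', hoa, hob, hoc, hoo, h2']
    · have := h3 t (by omega)
      simp only [St.g, Prod.mk_add_mk, Prod.mk.injEq] at this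
      simp [exec_cons, exec_put, exec_set, exec_nil, h1, St.g, Function.update_apply,
        htk, this]
  · simp [exec_cons, exec_put, exec_set, exec_nil]; omega

/-- A product by repeated addition; its cost of order `d*` is affordable because every processed
vertex contributes a factor of at least `d* + 2` to the time bound. -/
theorem growStride_spec (s : St) : (growStride.exec s).v .t = s.v .t + s.v .D * s.v .sz ∧
    (growStride.exec s).tm ≤ s.tm + 1 + 2 * s.v .D := by
  refine loop_rule (fun k s' => s'.v .t = s.v .t + k * s.v .sz ∧ s'.tm ≤ s.tm + 1 + 2 * k)
    ⟨by simp, by simp⟩ ?_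
  rintro k hk s' hf ⟨h1, h2⟩
  have hsz : s'.v .sz = s.v .sz := hf.v _ (by decide)
  refine ⟨?_, ?_⟩
  · simp [exec_set, h1, hsz]; ring
  · simp [exec_set]; omega

/-! ### Generations of combinations -/

/-- The set of combinations stored at the positions from `p` to `q - 1`. -/
def St.seg (s : St) (p q : ℕ) : Set (ℕ × ℕ × ℕ × ℕ) := {o | ∃ i, p ≤ i ∧ i < q ∧ s.g i = o}

theorem seg_congr {s s' : St} {p q : ℕ} (h : ∀ i < q, s'.g i = s.g i) :
    s'.seg p q = s.seg p q := by
  ext o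
  constructor
  · rintro ⟨i, h1, h2, h3⟩; exact ⟨i, h1, h2, by rw [← h i h2, h3]⟩
  · rintro ⟨i, h1, h2, h3⟩; exact ⟨i, h1, h2, by rw [h i h2, h3]⟩

theorem seg_union (s : St) {p q r : ℕ} (h : p ≤ q) (h' : q ≤ r) :
    s.seg p r = s.seg p q ∪ s.seg q r := by
  ext o
  constructor
  · rintro ⟨i, h1, h2, h3⟩
    by_cases hi : i < q
    · exact Or.inl ⟨i, h1, hi, h3⟩
    · exact Or.inr ⟨i, by omega, h2, h3⟩
  · rintro (⟨i, h1, h2, h3⟩ | ⟨i, h1, h2, h3⟩)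
    · exact ⟨i, h1, by omega, h3⟩
    · exact ⟨i, by omega, h2, h3⟩

theorem copyGen_seg (s : St) (hnx : s.v .hi ≤ s.v .nx) (hlo : s.v .lo ≤ s.v .hi) :
    (copyGen.exec s).v .nx = s.v .nx + (s.v .hi - s.v .lo) ∧
    (∀ p < s.v .nx, (copyGen.exec s).g p = s.g p) ∧
    (∀ q, q ∈ (copyGen.exec s).seg (s.v .nx) ((copyGen.exec s).v .nx) ↔
      ∃ q₀ ∈ s.seg (s.v .lo) (s.v .hi), q = q₀ + (s.v .oa, s.v .ob, s.v .oc, s.v .oo)) ∧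
    (copyGen.exec s).tm ≤ s.tm + 1 + 7 * (s.v .hi - s.v .lo) := by
  obtain ⟨h1, h2, h3, h4⟩ := copyGen_spec s hnx hlo
  refine ⟨h1, h2, fun q => ⟨?_, ?_⟩, h4⟩
  · rintro ⟨i, hi, hi', rfl⟩
    have := h3 (i - s.v .nx) (by omega)
    rw [show s.v .nx + (i - s.v .nx) = i by omega] at this
    exact ⟨_, ⟨s.v .lo + (i - s.v .nx), by omega, by omega, rfl⟩, this⟩
  · rintro ⟨_, ⟨i, hi, hi', rfl⟩, rfl⟩
    have := h3 (i - s.v .lo) (by omega)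
    rw [show s.v .lo + (i - s.v .lo) = i by omega] at this
    exact ⟨s.v .nx + (i - s.v .lo), by omega, by omega, this⟩

/-- The condition on a pair of values at the current vertex. -/
def St.pairOK (s : St) (j1 j2 : ℕ) : Prop :=
  if 0 < s.v .fc then j1 + j2 ≤ s.v .dst else j1 + j2 = s.a .dem (s.v .v)

theorem pairCond_eval (s : St) : 0 < pairCond.eval s ↔ s.pairOK (s.v .j1) (s.v .j2) := by
  by_cases h : 0 < s.v .fc
  · simp only [St.pairOK, if_pos h]
    have : pairCond.eval s = s.v .dst + 1 - (s.v .j1 + s.v .j2) := if_pos h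
    omega
  · simp only [St.pairOK, if_neg h]
    -- The sum of the two truncated differences vanishes exactly when the numbers are equal.
    have : pairCond.eval s = 1 - (s.v .j1 + s.v .j2 - s.a .dem (s.v .v) +
        (s.a .dem (s.v .v) - (s.v .j1 + s.v .j2))) := if_neg h
    omega

/-- The index `j2` stands for the value `j2 + 1`, since the value `0` is treated separately; this is
why the offsets are advanced before copying. -/
theorem pairsInner_spec (s : St) (hnx : s.v .hi ≤ s.v .nx) (hlo : s.v .lo ≤ s.v .hi) :
    s.v .nx ≤ (pairsInner.exec s).v .nx ∧
    (pairsInner.exec s).v .nx ≤ s.v .nx + s.v .lb * (s.v .hi - s.v .lo) ∧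
    (∀ p < s.v .nx, (pairsInner.exec s).g p = s.g p) ∧
    (∀ q, q ∈ (pairsInner.exec s).seg (s.v .nx) ((pairsInner.exec s).v .nx) ↔
      ∃ j2 < s.v .lb, s.pairOK (s.v .j1) j2 ∧ ∃ q₀ ∈ s.seg (s.v .lo) (s.v .hi),
        q = q₀ + (s.v .oa, s.v .ob + (j2 + 1) * s.v .eb, s.v .oc + (j2 + 1) * s.v .ec,
          s.v .oo)) ∧
    (pairsInner.exec s).tm ≤ s.tm + 1 + s.v .lb * (6 + 7 * (s.v .hi - s.v .lo)) := by
  have := loop_rule (x := .j2) (e := .v .lb) (s := s)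
    (c := block [.set .ob (.add (.v .ob) (.v .eb)),
      .set .oc (.add (.v .oc) (.v .ec)), .ite pairCond copyGen .skip])
    (fun k s' => s'.v .ob = s.v .ob + k * s.v .eb ∧ s'.v .oc = s.v .oc + k * s.v .ec ∧
      s.v .nx ≤ s'.v .nx ∧ s'.v .nx ≤ s.v .nx + k * (s.v .hi - s.v .lo) ∧
      (∀ p < s.v .nx, s'.g p = s.g p) ∧
      (∀ q, q ∈ s'.seg (s.v .nx) (s'.v .nx) ↔
        ∃ j2 < k, s.pairOK (s.v .j1) j2 ∧ ∃ q₀ ∈ s.seg (s.v .lo) (s.v .hi),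
          q = q₀ + (s.v .oa, s.v .ob + (j2 + 1) * s.v .eb, s.v .oc + (j2 + 1) * s.v .ec,
            s.v .oo)) ∧
      s'.tm ≤ s.tm + 1 + k * (6 + 7 * (s.v .hi - s.v .lo)))
    ⟨by simp, by simp, by simp, by simp, fun _ _ => rfl,
      fun q => ⟨by rintro ⟨i, h1, h2, -⟩; simp at h2; omega, by simp⟩, by simp⟩ ?_
  · exact this.2.2
  rintro k hk s' hf ⟨h1, h2, h3, h4, h5, h6, h7⟩
  have elo : s'.v .lo = s.v .lo := hf.v _ (by decide)
  have ehi : s'.v .hi = s.v .hi := hf.v _ (by decide)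
  have eeb : s'.v .eb = s.v .eb := hf.v _ (by decide)
  have eec : s'.v .ec = s.v .ec := hf.v _ (by decide)
  have eoa : s'.v .oa = s.v .oa := hf.v _ (by decide)
  have eoo : s'.v .oo = s.v .oo := hf.v _ (by decide)
  have efc : s'.v .fc = s.v .fc := hf.v _ (by decide)
  have eds : s'.v .dst = s.v .dst := hf.v _ (by decide)
  have ej1 : s'.v .j1 = s.v .j1 := hf.v _ (by decide)
  have ev : s'.v .v = s.v .v := hf.v _ (by decide)
  have ede : s'.a .dem = s.a .dem := hf.a _ (by decide)
  simp only [exec_cons, exec_nil, exec_ite]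
  generalize hs1 : (Cmd.set .oc (.add (.v .oc) (.v .ec))).exec
    ((Cmd.set .ob (.add (.v .ob) (.v .eb))).exec (s'.setv .j2 k).tick) = s1
  have b1 : s1.v .ob = s.v .ob + (k + 1) * s.v .eb := by
    simp [← hs1, exec_set, h1, eeb]; ring
  have b2 : s1.v .oc = s.v .oc + (k + 1) * s.v .ec := by
    simp [← hs1, exec_set, h2, eec]; ring
  have b3 : s1.tm = s'.tm + 3 := by simp [← hs1, exec_set]
  have b4 : ∀ p, s1.g p = s'.g p := fun p => by simp [← hs1, exec_set, St.g]
  have b5 : s1.v .nx = s'.v .nx := by simp [← hs1, exec_set]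
  have b6 : s1.v .lo = s.v .lo := by simp [← hs1, exec_set, elo]
  have b7 : s1.v .hi = s.v .hi := by simp [← hs1, exec_set, ehi]
  have b8 : s1.v .oa = s.v .oa := by simp [← hs1, exec_set, eoa]
  have b9 : s1.v .oo = s.v .oo := by simp [← hs1, exec_set, eoo]
  have b10 : 0 < pairCond.eval s1 ↔ s.pairOK (s.v .j1) k := by
    rw [pairCond_eval]
    simp [← hs1, exec_set, St.pairOK, efc, eds, ej1, ev, ede]
  clear hs1
  have hseg : s'.seg (s.v .lo) (s.v .hi) = s.seg (s.v .lo) (s.v .hi) :=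
    seg_congr fun i hi => h5 i (by omega)
  by_cases hc : 0 < pairCond.eval s1
  · rw [if_pos hc]
    obtain ⟨c1, c2, c3, c4⟩ := copyGen_seg s1.tick (by simp [b5, b7]; omega) (by simpa [b6, b7])
    have f := exec_frame copyGen s1.tick
    have fob := f.v .ob (by decide)
    have foc := f.v .oc (by decide)
    generalize copyGen.exec s1.tick = s2 at *
    simp only [tick_v, tick_tm, b5, b6, b7, b8, b9, b1, b2, b3] at c1 c2 c3 c4 fob foc
    have hg2 : ∀ p < s'.v .nx, s2.g p = s'.g p := fun p hp => (c2 p hp).trans (b4 p)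
    refine ⟨fob, foc, ?_, ?_, fun p hp => ?_, fun q => ?_, ?_⟩
    · simp [c1]; omega
    · simp [c1, Nat.add_one_mul k]; omega
    · exact (hg2 p (by omega)).trans (h5 p hp)
    · have hq := c3 q
      have : s1.tick.seg (s.v .lo) (s.v .hi) = s.seg (s.v .lo) (s.v .hi) := by
        rw [← hseg]; exact seg_congr fun i _ => b4 i
      rw [this] at hq
      show q ∈ s2.seg (s.v .nx) (s2.v .nx) ↔ _
      rw [seg_union s2 h3 (by omega), Set.mem_union, hq,
        seg_congr (s := s') hg2, h6]
      constructor
      · rintro (⟨j, hj, h⟩ | h)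
        · exact ⟨j, by omega, h⟩
        · exact ⟨k, by omega, b10.1 hc, h⟩
      · rintro ⟨j, hj, h, h'⟩
        by_cases hjk : j = k
        · subst hjk; exact Or.inr h'
        · exact Or.inl ⟨j, by omega, h, h'⟩
    · simp [Nat.add_one_mul k]; omega
  · rw [if_neg hc, exec_skip]
    refine ⟨b1, b2, ?_, ?_, fun p hp => (b4 p).trans (h5 p hp), fun q => ?_, ?_⟩
    · simp [b5, h3]
    · simp [b5, Nat.add_one_mul k]; omega
    · have : s1.tick.tick.seg (s.v .nx) (s1.tick.tick.v .nx) = s'.seg (s.v .nx) (s'.v .nx) := by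
        simp only [tick_v, b5]; exact seg_congr fun i _ => b4 i
      rw [show s1.tick.tick.tick.seg (s.v .nx) (s1.tick.tick.tick.v .nx) =
        s'.seg (s.v .nx) (s'.v .nx) from this, h6]
      constructor
      · rintro ⟨j, hj, h⟩; exact ⟨j, by omega, h⟩
      · rintro ⟨j, hj, h, h'⟩
        have : j ≠ k := by rintro rfl; exact hc (b10.2 h)
        exact ⟨j, by omega, h, h'⟩
    · simp [b3, Nat.add_one_mul k]; omega

/-- Values `j1 + 1` and `j2 + 1` combine to `j1 + j2 + 1`. The variable `od` carries `j1` times the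
new stride, from which each inner loop starts; no multiplication is needed. -/
theorem pairsOuter_spec (s : St) (hnx : s.v .hi ≤ s.v .nx) (hlo : s.v .lo ≤ s.v .hi)
    (hoa : s.v .oa = 0) (hod : s.v .od = 0) (hoo : s.v .oo = 0) :
    s.v .nx ≤ (pairsOuter.exec s).v .nx ∧
    (pairsOuter.exec s).v .nx ≤ s.v .nx + s.v .la * (s.v .lb * (s.v .hi - s.v .lo)) ∧
    (∀ p < s.v .nx, (pairsOuter.exec s).g p = s.g p) ∧
    (∀ q, q ∈ (pairsOuter.exec s).seg (s.v .nx) ((pairsOuter.exec s).v .nx) ↔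
      ∃ j1 < s.v .la, ∃ j2 < s.v .lb, s.pairOK j1 j2 ∧ ∃ q₀ ∈ s.seg (s.v .lo) (s.v .hi),
        q = q₀ + ((j1 + 1) * s.v .ea, (j2 + 1) * s.v .eb, (j1 + j2 + 1) * s.v .ec, 0)) ∧
    (pairsOuter.exec s).tm ≤ s.tm + 1 +
      s.v .la * (7 + s.v .lb * (6 + 7 * (s.v .hi - s.v .lo))) := by
  have := loop_rule (x := .j1) (e := .v .la) (s := s)
    (c := block [.set .oa (.add (.v .oa) (.v .ea)),
      .set .ob (.c 0), .set .oc (.v .od), pairsInner, .set .od (.add (.v .od) (.v .ec))])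
    (fun k s' => s'.v .oa = k * s.v .ea ∧ s'.v .od = k * s.v .ec ∧
      s.v .nx ≤ s'.v .nx ∧ s'.v .nx ≤ s.v .nx + k * (s.v .lb * (s.v .hi - s.v .lo)) ∧
      (∀ p < s.v .nx, s'.g p = s.g p) ∧
      (∀ q, q ∈ s'.seg (s.v .nx) (s'.v .nx) ↔
        ∃ j1 < k, ∃ j2 < s.v .lb, s.pairOK j1 j2 ∧ ∃ q₀ ∈ s.seg (s.v .lo) (s.v .hi),
          q = q₀ + ((j1 + 1) * s.v .ea, (j2 + 1) * s.v .eb, (j1 + j2 + 1) * s.v .ec, 0)) ∧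
      s'.tm ≤ s.tm + 1 + k * (7 + s.v .lb * (6 + 7 * (s.v .hi - s.v .lo))))
    ⟨by simp [hoa], by simp [hod], by simp, by simp, fun _ _ => rfl,
      fun q => ⟨by rintro ⟨i, h1, h2, -⟩; simp at h2; omega, by simp⟩, by simp⟩ ?_
  · exact this.2.2
  rintro k hk s' hf ⟨h1, h2, h3, h4, h5, h6, h7⟩
  have elo : s'.v .lo = s.v .lo := hf.v _ (by decide)
  have ehi : s'.v .hi = s.v .hi := hf.v _ (by decide)
  have eea : s'.v .ea = s.v .ea := hf.v _ (by decide)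
  have eeb : s'.v .eb = s.v .eb := hf.v _ (by decide)
  have eec : s'.v .ec = s.v .ec := hf.v _ (by decide)
  have elb : s'.v .lb = s.v .lb := hf.v _ (by decide)
  have eoo : s'.v .oo = s.v .oo := hf.v _ (by decide)
  have efc : s'.v .fc = s.v .fc := hf.v _ (by decide)
  have eds : s'.v .dst = s.v .dst := hf.v _ (by decide)
  have ev : s'.v .v = s.v .v := hf.v _ (by decide)
  have ede : s'.a .dem = s.a .dem := hf.a _ (by decide)
  simp only [exec_cons, exec_nil]
  generalize hs1 : (Cmd.set .oc (.v .od)).exec ((Cmd.set .ob (.c 0)).exec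
    ((Cmd.set .oa (.add (.v .oa) (.v .ea))).exec (s'.setv .j1 k).tick)) = s1
  have b1 : s1.v .oa = (k + 1) * s.v .ea := by simp [← hs1, exec_set, h1, eea]; ring
  have b2 : s1.v .od = k * s.v .ec := by simp [← hs1, exec_set, h2]
  have b2' : s1.v .oc = k * s.v .ec := by simp [← hs1, exec_set, h2]
  have b3 : s1.tm = s'.tm + 4 := by simp [← hs1, exec_set]
  have b4 : ∀ p, s1.g p = s'.g p := fun p => by simp [← hs1, exec_set, St.g]
  have b5 : s1.v .nx = s'.v .nx := by simp [← hs1, exec_set]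
  have b6 : s1.v .lo = s.v .lo := by simp [← hs1, exec_set, elo]
  have b7 : s1.v .hi = s.v .hi := by simp [← hs1, exec_set, ehi]
  have b8 : s1.v .ob = 0 := by simp [← hs1, exec_set]
  have b9 : s1.v .oo = 0 := by simp [← hs1, exec_set, eoo, hoo]
  have b11 : s1.v .lb = s.v .lb := by simp [← hs1, exec_set, elb]
  have b12 : s1.v .eb = s.v .eb := by simp [← hs1, exec_set, eeb]
  have b13 : s1.v .ec = s.v .ec := by simp [← hs1, exec_set, eec]
  have b14 : s1.v .j1 = k := by simp [← hs1, exec_set]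
  have b10 : ∀ j2, s1.pairOK k j2 ↔ s.pairOK k j2 := fun j2 => by
    simp [← hs1, exec_set, St.pairOK, efc, eds, ev, ede]
  clear hs1
  have hseg : s'.seg (s.v .lo) (s.v .hi) = s.seg (s.v .lo) (s.v .hi) :=
    seg_congr fun i hi => h5 i (by omega)
  obtain ⟨c0, c1, c2, c3, c4⟩ := pairsInner_spec s1 (by simp [b5, b7]; omega) (by simpa [b6, b7])
  have f := exec_frame pairsInner s1
  have foa := f.v .oa (by decide)
  have fod := f.v .od (by decide)
  have fec := f.v .ec (by decide)
  generalize pairsInner.exec s1 = s2 at *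
  have hX : s1.seg (s.v .lo) (s.v .hi) = s.seg (s.v .lo) (s.v .hi) := by
    rw [← hseg]; exact seg_congr fun i _ => b4 i
  simp only [b5, b6, b7, b8, b9, b1, b2, b2', b3, b11, b12, b13, b14, b10, hX]
    at c0 c1 c2 c3 c4 foa fod fec
  have hg2 : ∀ p < s'.v .nx, s2.g p = s'.g p := fun p hp => (c2 p hp).trans (b4 p)
  refine ⟨?_, ?_, ?_, ?_, fun p hp => ?_, fun q => ?_, ?_⟩
  · simp [exec_set, foa]
  · simp [exec_set, fod, fec]; ring
  · simp [exec_set]; omega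
  · simp [exec_set]
    calc _ ≤ s'.v .nx + s.v .lb * (s.v .hi - s.v .lo) := c1
      _ ≤ s.v .nx + k * (s.v .lb * (s.v .hi - s.v .lo)) + s.v .lb * (s.v .hi - s.v .lo) := by omega
      _ = _ := by ring
  · exact (hg2 p (by omega)).trans (h5 p hp)
  · have : ∀ a, ((Cmd.set .od a).exec s2).tick.seg (s.v .nx)
        (((Cmd.set .od a).exec s2).tick.v .nx) = s2.seg (s.v .nx) (s2.v .nx) := fun a => by
      simp only [exec_set, tick_v, setv_v, if_neg (show Var.nx ≠ Var.od by decide)]; rfl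
    rw [this, seg_union s2 h3 c0, Set.mem_union, c3, seg_congr (s := s') hg2, h6]
    constructor
    · rintro (⟨j, hj, h⟩ | ⟨j, hj, h, q₀, hq₀, rfl⟩)
      · exact ⟨j, by omega, h⟩
      · refine ⟨k, by omega, j, hj, h, q₀, hq₀, ?_⟩
        congr 3
        · ring
        · congr 1; ring
    · rintro ⟨j, hj, j', hj', h, q₀, hq₀, rfl⟩
      by_cases hjk : j = k
      · subst hjk
        refine Or.inr ⟨j', hj', h, q₀, hq₀, ?_⟩
        congr 3
        · ring
        · congr 1; ring
      · exact Or.inl ⟨j, by omega, j', hj', h, q₀, hq₀, rfl⟩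
  · simp [exec_set]
    calc _ ≤ (s.tm + 1 + k * (7 + s.v .lb * (6 + 7 * (s.v .hi - s.v .lo)))) + 4 + 1 +
          s.v .lb * (6 + 7 * (s.v .hi - s.v .lo)) + 1 + 1 := by omega
      _ = _ := by ring

/-- The admissible values at the current vertex. -/
def St.opt (s : St) (x y z : ℕ) : Prop :=
  (x = 0 ∧ y = 0 ∧ z = 0) ∨
  (0 < x ∧ 0 < y ∧ x + y = z + 1 ∧ x ≤ (if 0 < s.v .ea then s.v .dst + 1 else 1) ∧
    y ≤ (if 0 < s.v .eb then s.v .dst + 1 else 1) ∧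
    if 0 < s.v .fc then z ≤ s.v .dst + 1 else z = s.a .dem (s.v .v) + 1)

/-- The contribution of one vertex to the number of combinations. -/
def St.factor (s : St) : ℕ := 1 + (if 0 < s.v .ea then s.v .dst + 1 else 1) *
  (if 0 < s.v .eb then s.v .dst + 1 else 1)

/-- One copy of the old generation treats the vertex as chosen, with overlap `1` if it lies in both
boundaries; the double loop adds one copy per admissible pair of positive values. On a side whose
boundary misses the vertex, the only positive value is `1`. -/
theorem vertexGen_spec (s : St) (hlo : s.v .lo < s.v .hi) :
    (vertexGen.exec s).v .lo < (vertexGen.exec s).v .hi ∧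
    (vertexGen.exec s).v .hi - (vertexGen.exec s).v .lo ≤ s.factor * (s.v .hi - s.v .lo) ∧
    (∀ q, q ∈ (vertexGen.exec s).seg ((vertexGen.exec s).v .lo) ((vertexGen.exec s).v .hi) ↔
      ∃ x y z, s.opt x y z ∧ ∃ q₀ ∈ s.seg (s.v .lo) (s.v .hi),
        q = q₀ + (x * s.v .ea, y * s.v .eb, z * s.v .ec,
          if 0 < s.v .ea ∧ 0 < s.v .eb ∧ x = 0 then 1 else 0)) ∧
    (vertexGen.exec s).tm ≤ s.tm + 40 * (s.factor * (s.v .hi - s.v .lo)) := by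
  simp only [vertexGen, exec_cons, exec_nil]
  generalize hs1 : Cmd.exec (.set .oo (.ite (.v .ea) (.ite (.v .eb) (.c 1) (.c 0)) (.c 0)))
    (Cmd.exec (.set .oc (.c 0)) (Cmd.exec (.set .ob (.c 0)) (Cmd.exec (.set .oa (.c 0))
      (Cmd.exec (.set .nx (.v .hi)) s)))) = s1
  have a1 : s1.v .nx = s.v .hi := by simp [← hs1, exec_set]
  have a2 : s1.v .oa = 0 := by simp [← hs1, exec_set]
  have a3 : s1.v .ob = 0 := by simp [← hs1, exec_set]
  have a4 : s1.v .oc = 0 := by simp [← hs1, exec_set]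
  have a5 : s1.v .oo = if 0 < s.v .ea ∧ 0 < s.v .eb then 1 else 0 := by
    simp [← hs1, exec_set]; split_ifs <;> simp_all
  have a6 : s1.v .lo = s.v .lo := by simp [← hs1, exec_set]
  have a7 : s1.v .hi = s.v .hi := by simp [← hs1, exec_set]
  have a8 : s1.v .ea = s.v .ea := by simp [← hs1, exec_set]
  have a9 : s1.v .eb = s.v .eb := by simp [← hs1, exec_set]
  have a10 : s1.v .ec = s.v .ec := by simp [← hs1, exec_set]
  have a11 : s1.v .fc = s.v .fc := by simp [← hs1, exec_set]
  have a12 : s1.v .dst = s.v .dst := by simp [← hs1, exec_set]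
  have a13 : s1.v .v = s.v .v := by simp [← hs1, exec_set]
  have a14 : s1.a = s.a := by simp [← hs1, exec_set]
  have a15 : s1.tm = s.tm + 5 := by simp [← hs1, exec_set]
  clear hs1
  obtain ⟨c1, c2, c3, c4⟩ := copyGen_seg s1 (by omega) (by omega)
  have f := exec_frame copyGen s1
  have b1 := (f.v .lo (by decide)).trans a6
  have b2 := (f.v .hi (by decide)).trans a7
  have b3 := (f.v .ea (by decide)).trans a8
  have b4 := (f.v .eb (by decide)).trans a9
  have b5 := (f.v .ec (by decide)).trans a10
  have b6 := (f.v .fc (by decide)).trans a11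
  have b7 := (f.v .dst (by decide)).trans a12
  have b8 := (f.v .v (by decide)).trans a13
  have b9 : _ = s.a .dem := (f.a .dem (by decide)).trans (by rw [a14])
  have b10 := (f.v .oa (by decide)).trans a2
  generalize copyGen.exec s1 = s2 at *
  have hX1 : s1.seg (s.v .lo) (s.v .hi) = s.seg (s.v .lo) (s.v .hi) :=
    seg_congr fun i _ => by simp [St.g, a14]
  have hX2 : s2.seg (s.v .lo) (s.v .hi) = s.seg (s.v .lo) (s.v .hi) := by
    rw [← hX1]; exact seg_congr fun i hi => c2 i (by omega)
  simp only [a1, a2, a3, a4, a5, a6, a7, a15, hX1] at c1 c2 c3 c4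
  generalize hs3 : Cmd.exec (.set .lb (.ite (.v .eb) (.add (.v .dst) (.c 1)) (.c 1)))
    (Cmd.exec (.set .la (.ite (.v .ea) (.add (.v .dst) (.c 1)) (.c 1)))
    (Cmd.exec (.set .od (.c 0)) (Cmd.exec (.set .oo (.c 0)) s2))) = s3
  have d1 : s3.v .nx = s2.v .nx := by simp [← hs3, exec_set]
  have d2 : s3.v .lo = s.v .lo := by simp [← hs3, exec_set, b1]
  have d3 : s3.v .hi = s.v .hi := by simp [← hs3, exec_set, b2]
  have d4 : s3.v .la = if 0 < s.v .ea then s.v .dst + 1 else 1 := by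
    simp [← hs3, exec_set, b3, b7]
  have d5 : s3.v .lb = if 0 < s.v .eb then s.v .dst + 1 else 1 := by
    simp [← hs3, exec_set, b4, b7]
  have d6 : s3.v .ea = s.v .ea := by simp [← hs3, exec_set, b3]
  have d7 : s3.v .eb = s.v .eb := by simp [← hs3, exec_set, b4]
  have d8 : s3.v .ec = s.v .ec := by simp [← hs3, exec_set, b5]
  have d9 : s3.tm = s2.tm + 4 := by simp [← hs3, exec_set]
  have d10 : ∀ p, s3.g p = s2.g p := fun p => by simp [← hs3, exec_set, St.g]
  have d11 : ∀ j1 j2, s3.pairOK j1 j2 ↔ s.pairOK j1 j2 := fun j1 j2 => by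
    simp [← hs3, exec_set, St.pairOK, b6, b7, b8, b9]
  have hX3 : s3.seg (s.v .lo) (s.v .hi) = s.seg (s.v .lo) (s.v .hi) := by
    rw [← hX2]; exact seg_congr fun i _ => d10 i
  obtain ⟨e0, e1, e2, e3, e4⟩ := pairsOuter_spec s3 (by omega) (by omega)
    (by simp [← hs3, exec_set, b10]) (by simp [← hs3, exec_set]) (by simp [← hs3, exec_set])
  clear hs3
  have f4 := exec_frame pairsOuter s3
  have g1 := (f4.v .hi (by decide)).trans d3
  generalize pairsOuter.exec s3 = s4 at *
  simp only [d1, d2, d3, d4, d5, d6, d7, d8, d9, d11, hX3] at e0 e1 e2 e3 e4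
  have r1 : (Cmd.exec (.set .hi (.v .nx)) (Cmd.exec (.set .lo (.v .hi)) s4)).tick.v .lo
    = s.v .hi := by simp [exec_set, g1]
  have r2 : (Cmd.exec (.set .hi (.v .nx)) (Cmd.exec (.set .lo (.v .hi)) s4)).tick.v .hi
    = s4.v .nx := by simp [exec_set]
  have r3 : (Cmd.exec (.set .hi (.v .nx)) (Cmd.exec (.set .lo (.v .hi)) s4)).tick.tm
    = s4.tm + 3 := by simp [exec_set]
  have r4 : ∀ p q, (Cmd.exec (.set .hi (.v .nx)) (Cmd.exec (.set .lo (.v .hi)) s4)).tick.seg p q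
    = s4.seg p q := fun p q => rfl
  rw [r1, r2, r3, r4]
  set lx := s.v .hi - s.v .lo with hlx
  have hlx1 : 1 ≤ lx := by omega
  set la := if 0 < s.v .ea then s.v .dst + 1 else 1 with hla
  set lb := if 0 < s.v .eb then s.v .dst + 1 else 1 with hlb
  have hla1 : 1 ≤ la := by rw [hla]; split_ifs <;> omega
  have hlb1 : 1 ≤ lb := by rw [hlb]; split_ifs <;> omega
  have hfac : s.factor = 1 + la * lb := rfl
  rw [hfac]
  refine ⟨by omega, ?_, fun q => ?_, ?_⟩
  · have : la * (lb * lx) = la * lb * lx := by ring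
    rw [this] at e1
    have : (1 + la * lb) * lx = lx + la * lb * lx := by ring
    omega
  · rw [seg_union s4 (q := s2.v .nx) (by omega) e0, Set.mem_union, e3,
      seg_congr (s := s2) (fun i hi => (e2 i hi).trans (d10 i)), c3]
    constructor
    · rintro (⟨q₀, hq, rfl⟩ | ⟨j1, hj1, j2, hj2, h, q₀, hq, rfl⟩)
      · exact ⟨0, 0, 0, Or.inl ⟨rfl, rfl, rfl⟩, q₀, hq, by simp⟩
      · refine ⟨j1 + 1, j2 + 1, j1 + j2 + 1, Or.inr ⟨by omega, by omega, by omega, by omega,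
          by omega, ?_⟩, q₀, hq, by simp⟩
        simp only [St.pairOK] at h
        split_ifs at h ⊢ <;> omega
    · rintro ⟨x, y, z, (⟨rfl, rfl, rfl⟩ | ⟨h1, h2, h3, h4, h5, h6⟩), q₀, hq, rfl⟩
      · exact Or.inl ⟨q₀, hq, by simp⟩
      · refine Or.inr ⟨x - 1, by omega, y - 1, by omega, ?_, q₀, hq, ?_⟩
        · simp only [St.pairOK]; split_ifs at h6 ⊢ <;> omega
        · rw [show x - 1 + 1 = x by omega, show y - 1 + 1 = y by omega,
            show x - 1 + (y - 1) + 1 = z by omega, if_neg (by omega)]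
  · have h1 : s4.tm + 3 ≤ s.tm + 5 + 1 + 7 * lx + 4 + 1 + la * (7 + lb * (6 + 7 * lx)) + 3 := by
      omega
    -- All three factors are at least one, so every lower order term is absorbed in the product.
    have h2 : la ≤ la * lb * lx := by
      rw [mul_assoc]; exact Nat.le_mul_of_pos_right _ (Nat.mul_pos hlb1 hlx1)
    have h3 : la * lb ≤ la * lb * lx := Nat.le_mul_of_pos_right _ hlx1
    calc _ ≤ _ := h1
      _ = s.tm + 14 + 7 * lx + 7 * la + 6 * (la * lb) + 7 * (la * lb * lx) := by ring
      _ ≤ s.tm + 40 * ((1 + la * lb) * lx) := by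
        have : (1 + la * lb) * lx = lx + la * lb * lx := by ring
        rw [this]; omega

/-! ### Mixed radix codes -/

/-- The strides `str` give a code with digits below `D` for the assignments on `W`. -/
structure Radix (D : ℕ) (W : Finset ℕ) (str : ℕ → ℕ) (sz : ℕ) : Prop where
  pos : ∀ v, 0 < str v ↔ v ∈ W
  size : sz = D ^ W.card
  lt : ∀ σ : ℕ → ℕ, (∀ v, σ v < D) → ∑ v ∈ W, σ v * str v < sz
  inj : ∀ σ σ' : ℕ → ℕ, (∀ v, σ v < D) → (∀ v, σ' v < D) →
    ∑ v ∈ W, σ v * str v = ∑ v ∈ W, σ' v * str v → ∀ v ∈ W, σ v = σ' v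

theorem Radix.empty (D : ℕ) : Radix D ∅ (fun _ => 0) 1 :=
  ⟨by simp, by simp, by simp, by simp⟩

/-- The new vertex becomes the most significant digit, with stride equal to the old size. The
remaining digits sum to less than that, so division recovers the new digit and induction the others.
-/
theorem Radix.insert {D : ℕ} {W : Finset ℕ} {str : ℕ → ℕ} {sz v : ℕ} (h : Radix D W str sz)
    (hD : 0 < D) (hv : v ∉ W) : Radix D (insert v W) (Function.update str v sz) (D * sz) := by
  have hsz : 0 < sz := by rw [h.size]; positivity
  have hsum : ∀ σ : ℕ → ℕ, ∑ u ∈ Insert.insert v W, σ u * Function.update str v sz u =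
      σ v * sz + ∑ u ∈ W, σ u * str u := fun σ => by
    rw [Finset.sum_insert hv, Function.update_self]
    congr 1
    exact Finset.sum_congr rfl fun u hu => by
      rw [Function.update_of_ne (show u ≠ v by rintro rfl; exact hv hu)]
  refine ⟨fun u => ?_, ?_, fun σ hσ => ?_, fun σ σ' hσ hσ' he u hu => ?_⟩
  · by_cases hu : u = v
    · subst hu; simp [hsz]
    · simp [Function.update_of_ne hu, h.pos, hu]
  · rw [Finset.card_insert_of_notMem hv, h.size, pow_succ, mul_comm]
  · rw [hsum]
    have := h.lt σ hσ
    calc _ < σ v * sz + sz := by omega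
      _ = (σ v + 1) * sz := by ring
      _ ≤ D * sz := Nat.mul_le_mul_right _ (hσ v)
  · rw [hsum, hsum] at he
    have l1 := h.lt σ hσ
    have l2 := h.lt σ' hσ'
    have e1 : σ v = σ' v := by
      have a1 := congrArg (· / sz) he
      rw [add_comm, Nat.add_mul_div_right _ _ hsz, Nat.div_eq_of_lt l1, add_comm (σ' v * sz),
        Nat.add_mul_div_right _ _ hsz, Nat.div_eq_of_lt l2] at a1
      omega
    rcases Finset.mem_insert.1 hu with rfl | hu
    · exact e1
    · exact h.inj σ σ' hσ hσ' (by rw [e1] at he; omega) u hu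

/-! ### Boundary lists -/

/-- The positions from `p` to `q - 1` list the vertices in `W` with their edge counts and
strides. -/
structure BList (s : St) (D p q : ℕ) (W : Finset ℕ) (cnt str : ℕ → ℕ) (sz : ℕ) : Prop where
  len : q = p + W.card
  mem : ∀ i, p ≤ i → i < q → s.a .lv i ∈ W
  cov : ∀ v ∈ W, ∃ i, p ≤ i ∧ i < q ∧ s.a .lv i = v
  lc : ∀ i, p ≤ i → i < q → s.a .lc i = cnt (s.a .lv i)
  ls : ∀ i, p ≤ i → i < q → s.a .ls i = str (s.a .lv i)
  radix : Radix D W str sz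

theorem BList.congr {s s' : St} {D p q : ℕ} {W : Finset ℕ} {cnt str : ℕ → ℕ} {sz : ℕ}
    (h : BList s D p q W cnt str sz) (h1 : ∀ i < q, s'.a .lv i = s.a .lv i)
    (h2 : ∀ i < q, s'.a .lc i = s.a .lc i) (h3 : ∀ i < q, s'.a .ls i = s.a .ls i) :
    BList s' D p q W cnt str sz :=
  ⟨h.len, fun i a b => by rw [h1 i b]; exact h.mem i a b,
    fun v hv => by obtain ⟨i, a, b, c⟩ := h.cov v hv; exact ⟨i, a, b, by rw [h1 i b, c]⟩,
    fun i a b => by rw [h1 i b, h2 i b]; exact h.lc i a b,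
    fun i a b => by rw [h1 i b, h3 i b]; exact h.ls i a b, h.radix⟩

theorem BList.empty (s : St) (D p : ℕ) (cnt : ℕ → ℕ) : BList s D p p ∅ cnt (fun _ => 0) 1 :=
  ⟨by simp, fun i _ _ => by omega, by simp, fun i _ _ => by omega, fun i _ _ => by omega,
    .empty D⟩

theorem append_spec {s : St} {D p : ℕ} {W : Finset ℕ} {cnt str : ℕ → ℕ}
    (h : BList s D p (s.v .lf) W cnt str (s.v .sz)) (hD : s.v .D = D) (hD0 : 0 < D)
    (hv : s.v .v ∉ W) (hc : s.v .c = cnt (s.v .v)) :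
    BList (append.exec s) D p ((append.exec s).v .lf) (insert (s.v .v) W) cnt
      (Function.update str (s.v .v) (s.v .sz)) ((append.exec s).v .sz) ∧
    (append.exec s).v .lf = s.v .lf + 1 ∧
    (∀ i < s.v .lf, (append.exec s).a .lv i = s.a .lv i ∧ (append.exec s).a .lc i = s.a .lc i ∧
      (append.exec s).a .ls i = s.a .ls i) ∧
    (append.exec s).tm ≤ s.tm + 8 + 2 * D := by
  simp only [append, exec_cons, exec_nil]
  generalize hs1 : (Cmd.set .t (.c 0)).exec ((inc .lf).exec ((Cmd.put .ls (.v .lf) (.v .sz)).exec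
    ((Cmd.put .lc (.v .lf) (.v .c)).exec ((Cmd.put .lv (.v .lf) (.v .v)).exec s)))) = s1
  have a1 : s1.v .lf = s.v .lf + 1 := by simp [← hs1, exec_set, exec_put]
  have a2 : s1.a .lv = Function.update (s.a .lv) (s.v .lf) (s.v .v) := by
    simp [← hs1, exec_set, exec_put]
  have a3 : s1.a .lc = Function.update (s.a .lc) (s.v .lf) (s.v .c) := by
    simp [← hs1, exec_set, exec_put]
  have a4 : s1.a .ls = Function.update (s.a .ls) (s.v .lf) (s.v .sz) := by
    simp [← hs1, exec_set, exec_put]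
  have a5 : s1.v .t = 0 := by simp [← hs1, exec_set, exec_put]
  have a6 : s1.v .D = D := by simp [← hs1, exec_set, exec_put, hD]
  have a7 : s1.v .sz = s.v .sz := by simp [← hs1, exec_set, exec_put]
  have a8 : s1.tm = s.tm + 5 := by simp [← hs1, exec_set, exec_put]
  clear hs1
  obtain ⟨b1, b2⟩ := growStride_spec s1
  have f := exec_frame growStride s1
  have c1 := (f.v .lf (by decide)).trans a1
  have c2 := (f.a .lv (by decide)).trans a2
  have c3 := (f.a .lc (by decide)).trans a3
  have c4 := (f.a .ls (by decide)).trans a4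
  generalize growStride.exec s1 = s2 at *
  generalize hs3 : ((Cmd.set .sz (.v .t)).exec s2).tick = s3
  have d1 : s3.v .lf = s.v .lf + 1 := by simp [← hs3, exec_set, c1]
  have d2 : s3.a = s2.a := by simp [← hs3, exec_set]
  have d3 : s3.v .sz = D * s.v .sz := by simp [← hs3, exec_set, b1, a5, a6, a7]
  have d4 : s3.tm = s2.tm + 2 := by simp [← hs3, exec_set]
  clear hs3
  rw [← d2] at c2 c3 c4
  have hlen := h.len
  refine ⟨⟨?_, fun i hi hi' => ?_, fun v hv' => ?_, fun i hi hi' => ?_, fun i hi hi' => ?_, ?_⟩, d1,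
    fun i hi => ?_, ?_⟩
  · rw [Finset.card_insert_of_notMem hv]; omega
  · rw [c2]
    by_cases hi'' : i = s.v .lf
    · subst hi''; simp
    · rw [Function.update_of_ne hi'']; exact Finset.mem_insert_of_mem (h.mem i hi (by omega))
  · rcases Finset.mem_insert.1 hv' with rfl | hv'
    · exact ⟨s.v .lf, by omega, by omega, by simp [c2]⟩
    · obtain ⟨i, x, y, z⟩ := h.cov v hv'
      exact ⟨i, x, by omega, by rw [c2, Function.update_of_ne (by omega), z]⟩
  · rw [c2, c3]
    by_cases hi'' : i = s.v .lf
    · subst hi''; simp [hc]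
    · rw [Function.update_of_ne hi'', Function.update_of_ne hi'']; exact h.lc i hi (by omega)
  · rw [c2, c4]
    by_cases hi'' : i = s.v .lf
    · subst hi''; simp
    · rw [Function.update_of_ne hi'', Function.update_of_ne hi'', h.ls i hi (by omega),
        Function.update_of_ne]
      rintro hvv; exact hv (hvv ▸ h.mem i hi (by omega))
  · rw [d3]; exact h.radix.insert hD0 hv
  · rw [c2, c3, c4]; simp [Function.update_of_ne (show i ≠ s.v .lf by omega)]
  · rw [a6] at b2; omega

/-- A vertex all of whose edges are now inside is not appended; its new stride stays zero, so its
value does not enter the new address. -/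
theorem vertexStart_spec {s : St} {D p : ℕ} {W : Finset ℕ} {cnt str : ℕ → ℕ}
    (h : BList s D p (s.v .lf) W cnt str (s.v .sz)) (hD : s.v .D = D) (hD0 : 0 < D)
    (hv : s.v .v ∉ W) (hc : s.a .ca (s.v .v) + s.a .cb (s.v .v) = cnt (s.v .v)) :
    ∃ str' : ℕ → ℕ, (∀ u, u ≠ s.v .v → str' u = str u) ∧
    (vertexStart.exec s).v .ea = s.a .sa (s.v .v) ∧
    (vertexStart.exec s).v .eb = s.a .sb (s.v .v) ∧
    (vertexStart.exec s).v .ec = str' (s.v .v) ∧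
    (0 < (vertexStart.exec s).v .fc ↔ cnt (s.v .v) < s.a .deg (s.v .v)) ∧
    BList (vertexStart.exec s) D p ((vertexStart.exec s).v .lf)
      (if cnt (s.v .v) < s.a .deg (s.v .v) then insert (s.v .v) W else W) cnt str'
      ((vertexStart.exec s).v .sz) ∧
    s.v .lf ≤ (vertexStart.exec s).v .lf ∧
    (∀ i < s.v .lf, (vertexStart.exec s).a .lv i = s.a .lv i ∧
      (vertexStart.exec s).a .lc i = s.a .lc i ∧ (vertexStart.exec s).a .ls i = s.a .ls i) ∧
    (vertexStart.exec s).tm ≤ s.tm + 18 + 2 * D := by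
  simp only [vertexStart, exec_cons, exec_nil, exec_ite]
  generalize hs1 : (Cmd.set .fc (.c 0)).exec ((Cmd.set .ec (.c 0)).exec
    ((Cmd.set .c (.add (.a .ca (.v .v)) (.a .cb (.v .v)))).exec
    ((Cmd.set .eb (.a .sb (.v .v))).exec ((Cmd.set .ea (.a .sa (.v .v))).exec s)))) = s1
  have a1 : s1.v .ea = s.a .sa (s.v .v) := by simp [← hs1, exec_set]
  have a2 : s1.v .eb = s.a .sb (s.v .v) := by simp [← hs1, exec_set]
  have a3 : s1.v .ec = 0 := by simp [← hs1, exec_set]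
  have a4 : s1.v .fc = 0 := by simp [← hs1, exec_set]
  have a5 : s1.v .c = cnt (s.v .v) := by simp [← hs1, exec_set, hc]
  have a6 : s1.a = s.a := by simp [← hs1, exec_set]
  have a7 : s1.v .lf = s.v .lf := by simp [← hs1, exec_set]
  have a8 : s1.v .sz = s.v .sz := by simp [← hs1, exec_set]
  have a9 : s1.v .v = s.v .v := by simp [← hs1, exec_set]
  have a10 : s1.v .D = D := by simp [← hs1, exec_set, hD]
  have a11 : s1.tm = s.tm + 5 := by simp [← hs1, exec_set]
  clear hs1
  simp only [Ex.eval, a5, a6, a9, tsub_pos_iff_lt]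
  by_cases hlt : cnt (s.v .v) < s.a .deg (s.v .v)
  · simp only [hlt, if_true, iff_true]
    generalize hs2 : (Cmd.set .fc (.c 1)).exec ((Cmd.set .ec (.v .sz)).exec s1.tick) = s2
    have b1 : s2.a = s.a := by simp [← hs2, exec_set, a6]
    have b2 : s2.v .lf = s.v .lf := by simp [← hs2, exec_set, a7]
    have b3 : s2.v .sz = s.v .sz := by simp [← hs2, exec_set, a8]
    have b4 : s2.v .v = s.v .v := by simp [← hs2, exec_set, a9]
    have b5 : s2.v .D = D := by simp [← hs2, exec_set, a10]
    have b6 : s2.v .c = cnt (s.v .v) := by simp [← hs2, exec_set, a5]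
    have b7 : s2.tm = s.tm + 8 := by simp [← hs2, exec_set, a11]
    have b8 : s2.v .ea = s.a .sa (s.v .v) := by simp [← hs2, exec_set, a1]
    have b9 : s2.v .eb = s.a .sb (s.v .v) := by simp [← hs2, exec_set, a2]
    have b10 : s2.v .ec = s.v .sz := by simp [← hs2, exec_set, a8]
    have b11 : s2.v .fc = 1 := by simp [← hs2, exec_set]
    clear hs2
    have h2 : BList s2 D p (s2.v .lf) W cnt str (s2.v .sz) := by
      rw [b2, b3]; exact h.congr (fun _ _ => by rw [b1]) (fun _ _ => by rw [b1])
        (fun _ _ => by rw [b1])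
    obtain ⟨c1, c2, c3, c4⟩ := append_spec h2 b5 hD0 (b4 ▸ hv) (by rw [b6, b4])
    have f := exec_frame append s2
    have f1 := (f.v .ea (by decide)).trans b8
    have f2 := (f.v .eb (by decide)).trans b9
    have f3 := (f.v .ec (by decide)).trans b10
    have f4 := (f.v .fc (by decide)).trans b11
    generalize append.exec s2 = s3 at *
    rw [b1, b2] at c3
    rw [b2] at c2
    rw [b4, b3] at c1
    have f4' : 0 < s3.v .fc := by omega
    refine ⟨Function.update str (s.v .v) (s.v .sz), fun u hu => Function.update_of_ne hu _ _,
      f1, f2, by simp [f3], f4',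
      c1.congr (fun _ _ => rfl) (fun _ _ => rfl) (fun _ _ => rfl), by simp [c2], c3, ?_⟩
    simp; omega
  · simp only [hlt, if_false, iff_false, exec_skip]
    have hz : str (s.v .v) = 0 := by
      have := h.radix.pos (s.v .v); simp only [hv, iff_false] at this; omega
    have h2 : BList s1 D p (s1.v .lf) W cnt str (s1.v .sz) := by
      rw [a7, a8]; exact h.congr (fun _ _ => by rw [a6]) (fun _ _ => by rw [a6])
        (fun _ _ => by rw [a6])
    refine ⟨str, fun _ _ => rfl, a1, a2, by simp [a3, hz], by simp [a4],
      h2.congr (fun _ _ => rfl) (fun _ _ => rfl) (fun _ _ => rfl), by simp [a7],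
      fun i _ => by simp [a6], ?_⟩
    simp; omega

/-! ### Combinations of values over two boundaries -/

namespace Net

variable (G : Net)

/-- The number of ways in which the vertex `v` can be treated in a join, up to a bound. -/
def fac (A B : Finset ℕ) (v : ℕ) : ℕ :=
  if v ∈ G.bd A ∧ v ∈ G.bd B then (G.ds + 1) ^ 2 + 1 else G.ds + 2

theorem two_le_fac (A B : Finset ℕ) (v : ℕ) : 2 ≤ G.fac A B v := by
  unfold fac; split_ifs <;> nlinarith [Nat.zero_le G.ds]

theorem le_fac (A B : Finset ℕ) (v : ℕ) : G.ds + 2 ≤ G.fac A B v := by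
  unfold fac; split_ifs <;> nlinarith [Nat.zero_le G.ds]

/-- The combinations of values at the vertices of `U`. -/
def Combos (A B U : Finset ℕ) (sa sb sc : ℕ → ℕ) (q : ℕ × ℕ × ℕ × ℕ) : Prop :=
  ∃ σ1 σ2 σ : ℕ → ℕ, (∀ v ∈ U, G.Opt A B v (σ1 v) (σ2 v) (σ v)) ∧
    q = (∑ v ∈ U, σ1 v * sa v, ∑ v ∈ U, σ2 v * sb v, ∑ v ∈ U, σ v * sc v,
      ∑ v ∈ U, if v ∈ G.bd A ∧ v ∈ G.bd B ∧ σ1 v = 0 then 1 else 0)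

variable {G} {A B U : Finset ℕ} {sa sb sc : ℕ → ℕ}

theorem combos_congr {sc' : ℕ → ℕ} (h : ∀ v ∈ U, sc' v = sc v) (q : ℕ × ℕ × ℕ × ℕ) :
    G.Combos A B U sa sb sc' q ↔ G.Combos A B U sa sb sc q := by
  have : ∀ σ : ℕ → ℕ, ∑ v ∈ U, σ v * sc' v = ∑ v ∈ U, σ v * sc v := fun σ =>
    Finset.sum_congr rfl fun v hv => by rw [h v hv]
  simp only [Combos, this]

/-- Treatments of different vertices are independent and all four coordinates are sums over the
vertices; this is the recursion that one pass of the vertex loop realises. -/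
theorem combos_insert {v : ℕ} (hv : v ∉ U) (q : ℕ × ℕ × ℕ × ℕ) :
    G.Combos A B (insert v U) sa sb sc q ↔ ∃ x y z, G.Opt A B v x y z ∧
      ∃ q₀, G.Combos A B U sa sb sc q₀ ∧ q = q₀ + (x * sa v, y * sb v, z * sc v,
        if v ∈ G.bd A ∧ v ∈ G.bd B ∧ x = 0 then 1 else 0) := by
  constructor
  · rintro ⟨σ1, σ2, σ, h, rfl⟩
    refine ⟨σ1 v, σ2 v, σ v, h v (Finset.mem_insert_self _ _), _,
      ⟨σ1, σ2, σ, fun u hu => h u (Finset.mem_insert_of_mem hu), rfl⟩, ?_⟩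
    simp only [Finset.sum_insert hv, Prod.mk_add_mk, Prod.mk.injEq]
    refine ⟨?_, ?_, ?_, ?_⟩ <;> exact add_comm _ _
  · rintro ⟨x, y, z, h, _, ⟨σ1, σ2, σ, h', rfl⟩, rfl⟩
    have hne : ∀ u ∈ U, u ≠ v := fun u hu he => hv (he ▸ hu)
    refine ⟨Function.update σ1 v x, Function.update σ2 v y, Function.update σ v z,
      fun u hu => ?_, ?_⟩
    · rcases Finset.mem_insert.1 hu with rfl | hu
      · simpa using h
      · simpa [Function.update_of_ne (hne u hu)] using h' u hu
    · simp only [Finset.sum_insert hv, Prod.mk_add_mk, Prod.mk.injEq, Function.update_self]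
      refine ⟨?_, ?_, ?_, ?_⟩ <;> rw [add_comm] <;> congr 1 <;>
        exact Finset.sum_congr rfl fun u hu => by rw [Function.update_of_ne (hne u hu)]

end Net

/-- The constants of the input are stored in the state. -/
structure Inp (G : Net) (s : St) : Prop where
  dst : s.v .dst = G.ds
  D : s.v .D = G.ds + 2
  dem : s.a .dem = G.d
  deg : s.a .deg = G.dg

/-- The boundary of `A` has been loaded into the arrays for the first table. -/
structure Loaded (G : Net) (s : St) (A : Finset ℕ) (c t : Arr) : Prop where
  pos : ∀ v, 0 < s.a t v ↔ v ∈ G.bd A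
  cnt : ∀ v, s.a c v = if v ∈ G.bd A then G.degA A v else 0

-- Each vertex multiplies the list by at most its factor. As the factors are at least two, the
-- lengths of all generations are dominated by a geometric sum, and the total time is proportional
-- to the product of the factors.
open Net in
theorem allVertices_spec {G : Net} {s : St} {A B : Finset ℕ} (hA : A ⊆ Finset.range G.m)
    (hB : B ⊆ Finset.range G.m) (hd : Disjoint A B) (hI : Inp G s)
    (lA : Loaded G s A .ca .sa) (lB : Loaded G s B .cb .sb)
    (hU : (Finset.range (s.v .nu)).image (s.a .uu) = G.bd A ∪ G.bd B)
    (hinj : Set.InjOn (s.a .uu) (Set.Iio (s.v .nu)))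
    (hlo : s.v .lo = 0) (hhi : s.v .hi = 1) (hg : s.g 0 = (0, 0, 0, 0)) (hsz : s.v .sz = 1) :
    ∃ str : ℕ → ℕ,
      BList (allVertices.exec s) (G.ds + 2) (s.v .lf) ((allVertices.exec s).v .lf) (G.bd (A ∪ B))
        (G.degA (A ∪ B)) str ((allVertices.exec s).v .sz) ∧
      (∀ q, q ∈ (allVertices.exec s).seg ((allVertices.exec s).v .lo) ((allVertices.exec s).v .hi) ↔
        G.Combos A B (G.bd A ∪ G.bd B) (s.a .sa) (s.a .sb) str q) ∧
      (∀ i < s.v .lf, (allVertices.exec s).a .lv i = s.a .lv i ∧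
        (allVertices.exec s).a .lc i = s.a .lc i ∧ (allVertices.exec s).a .ls i = s.a .ls i) ∧
      (allVertices.exec s).v .hi - (allVertices.exec s).v .lo ≤
        ∏ v ∈ G.bd A ∪ G.bd B, G.fac A B v ∧
      (allVertices.exec s).v .lo < (allVertices.exec s).v .hi ∧
      (allVertices.exec s).tm ≤ s.tm + 200 * ∏ v ∈ G.bd A ∪ G.bd B, G.fac A B v := by
  classical
  have hC := Finset.union_subset hA hB
  set Ui : ℕ → Finset ℕ := fun k => (Finset.range k).image (s.a .uu) with hUi
  have hUs : ∀ k, Ui (k + 1) = insert (s.a .uu k) (Ui k) := fun k => by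
    simp [hUi, Finset.range_add_one, Finset.image_insert]
  have := loop_rule (x := .i) (e := .v .nu) (s := s)
    (c := block [.set .v (.a .uu (.v .i)), vertexStart, vertexGen])
    (fun k s' => ∃ str : ℕ → ℕ,
      BList s' (G.ds + 2) (s.v .lf) (s'.v .lf) (Ui k ∩ G.bd (A ∪ B))
        (G.degA (A ∪ B)) str (s'.v .sz) ∧
      (∀ q, q ∈ s'.seg (s'.v .lo) (s'.v .hi) ↔
        G.Combos A B (Ui k) (s.a .sa) (s.a .sb) str q) ∧
      (∀ i < s.v .lf, s'.a .lv i = s.a .lv i ∧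
        s'.a .lc i = s.a .lc i ∧ s'.a .ls i = s.a .ls i) ∧
      s'.v .hi - s'.v .lo ≤ ∏ v ∈ Ui k, G.fac A B v ∧ s'.v .lo < s'.v .hi ∧
      s'.tm ≤ s.tm + 1 + 160 * ∏ v ∈ Ui k, G.fac A B v)
    ?_ ?_
  · obtain ⟨str, h1, h2, h3, h4, h5, h6⟩ := this
    have e : (Ex.v Var.nu).eval s = s.v .nu := rfl
    simp only [e] at h1 h2 h4 h6
    simp only [show Ui (s.v .nu) = G.bd A ∪ G.bd B from hU] at h1 h2 h4 h6
    rw [Finset.inter_eq_right.2 (bd_union_subset hA hB hd)] at h1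
    refine ⟨str, h1, h2, h3, h4, h5, ?_⟩
    have : 0 < ∏ v ∈ G.bd A ∪ G.bd B, G.fac A B v :=
      Finset.prod_pos fun v _ => by have := G.two_le_fac A B v; omega
    exact h6.trans (by omega)
  · refine ⟨fun _ => 0, ?_, fun q => ?_, fun _ _ => ⟨rfl, rfl, rfl⟩, by
      simp [hlo, hhi, show Ui 0 = ∅ from rfl], by
      simp [hlo, hhi], by simp⟩
    · simp only [tick_v, hsz, hUi, Finset.range_zero, Finset.image_empty, Finset.empty_inter]
      exact .empty _ _ _ _
    · simp only [tick_v, hlo, hhi, hUi, Finset.range_zero, Finset.image_empty, Combos]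
      constructor
      · rintro ⟨i, h1, h2, h3⟩
        have : i = 0 := by omega
        subst this
        rw [← h3]
        exact ⟨0, 0, 0, by simp, by simp; exact hg⟩
      · rintro ⟨σ1, σ2, σ, -, rfl⟩
        exact ⟨0, le_rfl, one_pos, by simp; exact hg⟩
  · rintro k hk s' hf ⟨str, h1, h2, h3, h4, h5, h6⟩
    have hk' : k < s.v .nu := hk
    have edst : s'.v .dst = G.ds := (hf.v _ (by decide)).trans hI.dst
    have eD : s'.v .D = G.ds + 2 := (hf.v _ (by decide)).trans hI.D
    have edem : s'.a .dem = G.d := (hf.a _ (by decide)).trans hI.dem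
    have edeg : s'.a .deg = G.dg := (hf.a _ (by decide)).trans hI.deg
    have eca : s'.a .ca = s.a .ca := hf.a _ (by decide)
    have ecb : s'.a .cb = s.a .cb := hf.a _ (by decide)
    have esa : s'.a .sa = s.a .sa := hf.a _ (by decide)
    have esb : s'.a .sb = s.a .sb := hf.a _ (by decide)
    have euu : s'.a .uu = s.a .uu := hf.a _ (by decide)
    set v := s.a .uu k with hv
    have hvU : v ∈ G.bd A ∪ G.bd B := by
      rw [← hU]; exact Finset.mem_image_of_mem _ (Finset.mem_range.2 hk')
    have hvk : v ∉ Ui k := by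
      simp only [hUi, Finset.mem_image, Finset.mem_range, not_exists, not_and]
      intro j hj he
      have := hinj (show j ∈ Set.Iio (s.v .nu) by simp; omega) (show k ∈ Set.Iio (s.v .nu) by
        simpa using hk') he
      omega
    have both : ∀ v, v ∈ G.supp A → v ∈ G.supp B → v ∈ G.bd A ∧ v ∈ G.bd B := fun v h1 h2 =>
      ⟨mem_bd_left_of_both hA hB hd h1 h2, mem_bd_left_of_both hB hA hd.symm h2 h1⟩
    -- A vertex outside `bd B` that lies in `bd A` meets no edge of `B`, so the count `0` found for
    -- it is correct; the other case is symmetric.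
    have hcnt : s.a .ca v + s.a .cb v = G.degA (A ∪ B) v := by
      rw [degA_union hd, lA.cnt, lB.cnt]
      by_cases ha : v ∈ G.bd A <;> by_cases hb : v ∈ G.bd B
      · rw [if_pos ha, if_pos hb]
      · rw [if_pos ha, if_neg hb]
        have : v ∉ G.supp B := fun h => hb (both v (bd_subset_supp ha) h).2
        rw [mem_supp hB] at this; omega
      · rw [if_neg ha, if_pos hb]
        have : v ∉ G.supp A := fun h => ha (both v h (bd_subset_supp hb)).1
        rw [mem_supp hA] at this; omega
      · exact absurd hvU (by simp [ha, hb])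
    have hbdC : G.degA (A ∪ B) v < G.dg v ↔ v ∈ G.bd (A ∪ B) := by
      rw [mem_bd hC]
      have : 0 < G.degA (A ∪ B) v := by
        rw [degA_union hd]
        rcases Finset.mem_union.1 hvU with h | h
        · have := (mem_bd hA).1 h; omega
        · have := (mem_bd hB).1 h; omega
      simp [this]
    simp only [exec_cons, exec_nil]
    generalize hs1 : (Cmd.set .v (.a .uu (.v .i))).exec (s'.setv .i k).tick = s1
    have a1 : s1.v .v = v := by simp [← hs1, exec_set, euu, hv]
    have a2 : s1.v .lf = s'.v .lf := by simp [← hs1, exec_set]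
    have a3 : s1.v .sz = s'.v .sz := by simp [← hs1, exec_set]
    have a4 : s1.a = s'.a := by simp [← hs1, exec_set]
    have a5 : s1.v .D = G.ds + 2 := by simp [← hs1, exec_set, eD]
    have a6 : s1.v .dst = G.ds := by simp [← hs1, exec_set, edst]
    have a7 : s1.v .lo = s'.v .lo := by simp [← hs1, exec_set]
    have a8 : s1.v .hi = s'.v .hi := by simp [← hs1, exec_set]
    have a9 : s1.tm = s'.tm + 2 := by simp [← hs1, exec_set]
    clear hs1
    have b1 : BList s1 (G.ds + 2) (s.v .lf) (s1.v .lf) (Ui k ∩ G.bd (A ∪ B))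
        (G.degA (A ∪ B)) str (s1.v .sz) := by
      rw [a2, a3]
      exact h1.congr (fun _ _ => by rw [a4]) (fun _ _ => by rw [a4]) (fun _ _ => by rw [a4])
    obtain ⟨str', c1, c2, c3, c4, c5, c6, c7, c8, c9⟩ := vertexStart_spec b1 a5 (by omega)
      (by rw [a1]; exact fun h => hvk (Finset.mem_inter.1 h).1)
      (by rw [a1, a4, eca, ecb]; exact hcnt)
    rw [a1] at c1 c2 c3 c4 c5 c6
    rw [a4, esa] at c2
    rw [a4, esb] at c3
    rw [a4, edeg, hbdC] at c5
    rw [a4, edeg] at c6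
    simp only [hbdC] at c6
    rw [a2] at c7 c8
    rw [a4] at c8
    have f := exec_frame vertexStart s1
    have f1 := (f.v .v (by decide)).trans a1
    have f2 := (f.v .dst (by decide)).trans a6
    have f3 := (f.v .lo (by decide)).trans a7
    have f4 := (f.v .hi (by decide)).trans a8
    have f5 := (f.a .dem (by decide)).trans ((congrFun a4 _).trans edem)
    have f6 := (f.a .gA (by decide)).trans (congrFun a4 _)
    have f7 := (f.a .gB (by decide)).trans (congrFun a4 _)
    have f8 := (f.a .gC (by decide)).trans (congrFun a4 _)
    have f9 := (f.a .gO (by decide)).trans (congrFun a4 _)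
    generalize vertexStart.exec s1 = s2 at *
    have hseg : s2.seg (s'.v .lo) (s'.v .hi) = s'.seg (s'.v .lo) (s'.v .hi) :=
      seg_congr fun i _ => by simp [St.g, f6, f7, f8, f9]
    have hea : 0 < s2.v .ea ↔ v ∈ G.bd A := by rw [c2]; exact lA.pos v
    have heb : 0 < s2.v .eb ↔ v ∈ G.bd B := by rw [c3]; exact lB.pos v
    have hopt : ∀ x y z, s2.opt x y z ↔ G.Opt A B v x y z := fun x y z => by
      have hdv := G.d_le v
      simp only [St.opt, Opt, hea, heb, c5, f1, f2, f5]
      refine or_congr Iff.rfl ?_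
      by_cases ha : v ∈ G.bd A <;> by_cases hb : v ∈ G.bd B <;>
        by_cases hc : v ∈ G.bd (A ∪ B) <;>
        simp only [ha, hb, hc, if_true, if_false, not_true, not_false_iff, false_imp_iff,
          true_imp_iff, true_and] <;> omega
    have hfac : s2.factor = G.fac A B v := by
      have : v ∈ G.bd A ∨ v ∈ G.bd B := Finset.mem_union.1 hvU
      simp only [St.factor, Net.fac, hea, heb, f2]
      by_cases ha : v ∈ G.bd A <;> by_cases hb : v ∈ G.bd B <;>
        simp only [ha, hb, if_true, if_false, and_self, and_true, true_and, and_false]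
      · ring
      · ring
      · ring
      · simp_all
    obtain ⟨d1, d2, d3, d4⟩ := vertexGen_spec s2 (by omega)
    rw [f3, f4, hfac] at d2 d4
    rw [f3, f4, hseg] at d3
    simp only [hopt, c2, c3, c4, lA.pos, lB.pos] at d3
    have g := exec_frame vertexGen s2
    have g1 := g.v .lf (by decide)
    have g2 := g.v .sz (by decide)
    have g3 := g.a .lv (by decide)
    have g4 := g.a .lc (by decide)
    have g5 := g.a .ls (by decide)
    generalize vertexGen.exec s2 = s3 at *
    have hprod : ∏ u ∈ Ui (k + 1), G.fac A B u = G.fac A B v * ∏ u ∈ Ui k, G.fac A B u := by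
      rw [hUs, Finset.prod_insert hvk]
    refine ⟨str', ?_, fun q => ?_, fun i hi => ?_, ?_, d1, ?_⟩
    · simp only [tick_v, g1, g2]
      have : Ui (k + 1) ∩ G.bd (A ∪ B) = if v ∈ G.bd (A ∪ B) then
          insert v (Ui k ∩ G.bd (A ∪ B)) else Ui k ∩ G.bd (A ∪ B) := by
        rw [hUs]
        split_ifs with h
        · rw [Finset.insert_inter_of_mem h]
        · rw [Finset.insert_inter_of_notMem h]
      rw [this]
      exact c6.congr (fun _ _ => by simp [g3]) (fun _ _ => by simp [g4]) (fun _ _ => by simp [g5])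
    · rw [hUs, combos_insert hvk]
      refine (d3 q).trans ?_
      have : ∀ q₀, q₀ ∈ s'.seg (s'.v .lo) (s'.v .hi) ↔
          G.Combos A B (Ui k) (s.a .sa) (s.a .sb) str' q₀ := fun q₀ => by
        rw [h2, combos_congr fun u hu => c1 u fun h => hvk (h ▸ hu)]
      simp only [this]
    · have hle : s.v .lf ≤ s'.v .lf := by have := h1.len; omega
      simp only [tick_a, g3, g4, g5]
      obtain ⟨x, y, z⟩ := c8 i (by omega)
      obtain ⟨x', y', z'⟩ := h3 i hi
      exact ⟨x.trans x', y.trans y', z.trans z'⟩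
    · rw [hprod]
      simp only [tick_v]
      exact d2.trans (Nat.mul_le_mul_left _ h4)
    · rw [hprod]
      simp only [tick_tm]
      set P := ∏ u ∈ Ui k, G.fac A B u with hP
      have hP1 : 0 < P := Finset.prod_pos fun u _ => (G.two_le_fac A B u).trans' (by omega)
      have k1 := G.two_le_fac A B v
      have k2 := G.le_fac A B v
      have k3 : G.fac A B v * (s'.v .hi - s'.v .lo) ≤ G.fac A B v * P := Nat.mul_le_mul_left _ h4
      -- The time spent so far is at most half of the new bound; `k3` bounds the new generation, and
      -- `k2` with `k5` the computation of the stride.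
      have k4 : 2 * P ≤ G.fac A B v * P := Nat.mul_le_mul_right _ k1
      have k5 : G.fac A B v ≤ G.fac A B v * P := Nat.le_mul_of_pos_right _ hP1
      omega

/-! ### Filling tables -/

/-- The table entry at the address `p`: cost and data for tracing back. -/
def St.ent (s : St) (p : ℕ) : ℕ × ℕ × ℕ × ℕ × ℕ :=
  (s.a .cst p, s.a .el p, s.a .er p, s.a .eU p, s.a .eV p)

/-- From the address `f` on, the table of `s` holds the best of the candidates in `K`; below `f`
it agrees with `s₀`. -/
structure Fill (f : ℕ) (s₀ s : St) (K : Set (ℕ × ℕ × ℕ × ℕ × ℕ × ℕ)) : Prop where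
  sound : ∀ p, f ≤ p → 0 < s.a .cst p → (p, s.ent p) ∈ K
  best : ∀ p c d, (p, c, d) ∈ K → 0 < s.a .cst p ∧ s.a .cst p ≤ c
  zero : ∀ p, f ≤ p → s.a .cst p = 0 → s.ent p = (0, 0, 0, 0, 0)
  below : ∀ p < f, s.ent p = s₀.ent p

theorem Fill.congr {f : ℕ} {s₀ s s' : St} {K : Set (ℕ × ℕ × ℕ × ℕ × ℕ × ℕ)}
    (h : Fill f s₀ s K) (he : ∀ p, s'.ent p = s.ent p) : Fill f s₀ s' K := by
  have hc : ∀ p, s'.a .cst p = s.a .cst p := fun p => congrArg Prod.fst (he p)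
  exact ⟨fun p h1 h2 => by rw [he]; exact h.sound p h1 (hc p ▸ h2),
    fun p c d h1 => by rw [hc]; exact h.best p c d h1,
    fun p h1 h2 => by rw [he]; exact h.zero p h1 (hc p ▸ h2),
    fun p hp => by rw [he]; exact h.below p hp⟩

/-- The stored cost `0` means that there is no entry, so it loses every comparison; hence a new cost
must be positive. -/
theorem relax_spec {f : ℕ} {s₀ s : St} {K : Set (ℕ × ℕ × ℕ × ℕ × ℕ × ℕ)}
    (h : Fill f s₀ s K) (hp : f ≤ s.v .p) (hc : 0 < s.v .nc) :
    Fill f s₀ (relax.exec s)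
      (insert (s.v .p, s.v .nc, s.v .l, s.v .r, s.v .a1, s.v .a2) K) ∧
    (relax.exec s).tm ≤ s.tm + 7 := by
  have heval : 0 < Ex.eval (.ite (.a .cst (.v .p)) (.sub (.a .cst (.v .p)) (.v .nc)) (.c 1)) s ↔
      s.a .cst (s.v .p) = 0 ∨ s.v .nc < s.a .cst (s.v .p) := by
    by_cases h0 : 0 < s.a .cst (s.v .p)
    · rw [show Ex.eval (.ite (.a .cst (.v .p)) (.sub (.a .cst (.v .p)) (.v .nc)) (.c 1)) s =
        s.a .cst (s.v .p) - s.v .nc from if_pos h0]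
      omega
    · rw [show Ex.eval (.ite (.a .cst (.v .p)) (.sub (.a .cst (.v .p)) (.v .nc)) (.c 1)) s =
        1 from if_neg h0]
      omega
  rw [relax, exec_ite]
  by_cases hnew : s.a .cst (s.v .p) = 0 ∨ s.v .nc < s.a .cst (s.v .p)
  · rw [if_pos (heval.2 hnew)]
    have hent : ∀ q, ((block [.put .cst (.v .p) (.v .nc), .put .el (.v .p) (.v .l),
        .put .er (.v .p) (.v .r), .put .eU (.v .p) (.v .a1), .put .eV (.v .p) (.v .a2)]).exec
          s.tick).ent q = if q = s.v .p then (s.v .nc, s.v .l, s.v .r, s.v .a1, s.v .a2)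
          else s.ent q := by
      intro q
      by_cases hq : q = s.v .p
      · subst hq; simp [exec_cons, exec_put, exec_nil, St.ent]
      · simp [exec_cons, exec_put, exec_nil, St.ent, hq]
    have htm : ((block [.put .cst (.v .p) (.v .nc), .put .el (.v .p) (.v .l),
        .put .er (.v .p) (.v .r), .put .eU (.v .p) (.v .a1), .put .eV (.v .p) (.v .a2)]).exec
          s.tick).tm = s.tm + 7 := by simp [exec_cons, exec_put, exec_nil]
    refine ⟨?_, htm.le⟩
    generalize (block _).exec s.tick = s' at *
    have hcst : ∀ q, s'.a .cst q = if q = s.v .p then s.v .nc else s.a .cst q := fun q => by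
      have := congrArg Prod.fst (hent q)
      simp only [St.ent] at this
      rw [this]; split_ifs <;> rfl
    refine ⟨fun q h1 h2 => ?_, fun q c d hK => ?_, fun q h1 h2 => ?_, fun q hq => ?_⟩
    · rw [hent]
      rw [hcst] at h2
      split_ifs at h2 ⊢ with hq
      · subst hq; exact Set.mem_insert _ _
      · exact Set.mem_insert_of_mem _ (h.sound q h1 h2)
    · rw [hcst]
      rcases hK with hK | hK
      · simp only [Prod.mk.injEq] at hK
        rw [if_pos hK.1, hK.2.1]; exact ⟨hc, le_rfl⟩
      · have := h.best q c d hK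
        split_ifs with hq
        · subst hq; exact ⟨hc, by omega⟩
        · exact this
    · rw [hcst] at h2
      rw [hent]
      split_ifs at h2 ⊢ with hq
      · omega
      · exact h.zero q h1 h2
    · rw [hent, if_neg (by omega)]; exact h.below q hq
  · rw [if_neg fun h => hnew (heval.1 h), exec_skip]
    replace hnew : 0 < s.a .cst (s.v .p) ∧ s.a .cst (s.v .p) ≤ s.v .nc := by omega
    refine ⟨⟨fun q h1 h2 => Set.mem_insert_of_mem _ (h.sound q h1 h2), fun q c d hK => ?_,
      h.zero, h.below⟩, by simp⟩
    rcases hK with hK | hK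
    · simp only [Prod.mk.injEq] at hK
      rw [hK.1, hK.2.1]; exact hnew
    · exact h.best q c d hK

/-- The candidates for the table of a join that come from the combinations in `X`. -/
def joinCands (s : St) (X : Set (ℕ × ℕ × ℕ × ℕ)) : Set (ℕ × ℕ × ℕ × ℕ × ℕ × ℕ) :=
  {e | ∃ q ∈ X, 0 < s.a .cst (s.v .ba + q.1) ∧ 0 < s.a .cst (s.v .bb + q.2.1) ∧
    e = (s.v .free + q.2.2.1, s.a .cst (s.v .ba + q.1) + s.a .cst (s.v .bb + q.2.1) -
      (q.2.2.2 + 1), s.v .ba + q.1, s.v .bb + q.2.1, 0, 0)}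

/-- All entries that are read lie below `free` and all that are written lie at or above it, so the
candidates can be described by the initial state. -/
theorem joinFill_spec {s : St} (hz : ∀ p, s.v .free ≤ p → s.ent p = (0, 0, 0, 0, 0))
    (h1 : s.v .a1 = 0) (h2 : s.v .a2 = 0)
    (hq : ∀ q ∈ s.seg (s.v .lo) (s.v .hi), s.v .ba + q.1 < s.v .free ∧
      s.v .bb + q.2.1 < s.v .free ∧ (0 < s.a .cst (s.v .ba + q.1) →
      0 < s.a .cst (s.v .bb + q.2.1) →
        q.2.2.2 + 1 < s.a .cst (s.v .ba + q.1) + s.a .cst (s.v .bb + q.2.1))) :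
    Fill (s.v .free) s (joinFill.exec s) (joinCands s (s.seg (s.v .lo) (s.v .hi))) ∧
    (joinFill.exec s).tm ≤ s.tm + 1 + 16 * (s.v .hi - s.v .lo) := by
  have := loop_rule (x := .t) (e := .sub (.v .hi) (.v .lo)) (s := s) (c := block [
      .set .l (.add (.v .ba) (.a .gA (.add (.v .lo) (.v .t)))),
      .set .r (.add (.v .bb) (.a .gB (.add (.v .lo) (.v .t)))),
      .ite (andE (.a .cst (.v .l)) (.a .cst (.v .r))) (block [
        .set .p (.add (.v .free) (.a .gC (.add (.v .lo) (.v .t)))),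
        .set .nc (.sub (.add (.a .cst (.v .l)) (.a .cst (.v .r)))
          (.add (.a .gO (.add (.v .lo) (.v .t))) (.c 1))),
        relax]) .skip])
    (fun k s' => Fill (s.v .free) s s' (joinCands s (s.seg (s.v .lo) (s.v .lo + k))) ∧
      s'.tm ≤ s.tm + 1 + 16 * k) ?_ ?_
  · simp only [Ex.eval] at this
    by_cases hlo : s.v .lo ≤ s.v .hi
    · rwa [Nat.add_sub_cancel' hlo] at this
    · have e : s.seg (s.v .lo) (s.v .lo + (s.v .hi - s.v .lo)) = s.seg (s.v .lo) (s.v .hi) := by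
        ext q
        constructor
        · rintro ⟨i, a, b, c⟩; omega
        · rintro ⟨i, a, b, c⟩; omega
      rwa [e] at this
  · refine ⟨⟨fun p hp h => ?_, ?_, fun p hp _ => hz p hp, fun _ _ => rfl⟩, by simp⟩
    · have := congrArg Prod.fst (hz p hp)
      simp [St.ent] at this h
      omega
    · rintro p c d ⟨q, ⟨i, a, b, -⟩, -⟩; omega
  · rintro k hk s' hf ⟨hF, ht⟩
    simp only [Ex.eval] at hk
    have elo : s'.v .lo = s.v .lo := hf.v _ (by decide)
    have efr : s'.v .free = s.v .free := hf.v _ (by decide)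
    have eba : s'.v .ba = s.v .ba := hf.v _ (by decide)
    have ebb : s'.v .bb = s.v .bb := hf.v _ (by decide)
    have ea1 : s'.v .a1 = 0 := (hf.v _ (by decide)).trans h1
    have ea2 : s'.v .a2 = 0 := (hf.v _ (by decide)).trans h2
    have egA : s'.a .gA = s.a .gA := hf.a _ (by decide)
    have egB : s'.a .gB = s.a .gB := hf.a _ (by decide)
    have egC : s'.a .gC = s.a .gC := hf.a _ (by decide)
    have egO : s'.a .gO = s.a .gO := hf.a _ (by decide)
    set q := s.g (s.v .lo + k) with hqd
    have hqm : q ∈ s.seg (s.v .lo) (s.v .hi) := ⟨_, by omega, by omega, rfl⟩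
    obtain ⟨q1, q2, q3⟩ := hq q hqm
    have hseg : s.seg (s.v .lo) (s.v .lo + (k + 1)) = insert q (s.seg (s.v .lo) (s.v .lo + k)) := by
      ext o
      constructor
      · rintro ⟨i, a, b, c⟩
        by_cases hi : i = s.v .lo + k
        · subst hi; exact Or.inl c.symm
        · exact Or.inr ⟨i, a, by omega, c⟩
      · rintro (rfl | ⟨i, a, b, c⟩)
        · exact ⟨_, by omega, by omega, rfl⟩
        · exact ⟨i, a, by omega, c⟩
    have cst1 : s'.a .cst (s.v .ba + q.1) = s.a .cst (s.v .ba + q.1) :=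
      congrArg Prod.fst (hF.below _ q1)
    have cst2 : s'.a .cst (s.v .bb + q.2.1) = s.a .cst (s.v .bb + q.2.1) :=
      congrArg Prod.fst (hF.below _ q2)
    simp only [exec_cons, exec_nil, exec_ite]
    generalize hs1 : (Cmd.set .r (.add (.v .bb) (.a .gB (.add (.v .lo) (.v .t))))).exec
      ((Cmd.set .l (.add (.v .ba) (.a .gA (.add (.v .lo) (.v .t))))).exec
        (s'.setv .t k).tick) = s1
    have b1 : s1.v .l = s.v .ba + q.1 := by simp [← hs1, exec_set, eba, elo, egA, hqd, St.g]
    have b2 : s1.v .r = s.v .bb + q.2.1 := by simp [← hs1, exec_set, ebb, elo, egB, hqd, St.g]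
    have b3 : s1.a = s'.a := by simp [← hs1, exec_set]
    have b4 : s1.tm = s'.tm + 3 := by simp [← hs1, exec_set]
    have b5 : s1.v .free = s.v .free := by simp [← hs1, exec_set, efr]
    have b6 : s1.v .lo = s.v .lo := by simp [← hs1, exec_set, elo]
    have b7 : s1.v .t = k := by simp [← hs1, exec_set]
    have b8 : s1.v .a1 = 0 := by simp [← hs1, exec_set, ea1]
    have b9 : s1.v .a2 = 0 := by simp [← hs1, exec_set, ea2]
    clear hs1
    have hev : 0 < (andE (.a .cst (.v .l)) (.a .cst (.v .r))).eval s1 ↔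
        0 < s.a .cst (s.v .ba + q.1) ∧ 0 < s.a .cst (s.v .bb + q.2.1) := by
      simp only [Ex.eval, b1, b2, b3, cst1, cst2]
      split_ifs with h <;> simp_all
    by_cases hc : 0 < s.a .cst (s.v .ba + q.1) ∧ 0 < s.a .cst (s.v .bb + q.2.1)
    · rw [if_pos (hev.2 hc)]
      generalize hs2 : (Cmd.set .nc (.sub (.add (.a .cst (.v .l)) (.a .cst (.v .r)))
          (.add (.a .gO (.add (.v .lo) (.v .t))) (.c 1)))).exec
        ((Cmd.set .p (.add (.v .free) (.a .gC (.add (.v .lo) (.v .t))))).exec s1.tick) = s2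
      have c1 : s2.v .p = s.v .free + q.2.2.1 := by
        simp [← hs2, exec_set, b5, b3, b6, b7, egC, hqd, St.g]
      have c2 : s2.v .nc = s.a .cst (s.v .ba + q.1) + s.a .cst (s.v .bb + q.2.1) -
          (q.2.2.2 + 1) := by
        have cst1' := cst1
        have cst2' := cst2
        simp only [hqd, St.g] at cst1' cst2'
        simp [← hs2, exec_set, b3, b1, b2, b6, b7, cst1', cst2', egO, hqd, St.g]
      have c3 : s2.v .l = s.v .ba + q.1 := by simp [← hs2, exec_set, b1]
      have c4 : s2.v .r = s.v .bb + q.2.1 := by simp [← hs2, exec_set, b2]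
      have c5 : s2.v .a1 = 0 := by simp [← hs2, exec_set, b8]
      have c6 : s2.v .a2 = 0 := by simp [← hs2, exec_set, b9]
      have c7 : ∀ p, s2.ent p = s'.ent p := fun p => by simp [← hs2, exec_set, St.ent, b3]
      have c8 : s2.tm = s1.tm + 3 := by simp [← hs2, exec_set]
      clear hs2
      obtain ⟨d1, d2⟩ := relax_spec (hF.congr c7) (by omega) (by have := q3 hc.1 hc.2; omega)
      rw [c1, c2, c3, c4, c5, c6] at d1
      have : joinCands s (s.seg (s.v .lo) (s.v .lo + (k + 1))) =
          insert (s.v .free + q.2.2.1, s.a .cst (s.v .ba + q.1) + s.a .cst (s.v .bb + q.2.1) -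
            (q.2.2.2 + 1), s.v .ba + q.1, s.v .bb + q.2.1, 0, 0)
            (joinCands s (s.seg (s.v .lo) (s.v .lo + k))) := by
        rw [hseg]
        ext e
        constructor
        · rintro ⟨o, rfl | ho, h⟩
          · exact Or.inl h.2.2
          · exact Or.inr ⟨o, ho, h⟩
        · rintro (h | ⟨o, ho, h⟩)
          · exact ⟨q, Or.inl rfl, hc.1, hc.2, h⟩
          · exact ⟨o, Or.inr ho, h⟩
      rw [this]
      exact ⟨d1.congr fun _ => rfl, by simp only [tick_tm]; omega⟩
    · rw [if_neg fun h => hc (hev.1 h), exec_skip]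
      have : joinCands s (s.seg (s.v .lo) (s.v .lo + (k + 1))) =
          joinCands s (s.seg (s.v .lo) (s.v .lo + k)) := by
        rw [hseg]
        ext e
        constructor
        · rintro ⟨o, rfl | ho, h⟩
          · exact absurd ⟨h.1, h.2.1⟩ hc
          · exact ⟨o, ho, h⟩
        · rintro ⟨o, ho, h⟩
          exact ⟨o, Or.inr ho, h⟩
      rw [this]
      exact ⟨hF.congr fun p => by simp [St.ent, b3], by simp only [tick_tm]; omega⟩

/-! ### Loading boundaries -/

theorem BList.image {s : St} {D p n : ℕ} {W : Finset ℕ} {cnt str : ℕ → ℕ} {sz : ℕ}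
    (h : BList s D p (p + n) W cnt str sz) :
    (Finset.range n).image (fun i => s.a .lv (p + i)) = W ∧ W.card = n := by
  constructor
  · ext v
    simp only [Finset.mem_image, Finset.mem_range]
    constructor
    · rintro ⟨i, hi, rfl⟩; exact h.mem _ (by omega) (by omega)
    · intro hv
      obtain ⟨i, a, b, c⟩ := h.cov v hv
      exact ⟨i - p, by omega, by rw [Nat.add_sub_cancel' a, c]⟩
  · have := h.len; omega

theorem BList.inj {s : St} {D p n : ℕ} {W : Finset ℕ} {cnt str : ℕ → ℕ} {sz : ℕ}
    (h : BList s D p (p + n) W cnt str sz) {i j : ℕ} (hi : i < n) (hj : j < n)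
    (he : s.a .lv (p + i) = s.a .lv (p + j)) : i = j := by
  obtain ⟨h1, h2⟩ := h.image
  have : Set.InjOn (fun i => s.a .lv (p + i)) (Finset.range n : Finset ℕ) := by
    rw [← Finset.card_image_iff, h1, h2, Finset.card_range]
  exact this (by simpa using hi) (by simpa using hj) he

/-- Loading turns the boundary list into arrays indexed by vertices, in which counts and strides can
be looked up directly. -/
theorem loadA_spec {s : St} {D : ℕ} {W : Finset ℕ} {cnt str : ℕ → ℕ} {sz : ℕ}
    (h : BList s D (s.v .pa) (s.v .pa + s.v .na) W cnt str sz) (hnu : s.v .nu = 0)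
    (hca : s.a .ca = fun _ => 0) (hsa : s.a .sa = fun _ => 0) :
    (loadA.exec s).a .sa = str ∧
    (∀ v, (loadA.exec s).a .ca v = if v ∈ W then cnt v else 0) ∧
    (Finset.range ((loadA.exec s).v .nu)).image ((loadA.exec s).a .uu) = W ∧
    (loadA.exec s).v .nu = W.card ∧ (loadA.exec s).tm ≤ s.tm + 1 + 7 * W.card := by
  obtain ⟨him, hcard⟩ := h.image
  set Wk : ℕ → Finset ℕ := fun k => (Finset.range k).image (fun i => s.a .lv (s.v .pa + i)) with hWk
  have hWs : ∀ k, Wk (k + 1) = insert (s.a .lv (s.v .pa + k)) (Wk k) := fun k => by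
    simp [hWk, Finset.range_add_one, Finset.image_insert]
  have := loop_rule (x := .i) (e := .v .na) (s := s) (c := block [
      .set .v (.a .lv (.add (.v .pa) (.v .i))),
      .put .ca (.v .v) (.a .lc (.add (.v .pa) (.v .i))),
      .put .sa (.v .v) (.a .ls (.add (.v .pa) (.v .i))), .put .uu (.v .nu) (.v .v), inc .nu])
    (fun k s' => (∀ v, s'.a .sa v = if v ∈ Wk k then str v else 0) ∧
      (∀ v, s'.a .ca v = if v ∈ Wk k then cnt v else 0) ∧
      (Finset.range k).image (s'.a .uu) = Wk k ∧ s'.v .nu = k ∧ s'.tm ≤ s.tm + 1 + 7 * k)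
    ⟨by simp [hsa, Wk], by simp [hca, Wk], by simp [Wk], by simp [hnu], by simp⟩ ?_
  · obtain ⟨h1, h2, h3, h4, h5⟩ := this
    simp only [Ex.eval] at h1 h2 h3 h4 h5
    simp only [show Wk (s.v .na) = W from him] at h1 h2 h3
    refine ⟨?_, h2, ?_, h4.trans hcard.symm, by rw [hcard]; exact h5⟩
    · funext v
      refine (h1 v).trans ?_
      split_ifs with hv
      · rfl
      · have := h.radix.pos v; simp only [hv, iff_false] at this; omega
    · rw [← h3]; congr 2
  · rintro k hk s' hf ⟨h1, h2, h3, h4, h5⟩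
    simp only [Ex.eval] at hk
    have epa : s'.v .pa = s.v .pa := hf.v _ (by decide)
    have elv : s'.a .lv = s.a .lv := hf.a _ (by decide)
    have elc : s'.a .lc = s.a .lc := hf.a _ (by decide)
    have els : s'.a .ls = s.a .ls := hf.a _ (by decide)
    have hlc := h.lc (s.v .pa + k) (by omega) (by omega)
    have hls := h.ls (s.v .pa + k) (by omega) (by omega)
    refine ⟨fun v => ?_, fun v => ?_, ?_, ?_, ?_⟩
    · simp [exec_cons, exec_nil, exec_set, exec_put, epa, elv, els, Function.update_apply, hls, h1,
        hWs]
      by_cases hv : v = s.a .lv (s.v .pa + k)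
      · simp [hv]
      · simp [hv]
    · simp [exec_cons, exec_nil, exec_set, exec_put, epa, elv, elc, Function.update_apply, hlc, h2,
        hWs]
      by_cases hv : v = s.a .lv (s.v .pa + k)
      · simp [hv]
      · simp [hv]
    · rw [hWs, ← h3, Finset.range_add_one, Finset.image_insert]
      simp only [exec_cons, exec_nil, exec_set, exec_put]
      simp [epa, elv, h4]
      congr 1
      refine Finset.image_congr fun i hi => ?_
      have : i ≠ k := by have : i < k := by simpa using hi
                         omega
      simp [this]
    · simp [exec_cons, exec_nil, exec_set, exec_put, h4]
    · simp [exec_cons, exec_nil, exec_set, exec_put]; omega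

/-- Strides are positive exactly on the boundary. So a positive entry of `sa` reveals that a vertex
is already listed, and `uu` enumerates the union without repetition. -/
theorem loadB_spec {s : St} {D : ℕ} {V W : Finset ℕ} {cnt str : ℕ → ℕ} {sz : ℕ}
    (h : BList s D (s.v .pb) (s.v .pb + s.v .nb) W cnt str sz)
    (hcb : s.a .cb = fun _ => 0) (hsb : s.a .sb = fun _ => 0)
    (hV : ∀ v, 0 < s.a .sa v ↔ v ∈ V) (hnu : s.v .nu = V.card)
    (hi : (Finset.range (s.v .nu)).image (s.a .uu) = V) :
    (loadB.exec s).a .sb = str ∧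
    (∀ v, (loadB.exec s).a .cb v = if v ∈ W then cnt v else 0) ∧
    (Finset.range ((loadB.exec s).v .nu)).image ((loadB.exec s).a .uu) = V ∪ W ∧
    (loadB.exec s).v .nu = (V ∪ W).card ∧ (loadB.exec s).tm ≤ s.tm + 1 + 9 * W.card := by
  obtain ⟨him, hcard⟩ := h.image
  set Wk : ℕ → Finset ℕ := fun k => (Finset.range k).image (fun i => s.a .lv (s.v .pb + i)) with hWk
  have hWs : ∀ k, Wk (k + 1) = insert (s.a .lv (s.v .pb + k)) (Wk k) := fun k => by
    simp [hWk, Finset.range_add_one, Finset.image_insert]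
  have := loop_rule (x := .i) (e := .v .nb) (s := s) (c := block [
      .set .v (.a .lv (.add (.v .pb) (.v .i))),
      .put .cb (.v .v) (.a .lc (.add (.v .pb) (.v .i))),
      .put .sb (.v .v) (.a .ls (.add (.v .pb) (.v .i))),
      .ite (.a .sa (.v .v)) .skip (block [.put .uu (.v .nu) (.v .v), inc .nu])])
    (fun k s' => (∀ v, s'.a .sb v = if v ∈ Wk k then str v else 0) ∧
      (∀ v, s'.a .cb v = if v ∈ Wk k then cnt v else 0) ∧
      (Finset.range (s'.v .nu)).image (s'.a .uu) = V ∪ Wk k ∧ s'.v .nu = (V ∪ Wk k).card ∧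
      s'.tm ≤ s.tm + 1 + 9 * k)
    ⟨by simp [hsb, Wk], by simp [hcb, Wk], by simp [Wk, hi], by simp [hnu, Wk], by simp⟩ ?_
  · obtain ⟨h1, h2, h3, h4, h5⟩ := this
    simp only [Ex.eval] at h1 h2 h3 h4 h5
    simp only [show Wk (s.v .nb) = W from him] at h1 h2 h3 h4
    refine ⟨?_, h2, h3, h4, by rw [hcard]; exact h5⟩
    · funext v
      refine (h1 v).trans ?_
      split_ifs with hv
      · rfl
      · have := h.radix.pos v; simp only [hv, iff_false] at this; omega
  · rintro k hk s' hf ⟨h1, h2, h3, h4, h5⟩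
    simp only [Ex.eval] at hk
    have epb : s'.v .pb = s.v .pb := hf.v _ (by decide)
    have elv : s'.a .lv = s.a .lv := hf.a _ (by decide)
    have elc : s'.a .lc = s.a .lc := hf.a _ (by decide)
    have els : s'.a .ls = s.a .ls := hf.a _ (by decide)
    have esa : s'.a .sa = s.a .sa := hf.a _ (by decide)
    have hlc := h.lc (s.v .pb + k) (by omega) (by omega)
    have hls := h.ls (s.v .pb + k) (by omega) (by omega)
    set v := s.a .lv (s.v .pb + k) with hv
    have hvk : v ∉ Wk k := by
      simp only [hWk, Finset.mem_image, Finset.mem_range, not_exists, not_and]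
      intro j hj he
      have := h.inj (by omega) hk he
      omega
    simp only [exec_cons, exec_nil, exec_ite]
    generalize hs1 : (Cmd.put .sb (.v .v) (.a .ls (.add (.v .pb) (.v .i)))).exec
      ((Cmd.put .cb (.v .v) (.a .lc (.add (.v .pb) (.v .i)))).exec
      ((Cmd.set .v (.a .lv (.add (.v .pb) (.v .i)))).exec (s'.setv .i k).tick)) = s1
    have b1 : s1.v .v = v := by simp [← hs1, exec_set, exec_put, epb, elv, hv]
    have b2 : ∀ u, s1.a .sb u = if u ∈ Wk (k + 1) then str u else 0 := fun u => by
      simp [← hs1, exec_set, exec_put, epb, elv, els, Function.update_apply, hls, h1, hWs, ← hv]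
      by_cases hu : u = v
      · simp [hu]
      · simp [hu]
    have b3 : ∀ u, s1.a .cb u = if u ∈ Wk (k + 1) then cnt u else 0 := fun u => by
      simp [← hs1, exec_set, exec_put, epb, elv, elc, Function.update_apply, hlc, h2, hWs, ← hv]
      by_cases hu : u = v
      · simp [hu]
      · simp [hu]
    have b4 : s1.a .uu = s'.a .uu := by simp [← hs1, exec_set, exec_put]
    have b5 : s1.v .nu = s'.v .nu := by simp [← hs1, exec_set, exec_put]
    have b6 : s1.a .sa = s.a .sa := by simp [← hs1, exec_set, exec_put, esa]
    have b7 : s1.tm = s'.tm + 4 := by simp [← hs1, exec_set, exec_put]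
    clear hs1
    simp only [Ex.eval, b1, b6, hV]
    by_cases hvV : v ∈ V
    · have hU : V ∪ Wk (k + 1) = V ∪ Wk k := by
        rw [hWs, Finset.union_insert, Finset.insert_eq_self.2 (Finset.mem_union_left _ hvV)]
      simp only [hvV, if_true, exec_skip]
      rw [hU]
      refine ⟨b2, b3, ?_, ?_, ?_⟩
      · simpa [b4, b5] using h3
      · simpa [b5] using h4
      · simp; omega
    · have hU : V ∪ Wk (k + 1) = insert v (V ∪ Wk k) := by
        rw [hWs, Finset.union_insert]
      have hn : v ∉ V ∪ Wk k := by simp [hvV, hvk]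
      simp only [hvV, if_false]
      rw [hU, Finset.card_insert_of_notMem hn, ← h4, ← h3]
      refine ⟨?_, ?_, ?_, ?_, ?_⟩
      · simpa [exec_set, exec_put] using b2
      · simpa [exec_set, exec_put] using b3
      · simp only [exec_set, exec_put]
        simp [b5, b4, b1, Finset.range_add_one, Finset.image_insert]
        congr 1
        refine Finset.image_congr fun i hi => ?_
        have : i ≠ s'.v .nu := by have : i < s'.v .nu := by simpa using hi
                                  omega
        simp [this]
      · simp [exec_set, exec_put, b5]
      · simp [exec_set, exec_put]; omega

/-- Only the listed vertices are reset. Clearing whole arrays would cost time of order `n` in every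
join. -/
theorem clearMarks_spec {s : St}
    (h : ∀ v, v ∉ (Finset.range (s.v .nu)).image (s.a .uu) →
      s.a .ca v = 0 ∧ s.a .sa v = 0 ∧ s.a .cb v = 0 ∧ s.a .sb v = 0) :
    (∀ v, (clearMarks.exec s).a .ca v = 0 ∧ (clearMarks.exec s).a .sa v = 0 ∧
      (clearMarks.exec s).a .cb v = 0 ∧ (clearMarks.exec s).a .sb v = 0) ∧
    (clearMarks.exec s).tm ≤ s.tm + 1 + 7 * s.v .nu := by
  set Wk : ℕ → Finset ℕ := fun k => (Finset.range k).image (s.a .uu) with hWk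
  have hWs : ∀ k, Wk (k + 1) = insert (s.a .uu k) (Wk k) := fun k => by
    simp [hWk, Finset.range_add_one, Finset.image_insert]
  have := loop_rule (x := .i) (e := .v .nu) (s := s) (c := block [.set .v (.a .uu (.v .i)),
      .put .ca (.v .v) (.c 0), .put .sa (.v .v) (.c 0), .put .cb (.v .v) (.c 0),
      .put .sb (.v .v) (.c 0)])
    (fun k s' => (∀ v, v ∈ Wk k ∨ v ∉ Wk (s.v .nu) → s'.a .ca v = 0 ∧ s'.a .sa v = 0 ∧
      s'.a .cb v = 0 ∧ s'.a .sb v = 0) ∧ s'.tm ≤ s.tm + 1 + 7 * k) ?_ ?_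
  · exact ⟨fun v => this.1 v (em _), this.2⟩
  · refine ⟨fun v hv => h v (hv.resolve_left (by simp [Wk])), by simp⟩
  · rintro k hk s' hf ⟨h1, h2⟩
    have euu : s'.a .uu = s.a .uu := hf.a _ (by decide)
    refine ⟨fun v hv => ?_, ?_⟩
    · rw [hWs, Finset.mem_insert] at hv
      by_cases hvk : v = s.a .uu k
      · simp [exec_cons, exec_nil, exec_set, exec_put, euu, hvk]
      · have := h1 v (hv.imp_left fun h => h.resolve_left hvk)
        simp [exec_cons, exec_nil, exec_set, exec_put, euu, hvk, this]
    · simp [exec_cons, exec_nil, exec_set, exec_put]; omega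

/-! ### Tables -/

/-- The set coded by a traceback datum: zero codes the empty set, `v + 1` codes `{v}`. -/
def one (a : ℕ) : Finset ℕ := if a = 0 then ∅ else {a - 1}

/-- `sol` is the partial solution that is obtained by tracing back from a table entry. -/
structure Mem (s : St) (sol : ℕ → Finset ℕ) : Prop where
  free_pos : 0 < s.v .free
  zero : ∀ p, s.v .free ≤ p → s.ent p = (0, 0, 0, 0, 0)
  sol_zero : sol 0 = ∅
  ent_zero : (s.ent 0).2 = (0, 0, 0, 0)
  lt : ∀ p, 0 < p → s.a .el p < p ∧ s.a .er p < p
  eq : ∀ p, sol p = sol (s.a .el p) ∪ sol (s.a .er p) ∪ one (s.a .eU p) ∪ one (s.a .eV p)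

/-- The extension of partial solutions to new entries. -/
def extSol (f : ℕ) (s : St) (sol : ℕ → Finset ℕ) (p : ℕ) : Finset ℕ :=
  if p < f then sol p else
    sol (s.a .el p) ∪ sol (s.a .er p) ∪ one (s.a .eU p) ∪ one (s.a .eV p)

/-- Every pointer of a new entry leads below the old `free`, where solutions are already defined;
cells that received no candidate have both pointers at the empty entry `0`. So the recursion for
`sol` remains well founded. -/
theorem Mem.fill {s s' s'' : St} {sol : ℕ → Finset ℕ} {K : Set (ℕ × ℕ × ℕ × ℕ × ℕ × ℕ)} {sz : ℕ}
    (h : Mem s sol) (hF : Fill (s.v .free) s s' K)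
    (hK : ∀ p c l r d, (p, c, l, r, d) ∈ K → p < s.v .free + sz ∧ l < s.v .free ∧ r < s.v .free)
    (he : ∀ p, s''.ent p = s'.ent p) (hfree : s''.v .free = s.v .free + sz) :
    Mem s'' (extSol (s.v .free) s' sol) := by
  have hpos := h.free_pos
  have hcst : ∀ p, s.v .free + sz ≤ p → s'.a .cst p = 0 := fun p hp => by
    by_contra hne
    have := hF.sound p (by omega) (by omega)
    have := (hK _ _ _ _ _ this).1
    omega
  have hel : ∀ p, s''.a .el p = s'.a .el p := fun p => congrArg (fun q => q.2.1) (he p)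
  have her : ∀ p, s''.a .er p = s'.a .er p := fun p => congrArg (fun q => q.2.2.1) (he p)
  have heU : ∀ p, s''.a .eU p = s'.a .eU p := fun p => congrArg (fun q => q.2.2.2.1) (he p)
  have heV : ∀ p, s''.a .eV p = s'.a .eV p := fun p => congrArg (fun q => q.2.2.2.2) (he p)
  have hlt : ∀ p, s.v .free ≤ p → s'.a .el p < s.v .free ∧ s'.a .er p < s.v .free := by
    intro p hp
    by_cases hc : 0 < s'.a .cst p
    · exact (hK _ _ _ _ _ (hF.sound p hp hc)).2
    · have := hF.zero p hp (by omega)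
      have e1 : s'.a .el p = 0 := congrArg (fun q => q.2.1) this
      have e2 : s'.a .er p = 0 := congrArg (fun q => q.2.2.1) this
      omega
  have b1 : ∀ p < s.v .free, s'.a .el p = s.a .el p := fun p hp =>
    congrArg (fun q => q.2.1) (hF.below p hp)
  have b2 : ∀ p < s.v .free, s'.a .er p = s.a .er p := fun p hp =>
    congrArg (fun q => q.2.2.1) (hF.below p hp)
  have b3 : ∀ p < s.v .free, s'.a .eU p = s.a .eU p := fun p hp =>
    congrArg (fun q => q.2.2.2.1) (hF.below p hp)
  have b4 : ∀ p < s.v .free, s'.a .eV p = s.a .eV p := fun p hp =>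
    congrArg (fun q => q.2.2.2.2) (hF.below p hp)
  have hz : s.a .el 0 = 0 ∧ s.a .er 0 = 0 := by
    have := h.ent_zero
    simp only [St.ent, Prod.mk.injEq] at this
    exact ⟨this.1, this.2.1⟩
  refine ⟨by omega, fun p hp => ?_, by simp [extSol, hpos, h.sol_zero], ?_, fun p hp => ?_,
    fun p => ?_⟩
  · rw [he]; exact hF.zero p (by omega) (hcst p (by omega))
  · rw [he, hF.below 0 hpos]; exact h.ent_zero
  · rw [hel, her]
    by_cases hpf : p < s.v .free
    · rw [b1 p hpf, b2 p hpf]; exact h.lt p hp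
    · have := hlt p (by omega); omega
  · rw [hel, her, heU, heV]
    by_cases hpf : p < s.v .free
    · have l1 : s.a .el p < s.v .free ∧ s.a .er p < s.v .free := by
        rcases Nat.eq_zero_or_pos p with rfl | hp
        · rw [hz.1, hz.2]; exact ⟨hpos, hpos⟩
        · have := h.lt p hp; omega
      rw [b1 p hpf, b2 p hpf, b3 p hpf, b4 p hpf]
      simp only [extSol, if_pos hpf, if_pos l1.1, if_pos l1.2]
      exact h.eq p
    · have l1 := hlt p (by omega)
      simp only [extSol, if_neg hpf, if_pos l1.1, if_pos l1.2]

/-- The data of a correct table for the edges in `A`. -/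
structure Table (G : Net) (s : St) (sol : ℕ → Finset ℕ) (A : Finset ℕ) (b p q : ℕ)
    (str : ℕ → ℕ) (sz : ℕ) : Prop where
  list : BList s (G.ds + 2) p q (G.bd A) (G.degA A) str sz
  le_lf : q ≤ s.v .lf
  le_free : b + sz ≤ s.v .free
  entry : ∀ σ : ℕ → ℕ, (∀ v, σ v ≤ G.ds + 1) →
    G.EntryOK A σ (s.a .cst (b + ∑ v ∈ G.bd A, σ v * str v))
      (sol (b + ∑ v ∈ G.bd A, σ v * str v))

/-- The node `x` holds a correct table for the edges in `A`. -/
def TableOK (G : Net) (s : St) (sol : ℕ → Finset ℕ) (A : Finset ℕ) (x : ℕ) : Prop :=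
  ∃ str sz, Table G s sol A (s.a .base x) (s.a .wp x) (s.a .wp x + s.a .wn x) str sz

theorem Table.addr_lt {G : Net} {s : St} {sol : ℕ → Finset ℕ} {A : Finset ℕ} {b p q : ℕ}
    {str : ℕ → ℕ} {sz : ℕ} (h : Table G s sol A b p q str sz) {σ : ℕ → ℕ}
    (hσ : ∀ v, σ v ≤ G.ds + 1) : b + ∑ v ∈ G.bd A, σ v * str v < s.v .free := by
  have := h.list.radix.lt σ fun v => by have := hσ v; omega
  have := h.le_free
  omega

/-- Memory below `free` and lists below `lf` are never reused, so a table once correct stays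
correct. -/
theorem Table.mono {G : Net} {s s' : St} {sol sol' : ℕ → Finset ℕ} {A : Finset ℕ} {b p q : ℕ}
    {str : ℕ → ℕ} {sz : ℕ} (h : Table G s sol A b p q str sz)
    (h1 : ∀ i < s.v .lf, s'.a .lv i = s.a .lv i ∧ s'.a .lc i = s.a .lc i ∧ s'.a .ls i = s.a .ls i)
    (h2 : s.v .lf ≤ s'.v .lf) (h3 : s.v .free ≤ s'.v .free)
    (h4 : ∀ p < s.v .free, s'.ent p = s.ent p) (h5 : ∀ p < s.v .free, sol' p = sol p) :
    Table G s' sol' A b p q str sz := by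
  have := h.le_lf
  refine ⟨h.list.congr (fun i hi => (h1 i (by omega)).1) (fun i hi => (h1 i (by omega)).2.1)
    (fun i hi => (h1 i (by omega)).2.2), by omega, h.le_free.trans h3, fun σ hσ => ?_⟩
  have hlt := h.addr_lt hσ
  rw [show s'.a .cst _ = s.a .cst _ from congrArg Prod.fst (h4 _ hlt), h5 _ hlt]
  exact h.entry σ hσ

namespace Net

variable {G : Net} {A B : Finset ℕ}

/-- A combination restricts the assignments only on `U`; setting them to `0` elsewhere makes them
legitimate arguments of the tables without changing the sums. -/
theorem Combos.digits {U : Finset ℕ} {sa sb sc : ℕ → ℕ} {q : ℕ × ℕ × ℕ × ℕ}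
    (h : G.Combos A B U sa sb sc q) :
    ∃ σ1 σ2 σ : ℕ → ℕ, (∀ v ∈ U, G.Opt A B v (σ1 v) (σ2 v) (σ v)) ∧
      (∀ v, σ1 v ≤ G.ds + 1) ∧ (∀ v, σ2 v ≤ G.ds + 1) ∧ (∀ v, σ v ≤ G.ds + 1) ∧
      q = (∑ v ∈ U, σ1 v * sa v, ∑ v ∈ U, σ2 v * sb v, ∑ v ∈ U, σ v * sc v,
        ∑ v ∈ U, if v ∈ G.bd A ∧ v ∈ G.bd B ∧ σ1 v = 0 then 1 else 0) := by
  classical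
  obtain ⟨σ1, σ2, σ, h, rfl⟩ := h
  refine ⟨fun v => if v ∈ U then σ1 v else 0, fun v => if v ∈ U then σ2 v else 0,
    fun v => if v ∈ U then σ v else 0, fun v hv => ?_, fun v => ?_, fun v => ?_, fun v => ?_, ?_⟩
  · simpa [hv] using h v hv
  · dsimp only; split_ifs with hv
    · exact (h v hv).le.1
    · omega
  · dsimp only; split_ifs with hv
    · exact (h v hv).le.2.1
    · omega
  · dsimp only; split_ifs with hv
    · exact (h v hv).le.2.2
    · omega
  · simp only [Prod.mk.injEq]
    refine ⟨?_, ?_, ?_, ?_⟩ <;> exact Finset.sum_congr rfl fun v hv => by simp [hv]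

theorem Feas.congr {σ σ' : ℕ → ℕ} {S : Finset ℕ} (h : G.Feas A σ S)
    (he : ∀ v ∈ G.bd A, σ' v = σ v) : G.Feas A σ' S :=
  ⟨fun v hv => by rw [he v hv]; exact h.mem v hv, fun v hv => by rw [he v hv]; exact h.le v hv,
    h.inner⟩

end Net

/-- Strides vanish off `W`, so a sum over both boundaries computes the address in the table of
either part. -/
theorem Radix.sum_subset {D : ℕ} {W U : Finset ℕ} {str : ℕ → ℕ} {sz : ℕ} (h : Radix D W str sz)
    (hWU : W ⊆ U) (σ : ℕ → ℕ) : ∑ v ∈ U, σ v * str v = ∑ v ∈ W, σ v * str v := by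
  refine (Finset.sum_subset hWU fun v _ hv => ?_).symm
  have := (h.pos v).not.2 hv
  rw [Nat.eq_zero_of_not_pos this, mul_zero]

/-! ### Correctness of a joined table -/

section joinTable

open Net

variable {G : Net} {s : St} {sol : ℕ → Finset ℕ} {A B : Finset ℕ} {ba pa qa bb pb qb : ℕ}
  {stra strb strc : ℕ → ℕ} {sza szb szc : ℕ}
  (hA : A ⊆ Finset.range G.m) (hB : B ⊆ Finset.range G.m) (hd : Disjoint A B)
  (tA : Table G s sol A ba pa qa stra sza) (tB : Table G s sol B bb pb qb strb szb)
  (hr : Radix (G.ds + 2) (G.bd (A ∪ B)) strc szc)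
include hA hB hd tA tB hr

/-- The soundness half, by `join_sound`. Costs are sizes plus one, so from the sum of two costs the
overlap and one further unit are subtracted. -/
theorem combos_bound {q : ℕ × ℕ × ℕ × ℕ}
    (hq : G.Combos A B (G.bd A ∪ G.bd B) stra strb strc q) :
    ba + q.1 < s.v .free ∧ bb + q.2.1 < s.v .free ∧ q.2.2.1 < szc ∧
    (0 < s.a .cst (ba + q.1) → 0 < s.a .cst (bb + q.2.1) →
      q.2.2.2 + 1 < s.a .cst (ba + q.1) + s.a .cst (bb + q.2.1) ∧
      ∃ σ : ℕ → ℕ, (∀ v, σ v ≤ G.ds + 1) ∧ q.2.2.1 = ∑ v ∈ G.bd (A ∪ B), σ v * strc v ∧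
        sol (ba + q.1) ∪ sol (bb + q.2.1) ⊆ G.supp (A ∪ B) ∧
        G.Feas (A ∪ B) σ (sol (ba + q.1) ∪ sol (bb + q.2.1)) ∧
        (sol (ba + q.1) ∪ sol (bb + q.2.1)).card + 1 =
          s.a .cst (ba + q.1) + s.a .cst (bb + q.2.1) - (q.2.2.2 + 1)) := by
  obtain ⟨σ1, σ2, σ, h, h1, h2, h3, rfl⟩ := hq.digits
  dsimp only
  rw [tA.list.radix.sum_subset Finset.subset_union_left,
    tB.list.radix.sum_subset Finset.subset_union_right,
    hr.sum_subset (bd_union_subset hA hB hd)]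
  refine ⟨tA.addr_lt h1, tB.addr_lt h2, hr.lt σ fun v => by have := h3 v; omega,
    fun c1 c2 => ?_⟩
  have eA := tA.entry σ1 h1
  have eB := tB.entry σ2 h2
  obtain ⟨k1, k2, k3⟩ := join_sound hA hB hd h (eA.sub c1) (eB.sub c2) (eA.feas c1) (eB.feas c2)
  have k4 := eA.card c1
  have k5 := eB.card c2
  have k6 : (∑ v ∈ G.bd A ∪ G.bd B, if v ∈ G.bd A ∧ v ∈ G.bd B ∧ σ1 v = 0 then 1 else 0) =
      ((G.bd A ∩ G.bd B).filter fun v => σ1 v = 0).card := by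
    rw [← Finset.card_filter]
    congr 1
    ext v
    simp only [Finset.mem_filter, Finset.mem_union, Finset.mem_inter]
    tauto
  rw [k6]
  exact ⟨by omega, σ, h3, rfl, k1, k2, by omega⟩

/-- The completeness half: `join_complete` splits any competitor, and the two tables are at least as
good as its pieces. -/
theorem combos_opt {σ : ℕ → ℕ} (hσ : ∀ v, σ v ≤ G.ds + 1) {S : Finset ℕ}
    (hS : S ⊆ G.supp (A ∪ B)) (hf : G.Feas (A ∪ B) σ S) :
    ∃ q, G.Combos A B (G.bd A ∪ G.bd B) stra strb strc q ∧ 0 < s.a .cst (ba + q.1) ∧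
      0 < s.a .cst (bb + q.2.1) ∧ q.2.2.1 = ∑ v ∈ G.bd (A ∪ B), σ v * strc v ∧
      s.a .cst (ba + q.1) + s.a .cst (bb + q.2.1) - (q.2.2.2 + 1) ≤ S.card + 1 := by
  obtain ⟨σ1, σ2, σ', h, h1, h2, h3, S1, S2, hS1, hS2, f1, f2, rfl⟩ :=
    join_complete hA hB hd hσ hS hf
  have h' : ∀ v ∈ G.bd A ∪ G.bd B, G.Opt A B v (σ1 v) (σ2 v) (σ' v) := fun v hv =>
    (h v).resolve_right (not_not.2 hv)
  refine ⟨_, ⟨σ1, σ2, σ', h', rfl⟩, ?_⟩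
  dsimp only
  rw [tA.list.radix.sum_subset Finset.subset_union_left,
    tB.list.radix.sum_subset Finset.subset_union_right,
    hr.sum_subset (bd_union_subset hA hB hd)]
  obtain ⟨k1, k2⟩ := (tA.entry σ1 h1).opt S1 hS1 f1
  obtain ⟨k3, k4⟩ := (tB.entry σ2 h2).opt S2 hS2 f2
  have k5 := (join_sound hA hB hd h' hS1 hS2 f1 f2).2.2
  have k6 : (∑ v ∈ G.bd A ∪ G.bd B, if v ∈ G.bd A ∧ v ∈ G.bd B ∧ σ1 v = 0 then 1 else 0) =
      ((G.bd A ∩ G.bd B).filter fun v => σ1 v = 0).card := by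
    rw [← Finset.card_filter]
    congr 1
    ext v
    simp only [Finset.mem_filter, Finset.mem_union, Finset.mem_inter]
    tauto
  rw [k6]
  exact ⟨k1, k3, Finset.sum_congr rfl fun v hv => by rw [h3 v hv], by omega⟩

/-- An entry found at the address of `σ` comes from some assignment with the same code. By
injectivity of the code the two agree on the new boundary, and feasibility depends on nothing else.
-/
theorem join_entry {s' : St} {X : Set (ℕ × ℕ × ℕ × ℕ)} (hba : s.v .ba = ba) (hbb : s.v .bb = bb)
    (hX : ∀ q, q ∈ X ↔ G.Combos A B (G.bd A ∪ G.bd B) stra strb strc q)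
    (hF : Fill (s.v .free) s s' (joinCands s X)) {σ : ℕ → ℕ} (hσ : ∀ v, σ v ≤ G.ds + 1) :
    G.EntryOK (A ∪ B) σ (s'.a .cst (s.v .free + ∑ v ∈ G.bd (A ∪ B), σ v * strc v))
      (extSol (s.v .free) s' sol (s.v .free + ∑ v ∈ G.bd (A ∪ B), σ v * strc v)) := by
  set p := s.v .free + ∑ v ∈ G.bd (A ∪ B), σ v * strc v with hp
  have main : 0 < s'.a .cst p → extSol (s.v .free) s' sol p ⊆ G.supp (A ∪ B) ∧
      G.Feas (A ∪ B) σ (extSol (s.v .free) s' sol p) ∧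
      (extSol (s.v .free) s' sol p).card + 1 = s'.a .cst p := by
    intro hc
    obtain ⟨q, hq, c1, c2, he⟩ := hF.sound p (by omega) hc
    rw [hba] at c1 he
    rw [hbb] at c2 he
    obtain ⟨-, -, -, h⟩ := combos_bound hA hB hd tA tB hr ((hX q).1 hq)
    obtain ⟨-, σ', h1, h2, h3, h4, h5⟩ := h c1 c2
    simp only [St.ent, Prod.mk.injEq] at he
    obtain ⟨e1, e2, e3, e4, e5, e6⟩ := he
    have hsol : extSol (s.v .free) s' sol p = sol (ba + q.1) ∪ sol (bb + q.2.1) := by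
      rw [extSol, if_neg (by omega), e3, e4, e5, e6]
      simp [one]
    rw [hsol]
    refine ⟨h3, h4.congr ?_, by omega⟩
    exact hr.inj σ σ' (fun v => by have := hσ v; omega) (fun v => by have := h1 v; omega) (by omega)
  refine ⟨fun h => (main h).1, fun h => (main h).2.1, fun h => (main h).2.2, fun S hS hf => ?_⟩
  obtain ⟨q, hq, c1, c2, h1, h2⟩ := combos_opt hA hB hd tA tB hr hσ hS hf
  have := hF.best p (s.a .cst (ba + q.1) + s.a .cst (bb + q.2.1) - (q.2.2.2 + 1))
    (ba + q.1, bb + q.2.1, 0, 0)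
    ⟨q, (hX q).2 hq, by rwa [hba], by rwa [hbb], by rw [hba, hbb, hp, h1]⟩
  exact ⟨this.1, this.2.trans h2⟩

end joinTable

/-! ### Joining tables -/

/-- No boundary is loaded. -/
def NoMarks (s : St) : Prop := ∀ v, s.a .ca v = 0 ∧ s.a .sa v = 0 ∧ s.a .cb v = 0 ∧ s.a .sb v = 0

/-- Loading and clearing take time linear in the boundaries; this absorbs them in the bound for the
join. -/
theorem card_le_prod_fac (G : Net) (A B U : Finset ℕ) : U.card < ∏ v ∈ U, G.fac A B v := by
  have : 2 ^ U.card ≤ ∏ v ∈ U, G.fac A B v := by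
    rw [← Finset.prod_const]
    exact Finset.prod_le_prod (fun _ _ => by omega) fun v _ => G.two_le_fac A B v
  exact (Nat.lt_two_pow_self).trans_le this

open Net in
theorem joinPrep_spec {G : Net} {s : St} {A B : Finset ℕ} (hA : A ⊆ Finset.range G.m)
    (hB : B ⊆ Finset.range G.m) (hd : Disjoint A B) (hI : Inp G s) (hN : NoMarks s)
    {stra strb : ℕ → ℕ} {sza szb : ℕ}
    (lA : BList s (G.ds + 2) (s.a .wp (s.v .y)) (s.a .wp (s.v .y) + s.a .wn (s.v .y)) (G.bd A)
      (G.degA A) stra sza)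
    (lB : BList s (G.ds + 2) (s.a .wp (s.v .x)) (s.a .wp (s.v .x) + s.a .wn (s.v .x)) (G.bd B)
      (G.degA B) strb szb) :
    ∃ s', joinPrep.exec s = s' ∧ s'.v .ba = s.a .base (s.v .y) ∧ s'.v .bb = s.a .base (s.v .x) ∧
      s'.v .a1 = 0 ∧ s'.v .a2 = 0 ∧ s'.v .lp = s.v .lf ∧
      (∃ strc, BList s' (G.ds + 2) (s.v .lf) (s'.v .lf) (G.bd (A ∪ B)) (G.degA (A ∪ B)) strc
          (s'.v .sz) ∧
        ∀ q, q ∈ s'.seg (s'.v .lo) (s'.v .hi) ↔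
          G.Combos A B (G.bd A ∪ G.bd B) stra strb strc q) ∧
      (∀ i < s.v .lf, s'.a .lv i = s.a .lv i ∧ s'.a .lc i = s.a .lc i ∧ s'.a .ls i = s.a .ls i) ∧
      s'.v .hi - s'.v .lo ≤ ∏ v ∈ G.bd A ∪ G.bd B, G.fac A B v ∧
      (∀ v, v ∉ (Finset.range (s'.v .nu)).image (s'.a .uu) →
        s'.a .ca v = 0 ∧ s'.a .sa v = 0 ∧ s'.a .cb v = 0 ∧ s'.a .sb v = 0) ∧
      s'.v .nu ≤ ∏ v ∈ G.bd A ∪ G.bd B, G.fac A B v ∧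
      s'.tm ≤ s.tm + 250 * ∏ v ∈ G.bd A ∪ G.bd B, G.fac A B v := by
  refine ⟨_, rfl, ?_⟩
  simp only [joinPrep, exec_cons, exec_nil]
  generalize hs1 : joinStart.exec s = s1
  have a1 : s1.v .pa = s.a .wp (s.v .y) := by
    simp [← hs1, joinStart, exec_cons, exec_nil, exec_set]
  have a2 : s1.v .na = s.a .wn (s.v .y) := by
    simp [← hs1, joinStart, exec_cons, exec_nil, exec_set]
  have a3 : s1.v .pb = s.a .wp (s.v .x) := by
    simp [← hs1, joinStart, exec_cons, exec_nil, exec_set]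
  have a4 : s1.v .nb = s.a .wn (s.v .x) := by
    simp [← hs1, joinStart, exec_cons, exec_nil, exec_set]
  have a5 : s1.v .ba = s.a .base (s.v .y) := by
    simp [← hs1, joinStart, exec_cons, exec_nil, exec_set]
  have a6 : s1.v .bb = s.a .base (s.v .x) := by
    simp [← hs1, joinStart, exec_cons, exec_nil, exec_set]
  have a7 : s1.v .nu = 0 := by simp [← hs1, joinStart, exec_cons, exec_nil, exec_set]
  have a8 : s1.a = s.a := by simp [← hs1, joinStart, exec_cons, exec_nil, exec_set]
  have a9 : s1.v .lf = s.v .lf := by simp [← hs1, joinStart, exec_cons, exec_nil, exec_set]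
  have a10 : s1.v .dst = s.v .dst := by simp [← hs1, joinStart, exec_cons, exec_nil, exec_set]
  have a11 : s1.v .D = s.v .D := by simp [← hs1, joinStart, exec_cons, exec_nil, exec_set]
  have a12 : s1.tm = s.tm + 8 := by simp [← hs1, joinStart, exec_cons, exec_nil, exec_set]
  clear hs1
  have lA1 : BList s1 (G.ds + 2) (s1.v .pa) (s1.v .pa + s1.v .na) (G.bd A) (G.degA A) stra sza := by
    rw [a1, a2]; exact lA.congr (by simp [a8]) (by simp [a8]) (by simp [a8])
  obtain ⟨b1, b2, b3, b4, b5⟩ := loadA_spec lA1 a7 (by funext v; rw [a8]; exact (hN v).1)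
    (by funext v; rw [a8]; exact (hN v).2.1)
  have f1 := exec_frame loadA s1
  generalize loadA.exec s1 = s2 at *
  have c1 := (f1.v .pb (by decide)).trans a3
  have c2 := (f1.v .nb (by decide)).trans a4
  have c3 := (f1.v .ba (by decide)).trans a5
  have c4 := (f1.v .bb (by decide)).trans a6
  have c5 := (f1.v .lf (by decide)).trans a9
  have c6 := (f1.v .dst (by decide)).trans a10
  have c7 := (f1.v .D (by decide)).trans a11
  have c8 := (f1.a .lv (by decide)).trans (congrFun a8 _)
  have c9 := (f1.a .lc (by decide)).trans (congrFun a8 _)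
  have c10 := (f1.a .ls (by decide)).trans (congrFun a8 _)
  have c11 := (f1.a .dem (by decide)).trans (congrFun a8 _)
  have c12 := (f1.a .deg (by decide)).trans (congrFun a8 _)
  have c13 := (f1.a .cb (by decide)).trans (congrFun a8 _)
  have c14 := (f1.a .sb (by decide)).trans (congrFun a8 _)
  have lB2 : BList s2 (G.ds + 2) (s2.v .pb) (s2.v .pb + s2.v .nb) (G.bd B) (G.degA B) strb szb := by
    rw [c1, c2]; exact lB.congr (by simp [c8]) (by simp [c9]) (by simp [c10])
  obtain ⟨d1, d2, d3, d4, d5⟩ := loadB_spec (V := G.bd A) lB2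
    (by rw [c13]; funext v; exact (hN v).2.2.1) (by rw [c14]; funext v; exact (hN v).2.2.2)
    (fun v => by rw [b1]; exact lA.radix.pos v) b4 b3
  have f2 := exec_frame loadB s2
  generalize loadB.exec s2 = s3 at *
  have e1 := (f2.v .ba (by decide)).trans c3
  have e2 := (f2.v .bb (by decide)).trans c4
  have e3 := (f2.v .lf (by decide)).trans c5
  have e4 := (f2.v .dst (by decide)).trans c6
  have e5 := (f2.v .D (by decide)).trans c7
  have e6 := (f2.a .lv (by decide)).trans c8
  have e7 := (f2.a .lc (by decide)).trans c9
  have e8 := (f2.a .ls (by decide)).trans c10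
  have e9 := (f2.a .dem (by decide)).trans c11
  have e10 := (f2.a .deg (by decide)).trans c12
  have e11 := (f2.a .sa (by decide)).trans b1
  have e12 : ∀ v, s3.a .ca v = _ := fun v => (congrFun (f2.a .ca (by decide)) v).trans (b2 v)
  have f3 := exec_frame firstGen s3
  generalize hs4 : firstGen.exec s3 = s4
  rw [hs4] at f3
  have g1 : s4.v .lo = 0 := by simp [← hs4, firstGen, exec_cons, exec_nil, exec_set, exec_put]
  have g2 : s4.v .hi = 1 := by simp [← hs4, firstGen, exec_cons, exec_nil, exec_set, exec_put]
  have g3 : s4.g 0 = (0, 0, 0, 0) := by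
    simp [← hs4, firstGen, exec_cons, exec_nil, exec_set, exec_put, St.g]
  have g4 : s4.v .sz = 1 := by simp [← hs4, firstGen, exec_cons, exec_nil, exec_set, exec_put]
  have g5 : s4.v .lp = s.v .lf := by
    simp [← hs4, firstGen, exec_cons, exec_nil, exec_set, exec_put, e3]
  have g6 : s4.v .a1 = 0 := by simp [← hs4, firstGen, exec_cons, exec_nil, exec_set, exec_put]
  have g7 : s4.v .a2 = 0 := by simp [← hs4, firstGen, exec_cons, exec_nil, exec_set, exec_put]
  have g8 : s4.tm = s3.tm + 11 := by
    simp [← hs4, firstGen, exec_cons, exec_nil, exec_set, exec_put]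
  clear hs4
  have h1 := (f3.v .ba (by decide)).trans e1
  have h2 := (f3.v .bb (by decide)).trans e2
  have h3 := (f3.v .lf (by decide)).trans e3
  have h4 := (f3.v .dst (by decide)).trans e4
  have h5 := (f3.v .D (by decide)).trans e5
  have h6 := (f3.a .lv (by decide)).trans e6
  have h7 := (f3.a .lc (by decide)).trans e7
  have h8 := (f3.a .ls (by decide)).trans e8
  have h9 := (f3.a .dem (by decide)).trans e9
  have h10 := (f3.a .deg (by decide)).trans e10
  have h11 := (f3.a .sa (by decide)).trans e11
  have h12 : ∀ v, s4.a .ca v = _ := fun v => (congrFun (f3.a .ca (by decide)) v).trans (e12 v)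
  have h13 := (f3.a .sb (by decide)).trans d1
  have h14 : ∀ v, s4.a .cb v = _ := fun v => (congrFun (f3.a .cb (by decide)) v).trans (d2 v)
  have h15 := f3.v .nu (by decide)
  have h16 := f3.a .uu (by decide)
  have hinj : Set.InjOn (s4.a .uu) (Set.Iio (s4.v .nu)) := by
    have : Set.InjOn (s3.a .uu) (Finset.range (s3.v .nu) : Finset ℕ) := by
      rw [← Finset.card_image_iff, d3, d4, Finset.card_range]
    rw [h15, h16]
    simpa using this
  obtain ⟨strc, i1, i2, i3, i4, i5, i6⟩ := allVertices_spec hA hB hd (s := s4)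
    ⟨h4.trans hI.dst, h5.trans hI.D, h9.trans hI.dem, h10.trans hI.deg⟩
    ⟨fun v => by rw [h11]; exact lA.radix.pos v, h12⟩
    ⟨fun v => by rw [h13]; exact lB.radix.pos v, h14⟩
    (by rw [h15, h16]; exact d3) hinj g1 g2 g3 g4
  have f4 := exec_frame allVertices s4
  generalize allVertices.exec s4 = s5 at *
  rw [h3] at i1 i3
  rw [h11, h13] at i2
  have hcard : s3.v .nu < ∏ v ∈ G.bd A ∪ G.bd B, G.fac A B v := by
    rw [d4]; exact card_le_prod_fac G A B _
  refine ⟨(f4.v .ba (by decide)).trans h1, (f4.v .bb (by decide)).trans h2,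
    (f4.v .a1 (by decide)).trans g6, (f4.v .a2 (by decide)).trans g7,
    (f4.v .lp (by decide)).trans g5,
    ⟨strc, i1.congr (fun _ _ => rfl) (fun _ _ => rfl) (fun _ _ => rfl), i2⟩, fun i hi => ?_,
    i4, fun v hv => ?_, ?_, ?_⟩
  · obtain ⟨x, y, z⟩ := i3 i hi
    rw [h6] at x
    rw [h7] at y
    rw [h8] at z
    exact ⟨x, y, z⟩
  · simp only [tick_v, tick_a, f4.v .nu (by decide), f4.a .uu (by decide), h15, h16, d3,
      Finset.mem_union, not_or] at hv
    simp only [tick_a, f4.a .ca (by decide), f4.a .sa (by decide), f4.a .cb (by decide),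
      f4.a .sb (by decide), h11, h12, h13, h14, if_neg hv.1, if_neg hv.2]
    exact ⟨trivial, Nat.eq_zero_of_not_pos ((lA.radix.pos v).not.2 hv.1), trivial,
      Nat.eq_zero_of_not_pos ((lB.radix.pos v).not.2 hv.2)⟩
  · simp only [tick_v, f4.v .nu (by decide), h15]; omega
  · simp only [tick_tm]
    have x1 : (G.bd A).card ≤ s3.v .nu := by
      rw [d4]; exact Finset.card_le_card Finset.subset_union_left
    have x2 : (G.bd B).card ≤ s3.v .nu := by
      rw [d4]; exact Finset.card_le_card Finset.subset_union_right
    omega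

-- The time is a constant times the number of combinations. The tables of all nodes other than `y`
-- persist, because only the registration of `y` is redirected.
open Net in
theorem join_spec {G : Net} {s : St} {sol : ℕ → Finset ℕ} {A B : Finset ℕ}
    (hA : A ⊆ Finset.range G.m) (hB : B ⊆ Finset.range G.m) (hd : Disjoint A B) (hI : Inp G s)
    (hN : NoMarks s) (hM : Mem s sol) (tA : TableOK G s sol A (s.v .y))
    (tB : TableOK G s sol B (s.v .x)) :
    ∃ s', join.exec s = s' ∧ ∃ sol', Mem s' sol' ∧ NoMarks s' ∧ Inp G s' ∧
      TableOK G s' sol' (A ∪ B) (s.v .y) ∧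
      (∀ z E, z ≠ s.v .y → TableOK G s sol E z → TableOK G s' sol' E z) ∧
      s'.v .free = s.v .free + (G.ds + 2) ^ (G.bd (A ∪ B)).card ∧
      s'.tm ≤ s.tm + 300 * ∏ v ∈ G.bd A ∪ G.bd B, G.fac A B v := by
  have hC := Finset.union_subset hA hB
  obtain ⟨stra, sza, tA'⟩ := tA
  obtain ⟨strb, szb, tB'⟩ := tB
  obtain ⟨s1, hs1, b1, b2, b3, b4, b5, ⟨strc, b6, b7⟩, b8, b9, b10, b11, b12⟩ :=
    joinPrep_spec hA hB hd hI hN tA'.list tB'.list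
  refine ⟨_, rfl, ?_⟩
  have hfr := exec_frame join s
  simp only [join, exec_cons, exec_nil] at hfr ⊢
  have f1 := exec_frame joinPrep s
  rw [hs1] at f1 hfr ⊢
  have c1 := f1.v .free (by decide)
  have c2 := f1.v .x (by decide)
  have c3 := f1.v .y (by decide)
  have c4 : ∀ p, s1.ent p = s.ent p := fun p => by
    simp only [St.ent, f1.a .cst (by decide), f1.a .el (by decide), f1.a .er (by decide),
      f1.a .eU (by decide), f1.a .eV (by decide)]
  have c5 := f1.a .base (by decide)
  have c6 := f1.a .wp (by decide)
  have c7 := f1.a .wn (by decide)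
  have hlf : s.v .lf ≤ s1.v .lf := by have := b6.len; omega
  have tA1 : Table G s1 sol A _ _ _ stra sza := tA'.mono b8 hlf (by omega) (fun p _ => c4 p)
    (fun _ _ => rfl)
  have tB1 : Table G s1 sol B _ _ _ strb szb := tB'.mono b8 hlf (by omega) (fun p _ => c4 p)
    (fun _ _ => rfl)
  have hM1 : Mem s1 sol := by
    have hel : ∀ p, s1.a .el p = s.a .el p := fun p => congrArg (fun q => q.2.1) (c4 p)
    have her : ∀ p, s1.a .er p = s.a .er p := fun p => congrArg (fun q => q.2.2.1) (c4 p)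
    have heU : ∀ p, s1.a .eU p = s.a .eU p := fun p => congrArg (fun q => q.2.2.2.1) (c4 p)
    have heV : ∀ p, s1.a .eV p = s.a .eV p := fun p => congrArg (fun q => q.2.2.2.2) (c4 p)
    refine ⟨by rw [c1]; exact hM.free_pos, fun p hp => by rw [c4]; exact hM.zero p (c1 ▸ hp),
      hM.sol_zero, by rw [c4]; exact hM.ent_zero, fun p hp => ?_, fun p => ?_⟩
    · rw [hel, her]; exact hM.lt p hp
    · rw [hel, her, heU, heV]; exact hM.eq p
  have hb := fun q hq => combos_bound hA hB hd tA1 tB1 b6.radix ((b7 q).1 hq)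
  obtain ⟨d1, d2⟩ := joinFill_spec (s := s1) hM1.zero b3 b4 (fun q hq => by
    rw [b1, b2]; exact ⟨(hb q hq).1, (hb q hq).2.1, fun x y => ((hb q hq).2.2.2 x y).1⟩)
  have f2 := exec_frame joinFill s1
  generalize joinFill.exec s1 = s2 at *
  obtain ⟨e1, e2⟩ := clearMarks_spec (s := s2) (by
    simp only [f2.v .nu (by decide), f2.a .uu (by decide), f2.a .ca (by decide),
      f2.a .sa (by decide), f2.a .cb (by decide), f2.a .sb (by decide)]
    exact b10)
  have f3 := exec_frame clearMarks s2
  generalize clearMarks.exec s2 = s3 at *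
  have g1 : s3.v .free = s.v .free :=
    (f3.v .free (by decide)).trans ((f2.v .free (by decide)).trans c1)
  have g2 : s3.v .y = s.v .y := (f3.v .y (by decide)).trans ((f2.v .y (by decide)).trans c3)
  have g3 : s3.v .lf = s1.v .lf := (f3.v .lf (by decide)).trans (f2.v .lf (by decide))
  have g4 : s3.v .lp = s.v .lf := (f3.v .lp (by decide)).trans ((f2.v .lp (by decide)).trans b5)
  have g5 : s3.v .sz = s1.v .sz := (f3.v .sz (by decide)).trans (f2.v .sz (by decide))
  have g6 : s3.a .base = s.a .base :=
    (f3.a .base (by decide)).trans ((f2.a .base (by decide)).trans c5)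
  have g7 : s3.a .wp = s.a .wp := (f3.a .wp (by decide)).trans ((f2.a .wp (by decide)).trans c6)
  have g8 : s3.a .wn = s.a .wn := (f3.a .wn (by decide)).trans ((f2.a .wn (by decide)).trans c7)
  have g9 : ∀ p, s3.ent p = s2.ent p := fun p => by
    simp only [St.ent, f3.a .cst (by decide), f3.a .el (by decide), f3.a .er (by decide),
      f3.a .eU (by decide), f3.a .eV (by decide)]
  have g10 : s3.a .lv = s1.a .lv := (f3.a .lv (by decide)).trans (f2.a .lv (by decide))
  have g11 : s3.a .lc = s1.a .lc := (f3.a .lc (by decide)).trans (f2.a .lc (by decide))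
  have g12 : s3.a .ls = s1.a .ls := (f3.a .ls (by decide)).trans (f2.a .ls (by decide))
  generalize hs4 : joinEnd.exec s3 = s4 at *
  have i1 : s4.v .free = s.v .free + s1.v .sz := by
    simp [← hs4, joinEnd, exec_cons, exec_nil, exec_set, exec_put, g1, g5]
  have i2 : s4.v .lf = s1.v .lf := by
    simp [← hs4, joinEnd, exec_cons, exec_nil, exec_set, exec_put, g3]
  have i3 : s4.a .base = Function.update (s.a .base) (s.v .y) (s.v .free) := by
    simp [← hs4, joinEnd, exec_cons, exec_nil, exec_set, exec_put, g1, g2, g6]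
  have i4 : s4.a .wp = Function.update (s.a .wp) (s.v .y) (s.v .lf) := by
    simp [← hs4, joinEnd, exec_cons, exec_nil, exec_set, exec_put, g4, g2, g7]
  have i5 : s4.a .wn = Function.update (s.a .wn) (s.v .y) (s1.v .lf - s.v .lf) := by
    simp [← hs4, joinEnd, exec_cons, exec_nil, exec_set, exec_put, g4, g3, g2, g8]
  have i6 : ∀ p, s4.ent p = s2.ent p := fun p => by
    rw [← g9]; simp [← hs4, joinEnd, exec_cons, exec_nil, exec_set, exec_put, St.ent]
  have i7 : s4.tm = s3.tm + 5 := by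
    simp [← hs4, joinEnd, exec_cons, exec_nil, exec_set, exec_put]
  have f4 := exec_frame joinEnd s3
  rw [hs4] at f4
  clear hs4
  have i8 : ∀ i, s4.a .lv i = s1.a .lv i ∧ s4.a .lc i = s1.a .lc i ∧ s4.a .ls i = s1.a .ls i :=
    fun i => by rw [f4.a .lv (by decide), f4.a .lc (by decide), f4.a .ls (by decide), g10, g11,
                  g12]; simp
  have hsz : 0 < s1.v .sz := by rw [b6.radix.size]; positivity
  have hM4 : Mem s4 (extSol (s1.v .free) s2 sol) := by
    refine hM1.fill d1 (sz := s1.v .sz) ?_ i6 (by rw [i1, c1])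
    rintro p c l r d ⟨q, hq, h1, h2, h3⟩
    simp only [Prod.mk.injEq] at h3
    have h4 := hb q hq
    rw [b1, b2] at h3
    omega
  refine ⟨extSol (s1.v .free) s2 sol, ⟨hM4.1, hM4.2, hM4.3, hM4.4, hM4.5, hM4.6⟩,
    fun v => ?_, ⟨?_, ?_, ?_, ?_⟩, ?_, fun z E hz hE => ?_, ?_, ?_⟩
  · simp only [tick_a, f4.a .ca (by decide), f4.a .sa (by decide), f4.a .cb (by decide),
      f4.a .sb (by decide)]
    exact e1 v
  · exact (hfr.v .dst (by decide)).trans hI.dst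
  · exact (hfr.v .D (by decide)).trans hI.D
  · exact (hfr.a .dem (by decide)).trans hI.dem
  · exact (hfr.a .deg (by decide)).trans hI.deg
  · refine ⟨strc, s1.v .sz, ?_⟩
    have hlen : s.v .lf + (s1.v .lf - s.v .lf) = s1.v .lf := by omega
    simp only [tick_a, i3, i4, i5, Function.update_self, hlen]
    refine ⟨b6.congr (fun i _ => (i8 i).1) (fun i _ => (i8 i).2.1) (fun i _ => (i8 i).2.2),
      by simp [i2], by simp [i1], fun σ hσ => ?_⟩
    have := join_entry hA hB hd tA1 tB1 b6.radix b1 b2 b7 d1 hσ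
    rw [c1] at this ⊢
    rw [show s4.tick.a .cst _ = s2.a .cst _ from congrArg Prod.fst (i6 _)]
    exact this
  · obtain ⟨str, sz, hT⟩ := hE
    refine ⟨str, sz, ?_⟩
    simp only [tick_a, i3, i4, i5, Function.update_of_ne hz]
    refine hT.mono (fun i hi => ?_) (by simp [i2, hlf]) (by simp [i1]) (fun p hp => ?_)
      (fun p hp => ?_)
    · obtain ⟨x, y, z⟩ := i8 i
      obtain ⟨x', y', z'⟩ := b8 i hi
      exact ⟨x.trans x', y.trans y', z.trans z'⟩
    · exact (i6 p).trans ((d1.below p (by omega)).trans (c4 p))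
    · rw [extSol, if_pos (by omega)]
  · simp only [tick_v, i1, b6.radix.size]
  · have x1 := f2.v .nu (by decide)
    have x2 := card_le_prod_fac G A B (G.bd A ∪ G.bd B)
    simp only [tick_tm]
    omega

/-! ### Tables of single edges -/

theorem ite_pos_iff (e f g : Ex) (s : St) : 0 < (Ex.ite e f g).eval s ↔
    0 < e.eval s ∧ 0 < f.eval s ∨ ¬ 0 < e.eval s ∧ 0 < g.eval s := by
  by_cases h : 0 < e.eval s
  · rw [show (Ex.ite e f g).eval s = f.eval s from if_pos h]; tauto
  · rw [show (Ex.ite e f g).eval s = g.eval s from if_neg h]; tauto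

/-- The candidate for the table at the address `f` of the edge `k`, with strides `e1` and `e2` and
values `x` and `y` at the two ends. -/
def leafCand (G : Net) (k f e1 e2 x y : ℕ) : ℕ × ℕ × ℕ × ℕ × ℕ × ℕ :=
  (f + (x * e1 + y * e2), 1 + ((if x = 0 then 1 else 0) + (if y = 0 then 1 else 0)), 0, 0,
    if x = 0 then G.eu k + 1 else 0, if y = 0 then G.ev k + 1 else 0)

/-- The candidates whose values satisfy `X`. -/
def leafCands (G : Net) (k f e1 e2 : ℕ) (X : ℕ → ℕ → Prop) : Set (ℕ × ℕ × ℕ × ℕ × ℕ × ℕ) :=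
  {c | ∃ x y, X x y ∧ G.LeafOpt k x y ∧ c = leafCand G k f e1 e2 x y}

/-- The variables are set for filling the table of the edge `k`. -/
structure LeafReady (G : Net) (k : ℕ) (s : St) : Prop where
  u : s.v .u = G.eu k
  w : s.v .w = G.ev k
  e1 : 0 < s.v .e1 ↔ 1 < G.dg (G.eu k)
  e2 : 0 < s.v .e2 ↔ 1 < G.dg (G.ev k)
  l : s.v .l = 0
  r : s.v .r = 0
  D : s.v .D = G.ds + 2
  dem : s.a .dem = G.d

theorem LeafReady.congr {G : Net} {k : ℕ} {s s' : St} (h : LeafReady G k s)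
    (hv : ∀ x ∈ [Var.u, .w, .e1, .e2, .l, .r, .D], s'.v x = s.v x) (ha : s'.a .dem = s.a .dem) :
    LeafReady G k s' := by
  simp only [List.forall_mem_cons, List.not_mem_nil, false_imp_iff, implies_true, and_true] at hv
  obtain ⟨h1, h2, h3, h4, h5, h6, h7⟩ := hv
  exact ⟨h1.trans h.u, h2.trans h.w, h3 ▸ h.e1, h4 ▸ h.e2, h5.trans h.l, h6.trans h.r,
    h7.trans h.D, ha.trans h.dem⟩

theorem leafCond_eval {G : Net} {k : ℕ} {s : St} (h : LeafReady G k s) (h1 : s.v .j1 < 3)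
    (h2 : s.v .j2 < 3) : 0 < leafCond.eval s ↔ G.LeafOpt k (s.v .j1) (s.v .j2) := by
  simp only [leafCond, andE, ite_pos_iff]
  simp only [Ex.eval, h.u, h.w, h.e1, h.e2, h.D, h.dem, Net.LeafOpt]
  by_cases ha : 1 < G.dg (G.eu k) <;> by_cases hb : 1 < G.dg (G.ev k) <;>
    simp only [ha, hb, if_true, if_false, true_and, false_and, not_true, not_false_iff, false_or,
      or_false] <;> omega

theorem leafEntry_spec {G : Net} {k f : ℕ} {s₀ s : St} {K : Set (ℕ × ℕ × ℕ × ℕ × ℕ × ℕ)}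
    (h : LeafReady G k s) (h1 : s.v .j1 < 3) (h2 : s.v .j2 < 3) (hF : Fill f s₀ s K)
    (hf : s.v .free = f) :
    (G.LeafOpt k (s.v .j1) (s.v .j2) → Fill f s₀ (leafEntry.exec s)
      (insert (leafCand G k f (s.v .e1) (s.v .e2) (s.v .j1) (s.v .j2)) K)) ∧
    (¬ G.LeafOpt k (s.v .j1) (s.v .j2) → Fill f s₀ (leafEntry.exec s) K) ∧
    (leafEntry.exec s).tm ≤ s.tm + 14 := by
  have hmul : ∀ (s : St) (j e : Var), s.v j < 3 → (mul2 j e).eval s = s.v j * s.v e := by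
    intro s j e hj
    simp only [mul2, Ex.eval]
    have : s.v j = 0 ∨ s.v j = 1 ∨ s.v j = 2 := by omega
    rcases this with h | h | h <;> simp [h, two_mul]
  rw [leafEntry, exec_ite]
  by_cases hL : G.LeafOpt k (s.v .j1) (s.v .j2)
  · rw [if_pos ((leafCond_eval h h1 h2).2 hL)]
    simp only [exec_cons, exec_nil]
    generalize hs1 : (Cmd.set .a2 _).exec ((Cmd.set .a1 _).exec ((Cmd.set .nc _).exec
      ((Cmd.set .p _).exec s.tick))) = s1
    have a1 : s1.v .p = f + (s.v .j1 * s.v .e1 + s.v .j2 * s.v .e2) := by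
      rw [← hmul s _ _ h1, ← hmul s _ _ h2, ← hf, ← hs1]; simp [exec_set]; rfl
    have a2 : s1.v .nc = 1 + ((if s.v .j1 = 0 then 1 else 0) + (if s.v .j2 = 0 then 1 else 0)) := by
      rw [← hs1]; simp [exec_set, Nat.pos_iff_ne_zero]
    have a3 : s1.v .a1 = if s.v .j1 = 0 then G.eu k + 1 else 0 := by
      rw [← hs1]; simp [exec_set, Nat.pos_iff_ne_zero, h.u]
    have a4 : s1.v .a2 = if s.v .j2 = 0 then G.ev k + 1 else 0 := by
      rw [← hs1]; simp [exec_set, Nat.pos_iff_ne_zero, h.w]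
    have a5 : s1.a = s.a := by rw [← hs1]; simp [exec_set]
    have a6 : s1.v .l = 0 := by rw [← hs1]; simp [exec_set, h.l]
    have a7 : s1.v .r = 0 := by rw [← hs1]; simp [exec_set, h.r]
    have a8 : s1.tm = s.tm + 5 := by rw [← hs1]; simp [exec_set]
    clear hs1
    obtain ⟨b1, b2⟩ := relax_spec (hF.congr (s' := s1) fun p => by simp [St.ent, a5]) (by omega)
      (by omega)
    refine ⟨fun _ => ?_, fun h => absurd hL h, by simp; omega⟩
    rw [a1, a2, a3, a4, a6, a7] at b1
    exact b1.congr fun _ => rfl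
  · rw [if_neg fun h' => hL ((leafCond_eval h h1 h2).1 h'), exec_skip]
    exact ⟨fun h => absurd h hL, fun _ => hF.congr fun _ => rfl, by simp⟩

theorem leafCands_congr {G : Net} {k f e1 e2 : ℕ} {X Y : ℕ → ℕ → Prop}
    (h : ∀ x y, G.LeafOpt k x y → (X x y ↔ Y x y)) :
    leafCands G k f e1 e2 X = leafCands G k f e1 e2 Y := by
  ext c
  constructor
  · rintro ⟨x, y, hx, hl, rfl⟩; exact ⟨x, y, (h x y hl).1 hx, hl, rfl⟩
  · rintro ⟨x, y, hx, hl, rfl⟩; exact ⟨x, y, (h x y hl).2 hx, hl, rfl⟩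

theorem leafCands_step {G : Net} {k f e1 e2 x y : ℕ} {X Y : ℕ → ℕ → Prop} {s₀ s : St}
    (h1 : G.LeafOpt k x y → Fill f s₀ s (insert (leafCand G k f e1 e2 x y)
      (leafCands G k f e1 e2 X)))
    (h2 : ¬ G.LeafOpt k x y → Fill f s₀ s (leafCands G k f e1 e2 X))
    (hXY : ∀ x' y', Y x' y' ↔ X x' y' ∨ x' = x ∧ y' = y) :
    Fill f s₀ s (leafCands G k f e1 e2 Y) := by
  by_cases hL : G.LeafOpt k x y
  · convert h1 hL using 1
    ext c
    constructor
    · rintro ⟨x', y', h, hl, rfl⟩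
      rcases (hXY _ _).1 h with h | ⟨rfl, rfl⟩
      · exact Or.inr ⟨x', y', h, hl, rfl⟩
      · exact Or.inl rfl
    · rintro (rfl | ⟨x', y', h, hl, rfl⟩)
      · exact ⟨x, y, (hXY _ _).2 (Or.inr ⟨rfl, rfl⟩), hL, rfl⟩
      · exact ⟨x', y', (hXY _ _).2 (Or.inl h), hl, rfl⟩
  · convert h2 hL using 1
    ext c
    constructor
    · rintro ⟨x', y', h, hl, rfl⟩
      rcases (hXY _ _).1 h with h | ⟨rfl, rfl⟩
      · exact ⟨x', y', h, hl, rfl⟩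
      · exact absurd hl hL
    · rintro ⟨x', y', h, hl, rfl⟩
      exact ⟨x', y', (hXY _ _).2 (Or.inl h), hl, rfl⟩

/-- A single edge supplies at most one neighbour, so values above two are infeasible and nine pairs
suffice, whatever `d*` is. -/
theorem leafFill_spec {G : Net} {k : ℕ} {s : St} (h : LeafReady G k s)
    (hz : ∀ p, s.v .free ≤ p → s.ent p = (0, 0, 0, 0, 0)) :
    Fill (s.v .free) s (leafFill.exec s)
      (leafCands G k (s.v .free) (s.v .e1) (s.v .e2) fun _ _ => True) ∧
    (leafFill.exec s).tm ≤ s.tm + 170 := by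
  have := loop_rule (x := .j1) (e := .c 3) (s := s) (c := .loop .j2 (.c 3) leafEntry)
    (fun i s' => Fill (s.v .free) s s'
      (leafCands G k (s.v .free) (s.v .e1) (s.v .e2) fun x _ => x < i) ∧
      s'.tm ≤ s.tm + 1 + 50 * i) ?_ ?_
  · obtain ⟨h1, h2⟩ := this
    refine ⟨?_, h2.trans (by simp only [Ex.eval]; omega)⟩
    rw [leafCands_congr (Y := fun x _ => x < (Ex.c 3).eval s) fun x y hl => by
      simpa only [Ex.eval, true_iff] using hl.1]
    exact h1
  · refine ⟨⟨fun p hp h => ?_, ?_, fun p hp _ => hz p hp, fun _ _ => rfl⟩, by simp⟩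
    · have := congrArg Prod.fst (hz p hp)
      simp [St.ent] at this h
      omega
    · rintro p c d ⟨x, y, h, -⟩; omega
  · rintro i hi s1 hf ⟨hF, ht⟩
    simp only [Ex.eval] at hi
    have e1 : s1.v .e1 = s.v .e1 := hf.v _ (by decide)
    have e2 : s1.v .e2 = s.v .e2 := hf.v _ (by decide)
    have e3 : s1.v .free = s.v .free := hf.v _ (by decide)
    have hr : LeafReady G k s1 := h.congr (fun x hx => hf.v _ (by revert x; decide))
      (hf.a _ (by decide))
    have := loop_rule (x := .j2) (e := .c 3) (s := (s1.setv .j1 i).tick) (c := leafEntry)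
      (fun j s' => Fill (s.v .free) s s'
        (leafCands G k (s.v .free) (s.v .e1) (s.v .e2) fun x y => x < i ∨ x = i ∧ y < j) ∧
        s'.tm ≤ s1.tm + 2 + 15 * j) ?_ ?_
    · obtain ⟨h1, h2⟩ := this
      refine ⟨?_, by simp only [Ex.eval] at h2; omega⟩
      rw [leafCands_congr (Y := fun x y => x < i ∨ x = i ∧ y < (Ex.c 3).eval
        (s1.setv .j1 i).tick) fun x y hl => by have := hl.2.1; simp only [Ex.eval]; omega]
      exact h1
    · refine ⟨?_, by simp⟩
      rw [leafCands_congr (Y := fun x y => x < i) fun x y hl => by omega]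
      exact hF.congr fun _ => rfl
    · rintro j hj s2 hf2 ⟨hF2, ht2⟩
      simp only [Ex.eval] at hj
      have g1 : s2.v .e1 = s.v .e1 := (hf2.v _ (by decide)).trans (by simp [e1])
      have g2 : s2.v .e2 = s.v .e2 := (hf2.v _ (by decide)).trans (by simp [e2])
      have g3 : s2.v .free = s.v .free := (hf2.v _ (by decide)).trans (by simp [e3])
      have g4 : s2.v .j1 = i := (hf2.v _ (by decide)).trans (by simp)
      have hr2 : LeafReady G k (s2.setv .j2 j).tick := hr.congr
        (fun x hx => by
          have := hf2.v x (by revert x; decide)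
          revert x; simp) (by
          have := hf2.a .dem (by decide)
          simpa using this)
      obtain ⟨k1, k2, k3⟩ := leafEntry_spec (f := s.v .free) (s₀ := s) hr2 (by simp [g4]; exact hi)
        (by simp; exact hj) (hF2.congr fun _ => rfl) (by simp [g3])
      refine ⟨leafCands_step (x := i) (y := j) (X := fun x y => x < i ∨ x = i ∧ y < j) ?_ ?_ fun x' y' => ?_, ?_⟩
      · convert k1 using 2 <;> simp [g1, g2, g4]
      · convert k2 using 2 <;> simp [g1, g2, g4]
      · omega
      · simp at k3 ⊢; omega

/-- The cost of order `D` arises only when the end is appended, and then the size of the table is a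
positive multiple of `D`; so the time is bounded by the size. -/
theorem leafEnd_spec {e : Var} (he : e = .e1 ∨ e = .e2) {s : St} {D p : ℕ} {W : Finset ℕ}
    {cnt str : ℕ → ℕ} (h : BList s D p (s.v .lf) W cnt str (s.v .sz)) (hD : s.v .D = D)
    (hD0 : 0 < D) (hv : s.v .v ∉ W) (hc : s.v .c = cnt (s.v .v)) :
    ∃ str' : ℕ → ℕ, (∀ u, u ≠ s.v .v → str' u = str u) ∧
    ((leafEnd e).exec s).v e = str' (s.v .v) ∧
    BList ((leafEnd e).exec s) D p (((leafEnd e).exec s).v .lf)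
      (if 1 < s.a .deg (s.v .v) then insert (s.v .v) W else W) cnt str'
      (((leafEnd e).exec s).v .sz) ∧
    s.v .lf ≤ ((leafEnd e).exec s).v .lf ∧
    (∀ i < s.v .lf, ((leafEnd e).exec s).a .lv i = s.a .lv i ∧
      ((leafEnd e).exec s).a .lc i = s.a .lc i ∧ ((leafEnd e).exec s).a .ls i = s.a .ls i) ∧
    s.v .sz ≤ ((leafEnd e).exec s).v .sz ∧
    ((leafEnd e).exec s).tm ≤ s.tm + 14 + 2 * ((leafEnd e).exec s).v .sz := by
  have hsz : 0 < s.v .sz := by rw [h.radix.size]; positivity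
  simp only [leafEnd, exec_cons, exec_nil, exec_ite]
  generalize hs1 : (Cmd.set e (.c 0)).exec s = s1
  have a1 : s1.v e = 0 := by simp [← hs1, exec_set]
  have a2 : ∀ x, x ≠ e → s1.v x = s.v x := fun x hx => by simp [← hs1, exec_set, hx]
  have a3 : s1.a = s.a := by simp [← hs1, exec_set]
  have a4 : s1.tm = s.tm + 1 := by simp [← hs1, exec_set]
  clear hs1
  have nv : Var.v ≠ e ∧ Var.lf ≠ e ∧ Var.sz ≠ e ∧ Var.D ≠ e ∧ Var.c ≠ e := by
    rcases he with rfl | rfl <;> decide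
  have hm : e ∉ append.mv := by rcases he with rfl | rfl <;> decide
  obtain ⟨n1, n2, n3, n4, n5⟩ := nv
  have b1 := a2 _ n1
  have b2 := a2 _ n2
  have b3 := a2 _ n3
  have b4 := a2 _ n4
  have b5 := a2 _ n5
  simp only [Ex.eval, a3, b1, tsub_pos_iff_lt]
  by_cases hlt : 1 < s.a .deg (s.v .v)
  · simp only [hlt, if_true]
    generalize hs2 : (Cmd.set e (.v .sz)).exec s1.tick = s2
    have c1 : s2.v e = s.v .sz := by simp [← hs2, exec_set, b3]
    have c2 : ∀ x, x ≠ e → s2.v x = s.v x := fun x hx => by simp [← hs2, exec_set, hx, a2 x hx]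
    have c3 : s2.a = s.a := by simp [← hs2, exec_set, a3]
    have c4 : s2.tm = s.tm + 3 := by simp [← hs2, exec_set, a4]
    clear hs2
    have h2 : BList s2 D p (s2.v .lf) W cnt str (s2.v .sz) := by
      rw [c2 _ n2, c2 _ n3]
      exact h.congr (fun _ _ => by rw [c3]) (fun _ _ => by rw [c3]) (fun _ _ => by rw [c3])
    obtain ⟨d1, d2, d3, d4⟩ := append_spec h2 ((c2 _ n4).trans hD) hD0 (c2 _ n1 ▸ hv)
      (by rw [c2 _ n5, c2 _ n1, hc])
    have f := exec_frame append s2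
    have f1 := (f.v e hm).trans c1
    generalize append.exec s2 = s3 at *
    rw [c3, c2 _ n2] at d3
    rw [c2 _ n2] at d2
    rw [c2 _ n1, c2 _ n3] at d1
    have hsz3 : s3.v .sz = D * s.v .sz := by
      rw [d1.radix.size, Finset.card_insert_of_notMem hv, h.radix.size, pow_succ, mul_comm]
    have l1 : s.v .sz ≤ D * s.v .sz := Nat.le_mul_of_pos_left _ hD0
    have l2 : D ≤ D * s.v .sz := Nat.le_mul_of_pos_right _ hsz
    refine ⟨Function.update str (s.v .v) (s.v .sz), fun u hu => Function.update_of_ne hu _ _,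
      by simp [f1], d1.congr (fun _ _ => rfl) (fun _ _ => rfl) (fun _ _ => rfl), by simp [d2], d3,
      ?_, ?_⟩
    · simp only [tick_v]; omega
    · simp only [tick_v, tick_tm]; omega
  · simp only [hlt, if_false, exec_skip]
    have hz : str (s.v .v) = 0 := by
      have := h.radix.pos (s.v .v); simp only [hv, iff_false] at this; omega
    have h2 : BList s1 D p (s1.v .lf) W cnt str (s1.v .sz) := by
      rw [b2, b3]; exact h.congr (fun _ _ => by rw [a3]) (fun _ _ => by rw [a3])
        (fun _ _ => by rw [a3])
    refine ⟨str, fun _ _ => rfl, by simp [a1, hz],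
      h2.congr (fun _ _ => rfl) (fun _ _ => rfl) (fun _ _ => rfl), by simp [b2],
      fun i _ => by simp [a3], by simp [b3], ?_⟩
    simp; omega

/-- An end off the boundary has stride zero, so all its values share an address, and the entry keeps
the best of them. -/
theorem leaf_entry {G : Net} {k : ℕ} (hk : k < G.m) {s s' : St} {sol : ℕ → Finset ℕ}
    {str : ℕ → ℕ} {sz : ℕ} (hr : Radix (G.ds + 2) (G.bd {k}) str sz) (hsol : sol 0 = ∅)
    (hpos : 0 < s.v .free)
    (hF : Fill (s.v .free) s s' (leafCands G k (s.v .free) (str (G.eu k)) (str (G.ev k))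
      fun _ _ => True)) {σ : ℕ → ℕ} (hσ : ∀ v, σ v ≤ G.ds + 1) :
    G.EntryOK {k} σ (s'.a .cst (s.v .free + ∑ v ∈ G.bd {k}, σ v * str v))
      (extSol (s.v .free) s' sol (s.v .free + ∑ v ∈ G.bd {k}, σ v * str v)) := by
  have hne := G.ne k hk
  have hsum : ∀ σ : ℕ → ℕ, ∑ v ∈ G.bd {k}, σ v * str v =
      σ (G.eu k) * str (G.eu k) + σ (G.ev k) * str (G.ev k) := fun σ => by
    rw [← hr.sum_subset (Net.bd_subset_supp), Net.supp_singleton hk, Finset.sum_pair hne]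
  have su : 1 < G.dg (G.eu k) ↔ G.eu k ∈ G.bd {k} := by simp [Net.mem_bd_singleton hk]
  have sv : 1 < G.dg (G.ev k) ↔ G.ev k ∈ G.bd {k} := by simp [Net.mem_bd_singleton hk]
  set p := s.v .free + ∑ v ∈ G.bd {k}, σ v * str v with hp
  have main : 0 < s'.a .cst p → extSol (s.v .free) s' sol p ⊆ G.supp {k} ∧
      G.Feas {k} σ (extSol (s.v .free) s' sol p) ∧
      (extSol (s.v .free) s' sol p).card + 1 = s'.a .cst p := by
    intro hc
    obtain ⟨x, y, -, hl, he⟩ := hF.sound p (by omega) hc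
    simp only [St.ent, leafCand, Prod.mk.injEq] at he
    obtain ⟨e1, e2, e3, e4, e5, e6⟩ := he
    have hs : extSol (s.v .free) s' sol p = G.leafSol k x y := by
      rw [extSol, if_neg (by omega), e3, e4, e5, e6]
      simp only [hsol, Finset.empty_union, Net.leafSol]
      congr 1 <;> split_ifs <;> simp [one]
    -- The pair as an assignment, cut down to the boundary: a value off the boundary may exceed the
    -- permitted digits, but it does not affect the address.
    set τ : ℕ → ℕ := fun v => if v ∈ G.bd {k} then if v = G.eu k then x else y else 0 with hτ
    have hτ1 : ∀ v, τ v < G.ds + 2 := by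
      intro v
      obtain ⟨-, -, -, -, h5, h6⟩ := hl
      simp only [hτ]
      split_ifs with h1 h2
      · subst h2; rw [if_pos (su.2 h1)] at h5; omega
      · have := ((Net.mem_bd_singleton hk).1 h1)
        rcases this with ⟨h | h, h3⟩
        · exact absurd h h2
        · subst h; rw [if_pos h3] at h6; omega
      · omega
    have hs0 : ∀ v, v ∉ G.bd {k} → str v = 0 := fun v hv =>
      Nat.eq_zero_of_not_pos ((hr.pos v).not.2 hv)
    have hτ2 : ∑ v ∈ G.bd {k}, τ v * str v = x * str (G.eu k) + y * str (G.ev k) := by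
      rw [hsum]
      congr 1
      · by_cases h : G.eu k ∈ G.bd {k}
        · simp [hτ, h]
        · simp [hs0 _ h]
      · by_cases h : G.ev k ∈ G.bd {k}
        · simp [hτ, h, hne.symm]
        · simp [hs0 _ h]
    have hinj := hr.inj σ τ (fun v => by have := hσ v; omega) hτ1 (by omega)
    obtain ⟨k1, k2, k3⟩ := Net.leaf_sound hk (σ := σ) hl
      (fun h => by rw [hinj _ (su.1 h)]; simp [hτ, su.1 h])
      (fun h => by rw [hinj _ (sv.1 h)]; simp [hτ, sv.1 h, hne.symm])
    rw [hs]
    exact ⟨k1, k2, by omega⟩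
  refine ⟨fun h => (main h).1, fun h => (main h).2.1, fun h => (main h).2.2, fun S hS hf => ?_⟩
  obtain ⟨x, y, hl, h1, h2, h3⟩ := Net.leaf_complete hk hσ hS hf
  have hs0 : ∀ v, v ∉ G.bd {k} → str v = 0 := fun v hv =>
    Nat.eq_zero_of_not_pos ((hr.pos v).not.2 hv)
  have e1 : σ (G.eu k) * str (G.eu k) = x * str (G.eu k) := by
    by_cases h : G.eu k ∈ G.bd {k}
    · rw [h1 (su.2 h)]
    · simp [hs0 _ h]
  have e2 : σ (G.ev k) * str (G.ev k) = y * str (G.ev k) := by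
    by_cases h : G.ev k ∈ G.bd {k}
    · rw [h2 (sv.2 h)]
    · simp [hs0 _ h]
  have := hF.best p (1 + ((if x = 0 then 1 else 0) + (if y = 0 then 1 else 0))) _
    ⟨x, y, trivial, hl, by
      rw [leafCand, hp, hsum, e1, e2]⟩
  omega

theorem leafTable_spec {G : Net} {s : St} {sol : ℕ → Finset ℕ} (hk : s.v .k < G.m)
    (hI : Inp G s) (hu : s.a .eu (s.v .k) = G.eu (s.v .k)) (hw : s.a .ev (s.v .k) = G.ev (s.v .k))
    (hM : Mem s sol) :
    ∃ s', leafTable.exec s = s' ∧ ∃ sol', Mem s' sol' ∧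
      TableOK G s' sol' {s.v .k} (s.a .et (s.v .k)) ∧
      (∀ z E, z ≠ s.a .et (s.v .k) → TableOK G s sol E z → TableOK G s' sol' E z) ∧
      s'.v .free = s.v .free + (G.ds + 2) ^ (G.bd {s.v .k}).card ∧
      s'.tm ≤ s.tm + 220 * (G.ds + 2) ^ (G.bd {s.v .k}).card := by
  refine ⟨_, rfl, ?_⟩
  generalize hkk : s.v .k = k at *
  have hne := G.ne k hk
  simp only [leafTable, exec_cons, exec_nil]
  generalize hs1 : (Cmd.set .v (.v .u)).exec _ = s1
  have a1 : s1.v .u = G.eu k := by simp [← hs1, exec_set, exec_put, hkk, hu]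
  have a2 : s1.v .w = G.ev k := by simp [← hs1, exec_set, exec_put, hkk, hw]
  have a3 : s1.v .x = s.a .et k := by simp [← hs1, exec_set, exec_put, hkk]
  have a4 : s1.a .base = Function.update (s.a .base) (s.a .et k) (s.v .free) := by
    simp [← hs1, exec_set, exec_put, hkk]
  have a5 : s1.a .wp = Function.update (s.a .wp) (s.a .et k) (s.v .lf) := by
    simp [← hs1, exec_set, exec_put, hkk]
  have a6 : ∀ A, A ≠ .base → A ≠ .wp → s1.a A = s.a A := fun A h1 h2 => by
    simp [← hs1, exec_set, exec_put, h1, h2]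
  have a7 : s1.v .sz = 1 := by simp [← hs1, exec_set, exec_put]
  have a8 : s1.v .c = 1 := by simp [← hs1, exec_set, exec_put]
  have a9 : s1.v .v = G.eu k := by simp [← hs1, exec_set, exec_put, hkk, hu]
  have a10 : s1.v .lf = s.v .lf := by simp [← hs1, exec_set, exec_put]
  have a11 : s1.v .free = s.v .free := by simp [← hs1, exec_set, exec_put]
  have a12 : s1.v .D = G.ds + 2 := by simp [← hs1, exec_set, exec_put, hI.D]
  have a13 : s1.tm = s.tm + 8 := by simp [← hs1, exec_set, exec_put]
  clear hs1
  have hu1 : G.degA {k} (G.eu k) = 1 := by simp [Net.degA_singleton]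
  have hv1 : G.degA {k} (G.ev k) = 1 := by simp [Net.degA_singleton]
  have hb0 : BList s1 (G.ds + 2) (s.v .lf) (s1.v .lf) ∅ (G.degA {k}) (fun _ => 0) (s1.v .sz) := by
    rw [a10, a7]; exact BList.empty _ _ _ _
  obtain ⟨str1, b1, b2, b3, b4, b5, b6, b7⟩ := leafEnd_spec (Or.inl rfl) hb0 a12 (by omega)
    (by simp) (by rw [a8, a9, hu1])
  have f1 := exec_frame (leafEnd .e1) s1
  generalize (leafEnd .e1).exec s1 = s2 at *
  rw [a9] at b1 b2 b3
  rw [a10] at b4 b5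
  generalize hs3 : (Cmd.set .v (.v .w)).exec s2 = s3
  have c1 : s3.v .v = G.ev k := by
    simp [← hs3, exec_set, f1.v .w (by decide), a2]
  have c2 : ∀ x, x ≠ .v → s3.v x = s2.v x := fun x hx => by simp [← hs3, exec_set, hx]
  have c3 : s3.a = s2.a := by simp [← hs3, exec_set]
  have c4 : s3.tm = s2.tm + 1 := by simp [← hs3, exec_set]
  clear hs3
  have d1 : s3.v .lf = s2.v .lf := c2 _ (by decide)
  have d2 : s3.v .sz = s2.v .sz := c2 _ (by decide)
  have hb1 := b3.congr (s' := s3) (fun _ _ => by rw [c3]) (fun _ _ => by rw [c3])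
    (fun _ _ => by rw [c3])
  rw [← d1, ← d2, a6 _ (by decide) (by decide), hI.deg] at hb1
  obtain ⟨str, e1, e2, e3, e4, e5, e6, e7⟩ := leafEnd_spec (e := .e2) (Or.inr rfl) hb1
    (by rw [c2 _ (by decide), f1.v .D (by decide), a12]) (by omega)
    (by rw [c1]; split_ifs <;> simp [hne.symm])
    (by rw [c1, c2 _ (by decide), f1.v .c (by decide), a8, hv1])
  have f2 := exec_frame (leafEnd .e2) s3
  generalize (leafEnd .e2).exec s3 = s4 at *
  rw [c1] at e1 e2 e3
  rw [d1] at e4 e5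
  rw [c3] at e5 e3
  rw [f1.a .deg (by decide), a6 _ (by decide) (by decide), hI.deg] at e3
  have hW : (if 1 < G.dg (G.ev k) then insert (G.ev k) (if 1 < G.dg (G.eu k) then
      insert (G.eu k) ∅ else ∅) else if 1 < G.dg (G.eu k) then insert (G.eu k) ∅ else ∅) =
      G.bd {k} := by
    ext v
    rw [Net.mem_bd_singleton hk]
    split_ifs with h1 h2 h2
    · simp only [Finset.mem_insert, Finset.notMem_empty, or_false]
      constructor
      · rintro (rfl | rfl) <;> simp [h1, h2]
      · tauto
    · simp only [Finset.mem_insert, Finset.notMem_empty, or_false]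
      constructor
      · rintro rfl; simp [h1]
      · rintro ⟨rfl | rfl, h⟩
        · exact absurd h h2
        · rfl
    · simp only [Finset.mem_insert, Finset.notMem_empty, or_false]
      constructor
      · rintro rfl; simp [h2]
      · rintro ⟨rfl | rfl, h⟩
        · rfl
        · exact absurd h h1
    · simp only [Finset.notMem_empty, false_iff]
      rintro ⟨rfl | rfl, h⟩
      · exact absurd h h2
      · exact absurd h h1
  simp only [hW] at e3
  generalize hs5 : (Cmd.set .r (.c 0)).exec _ = s5
  have g1 : s5.v .l = 0 := by simp [← hs5, exec_set, exec_put]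
  have g2 : s5.v .r = 0 := by simp [← hs5, exec_set, exec_put]
  have g3 : ∀ x, x ≠ .l → x ≠ .r → s5.v x = s4.v x := fun x h1 h2 => by
    simp [← hs5, exec_set, exec_put, h1, h2]
  have g4 : ∀ A, A ≠ .wn → s5.a A = s4.a A := fun A h => by
    simp [← hs5, exec_set, exec_put, h]
  have hx4 : s4.v .x = s.a .et k := by
    rw [f2.v _ (by decide), c2 _ (by decide), f1.v _ (by decide), a3]
  have hwp4 : s4.a .wp = Function.update (s.a .wp) (s.a .et k) (s.v .lf) := by
    rw [f2.a _ (by decide), c3, f1.a _ (by decide), a5]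
  have hwn4 : s4.a .wn = s.a .wn := by
    rw [f2.a _ (by decide), c3, f1.a _ (by decide), a6 _ (by decide) (by decide)]
  have g5 : s5.a .wn = Function.update (s.a .wn) (s.a .et k) (s4.v .lf - s.v .lf) := by
    simp [← hs5, exec_set, exec_put, hx4, hwp4, hwn4]
  have g6 : s5.tm = s4.tm + 3 := by simp [← hs5, exec_set, exec_put]
  clear hs5
  have hlow : ∀ A, A ∈ [Arr.cst, .el, .er, .eU, .eV, .dem] → s5.a A = s.a A := by
    intro A hA
    have q1 : A ∉ (leafEnd .e2).ma ∧ A ∉ (leafEnd .e1).ma ∧ A ≠ .wn ∧ A ≠ .base ∧ A ≠ .wp := by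
      revert A; decide
    obtain ⟨q1, q2, q3, q4, q5⟩ := q1
    rw [g4 A q3, f2.a A q1, c3, f1.a A q2, a6 A q4 q5]
  have hent : ∀ p, s5.ent p = s.ent p := fun p => by
    simp only [St.ent, hlow _ (by simp : Arr.cst ∈ _), hlow _ (by simp : Arr.el ∈ _),
      hlow _ (by simp : Arr.er ∈ _), hlow _ (by simp : Arr.eU ∈ _), hlow _ (by simp : Arr.eV ∈ _)]
  have hfree : s5.v .free = s.v .free := by
    rw [g3 _ (by decide) (by decide), f2.v _ (by decide), c2 _ (by decide), f1.v _ (by decide), a11]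
  have hEu : s5.v .e1 = str (G.eu k) := by
    rw [g3 _ (by decide) (by decide), f2.v _ (by decide), c2 _ (by decide), b2, e1 _ hne]
  have hEv : s5.v .e2 = str (G.ev k) := by
    rw [g3 _ (by decide) (by decide), e2]
  have hready : LeafReady G k s5 := by
    refine ⟨?_, ?_, ?_, ?_, g1, g2, ?_, (hlow _ (by simp)).trans hI.dem⟩
    · rw [g3 _ (by decide) (by decide), f2.v _ (by decide), c2 _ (by decide), f1.v _ (by decide),
        a1]
    · rw [g3 _ (by decide) (by decide), f2.v _ (by decide), c2 _ (by decide), f1.v _ (by decide),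
        a2]
    · rw [hEu, e3.radix.pos]; simp [Net.mem_bd_singleton hk]
    · rw [hEv, e3.radix.pos]; simp [Net.mem_bd_singleton hk]
    · rw [g3 _ (by decide) (by decide), f2.v _ (by decide), c2 _ (by decide), f1.v _ (by decide),
        a12]
  obtain ⟨h1, h2⟩ := leafFill_spec hready (fun p hp => by
    rw [hent]; exact hM.zero p (hfree ▸ hp))
  rw [hfree, hEu, hEv] at h1
  have h1' : Fill (s.v .free) s (leafFill.exec s5) (leafCands G k (s.v .free) (str (G.eu k))
      (str (G.ev k)) fun _ _ => True) :=
    ⟨h1.sound, h1.best, h1.zero, fun p hp => (h1.below p hp).trans (hent p)⟩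
  have f3 := exec_frame leafFill s5
  generalize leafFill.exec s5 = s6 at *
  have hsz : s6.v .sz = (G.ds + 2) ^ (G.bd {k}).card := by
    rw [f3.v _ (by decide), g3 _ (by decide) (by decide), e3.radix.size]
  have hsz4 : s4.v .sz = (G.ds + 2) ^ (G.bd {k}).card := e3.radix.size
  generalize hs7 : ((Cmd.set .free (.add (.v .free) (.v .sz))).exec s6).tick = s7
  have i1 : s7.v .free = s.v .free + s6.v .sz := by
    simp [← hs7, exec_set, f3.v .free (by decide), hfree]
  have i2 : s7.a = s6.a := by simp [← hs7, exec_set]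
  have i3 : s7.tm = s6.tm + 2 := by simp [← hs7, exec_set]
  have i4 : s7.v .lf = s4.v .lf := by
    simp [← hs7, exec_set, f3.v .lf (by decide), g3 .lf (by decide) (by decide)]
  clear hs7
  have hM7 : Mem s7 (extSol (s.v .free) s6 sol) := by
    refine hM.fill h1' (sz := s6.v .sz) ?_ (fun p => by simp [St.ent, i2]) i1
    rintro p c l r d ⟨x, y, -, hl, he⟩
    simp only [leafCand, Prod.mk.injEq] at he
    obtain ⟨he1, -, he3, he4, -⟩ := he
    have hb : x * str (G.eu k) + y * str (G.ev k) < s6.v .sz := by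
      set τ : ℕ → ℕ := fun v => if v ∈ G.bd {k} then if v = G.eu k then x else y else 0 with hτ
      have hτ1 : ∀ v, τ v < G.ds + 2 := by
        intro v
        obtain ⟨-, -, -, -, h5, h6⟩ := hl
        simp only [hτ]
        split_ifs with h1 h2
        · subst h2
          rw [if_pos ((Net.mem_bd_singleton hk).1 h1).2] at h5; omega
        · have := ((Net.mem_bd_singleton hk).1 h1)
          rcases this with ⟨h | h, h3⟩
          · exact absurd h h2
          · subst h; rw [if_pos h3] at h6; omega
        · omega
      have hs0 : ∀ v, v ∉ G.bd {k} → str v = 0 := fun v hv =>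
        Nat.eq_zero_of_not_pos ((e3.radix.pos v).not.2 hv)
      have := e3.radix.lt τ hτ1
      rw [← e3.radix.sum_subset (Net.bd_subset_supp), Net.supp_singleton hk,
        Finset.sum_pair hne] at this
      have t1 : τ (G.eu k) * str (G.eu k) = x * str (G.eu k) := by
        by_cases h : G.eu k ∈ G.bd {k}
        · simp [hτ, h]
        · simp [hs0 _ h]
      have t2 : τ (G.ev k) * str (G.ev k) = y * str (G.ev k) := by
        by_cases h : G.ev k ∈ G.bd {k}
        · simp [hτ, h, hne.symm]
        · simp [hs0 _ h]
      rw [t1, t2] at this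
      omega
    have := hM.free_pos
    omega
  have hlists : ∀ A, A ∈ [Arr.lv, .lc, .ls] → s7.a A = s4.a A := by
    intro A hA
    have q1 : A ∉ leafFill.ma ∧ A ≠ .wn := by revert A; decide
    rw [i2, f3.a A q1.1, g4 A q1.2]
  have hl1 := hlists .lv (by simp)
  have hl2 := hlists .lc (by simp)
  have hl3 := hlists .ls (by simp)
  have hbase : s7.a .base = Function.update (s.a .base) (s.a .et k) (s.v .free) := by
    rw [i2, f3.a _ (by decide), g4 _ (by decide), f2.a _ (by decide), c3, f1.a _ (by decide), a4]
  have hwp : s7.a .wp = Function.update (s.a .wp) (s.a .et k) (s.v .lf) := by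
    rw [i2, f3.a _ (by decide), g4 _ (by decide), hwp4]
  have hwn : s7.a .wn = Function.update (s.a .wn) (s.a .et k) (s4.v .lf - s.v .lf) := by
    rw [i2, f3.a _ (by decide), g5]
  refine ⟨extSol (s.v .free) s6 sol, hM7, ⟨str, s4.v .sz, ?_⟩, fun z E hz ⟨str', sz', hT⟩ =>
    ⟨str', sz', ?_⟩, by rw [i1, hsz], ?_⟩
  · have hlen : s.v .lf + (s4.v .lf - s.v .lf) = s4.v .lf := by omega
    simp only [hbase, hwp, hwn, Function.update_self, hlen]
    refine ⟨e3.congr (fun _ _ => by rw [hl1]) (fun _ _ => by rw [hl2]) (fun _ _ => by rw [hl3]),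
      by omega, by omega, fun σ hσ => ?_⟩
    have := leaf_entry hk e3.radix hM.sol_zero hM.free_pos h1' hσ
    rw [i2]
    exact this
  · simp only [hbase, hwp, hwn, Function.update_of_ne hz]
    refine hT.mono (fun i hi => ?_) (by omega) (by omega) (fun p hp => ?_) (fun p hp => ?_)
    · rw [hl1, hl2, hl3]
      obtain ⟨x, y, z⟩ := b5 i hi
      obtain ⟨x', y', z'⟩ := e5 i (by omega)
      rw [x', y', z', x, y, z]
      simp [a6]
    · rw [show s7.ent p = s6.ent p by simp [St.ent, i2]]
      exact h1'.below p hp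
    · rw [extSol, if_pos hp]
  · have : 0 < (G.ds + 2) ^ (G.bd {k}).card := by positivity
    omega

/-! ### Dismantling a tree -/

open Classical in
/-- A branch decomposition of width at most `b` of a net: a tree on the nodes `0, …, N - 1`, with
the edge `k` of the net at the node `et k`. -/
structure Deco (G : Net) where
  N : ℕ
  b : ℕ
  adj : ℕ → ℕ → Prop
  et : ℕ → ℕ
  N_pos : 0 < N
  symm : ∀ a c, adj a c → adj c a
  ne : ∀ a c, adj a c → a ≠ c
  lt : ∀ a c, adj a c → a < N
  et_lt : ∀ k < G.m, et k < N
  et_inj : ∀ k < G.m, ∀ l < G.m, et k = et l → k = l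
  conn : ∀ (D : Set ℕ), ∀ a ∈ D, a < N → (∀ a ∈ D, ∀ c, adj a c → c ∈ D) → ∀ c < N, c ∈ D
  sum : ∑ x ∈ Finset.range N, ((Finset.range N).filter (adj x)).card + 2 = 2 * N
  deg : ∀ x, 2 ≤ ((Finset.range N).filter (adj x)).card →
    ((Finset.range N).filter (adj x)).card = 3 ∧ ∀ k < G.m, et k ≠ x
  -- The hypotheses say that `D` is connected and that `xy` is the only edge leaving it: `D` is the
  -- component of `x` after deleting `xy`.
  width : ∀ (D : Set ℕ) (x y : ℕ), x ∈ D → y ∉ D → adj x y → (∀ a ∈ D, a < N) →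
    (∀ a ∈ D, ∀ c, c ∉ D → adj a c → a = x ∧ c = y) →
    (∀ D' : Set ℕ, x ∈ D' → (∀ a ∈ D', ∀ c ∈ D, a ∈ D → adj a c → c ∈ D') → D ⊆ D') →
    (G.bd ((Finset.range G.m).filter fun k => et k ∈ D)).card ≤ b

namespace Deco

variable {G : Net} (T : Deco G)

open Classical in
/-- The neighbours of `x` in `R`. -/
noncomputable def nb (R : Finset ℕ) (x : ℕ) : Finset ℕ := R.filter (T.adj x)

theorem mem_nb {R : Finset ℕ} {x c : ℕ} : c ∈ T.nb R x ↔ c ∈ R ∧ T.adj x c := by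
  classical exact Finset.mem_filter

/-- The edges of the net in the part of the tree that is represented by `x`. -/
def part (rep : ℕ → ℕ) (x : ℕ) : Finset ℕ := (Finset.range G.m).filter fun k => rep (T.et k) = x

theorem mem_part {rep : ℕ → ℕ} {x k : ℕ} : k ∈ T.part rep x ↔ k < G.m ∧ rep (T.et k) = x := by
  simp [part]

/-- The tree has been contracted to the nodes in `R`; every node `a` has been merged into
`rep a`. -/
structure Contracted (R : Finset ℕ) (rep : ℕ → ℕ) : Prop where
  lt : ∀ x ∈ R, x < T.N
  mem : ∀ a < T.N, rep a ∈ R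
  self : ∀ x ∈ R, rep x = x
  -- By symmetry the other end is a representative too, so the contracted tree is just the graph
  -- induced on `R`.
  cut : ∀ a c, T.adj a c → rep a ≠ rep c → rep a = a
  conn : ∀ x ∈ R, ∀ D : Set ℕ, x ∈ D →
    (∀ a ∈ D, ∀ c, T.adj a c → rep a = x → rep c = x → c ∈ D) → ∀ c < T.N, rep c = x → c ∈ D
  sum : ∑ x ∈ R, (T.nb R x).card + 2 = 2 * R.card
  -- For nodes with at most one remaining neighbour the same bound follows from the width; see
  -- `Contracted.card_bd_le`.
  big : ∀ x ∈ R, 2 ≤ (T.nb R x).card → (G.bd (T.part rep x)).card ≤ T.b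

variable {T} {R : Finset ℕ} {rep : ℕ → ℕ}

theorem lt' {a c : ℕ} (h : T.adj a c) : c < T.N := T.lt c a (T.symm a c h)

theorem nb_range_eq (x : ℕ) [DecidablePred (T.adj x)] :
    T.nb (Finset.range T.N) x = (Finset.range T.N).filter (T.adj x) := by
  ext; simp [mem_nb]

/-- A node with at least two neighbours is not a leaf and carries no edge of the net, so its part is
empty. -/
theorem Contracted.init : T.Contracted (Finset.range T.N) id where
  lt x hx := Finset.mem_range.1 hx
  mem a ha := Finset.mem_range.2 ha
  self x _ := rfl
  cut a c _ _ := rfl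
  conn x _ D hx _ c _ hc := by rwa [show c = x from hc]
  sum := by
    have := T.sum
    rw [Finset.card_range]
    exact this
  big x _ h := by
    classical
    rw [nb_range_eq] at h
    have h2 := (T.deg x (by convert h)).2
    have : T.part id x = ∅ := by
      ext k; simp only [mem_part, id, Finset.notMem_empty, iff_false, not_and]; exact h2 k
    rw [this]
    simp [Net.bd, Net.degA]

theorem Contracted.mem_nb_of_adj (h : T.Contracted R rep) {x a c : ℕ} (ha : rep a = x)
    (hc : rep c ≠ x) (hac : T.adj a c) : a = x ∧ c ∈ T.nb R x := by
  have h1 := h.cut a c hac (by rw [ha]; exact hc.symm)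
  have h2 := h.cut c a (T.symm a c hac) (by rw [ha]; exact hc)
  have : a = x := h1.symm.trans ha
  subst this
  exact ⟨rfl, T.mem_nb.2 ⟨h2 ▸ h.mem c (lt' hac), hac⟩⟩

/-- The class of such a node is closed under adjacency, hence is the whole tree. -/
theorem Contracted.rep_eq_of_nb_empty (h : T.Contracted R rep) {x : ℕ} (hx : x ∈ R)
    (h0 : T.nb R x = ∅) : ∀ c < T.N, rep c = x := by
  refine T.conn {c | rep c = x} x (h.self x hx) (h.lt x hx) fun a ha c hac => ?_
  by_contra hc
  have := (h.mem_nb_of_adj ha hc hac).2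
  simp [h0] at this

theorem Contracted.nb_pos (h : T.Contracted R rep) {x : ℕ} (hx : x ∈ R) (hR : 1 < R.card) :
    0 < (T.nb R x).card := by
  rw [Finset.card_pos, Finset.nonempty_iff_ne_empty]
  intro h0
  obtain ⟨y, hy, hne⟩ := Finset.exists_mem_ne hR x
  exact hne ((h.self y hy).symm.trans (h.rep_eq_of_nb_empty hx h0 y (h.lt y hy)))

/-- The degrees sum to `2|R| - 2`, so they cannot all be at least two, and none is zero. -/
theorem Contracted.exists_leaf (h : T.Contracted R rep) (hR : 1 < R.card) :
    ∃ x ∈ R, (T.nb R x).card = 1 := by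
  by_contra! hne
  have : ∑ x ∈ R, 2 ≤ ∑ x ∈ R, (T.nb R x).card := Finset.sum_le_sum fun x hx => by
    have := h.nb_pos hx hR
    have := hne x hx
    omega
  rw [Finset.sum_const, smul_eq_mul] at this
  have := h.sum
  omega

theorem Contracted.part_eq_range (h : T.Contracted R rep) {x : ℕ} (hx : x ∈ R)
    (h0 : T.nb R x = ∅) : T.part rep x = Finset.range G.m := by
  ext k
  simp only [mem_part, Finset.mem_range, and_iff_left_iff_imp]
  exact fun hk => h.rep_eq_of_nb_empty hx h0 _ (T.et_lt k hk)

theorem bd_range (G : Net) : G.bd (Finset.range G.m) = ∅ := by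
  simp [Net.bd, Net.dg]

/-- With no remaining neighbour the part consists of all edges and has no boundary. With one, the
class is one side of a tree edge and the width applies. With two or more, the invariant says so. -/
theorem Contracted.card_bd_le (h : T.Contracted R rep) {x : ℕ} (hx : x ∈ R) :
    (G.bd (T.part rep x)).card ≤ T.b := by
  rcases Nat.lt_or_ge (T.nb R x).card 2 with hlt | hge
  · rcases Nat.eq_zero_or_pos (T.nb R x).card with h0 | h0
    · rw [h.part_eq_range hx (Finset.card_eq_zero.1 h0), bd_range]
      simp
    · obtain ⟨y, hy⟩ := Finset.card_eq_one.1 (show (T.nb R x).card = 1 by omega)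
      have hyx : y ∈ T.nb R x := by simp [hy]
      obtain ⟨hyR, hxy⟩ := T.mem_nb.1 hyx
      have hne := T.ne _ _ hxy
      have hry := h.self y hyR
      have hw := T.width {c | c < T.N ∧ rep c = x} x y ⟨h.lt x hx, h.self x hx⟩
        (fun h => hne (by rw [← hry, h.2])) hxy (fun a ha => ha.1) (fun a ha c hc hac => ?_)
        (fun D hD hcl c hc => ?_)
      · refine le_trans (le_of_eq ?_) hw
        congr 2
        ext k
        simp only [mem_part, Finset.mem_filter, Finset.mem_range, Set.mem_ofPred_eq]
        exact and_congr_right fun hk => by simp [T.et_lt k hk]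
      · obtain ⟨h1, h2⟩ := h.mem_nb_of_adj ha.2 (fun h' => hc ⟨lt' hac, h'⟩) hac
        rw [hy, Finset.mem_singleton] at h2
        exact ⟨h1, h2⟩
      · refine h.conn x hx D hD (fun a ha c hac h1 h2 => ?_) c hc.1 hc.2
        exact hcl a ha c ⟨lt' hac, h2⟩ ⟨T.lt _ _ hac, h1⟩ hac
  · exact h.big x hx hge

theorem nb_erase {x z : ℕ} : T.nb (R.erase x) z = (T.nb R z).erase x := by
  ext; simp only [mem_nb, Finset.mem_erase]; tauto

theorem part_merge {x y : ℕ} (hxy : x ≠ y) :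
    T.part (fun a => if rep a = x then y else rep a) y = T.part rep y ∪ T.part rep x := by
  ext k
  simp only [mem_part, Finset.mem_union]
  split_ifs with h <;> simp [h]; tauto

theorem part_merge_of_ne {x y z : ℕ} (hx : z ≠ x) (hy : z ≠ y) :
    T.part (fun a => if rep a = x then y else rep a) z = T.part rep z := by
  ext k
  simp only [mem_part]
  split_ifs with h
  · simp [h, hx.symm, hy.symm]
  · rfl

theorem disjoint_part {x y : ℕ} (hxy : x ≠ y) : Disjoint (T.part rep x) (T.part rep y) := by
  rw [Finset.disjoint_left]
  intro k h1 h2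
  rw [mem_part] at h1 h2
  exact hxy (h1.2.symm.trans h2.2)

theorem notMem_nb_of_leaf {x y z : ℕ} (hxR : x ∈ R) (hx : T.nb R x = {y}) (hz : z ∈ R)
    (hzy : z ≠ y) : x ∉ T.nb R z := fun h => by
  have : z ∈ T.nb R x := T.mem_nb.2 ⟨hz, T.symm _ _ (T.mem_nb.1 h).2⟩
  rw [hx, Finset.mem_singleton] at this
  exact hzy this

/-- Intermediate parts need not be sides of tree edges. The critical case is a node `y` that still
has two neighbours after absorbing `x`: nothing was merged into it before and it carries no edge
itself, so its part is now that of `x`. -/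
theorem Contracted.merge (h : T.Contracted R rep) {x y : ℕ} (hxR : x ∈ R) (hx : T.nb R x = {y}) :
    T.Contracted (R.erase x) fun a => if rep a = x then y else rep a := by
  obtain ⟨hyR, hxy⟩ := T.mem_nb.1 (show y ∈ T.nb R x by simp [hx])
  have hne := T.ne _ _ hxy
  have hxy' : x ∈ T.nb R y := T.mem_nb.2 ⟨hxR, T.symm _ _ hxy⟩
  have hsx := h.self x hxR
  have hsy := h.self y hyR
  have hyR' : y ∈ R.erase x := Finset.mem_erase.2 ⟨hne.symm, hyR⟩
  refine ⟨fun z hz => h.lt z (Finset.mem_of_mem_erase hz), fun a ha => ?_, fun z hz => ?_,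
    fun a c hac hr => ?_, fun z hz D hD hcl c hc hrc => ?_, ?_, fun z hz hz2 => ?_⟩
  · split_ifs with h'
    · exact hyR'
    · exact Finset.mem_erase.2 ⟨h', h.mem a ha⟩
  · rw [Finset.mem_erase] at hz
    rw [h.self z hz.2, if_neg hz.1]
  · have hr0 : rep a ≠ rep c := fun h' => by simp [h'] at hr
    have h1 := h.cut a c hac hr0
    have h2 := h.cut c a (T.symm _ _ hac) hr0.symm
    by_cases hax : rep a = x
    · exfalso
      have hcm := (h.mem_nb_of_adj hax (fun h' => hr0 (hax.trans h'.symm)) hac).2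
      rw [hx, Finset.mem_singleton] at hcm
      rw [if_pos hax, hcm, hsy, if_neg hne.symm] at hr
      exact hr rfl
    · rw [if_neg hax]; exact h1
  · rw [Finset.mem_erase] at hz
    have hz1 : ∀ c < T.N, rep c = z → c ∈ D := by
      refine h.conn z hz.2 D hD fun a ha c hac h1 h2 => hcl a ha c hac ?_ ?_
      · rw [h1, if_neg hz.1]
      · rw [h2, if_neg hz.1]
    by_cases hcx : rep c = x
    · rw [if_pos hcx] at hrc
      subst hrc
      refine h.conn x hxR D ?_ (fun a ha c hac h1 h2 => hcl a ha c hac ?_ ?_) c hc hcx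
      · refine hcl y hD x (T.symm _ _ hxy) ?_ ?_
        · rw [hsy, if_neg hne.symm]
        · rw [hsx, if_pos rfl]
      · rw [if_pos h1]
      · rw [if_pos h2]
    · rw [if_neg hcx] at hrc
      exact hz1 c hc hrc
  · have h1 := h.sum
    rw [← Finset.add_sum_erase R _ hxR, ← Finset.add_sum_erase _ _ hyR'] at h1
    rw [← Finset.add_sum_erase _ _ hyR', Finset.card_erase_of_mem hxR]
    have h2 : ∑ z ∈ (R.erase x).erase y, (T.nb (R.erase x) z).card =
        ∑ z ∈ (R.erase x).erase y, (T.nb R z).card := by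
      refine Finset.sum_congr rfl fun z hz => ?_
      simp only [Finset.mem_erase] at hz
      rw [nb_erase, Finset.erase_eq_of_notMem (notMem_nb_of_leaf hxR hx hz.2.2 hz.1)]
    have h3 : 0 < (T.nb R y).card := Finset.card_pos.2 ⟨x, hxy'⟩
    rw [h2, nb_erase, Finset.card_erase_of_mem hxy']
    rw [hx, Finset.card_singleton] at h1
    have : 0 < R.card := Finset.card_pos.2 ⟨x, hxR⟩
    omega
  · rw [Finset.mem_erase] at hz
    by_cases hzy : z = y
    · subst hzy
      rw [nb_erase, Finset.card_erase_of_mem hxy'] at hz2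
      classical
      -- Two neighbours besides `x` make three, which is the full degree; so all original neighbours
      -- are still present and the class of `z` is `{z}`.
      have hsub : T.nb R z ⊆ (Finset.range T.N).filter (T.adj z) := fun c hc => by
        rw [T.mem_nb] at hc
        exact Finset.mem_filter.2 ⟨Finset.mem_range.2 (h.lt c hc.1), hc.2⟩
      have hle := Finset.card_le_card hsub
      have hd := T.deg z (by convert (show 2 ≤ _ by omega : 2 ≤ ((Finset.range T.N).filter (T.adj z)).card))
      have hd1 : ((Finset.range T.N).filter (T.adj z)).card = 3 := by convert hd.1
      have heq := Finset.eq_of_subset_of_card_le hsub (by omega)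
      have hsing : ∀ c < T.N, rep c = z → c ∈ ({z} : Set ℕ) := by
        refine h.conn z hyR {z} rfl fun a ha c hac h1 h2 => ?_
        rw [Set.mem_singleton_iff] at ha
        subst ha
        have : c ∈ T.nb R a := by
          rw [heq]; exact Finset.mem_filter.2 ⟨Finset.mem_range.2 (lt' hac), hac⟩
        rw [h.self c (T.mem_nb.1 this).1] at h2
        exact h2
      have he : T.part rep z = ∅ := by
        ext k
        simp only [mem_part, Finset.notMem_empty, iff_false, not_and]
        exact fun hk h' => hd.2 k hk (hsing _ (T.et_lt k hk) h')
      rw [part_merge hne, he, Finset.empty_union]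
      exact h.card_bd_le hxR
    · rw [nb_erase, Finset.erase_eq_of_notMem (notMem_nb_of_leaf hxR hx hz.2 hzy)] at hz2
      rw [part_merge_of_ne hz.1 hzy]
      exact h.big z hz.2 hz2

end Deco

/-! ### The initial tables -/

theorem bd_empty (G : Net) : G.bd ∅ = ∅ := by simp [Net.bd, Net.degA]

/-- Address `0` is kept free as the end of all traceback pointers. Every node receives a one-entry
table of cost `1`, the empty solution; the tables of edges later replace those at the leaves, and
inner nodes join with the trivial one. -/
theorem emptyTables_spec (G : Net) {s : St} (hent : ∀ p, s.ent p = (0, 0, 0, 0, 0))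
    (hwp : ∀ x, s.a .wp x = 0) (hwn : ∀ x, s.a .wn x = 0) (hfree : s.v .free = 1) :
    Mem (emptyTables.exec s) (fun _ => ∅) ∧
    (∀ x < s.v .N, TableOK G (emptyTables.exec s) (fun _ => ∅) ∅ x) ∧
    (emptyTables.exec s).v .free = 1 + s.v .N ∧
    (emptyTables.exec s).tm ≤ s.tm + 1 + 5 * s.v .N := by
  obtain ⟨h1, h2, h3, h4⟩ := loop_rule (x := .k) (e := .v .N) (s := s)
    (c := block [.put .base (.v .k) (.v .free), .put .cst (.v .free) (.c 1), inc .free])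
    (fun k s' => (∀ x < k, s'.a .base x = 1 + x) ∧ s'.v .free = 1 + k ∧
      (∀ p, s'.a .cst p = if 1 ≤ p ∧ p < 1 + k then 1 else 0) ∧ s'.tm ≤ s.tm + 1 + 5 * k)
    ⟨by simp, by simp [hfree], fun p => by
      rw [if_neg (by omega)]; exact congrArg Prod.fst (hent p), by simp⟩
    (by
      rintro k hk s' hf ⟨h1, h2, h3, h4⟩
      refine ⟨fun x hx => ?_, ?_, fun p => ?_, ?_⟩
      · by_cases hxk : x = k
        · subst hxk; simp [exec_cons, exec_nil, exec_set, exec_put, h2]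
        · simp [exec_cons, exec_nil, exec_set, exec_put, hxk, h1 x (by omega)]
      · simp [exec_cons, exec_nil, exec_set, exec_put, h2]; omega
      · by_cases hp : p = 1 + k
        · subst hp
          rw [if_pos (by omega)]
          simp [exec_cons, exec_nil, exec_set, exec_put, h2]
        · simp only [exec_cons, exec_nil, exec_set, exec_put, tick_a, setv_a, seta_a, Ex.eval,
            tick_v, setv_v, seta_v]
          simp only [h2, reduceCtorEq, if_false, if_true, Function.update_of_ne hp, h3]
          split_ifs <;> omega
      · simp [exec_cons, exec_nil, exec_set, exec_put]; omega)
  have hf := exec_frame emptyTables s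
  change ∀ x < s.v .N, (emptyTables.exec s).a .base x = _ at h1
  change (emptyTables.exec s).v .free = 1 + s.v .N at h2
  change ∀ p, (emptyTables.exec s).a .cst p = if 1 ≤ p ∧ p < 1 + s.v .N then 1 else 0 at h3
  change (emptyTables.exec s).tm ≤ s.tm + 1 + 5 * s.v .N at h4
  generalize emptyTables.exec s = s' at *
  have e1 : ∀ p, s'.a .el p = 0 := fun p => by
    rw [hf.a _ (by decide)]; exact congrArg (fun q => q.2.1) (hent p)
  have e2 : ∀ p, s'.a .er p = 0 := fun p => by
    rw [hf.a _ (by decide)]; exact congrArg (fun q => q.2.2.1) (hent p)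
  have e3 : ∀ p, s'.a .eU p = 0 := fun p => by
    rw [hf.a _ (by decide)]; exact congrArg (fun q => q.2.2.2.1) (hent p)
  have e4 : ∀ p, s'.a .eV p = 0 := fun p => by
    rw [hf.a _ (by decide)]; exact congrArg (fun q => q.2.2.2.2) (hent p)
  refine ⟨⟨by omega, fun p hp => ?_, rfl, ?_, fun p hp => ?_, fun p => ?_⟩, fun x hx => ?_, h2, h4⟩
  · simp only [St.ent, e1, e2, e3, e4, h3]
    rw [if_neg (by omega)]
  · simp only [St.ent, e1, e2, e3, e4]
  · rw [e1, e2]; exact ⟨hp, hp⟩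
  · simp [one, e3, e4]
  · refine ⟨fun _ => 0, 1, ?_⟩
    rw [hf.a .wp (by decide), hf.a .wn (by decide), hwp, hwn, h1 x hx]
    refine ⟨?_, by omega, by omega, fun σ hσ => ?_⟩
    · rw [bd_empty]; exact BList.empty _ _ _ _
    · rw [bd_empty, Finset.sum_empty, h3, if_pos (by omega)]
      exact Net.entryOK_empty σ

/-- The edges of the net are stored in the state. -/
structure EdgesOK {G : Net} (T : Deco G) (s : St) : Prop where
  eu : ∀ k < G.m, s.a .eu k = G.eu k
  ev : ∀ k < G.m, s.a .ev k = G.ev k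
  et : ∀ k < G.m, s.a .et k = T.et k

/-- A single edge is the part of its leaf before any contraction. -/
theorem Deco.card_bd_singleton {G : Net} (T : Deco G) {k : ℕ} (hk : k < G.m) :
    (G.bd {k}).card ≤ T.b := by
  have := Deco.Contracted.init (T := T) |>.card_bd_le (Finset.mem_range.2 (T.et_lt k hk))
  have e : T.part id (T.et k) = {k} := by
    ext l
    simp only [Deco.mem_part, id, Finset.mem_singleton]
    exact ⟨fun h => T.et_inj _ h.1 _ hk h.2, fun h => by rw [h]; exact ⟨hk, rfl⟩⟩
  rwa [e] at this

theorem leafTables_spec {G : Net} {T : Deco G} {s : St} {sol : ℕ → Finset ℕ} {J : ℕ}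
    (hJ : (G.ds + 2) ^ T.b ≤ J) (hm : s.v .m = G.m) (hI : Inp G s) (hE : EdgesOK T s)
    (hM : Mem s sol) (hT : ∀ x < T.N, TableOK G s sol ∅ x) :
    ∃ s', leafTables.exec s = s' ∧ ∃ sol', Mem s' sol' ∧
      (∀ x < T.N, TableOK G s' sol' (T.part id x) x) ∧
      s'.v .free ≤ s.v .free + G.m * J ∧ s'.tm ≤ s.tm + 1 + G.m * (1 + 220 * J) := by
  refine ⟨_, rfl, ?_⟩
  have := loop_rule (x := .k) (e := .v .m) (s := s) (c := leafTable)
    (fun k s' => ∃ sol', Mem s' sol' ∧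
      (∀ x < T.N, TableOK G s' sol' ((Finset.range k).filter fun l => T.et l = x) x) ∧
      s'.v .free ≤ s.v .free + k * J ∧ s'.tm ≤ s.tm + 1 + k * (1 + 220 * J)) ?_ ?_
  · simp only [Ex.eval, hm] at this
    exact this
  · refine ⟨sol, ⟨hM.1, hM.2, hM.3, hM.4, hM.5, hM.6⟩, fun x hx => ?_, by simp, by simp⟩
    obtain ⟨str, sz, h⟩ := hT x hx
    refine ⟨str, sz, ?_⟩
    rw [Finset.range_zero, Finset.filter_empty]
    exact h.mono (fun _ _ => ⟨rfl, rfl, rfl⟩) le_rfl le_rfl (fun _ _ => rfl) (fun _ _ => rfl)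
  · rintro k hk s' hf ⟨sol', hM', hT', hfr, htm⟩
    simp only [Ex.eval, hm] at hk
    set s1 := (s'.setv .k k).tick with hs1
    have hk1 : s1.v .k = k := by simp [hs1]
    have hv : ∀ x, x ≠ .k → x ∉ (Cmd.loop .k (.v .m) leafTable).mv → s1.v x = s.v x :=
      fun x h1 h2 => by rw [← hf.v x h2]; simp [hs1, h1]
    have ha : ∀ A, A ∉ (Cmd.loop .k (.v .m) leafTable).ma → s1.a A = s.a A :=
      fun A h2 => by rw [← hf.a A h2]; simp [hs1]
    have hfree1 : s1.v .free = s'.v .free := by simp [hs1]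
    have heu := (congrFun (ha .eu (by decide)) k).trans (hE.eu k hk)
    have hev := (congrFun (ha .ev (by decide)) k).trans (hE.ev k hk)
    have het := (congrFun (ha .et (by decide)) k).trans (hE.et k hk)
    obtain ⟨s2, hs2, sol2, hM2, hT2, hO2, hf2, ht2⟩ := leafTable_spec (G := G) (s := s1)
      (sol := sol') (by rw [hk1]; exact hk)
      ⟨(hv _ (by decide) (by decide)).trans hI.dst, (hv _ (by decide) (by decide)).trans hI.D,
        (ha _ (by decide)).trans hI.dem, (ha _ (by decide)).trans hI.deg⟩
      (by rw [hk1, heu]) (by rw [hk1, hev])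
      ⟨by rw [hfree1]; exact hM'.1, fun p hp => hM'.2 p (hfree1 ▸ hp), hM'.3, hM'.4, hM'.5, hM'.6⟩
    rw [hk1] at hT2 hO2 hf2 ht2
    rw [het] at hT2 hO2
    have hpow : (G.ds + 2) ^ (G.bd {k}).card ≤ J :=
      (Nat.pow_le_pow_right (by omega) (T.card_bd_singleton hk)).trans hJ
    rw [hs2]
    refine ⟨sol2, hM2, fun x hx => ?_, ?_, ?_⟩
    · by_cases hxk : x = T.et k
      · have : (Finset.range (k + 1)).filter (fun l => T.et l = x) = {k} := by
          ext l
          simp only [Finset.mem_filter, Finset.mem_range, Finset.mem_singleton]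
          exact ⟨fun h => T.et_inj _ (by omega) _ hk (h.2.trans hxk),
            fun h => by subst h; exact ⟨by omega, hxk.symm⟩⟩
        rw [this, hxk]; exact hT2
      · have : (Finset.range (k + 1)).filter (fun l => T.et l = x) =
            (Finset.range k).filter (fun l => T.et l = x) := by
          rw [Finset.range_add_one, Finset.filter_insert, if_neg (Ne.symm hxk)]
        rw [this]
        refine hO2 x _ hxk ?_
        obtain ⟨str, sz, h⟩ := hT' x hx
        exact ⟨str, sz, h.mono (fun _ _ => ⟨rfl, rfl, rfl⟩) le_rfl le_rfl (fun _ _ => rfl)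
          (fun _ _ => rfl)⟩
    · rw [Nat.add_one_mul k]; omega
    · rw [Nat.add_one_mul k]
      have : s1.tm = s'.tm + 1 := by simp [hs1]
      omega

/-! ### The queue -/

/-- The queue, from position `i` on, lists the nodes in `M`. -/
structure Queue (s : St) (i : ℕ) (M : Set ℕ) : Prop where
  inj : ∀ j l, i ≤ j → j < s.v .qe → i ≤ l → l < s.v .qe → s.a .q j = s.a .q l → j = l
  le : i ≤ s.v .qe
  mem : ∀ x, x ∈ M ↔ ∃ j, i ≤ j ∧ j < s.v .qe ∧ s.a .q j = x

theorem Queue.congr {s s' : St} {i : ℕ} {M : Set ℕ} (h : Queue s i M) (h1 : s'.v .qe = s.v .qe)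
    (h2 : s'.a .q = s.a .q) : Queue s' i M :=
  ⟨by rw [h1, h2]; exact h.inj, by rw [h1]; exact h.le, by rw [h1, h2]; exact h.mem⟩

theorem Queue.pop {s : St} {i : ℕ} {M : Set ℕ} (h : Queue s i M) (hM : M.Nonempty) :
    s.a .q i ∈ M ∧ Queue s (i + 1) (M \ {s.a .q i}) := by
  obtain ⟨x, hx⟩ := hM
  obtain ⟨j, h1, h2, -⟩ := (h.mem x).1 hx
  refine ⟨(h.mem _).2 ⟨i, le_rfl, by omega, rfl⟩,
    fun j l a b c d e => h.inj j l (by omega) b (by omega) d e, by omega, fun x => ?_⟩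
  simp only [Set.mem_sdiff, Set.mem_singleton_iff, h.mem]
  constructor
  · rintro ⟨⟨j, a, b, c⟩, hne⟩
    refine ⟨j, ?_, b, c⟩
    rcases Nat.lt_or_ge i j with h' | h'
    · exact h'
    · exact absurd (by rw [← c, show j = i by omega]) hne
  · rintro ⟨j, a, b, c⟩
    refine ⟨⟨j, by omega, b, c⟩, fun he => ?_⟩
    have := h.inj j i (by omega) b le_rfl (by omega) (c.trans he)
    omega

theorem isOne_pos_iff (e : Ex) (s : St) : 0 < (isOne e).eval s ↔ e.eval s = 1 := by
  rw [isOne, ite_pos_iff]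
  simp only [Ex.eval]
  omega

theorem enqueue_spec {x : Var} (hx : x ≠ .qe) {s : St} {i : ℕ} {M : Set ℕ} (h : Queue s i M)
    (hM : s.a .tdeg (s.v x) = 1 → s.v x ∉ M) :
    Queue ((enqueue x).exec s) i {z | z ∈ M ∨ z = s.v x ∧ s.a .tdeg (s.v x) = 1} ∧
    ((enqueue x).exec s).tm ≤ s.tm + 5 := by
  rw [enqueue, exec_ite]
  by_cases h1 : s.a .tdeg (s.v x) = 1
  · rw [if_pos ((isOne_pos_iff (.a .tdeg (.v x)) s).2 h1)]
    simp only [exec_cons, exec_nil, h1, and_true]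
    generalize hs1 : ((inc .qe).exec ((Cmd.put .q (.v .qe) (.v x)).exec s.tick)).tick = s1
    have a1 : s1.v .qe = s.v .qe + 1 := by simp [← hs1, exec_set, exec_put]
    have a2 : s1.a .q = Function.update (s.a .q) (s.v .qe) (s.v x) := by
      simp [← hs1, exec_set, exec_put]
    have a3 : s1.tm = s.tm + 4 := by simp [← hs1, exec_set, exec_put]
    clear hs1
    have hn : ∀ j, i ≤ j → j < s.v .qe → s.a .q j ≠ s.v x := fun j a b c =>
      hM h1 ((h.mem _).2 ⟨j, a, b, c⟩)
    have hle := h.le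
    refine ⟨⟨fun j l b1 b2 b3 b4 b5 => ?_, by omega, fun z => ?_⟩, by omega⟩
    · rw [a2] at b5
      by_cases hj : j = s.v .qe <;> by_cases hl : l = s.v .qe
      · omega
      · rw [hj, Function.update_self, Function.update_of_ne hl] at b5
        exact absurd b5.symm (hn l b3 (by omega))
      · rw [hl, Function.update_self, Function.update_of_ne hj] at b5
        exact absurd b5 (hn j b1 (by omega))
      · rw [Function.update_of_ne hj, Function.update_of_ne hl] at b5
        exact h.inj j l b1 (by omega) b3 (by omega) b5
    · simp only [Set.mem_ofPred_eq, h.mem, a1, a2]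
      constructor
      · rintro (⟨j, b1, b2, b3⟩ | rfl)
        · exact ⟨j, b1, by omega, by rw [Function.update_of_ne (by omega), b3]⟩
        · exact ⟨s.v .qe, hle, by omega, by simp⟩
      · rintro ⟨j, b1, b2, b3⟩
        by_cases hj : j = s.v .qe
        · rw [hj, Function.update_self] at b3; exact Or.inr b3.symm
        · rw [Function.update_of_ne hj] at b3; exact Or.inl ⟨j, b1, by omega, b3⟩
  · rw [if_neg fun h' => h1 ((isOne_pos_iff (.a .tdeg (.v x)) s).1 h'), exec_skip]
    simp only [h1, and_false, or_false]
    exact ⟨h.congr rfl rfl, by simp⟩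

theorem startQueue_spec {s : St} (hqe : s.v .qe = 0) :
    Queue (startQueue.exec s) 0 {x | x < s.v .N ∧ s.a .tdeg x = 1} ∧
    (startQueue.exec s).tm ≤ s.tm + 1 + 6 * s.v .N := by
  have := loop_rule (x := .k) (e := .v .N) (s := s) (c := enqueue .k)
    (fun k s' => Queue s' 0 {x | x < k ∧ s.a .tdeg x = 1} ∧ s'.tm ≤ s.tm + 1 + 6 * k) ?_ ?_
  · exact this
  · exact ⟨⟨fun j l _ h => by simp [hqe] at h, by simp, fun x => by simp [hqe]⟩, by simp⟩
  · rintro k hk s' hf ⟨hQ, ht⟩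
    have htd : s'.a .tdeg = s.a .tdeg := hf.a _ (by decide)
    obtain ⟨h1, h2⟩ := enqueue_spec (x := .k) (by decide) (s := (s'.setv .k k).tick) (i := 0)
      (hQ.congr (by simp) (by simp)) (by simp)
    refine ⟨?_, ?_⟩
    · convert h1 using 1
      ext z
      simp only [Set.mem_ofPred_eq, tick_v, tick_a, setv_a, setv_v, if_true, htd]
      constructor
      · rintro ⟨a, b⟩
        by_cases hz : z = k
        · subst hz; exact Or.inr ⟨rfl, b⟩
        · exact Or.inl ⟨by omega, b⟩
      · rintro (⟨a, b⟩ | ⟨rfl, b⟩)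
        · exact ⟨by omega, b⟩
        · exact ⟨by omega, b⟩
    · simp at h2; omega

/-! ### Joining all tables -/

/-- The number `J` bounds the sizes of the tables and the times of the joins. -/
structure Bound {G : Net} (T : Deco G) (J : ℕ) : Prop where
  pow : (G.ds + 2) ^ T.b ≤ J
  prod : ∀ A B, (G.bd A).card ≤ T.b → (G.bd B).card ≤ T.b → (G.bd (A ∪ B)).card ≤ T.b →
    A ⊆ Finset.range G.m → B ⊆ Finset.range G.m → Disjoint A B →
    ∏ v ∈ G.bd A ∪ G.bd B, G.fac A B v ≤ J

/-- The state of the algorithm after some of the joins. -/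
structure Joined {G : Net} (T : Deco G) (s : St) (i : ℕ) (R : Finset ℕ) (rep : ℕ → ℕ)
    (sol : ℕ → Finset ℕ) (M : Set ℕ) : Prop where
  con : T.Contracted R rep
  card : R.card + i = T.N
  tdeg : ∀ x ∈ R, s.a .tdeg x = (T.nb R x).card
  tsum : ∀ x ∈ R, s.a .tsum x = ∑ c ∈ T.nb R x, c
  queue : Queue s i M
  leaf : ∀ x ∈ R, (T.nb R x).card = 1 → x ∈ M
  sub : ∀ x ∈ M, x ∈ R ∧ (T.nb R x).card ≤ 1
  mem : Mem s sol
  marks : NoMarks s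
  inp : Inp G s
  table : ∀ x ∈ R, TableOK G s sol (T.part rep x) x
  rt : s.v .rt ∈ R

/-- No adjacency lists are kept: for each node the number and the sum of its remaining neighbours
suffice, because for a leaf the sum is its only neighbour. The queue contains all leaves of the
contracted tree. -/
theorem peel_step {G : Net} {T : Deco G} {J : ℕ} (hJ : Bound T J) {s : St} {R : Finset ℕ}
    {rep : ℕ → ℕ} {sol : ℕ → Finset ℕ} {M : Set ℕ} (h : Joined T s (s.v .k) R rep sol M)
    (hk : s.v .k + 1 < T.N) {s' : St} (hs' : (block [.set .x (.a .q (.v .k)),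
      .set .y (.a .tsum (.v .x)), join,
      .put .tsum (.v .y) (.sub (.a .tsum (.v .y)) (.v .x)),
      .put .tdeg (.v .y) (.sub (.a .tdeg (.v .y)) (.c 1)), enqueue .y,
      .set .rt (.v .y)]).exec s = s') :
    (∃ R' rep' sol' M', Joined T s' (s.v .k + 1) R' rep' sol' M') ∧
      s'.v .free ≤ s.v .free + J ∧ s'.tm ≤ s.tm + 20 + 300 * J := by
  have hcard := h.card
  have hR : 1 < R.card := by omega
  obtain ⟨z, hzR, hz1⟩ := h.con.exists_leaf hR
  obtain ⟨hxM, hQ⟩ := h.queue.pop ⟨z, h.leaf z hzR hz1⟩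
  set x := s.a .q (s.v .k) with hx
  obtain ⟨hxR, hx1⟩ := h.sub x hxM
  have hx1' : (T.nb R x).card = 1 := le_antisymm hx1 (h.con.nb_pos hxR hR)
  obtain ⟨y, hy⟩ := Finset.card_eq_one.1 hx1'
  have htx : s.a .tsum x = y := by rw [h.tsum x hxR, hy, Finset.sum_singleton]
  obtain ⟨hyR, hxy⟩ := T.mem_nb.1 (show y ∈ T.nb R x by simp [hy])
  have hne := T.ne _ _ hxy
  have hxy' : x ∈ T.nb R y := T.mem_nb.2 ⟨hxR, T.symm _ _ hxy⟩
  have hcon' := h.con.merge hxR hy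
  have hyR' : y ∈ R.erase x := Finset.mem_erase.2 ⟨hne.symm, hyR⟩
  simp only [exec_cons, exec_nil] at hs'
  generalize hs1 : (Cmd.set .y (.a .tsum (.v .x))).exec ((Cmd.set .x (.a .q (.v .k))).exec s) = s1
    at hs'
  have a1 : s1.v .x = x := by simp [← hs1, exec_set, hx]
  have a2 : s1.v .y = y := by simp [← hs1, exec_set, ← hx, htx]
  have a3 : s1.a = s.a := by simp [← hs1, exec_set]
  have a4 : ∀ v, v ≠ .x → v ≠ .y → s1.v v = s.v v := fun v h1 h2 => by
    simp [← hs1, exec_set, h1, h2]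
  have a5 : s1.tm = s.tm + 2 := by simp [← hs1, exec_set]
  clear hs1
  have e1 : ∀ p, s1.ent p = s.ent p := fun p => by simp only [St.ent, a3]
  have efr : s1.v .free = s.v .free := a4 _ (by decide) (by decide)
  have elf : s1.v .lf = s.v .lf := a4 _ (by decide) (by decide)
  have hM1 : Mem s1 sol := ⟨by rw [efr]; exact h.mem.1, fun p hp => by
    rw [e1]; exact h.mem.2 p (efr ▸ hp), h.mem.3, by rw [e1]; exact h.mem.4,
    by rw [a3]; exact h.mem.5, by rw [a3]; exact h.mem.6⟩
  have hI1 : Inp G s1 := ⟨(a4 _ (by decide) (by decide)).trans h.inp.dst,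
    (a4 _ (by decide) (by decide)).trans h.inp.D, by rw [a3]; exact h.inp.dem,
    by rw [a3]; exact h.inp.deg⟩
  have hT1 : ∀ z ∈ R, TableOK G s1 sol (T.part rep z) z := fun z hz => by
    obtain ⟨str, sz, ht⟩ := h.table z hz
    refine ⟨str, sz, ?_⟩
    rw [a3]
    exact ht.mono (fun i hi => by rw [a3]; exact ⟨rfl, rfl, rfl⟩) elf.ge efr.ge
      (fun p _ => e1 p) (fun _ _ => rfl)
  have hAs : ∀ z, T.part rep z ⊆ Finset.range G.m := fun z => Finset.filter_subset _ _
  have hd : Disjoint (T.part rep y) (T.part rep x) := Deco.disjoint_part hne.symm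
  have hbU : (G.bd (T.part rep y ∪ T.part rep x)).card ≤ T.b := by
    rw [← Deco.part_merge hne]; exact hcon'.card_bd_le hyR'
  obtain ⟨s2, hs2, sol2, hM2, hN2, hI2, hT2, hO2, hf2, ht2⟩ := join_spec (hAs y) (hAs x) hd hI1
    (by intro v; rw [a3]; exact h.marks v) hM1 (a2 ▸ hT1 y hyR) (a1 ▸ hT1 x hxR)
  rw [a2] at hT2 hO2
  have f2 := exec_frame join s1
  rw [hs2] at f2 hs'
  have hprod := hJ.prod _ _ (h.con.card_bd_le hyR) (h.con.card_bd_le hxR) hbU (hAs y) (hAs x) hd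
  have hpow : (G.ds + 2) ^ (G.bd (T.part rep y ∪ T.part rep x)).card ≤ J :=
    (Nat.pow_le_pow_right (by omega) hbU).trans hJ.pow
  have b1 := (f2.v .x (by decide)).trans a1
  have b2 := (f2.v .y (by decide)).trans a2
  have b3 := (f2.a .tsum (by decide)).trans (congrFun a3 _)
  have b4 := (f2.a .tdeg (by decide)).trans (congrFun a3 _)
  have b5 := (f2.a .q (by decide)).trans (congrFun a3 _)
  have b6 := (f2.v .qe (by decide)).trans (a4 _ (by decide) (by decide))
  generalize hs3 : (Cmd.put .tdeg (.v .y) (.sub (.a .tdeg (.v .y)) (.c 1))).exec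
    ((Cmd.put .tsum (.v .y) (.sub (.a .tsum (.v .y)) (.v .x))).exec s2) = s3 at hs'
  have c1 : s3.a .tdeg = Function.update (s.a .tdeg) y (s.a .tdeg y - 1) := by
    simp [← hs3, exec_put, b2, b4]
  have c2 : s3.a .tsum = Function.update (s.a .tsum) y (s.a .tsum y - x) := by
    simp [← hs3, exec_put, b2, b3, b1]
  have c3 : ∀ A, A ≠ .tdeg → A ≠ .tsum → s3.a A = s2.a A := fun A h1 h2 => by
    simp [← hs3, exec_put, h1, h2]
  have c4 : s3.v = s2.v := by simp [← hs3, exec_put]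
  have c5 : s3.tm = s2.tm + 2 := by simp [← hs3, exec_put]
  clear hs3
  have hQ3 : Queue s3 (s.v .k + 1) (M \ {x}) := hQ.congr (by rw [c4, b6])
    (by rw [c3 _ (by decide) (by decide), b5])
  have hty : s3.a .tdeg (s3.v .y) = (T.nb (R.erase x) y).card := by
    rw [c4, b2, c1, Function.update_self, h.tdeg y hyR, Deco.nb_erase,
      Finset.card_erase_of_mem hxy']
  -- If `y` becomes a leaf now, it had two neighbours before, so it was not in the queue.
  obtain ⟨d1, d2⟩ := enqueue_spec (x := .y) (by decide) hQ3 (fun h1 hm => by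
    rw [hty, Deco.nb_erase, Finset.card_erase_of_mem hxy'] at h1
    have := (h.sub _ hm.1).2
    rw [c4, b2] at this
    omega)
  rw [hty, c4, b2] at d1
  have f3 := exec_frame (enqueue .y) s3
  generalize (enqueue .y).exec s3 = s4 at *
  have hv4 : ∀ v, v ≠ .qe → s4.v v = s2.v v := fun v hv => by
    rw [f3.v v (by simpa [enqueue, block, Cmd.mv] using hv), c4]
  have ha4 : ∀ A, A ≠ .q → s4.a A = s3.a A := fun A hA =>
    f3.a A (by simpa [enqueue, block, Cmd.ma] using hA)
  have ha42 : ∀ A, A ≠ .q → A ≠ .tdeg → A ≠ .tsum → s4.a A = s2.a A := fun A h1 h2 h3 => by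
    rw [ha4 A h1, c3 A h2 h3]
  have g1 : s'.v .rt = y := by simp [← hs', exec_set, hv4 .y (by decide), b2]
  have g2 : ∀ v, v ≠ .rt → s'.v v = s4.v v := fun v h1 => by simp [← hs', exec_set, h1]
  have g3 : s'.a = s4.a := by simp [← hs', exec_set]
  have g4 : s'.tm = s4.tm + 2 := by simp [← hs', exec_set]
  clear hs'
  have i1 : ∀ p, s'.ent p = s2.ent p := fun p => by
    simp only [St.ent, g3, ha42 .cst (by decide) (by decide) (by decide),
      ha42 .el (by decide) (by decide) (by decide), ha42 .er (by decide) (by decide) (by decide),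
      ha42 .eU (by decide) (by decide) (by decide), ha42 .eV (by decide) (by decide) (by decide)]
  have ifr : s'.v .free = s2.v .free := (g2 _ (by decide)).trans (hv4 _ (by decide))
  have ilf : s'.v .lf = s2.v .lf := (g2 _ (by decide)).trans (hv4 _ (by decide))
  have hnbz : ∀ z ∈ R.erase x, z ≠ y → T.nb (R.erase x) z = T.nb R z := fun z hz hzy => by
    rw [Deco.nb_erase, Finset.erase_eq_of_notMem
      (Deco.notMem_nb_of_leaf hxR hy (Finset.mem_of_mem_erase hz) hzy)]
  have hqs : Queue s' (s.v .k + 1) {z | z ∈ M \ {x} ∨ z = y ∧ (T.nb (R.erase x) y).card = 1} :=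
    d1.congr (g2 _ (by decide)) (by rw [g3])
  refine ⟨⟨R.erase x, _, sol2, _, ⟨hcon', ?_, fun z hz => ?_, fun z hz => ?_, hqs, fun z hz h1 => ?_,
    fun z hz => ?_, ?_, fun v => ?_, ?_, fun z hz => ?_, ?_⟩⟩, ?_, ?_⟩
  · rw [Finset.card_erase_of_mem hxR]; omega
  · rw [g3, ha4 _ (by decide), c1]
    by_cases hzy : z = y
    · rw [hzy, Function.update_self, h.tdeg y hyR, Deco.nb_erase, Finset.card_erase_of_mem hxy']
    · rw [Function.update_of_ne hzy, hnbz z hz hzy, h.tdeg z (Finset.mem_of_mem_erase hz)]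
  · rw [g3, ha4 _ (by decide), c2]
    by_cases hzy : z = y
    · rw [hzy, Function.update_self, h.tsum y hyR, Deco.nb_erase,
        ← Finset.add_sum_erase _ _ hxy']
      omega
    · rw [Function.update_of_ne hzy, hnbz z hz hzy, h.tsum z (Finset.mem_of_mem_erase hz)]
  · by_cases hzy : z = y
    · subst hzy; exact Or.inr ⟨rfl, h1⟩
    · rw [hnbz z hz hzy] at h1
      exact Or.inl ⟨h.leaf z (Finset.mem_of_mem_erase hz) h1, (Finset.mem_erase.1 hz).1⟩
  · rcases hz with ⟨h1, h2⟩ | ⟨rfl, h1⟩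
    · obtain ⟨h3, h4⟩ := h.sub z h1
      refine ⟨Finset.mem_erase.2 ⟨h2, h3⟩, ?_⟩
      rw [Deco.nb_erase]
      exact (Finset.card_le_card (Finset.erase_subset _ _)).trans h4
    · exact ⟨hyR', h1.le⟩
  · refine ⟨by rw [ifr]; exact hM2.1, fun p hp => by rw [i1]; exact hM2.2 p (ifr ▸ hp), hM2.3,
      by rw [i1]; exact hM2.4, fun p hp => ?_, fun p => ?_⟩
    · rw [show s'.a .el p = s2.a .el p from congrArg (fun q => q.2.1) (i1 p),
        show s'.a .er p = s2.a .er p from congrArg (fun q => q.2.2.1) (i1 p)]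
      exact hM2.5 p hp
    · rw [show s'.a .el p = s2.a .el p from congrArg (fun q => q.2.1) (i1 p),
        show s'.a .er p = s2.a .er p from congrArg (fun q => q.2.2.1) (i1 p),
        show s'.a .eU p = s2.a .eU p from congrArg (fun q => q.2.2.2.1) (i1 p),
        show s'.a .eV p = s2.a .eV p from congrArg (fun q => q.2.2.2.2) (i1 p)]
      exact hM2.6 p
  · rw [g3, ha42 .ca (by decide) (by decide) (by decide),
      ha42 .sa (by decide) (by decide) (by decide), ha42 .cb (by decide) (by decide) (by decide),
      ha42 .sb (by decide) (by decide) (by decide)]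
    exact hN2 v
  · exact ⟨((g2 _ (by decide)).trans (hv4 _ (by decide))).trans hI2.dst,
      ((g2 _ (by decide)).trans (hv4 _ (by decide))).trans hI2.D,
      by rw [g3, ha42 .dem (by decide) (by decide) (by decide)]; exact hI2.dem,
      by rw [g3, ha42 .deg (by decide) (by decide) (by decide)]; exact hI2.deg⟩
  · have hz' : TableOK G s2 sol2 (T.part (fun a => if rep a = x then y else rep a) z) z := by
      by_cases hzy : z = y
      · rw [hzy, Deco.part_merge hne]; exact hT2
      · rw [Deco.part_merge_of_ne (Finset.mem_erase.1 hz).1 hzy]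
        exact hO2 z _ hzy (hT1 z (Finset.mem_of_mem_erase hz))
    obtain ⟨str, sz, ht⟩ := hz'
    refine ⟨str, sz, ?_⟩
    rw [g3, ha42 .base (by decide) (by decide) (by decide),
      ha42 .wp (by decide) (by decide) (by decide), ha42 .wn (by decide) (by decide) (by decide)]
    refine ht.mono (fun i hi => ?_) ilf.ge ifr.ge (fun p _ => i1 p) (fun _ _ => rfl)
    rw [g3, ha42 .lv (by decide) (by decide) (by decide),
      ha42 .lc (by decide) (by decide) (by decide), ha42 .ls (by decide) (by decide) (by decide)]
    exact ⟨rfl, rfl, rfl⟩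
  · rw [g1]; exact hyR'
  · omega
  · omega

theorem peel_spec {G : Net} {T : Deco G} {J : ℕ} (hJ : Bound T J) {s : St} {R : Finset ℕ}
    {rep : ℕ → ℕ} {sol : ℕ → Finset ℕ} {M : Set ℕ} (h : Joined T s 0 R rep sol M)
    (hN : s.v .N = T.N) :
    ∃ s', peel.exec s = s' ∧ (∃ R' rep' sol' M', Joined T s' (T.N - 1) R' rep' sol' M') ∧
      s'.v .free ≤ s.v .free + (T.N - 1) * J ∧
      s'.tm ≤ s.tm + 1 + (T.N - 1) * (21 + 300 * J) := by
  refine ⟨_, rfl, ?_⟩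
  have := loop_rule (x := .k) (e := .sub (.v .N) (.c 1)) (s := s)
    (c := block [.set .x (.a .q (.v .k)),
      .set .y (.a .tsum (.v .x)), join,
      .put .tsum (.v .y) (.sub (.a .tsum (.v .y)) (.v .x)),
      .put .tdeg (.v .y) (.sub (.a .tdeg (.v .y)) (.c 1)), enqueue .y, .set .rt (.v .y)])
    (fun i s' => (∃ R' rep' sol' M', Joined T s' i R' rep' sol' M') ∧
      s'.v .free ≤ s.v .free + i * J ∧ s'.tm ≤ s.tm + 1 + i * (21 + 300 * J)) ?_ ?_
  · simp only [Ex.eval, hN] at this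
    exact this
  · refine ⟨⟨R, rep, sol, M, ?_⟩, by simp, by simp⟩
    have hT : ∀ x ∈ R, TableOK G s.tick sol (T.part rep x) x := fun x hx => by
      obtain ⟨str, sz, ht⟩ := h.table x hx
      exact ⟨str, sz, ht.mono (fun _ _ => ⟨rfl, rfl, rfl⟩) le_rfl le_rfl (fun _ _ => rfl)
        (fun _ _ => rfl)⟩
    exact ⟨h.con, h.card, h.tdeg, h.tsum, h.queue.congr rfl rfl, h.leaf, h.sub,
      ⟨h.mem.1, h.mem.2, h.mem.3, h.mem.4, h.mem.5, h.mem.6⟩, h.marks,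
      ⟨h.inp.1, h.inp.2, h.inp.3, h.inp.4⟩, hT, h.rt⟩
  · rintro k hk s1 hf ⟨⟨R', rep', sol', M', h'⟩, h1, h2⟩
    simp only [Ex.eval, hN] at hk
    have hk1 : (s1.setv .k k).tick.v .k = k := by simp
    have hT : ∀ x ∈ R', TableOK G (s1.setv .k k).tick sol' (T.part rep' x) x := fun x hx => by
      obtain ⟨str, sz, ht⟩ := h'.table x hx
      exact ⟨str, sz, ht.mono (fun _ _ => ⟨rfl, rfl, rfl⟩) le_rfl le_rfl (fun _ _ => rfl)
        (fun _ _ => rfl)⟩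
    have hJs : Joined T (s1.setv .k k).tick ((s1.setv .k k).tick.v .k) R' rep' sol' M' := by
      rw [hk1]
      exact ⟨h'.con, h'.card, h'.tdeg, h'.tsum, h'.queue.congr rfl rfl, h'.leaf, h'.sub,
        ⟨h'.mem.1, h'.mem.2, h'.mem.3, h'.mem.4, h'.mem.5, h'.mem.6⟩, h'.marks,
        ⟨h'.inp.1, h'.inp.2, h'.inp.3, h'.inp.4⟩, hT, h'.rt⟩
    obtain ⟨g1, g2, g3⟩ := peel_step hJ hJs (by rw [hk1]; omega) rfl
    rw [hk1] at g1
    refine ⟨g1, ?_, ?_⟩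
    · rw [Nat.add_one_mul k]; simp at g2; omega
    · rw [Nat.add_one_mul k]; simp at g3; omega

/-! ### Tracing back and printing -/

theorem mem_one {v a : ℕ} : v ∈ one a ↔ v + 1 = a := by
  unfold one
  split_ifs with h
  · simp [h]
  · rw [Finset.mem_singleton]; omega

/-- The sweep runs through the addresses downwards. The solution always consists of the vertices
recorded so far and the solutions of the marked entries not yet visited; pointers lead to smaller
addresses, so every mark is set before its turn. -/
theorem trace_spec {s : St} {sol : ℕ → Finset ℕ} (hM : Mem s sol) {p₀ : ℕ}
    (hp : p₀ < s.v .free) (hmark : ∀ p, 0 < s.a .mark p ↔ p = p₀) (hins : ∀ v, s.a .ins v = 0) :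
    (∀ v, 0 < (trace.exec s).a .ins (v + 1) ↔ v ∈ sol p₀) ∧
    (trace.exec s).tm ≤ s.tm + 1 + 10 * s.v .free := by
  have := loop_rule (x := .k) (e := .v .free) (s := s) (c := block [
      .set .p (.sub (.v .free) (.add (.v .k) (.c 1))),
      .ite (.a .mark (.v .p)) (block [.put .mark (.a .el (.v .p)) (.c 1),
        .put .mark (.a .er (.v .p)) (.c 1), .put .ins (.a .eU (.v .p)) (.c 1),
        .put .ins (.a .eV (.v .p)) (.c 1)]) .skip])
    (fun k s' => (∀ v, v ∈ sol p₀ ↔ 0 < s'.a .ins (v + 1) ∨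
      ∃ p < s.v .free - k, 0 < s'.a .mark p ∧ v ∈ sol p) ∧ s'.tm ≤ s.tm + 1 + 10 * k) ?_ ?_
  · obtain ⟨h1, h2⟩ := this
    refine ⟨fun v => ?_, h2⟩
    rw [h1 v]
    simp only [Ex.eval, Nat.sub_self, Nat.not_lt_zero, false_and, exists_false, or_false]
    exact Iff.rfl
  · refine ⟨fun v => ?_, by simp⟩
    simp only [tick_a, hins, hmark]
    constructor
    · exact fun h => Or.inr ⟨p₀, by simpa using hp, rfl, h⟩
    · rintro (h | ⟨p, -, rfl, h⟩)
      · omega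
      · exact h
  · rintro k hk s' hf ⟨h1, h2⟩
    simp only [Ex.eval] at hk
    have hfr : s'.v .free = s.v .free := hf.v _ (by decide)
    have hel : s'.a .el = s.a .el := hf.a _ (by decide)
    have her : s'.a .er = s.a .er := hf.a _ (by decide)
    have heU : s'.a .eU = s.a .eU := hf.a _ (by decide)
    have heV : s'.a .eV = s.a .eV := hf.a _ (by decide)
    simp only [exec_cons, exec_nil, exec_ite]
    generalize hs1 : (Cmd.set .p (.sub (.v .free) (.add (.v .k) (.c 1)))).exec
      (s'.setv .k k).tick = s1
    have a1 : s1.v .p = s.v .free - (k + 1) := by simp [← hs1, exec_set, hfr]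
    have a2 : s1.a = s'.a := by simp [← hs1, exec_set]
    have a3 : s1.tm = s'.tm + 2 := by simp [← hs1, exec_set]
    clear hs1
    set p := s.v .free - (k + 1) with hpd
    have hlast : ∀ q, q < s.v .free - k ↔ q < p ∨ q = p := fun q => by omega
    by_cases hm : 0 < s'.a .mark p
    · rw [if_pos (by simpa [a1, a2] using hm)]
      generalize hs2 : ((Cmd.put .ins (.a .eV (.v .p)) (.c 1)).exec
        ((Cmd.put .ins (.a .eU (.v .p)) (.c 1)).exec ((Cmd.put .mark (.a .er (.v .p)) (.c 1)).exec
        ((Cmd.put .mark (.a .el (.v .p)) (.c 1)).exec s1.tick)))).tick.tick = s2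
      have b1 : s2.a .mark = Function.update (Function.update (s'.a .mark) (s.a .el p) 1)
          (s.a .er p) 1 := by
        simp [← hs2, exec_put, a1, a2, hel, her]
      have b2 : s2.a .ins = Function.update (Function.update (s'.a .ins) (s.a .eU p) 1)
          (s.a .eV p) 1 := by
        simp [← hs2, exec_put, a1, a2, heU, heV]
      have b3 : s2.tm = s1.tm + 7 := by simp [← hs2, exec_put]
      clear hs2
      have hmark2 : ∀ q, 0 < s2.a .mark q ↔ 0 < s'.a .mark q ∨ q = s.a .el p ∨ q = s.a .er p := by
        intro q
        rw [b1, Function.update_apply, Function.update_apply]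
        split_ifs <;> omega
      have hins2 : ∀ v, 0 < s2.a .ins (v + 1) ↔ 0 < s'.a .ins (v + 1) ∨ v ∈ one (s.a .eU p) ∨
          v ∈ one (s.a .eV p) := by
        intro v
        rw [b2, Function.update_apply, Function.update_apply, mem_one, mem_one]
        split_ifs <;> omega
      refine ⟨fun v => ?_, by omega⟩
      rw [h1 v, hins2]
      simp only [hmark2, hlast]
      have hsol : v ∈ sol p ↔ ((v ∈ sol (s.a .el p) ∨ v ∈ sol (s.a .er p)) ∨ v ∈ one (s.a .eU p)) ∨
          v ∈ one (s.a .eV p) := by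
        conv_lhs => rw [hM.eq p]
        simp only [Finset.mem_union]
      -- Entry `0` points to itself, but its solution is empty and it only writes to cell `0` of
      -- `ins`, which belongs to no vertex.
      rcases Nat.eq_zero_or_pos p with h0 | hpos
      · have hz := hM.ent_zero
        simp only [St.ent, Prod.mk.injEq] at hz
        obtain ⟨z1, z2, z3, z4⟩ := hz
        rw [h0] at hsol ⊢
        simp only [z3, z4, mem_one]
        constructor
        · rintro (h | ⟨q, h | h, -, h'⟩)
          · exact Or.inl (Or.inl h)
          · omega
          · rw [h, hM.sol_zero] at h'; simp at h'
        · rintro ((h | h | h) | ⟨q, h, -⟩) <;> omega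
      · obtain ⟨l1, l2⟩ := hM.lt p hpos
        constructor
        · rintro (h | ⟨q, h | rfl, hq, hv⟩)
          · exact Or.inl (Or.inl h)
          · exact Or.inr ⟨q, h, Or.inl hq, hv⟩
          · rcases hsol.1 hv with ((h | h) | h) | h
            · exact Or.inr ⟨_, l1, Or.inr (Or.inl rfl), h⟩
            · exact Or.inr ⟨_, l2, Or.inr (Or.inr rfl), h⟩
            · exact Or.inl (Or.inr (Or.inl h))
            · exact Or.inl (Or.inr (Or.inr h))
        · rintro ((h | h | h) | ⟨q, h, hq | rfl | rfl, hv⟩)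
          · exact Or.inl h
          · exact Or.inr ⟨p, Or.inr rfl, hm, hsol.2 (Or.inl (Or.inr h))⟩
          · exact Or.inr ⟨p, Or.inr rfl, hm, hsol.2 (Or.inr h)⟩
          · exact Or.inr ⟨q, Or.inl h, hq, hv⟩
          · exact Or.inr ⟨p, Or.inr rfl, hm, hsol.2 (Or.inl (Or.inl (Or.inl hv)))⟩
          · exact Or.inr ⟨p, Or.inr rfl, hm, hsol.2 (Or.inl (Or.inl (Or.inr hv)))⟩
    · rw [if_neg (by simpa [a1, a2] using hm), exec_skip]
      refine ⟨fun v => ?_, by simp; omega⟩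
      rw [h1 v]
      simp only [tick_a, a2, hlast]
      constructor
      · rintro (h | ⟨q, h | rfl, hq, hv⟩)
        · exact Or.inl h
        · exact Or.inr ⟨q, h, hq, hv⟩
        · exact absurd hq hm
      · rintro (h | ⟨q, h, hq, hv⟩)
        · exact Or.inl h
        · exact Or.inr ⟨q, Or.inl h, hq, hv⟩

theorem output_spec (s : St) (f : ℕ → Bool)
    (hf : ∀ v, f v = true ↔ 0 < s.a .deg v ∧ 0 < s.a .ins (v + 1) ∨
      s.a .deg v = 0 ∧ 0 < s.a .dem v) :
    (output.exec s).out = s.out ++ (List.range (s.v .n)).filter f ∧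
    (output.exec s).tm ≤ s.tm + 1 + 4 * s.v .n := by
  have := loop_rule (x := .k) (e := .v .n) (s := s) (c := .ite (.a .deg (.v .k))
      (.ite (.a .ins (.add (.v .k) (.c 1))) (.print (.v .k)) .skip)
      (.ite (.a .dem (.v .k)) (.print (.v .k)) .skip))
    (fun k s' => s'.out = s.out ++ (List.range k).filter f ∧ s'.tm ≤ s.tm + 1 + 4 * k) ?_ ?_
  · exact this
  · simp
  · rintro k hk s' hfr ⟨h1, h2⟩
    have hdeg : s'.a .deg = s.a .deg := hfr.a _ (by decide)
    have hins : s'.a .ins = s.a .ins := hfr.a _ (by decide)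
    have hdem : s'.a .dem = s.a .dem := hfr.a _ (by decide)
    simp only [exec_ite, exec_print, exec_skip, List.range_succ, List.filter_append,
      List.filter_cons, List.filter_nil, Ex.eval, tick_a, tick_v, setv_a, setv_v, if_true, hdeg,
      hins, hdem, hf]
    by_cases c1 : 0 < s.a .deg k
    · have c1' : s.a .deg k ≠ 0 := by omega
      by_cases c2 : 0 < s.a .ins (k + 1)
      · simp [c1, c1', c2, h1]; omega
      · simp [c1, c1', c2, h1]; omega
    · have c1' : s.a .deg k = 0 := by omega
      by_cases c2 : 0 < s.a .dem k
      · simp [c1', c2, h1]; omega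
      · simp [c1', c2, h1]; omega

/-! ### Reading the input -/

theorem readDemands_spec {s : St} {d : ℕ → ℕ} {rest : List ℕ} {n : ℕ} (hn : s.v .n = n)
    (hin : s.inp = (List.range n).map d ++ rest) (hdst : s.v .dst = 0)
    (hdem : ∀ v, s.a .dem v = 0) :
    (readDemands.exec s).inp = rest ∧
    (∀ v, (readDemands.exec s).a .dem v = if v < n then d v else 0) ∧
    (∀ v < n, d v ≤ (readDemands.exec s).v .dst) ∧
    ((readDemands.exec s).v .dst = 0 ∨ ∃ v < n, d v = (readDemands.exec s).v .dst) ∧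
    (readDemands.exec s).tm ≤ s.tm + 1 + 5 * n := by
  have := loop_rule (x := .k) (e := .v .n) (s := s) (c := block [.read .t, .put .dem (.v .k) (.v .t),
      .set .dst (.ite (.sub (.v .t) (.v .dst)) (.v .t) (.v .dst))])
    (fun k s' => s'.inp = (List.range' k (n - k)).map d ++ rest ∧
      (∀ v, s'.a .dem v = if v < k then d v else 0) ∧ (∀ v < k, d v ≤ s'.v .dst) ∧
      (s'.v .dst = 0 ∨ ∃ v < k, d v = s'.v .dst) ∧ s'.tm ≤ s.tm + 1 + 5 * k) ?_ ?_
  · simp only [Ex.eval, hn] at this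
    obtain ⟨h1, h2, h3, h4, h5⟩ := this
    refine ⟨?_, h2, h3, h4, h5⟩
    rw [Nat.sub_self] at h1
    exact h1
  · exact ⟨by simp [hin, List.range_eq_range'], by simp [hdem], by simp, by simp [hdst], by simp⟩
  · rintro k hk s' hf ⟨h1, h2, h3, h4, h5⟩
    simp only [Ex.eval, hn] at hk
    rw [show n - k = (n - (k + 1)) + 1 by omega, List.range'_succ, List.map_cons,
      List.cons_append] at h1
    simp only [exec_cons, exec_nil]
    generalize hs1 : (Cmd.put .dem (.v .k) (.v .t)).exec ((Cmd.read .t).exec (s'.setv .k k).tick)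
      = s1
    have a1 : s1.v .t = d k := by simp [← hs1, exec_put, exec_read, h1]
    have a2 : s1.v .dst = s'.v .dst := by simp [← hs1, exec_put, exec_read]
    have a3 : s1.a .dem = Function.update (s'.a .dem) k (d k) := by
      simp [← hs1, exec_put, exec_read, h1]
    have a4 : s1.inp = (List.range' (k + 1) (n - (k + 1))).map d ++ rest := by
      simp [← hs1, exec_put, exec_read, h1]
    have a5 : s1.tm = s'.tm + 3 := by simp [← hs1, exec_put, exec_read]
    clear hs1
    have hdst' : ((Cmd.set .dst (.ite (.sub (.v .t) (.v .dst)) (.v .t) (.v .dst))).exec s1).tick.v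
        .dst = max (s'.v .dst) (d k) := by
      simp only [exec_set, tick_v, setv_v, if_true]
      by_cases h : 0 < d k - s'.v .dst
      · rw [show Ex.eval (.ite (.sub (.v .t) (.v .dst)) (.v .t) (.v .dst)) s1 = s1.v .t from
          if_pos (by simpa [a1, a2] using h), a1]
        omega
      · rw [show Ex.eval (.ite (.sub (.v .t) (.v .dst)) (.v .t) (.v .dst)) s1 = s1.v .dst from
          if_neg (by simpa [a1, a2] using h), a2]
        omega
    refine ⟨by simpa [exec_set] using a4, fun v => ?_, fun v hv => ?_, ?_, ?_⟩
    · simp only [exec_set, tick_a, setv_a, a3, Function.update_apply]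
      split_ifs with c1 c2 c2
      · rw [c1]
      · omega
      · rw [h2, if_pos (by omega)]
      · rw [h2, if_neg (by omega)]
    · rw [hdst']
      by_cases hvk : v = k
      · rw [hvk]; omega
      · have := h3 v (by omega); omega
    · rw [hdst']
      rcases Nat.le_total (d k) (s'.v .dst) with h | h
      · rw [max_eq_left h]
        rcases h4 with h4 | ⟨v, hv, h4⟩
        · exact Or.inl h4
        · exact Or.inr ⟨v, by omega, h4⟩
      · rw [max_eq_right h]; exact Or.inr ⟨k, by omega, rfl⟩
    · simp [exec_set]; omega

theorem readEdges_spec {s : St} {eu ev et : ℕ → ℕ} {rest : List ℕ} {m : ℕ} (hm : s.v .m = m)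
    (hin : s.inp = (List.range m).flatMap (fun k => [eu k, ev k, et k]) ++ rest)
    (hdeg : ∀ v, s.a .deg v = 0) :
    (readEdges.exec s).inp = rest ∧
    (∀ k < m, (readEdges.exec s).a .eu k = eu k ∧ (readEdges.exec s).a .ev k = ev k ∧
      (readEdges.exec s).a .et k = et k) ∧
    (∀ v, (readEdges.exec s).a .deg v =
      ∑ k ∈ Finset.range m, ((if v = eu k then 1 else 0) + (if v = ev k then 1 else 0))) ∧
    (readEdges.exec s).tm ≤ s.tm + 1 + 10 * m := by
  have := loop_rule (x := .k) (e := .v .m) (s := s) (c := block [.read .u, .read .w, .read .t,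
      .put .eu (.v .k) (.v .u), .put .ev (.v .k) (.v .w), .put .et (.v .k) (.v .t),
      bump .deg (.v .u), bump .deg (.v .w)])
    (fun k s' => s'.inp = (List.range' k (m - k)).flatMap (fun k => [eu k, ev k, et k]) ++ rest ∧
      (∀ j < k, s'.a .eu j = eu j ∧ s'.a .ev j = ev j ∧ s'.a .et j = et j) ∧
      (∀ v, s'.a .deg v =
        ∑ j ∈ Finset.range k, ((if v = eu j then 1 else 0) + (if v = ev j then 1 else 0))) ∧
      s'.tm ≤ s.tm + 1 + 10 * k) ?_ ?_
  · simp only [Ex.eval, hm] at this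
    obtain ⟨h1, h2, h3, h4⟩ := this
    refine ⟨?_, h2, h3, h4⟩
    rw [Nat.sub_self] at h1
    exact h1
  · exact ⟨by simp [hin, List.range_eq_range'], by simp, by simp [hdeg], by simp⟩
  · rintro k hk s' hf ⟨h1, h2, h3, h4⟩
    simp only [Ex.eval, hm] at hk
    rw [show m - k = (m - (k + 1)) + 1 by omega, List.range'_succ, List.flatMap_cons] at h1
    generalize hs1 : (block _).exec (s'.setv .k k).tick = s1
    have a1 : s1.a .eu = Function.update (s'.a .eu) k (eu k) := by
      simp [← hs1, exec_cons, exec_nil, exec_put, exec_read, h1]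
    have a2 : s1.a .ev = Function.update (s'.a .ev) k (ev k) := by
      simp [← hs1, exec_cons, exec_nil, exec_put, exec_read, h1]
    have a3 : s1.a .et = Function.update (s'.a .et) k (et k) := by
      simp [← hs1, exec_cons, exec_nil, exec_put, exec_read, h1]
    have a4 : s1.inp = (List.range' (k + 1) (m - (k + 1))).flatMap
        (fun k => [eu k, ev k, et k]) ++ rest := by
      simp [← hs1, exec_cons, exec_nil, exec_put, exec_read, h1]
    have a5 : ∀ v, s1.a .deg v = s'.a .deg v + ((if v = eu k then 1 else 0) +
        (if v = ev k then 1 else 0)) := fun v => by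
      simp only [← hs1, exec_cons, exec_nil, exec_put, exec_read, tick_a, seta_a, setv_a, tick_v,
        seta_v, setv_v, Ex.eval]
      simp only [h1, tick_inp, setv_inp, List.headD_cons, List.tail_cons, List.cons_append,
        reduceCtorEq, if_true, if_false, Function.update_apply]
      split_ifs <;> simp_all
    have a6 : s1.tm = s'.tm + 10 := by
      simp [← hs1, exec_cons, exec_nil, exec_put, exec_read]
    clear hs1
    refine ⟨a4, fun j hj => ?_, fun v => ?_, by omega⟩
    · rw [a1, a2, a3]
      by_cases hjk : j = k
      · subst hjk; simp
      · simp only [Function.update_of_ne hjk]; exact h2 j (by omega)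
    · rw [a5, h3, Finset.sum_range_succ]

theorem readTree_spec {s : St} {tu tv : ℕ → ℕ} {rest : List ℕ} {M : ℕ} (hN : s.v .N - 1 = M)
    (hin : s.inp = (List.range M).flatMap (fun k => [tu k, tv k]) ++ rest)
    (hdeg : ∀ x, s.a .tdeg x = 0) (hsum : ∀ x, s.a .tsum x = 0) :
    (∀ x, (readTree.exec s).a .tdeg x =
      ∑ k ∈ Finset.range M, ((if x = tu k then 1 else 0) + (if x = tv k then 1 else 0))) ∧
    (∀ x, (readTree.exec s).a .tsum x =
      ∑ k ∈ Finset.range M, ((if x = tu k then tv k else 0) + (if x = tv k then tu k else 0))) ∧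
    (readTree.exec s).tm ≤ s.tm + 1 + 8 * M := by
  have := loop_rule (x := .k) (e := .sub (.v .N) (.c 1)) (s := s) (c := block [.read .x, .read .y,
      bump .tdeg (.v .x), bump .tdeg (.v .y),
      .put .tsum (.v .x) (.add (.a .tsum (.v .x)) (.v .y)),
      .put .tsum (.v .y) (.add (.a .tsum (.v .y)) (.v .x))])
    (fun k s' => s'.inp = (List.range' k (M - k)).flatMap (fun k => [tu k, tv k]) ++ rest ∧
      (∀ x, s'.a .tdeg x =
        ∑ j ∈ Finset.range k, ((if x = tu j then 1 else 0) + (if x = tv j then 1 else 0))) ∧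
      (∀ x, s'.a .tsum x =
        ∑ j ∈ Finset.range k, ((if x = tu j then tv j else 0) + (if x = tv j then tu j else 0))) ∧
      s'.tm ≤ s.tm + 1 + 8 * k) ?_ ?_
  · simp only [Ex.eval, hN] at this
    exact this.2
  · exact ⟨by simp [hin, List.range_eq_range'], by simp [hdeg], by simp [hsum], by simp⟩
  · rintro k hk s' hf ⟨h1, h2, h3, h4⟩
    simp only [Ex.eval, hN] at hk
    rw [show M - k = (M - (k + 1)) + 1 by omega, List.range'_succ, List.flatMap_cons] at h1
    generalize hs1 : (block _).exec (s'.setv .k k).tick = s1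
    have a4 : s1.inp = (List.range' (k + 1) (M - (k + 1))).flatMap
        (fun k => [tu k, tv k]) ++ rest := by
      simp [← hs1, exec_cons, exec_nil, exec_put, exec_read, h1]
    have a5 : ∀ x, s1.a .tdeg x = s'.a .tdeg x + ((if x = tu k then 1 else 0) +
        (if x = tv k then 1 else 0)) := fun x => by
      simp only [← hs1, exec_cons, exec_nil, exec_put, exec_read, tick_a, seta_a, setv_a, tick_v,
        seta_v, setv_v, Ex.eval]
      simp only [h1, tick_inp, setv_inp, List.headD_cons, List.tail_cons, List.cons_append,
        reduceCtorEq, if_true, if_false, Function.update_apply]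
      split_ifs <;> simp_all
    have a6 : ∀ x, s1.a .tsum x = s'.a .tsum x + ((if x = tu k then tv k else 0) +
        (if x = tv k then tu k else 0)) := fun x => by
      simp only [← hs1, exec_cons, exec_nil, exec_put, exec_read, tick_a, seta_a, setv_a, tick_v,
        seta_v, setv_v, Ex.eval]
      simp only [h1, tick_inp, setv_inp, List.headD_cons, List.tail_cons, List.cons_append,
        reduceCtorEq, if_true, if_false, Function.update_apply]
      split_ifs <;> simp_all <;> omega
    have a7 : s1.tm = s'.tm + 8 := by
      simp [← hs1, exec_cons, exec_nil, exec_put, exec_read]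
    clear hs1
    refine ⟨a4, fun x => ?_, fun x => ?_, by omega⟩
    · rw [a5, h2, Finset.sum_range_succ]
    · rw [a6, h3, Finset.sum_range_succ]

/-! ### The whole algorithm -/

theorem Mem.congr {s s' : St} {sol : ℕ → Finset ℕ} (h : Mem s sol) (hf : s'.v .free = s.v .free)
    (he : ∀ p, s'.ent p = s.ent p) : Mem s' sol := by
  refine ⟨by rw [hf]; exact h.1, fun p hp => by rw [he]; exact h.2 p (hf ▸ hp), h.3,
    by rw [he]; exact h.4, fun p hp => ?_, fun p => ?_⟩
  · rw [show s'.a .el p = s.a .el p from congrArg (fun q => q.2.1) (he p),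
      show s'.a .er p = s.a .er p from congrArg (fun q => q.2.2.1) (he p)]
    exact h.5 p hp
  · rw [show s'.a .el p = s.a .el p from congrArg (fun q => q.2.1) (he p),
      show s'.a .er p = s.a .er p from congrArg (fun q => q.2.2.1) (he p),
      show s'.a .eU p = s.a .eU p from congrArg (fun q => q.2.2.2.1) (he p),
      show s'.a .eV p = s.a .eV p from congrArg (fun q => q.2.2.2.2) (he p)]
    exact h.6 p

theorem ent_congr {s s' : St} (h : ∀ A ∈ [Arr.cst, .el, .er, .eU, .eV], s'.a A = s.a A) (p : ℕ) :
    s'.ent p = s.ent p := by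
  simp only [List.forall_mem_cons, List.not_mem_nil, false_imp_iff, implies_true, and_true] at h
  simp only [St.ent, h]

theorem TableOK.congr {G : Net} {s s' : St} {sol : ℕ → Finset ℕ} {A : Finset ℕ} {x : ℕ}
    (h : TableOK G s sol A x) (hf : s'.v .free = s.v .free) (hl : s'.v .lf = s.v .lf)
    (ha : ∀ A ∈ [Arr.cst, .el, .er, .eU, .eV, .lv, .lc, .ls, .base, .wp, .wn], s'.a A = s.a A) :
    TableOK G s' sol A x := by
  obtain ⟨str, sz, h⟩ := h
  refine ⟨str, sz, ?_⟩
  rw [ha .base (by simp), ha .wp (by simp), ha .wn (by simp)]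
  refine h.mono (fun i _ => ?_) hl.ge hf.ge (fun p _ => ent_congr (fun A hA => ha A ?_) p)
    (fun _ _ => rfl)
  · rw [ha .lv (by simp), ha .lc (by simp), ha .ls (by simp)]; exact ⟨rfl, rfl, rfl⟩
  · simp only [List.mem_cons, List.not_mem_nil, or_false] at hA ⊢; tauto

/-- The reading loop counts ends of edges; without loops this is the same as counting incident
edges. -/
theorem sum_ends_eq_degA (G : Net) (v m : ℕ) (hm : m ≤ G.m) :
    ∑ k ∈ Finset.range m, ((if v = G.eu k then 1 else 0) + (if v = G.ev k then 1 else 0)) =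
      G.degA (Finset.range m) v := by
  rw [Net.degA, Finset.card_filter]
  refine Finset.sum_congr rfl fun k hk => ?_
  have := G.ne k (by have := Finset.mem_range.1 hk; omega)
  split_ifs <;> omega

/-- The input of the algorithm. -/
def inputList {G : Net} (T : Deco G) (tu tv : ℕ → ℕ) : List ℕ :=
  [G.n, G.m, T.N] ++ (List.range G.n).map G.d
    ++ (List.range G.m).flatMap (fun k => [G.eu k, G.ev k, T.et k])
    ++ (List.range (T.N - 1)).flatMap (fun k => [tu k, tv k])

/-- The state after reading the input. -/
structure Started {G : Net} (T : Deco G) (s : St) : Prop where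
  n : s.v .n = G.n
  m : s.v .m = G.m
  N : s.v .N = T.N
  inp : Inp G s
  edges : EdgesOK T s
  tdeg : ∀ x < T.N, s.a .tdeg x = (T.nb (Finset.range T.N) x).card
  tsum : ∀ x < T.N, s.a .tsum x = ∑ c ∈ T.nb (Finset.range T.N) x, c
  free : s.v .free = 1
  qe : s.v .qe = 0
  rt : s.v .rt = 0
  zero : ∀ A, A ∉ [Arr.dem, .eu, .ev, .et, .deg, .tdeg, .tsum] → s.a A = fun _ => 0
  out : s.out = []

theorem started {G : Net} {T : Deco G} {tu tv : ℕ → ℕ} (hd : ∀ v, G.n ≤ v → G.d v = 0)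
    (hds : G.ds = 0 ∨ ∃ v < G.n, G.d v = G.ds)
    (ht1 : ∀ x < T.N, ∑ k ∈ Finset.range (T.N - 1), ((if x = tu k then 1 else 0) +
      (if x = tv k then 1 else 0)) = (T.nb (Finset.range T.N) x).card)
    (ht2 : ∀ x < T.N, ∑ k ∈ Finset.range (T.N - 1), ((if x = tu k then tv k else 0) +
      (if x = tv k then tu k else 0)) = ∑ c ∈ T.nb (Finset.range T.N) x, c)
    {s : St} (hs : s = (block [.read .n, .read .m, .read .N, readDemands, readEdges, readTree,
      .set .D (.add (.v .dst) (.c 2)), .set .free (.c 1)]).exec (St.init (inputList T tu tv))) :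
    Started T s ∧ s.tm ≤ 10 + 5 * G.n + 10 * G.m + 8 * (T.N - 1) := by
  simp only [exec_cons, exec_nil] at hs
  generalize hs1 : (Cmd.read .N).exec ((Cmd.read .m).exec ((Cmd.read .n).exec
    (St.init (inputList T tu tv)))) = s1 at hs
  have a1 : s1.v .n = G.n := by simp [← hs1, exec_read, inputList, St.init]
  have a2 : s1.v .m = G.m := by simp [← hs1, exec_read, inputList, St.init]
  have a3 : s1.v .N = T.N := by simp [← hs1, exec_read, inputList, St.init]
  have a4 : s1.inp = (List.range G.n).map G.d ++
      ((List.range G.m).flatMap (fun k => [G.eu k, G.ev k, T.et k]) ++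
      ((List.range (T.N - 1)).flatMap (fun k => [tu k, tv k]) ++ [])) := by
    simp [← hs1, exec_read, inputList, St.init]
  have a5 : s1.a = fun _ _ => 0 := by simp [← hs1, exec_read, St.init]
  have a6 : ∀ x, x ≠ .n → x ≠ .m → x ≠ .N → s1.v x = 0 := fun x h1 h2 h3 => by
    simp [← hs1, exec_read, St.init, h1, h2, h3]
  have a7 : s1.tm = 3 := by simp [← hs1, exec_read, St.init]
  have a8 : s1.out = [] := by simp [← hs1, exec_read, St.init]
  clear hs1
  obtain ⟨b1, b2, b3, b4, b5⟩ := readDemands_spec a1 a4 (a6 _ (by decide) (by decide) (by decide))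
    (by simp [a5])
  have f1 := exec_frame readDemands s1
  generalize readDemands.exec s1 = s2 at *
  obtain ⟨c1, c2, c3, c4⟩ := readEdges_spec (s := s2) ((f1.v _ (by decide)).trans a2) b1
    (by simp [f1.a .deg (by decide), a5])
  have f2 := exec_frame readEdges s2
  generalize readEdges.exec s2 = s3 at *
  obtain ⟨d1, d2, d3⟩ := readTree_spec (s := s3) (M := T.N - 1)
    (by rw [f2.v _ (by decide), f1.v _ (by decide), a3]) c1
    (by simp [f2.a .tdeg (by decide), f1.a .tdeg (by decide), a5])
    (by simp [f2.a .tsum (by decide), f1.a .tsum (by decide), a5])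
  have f3 := exec_frame readTree s3
  generalize readTree.exec s3 = s4 at *
  have e1 : s.a = s4.a := by simp [hs, exec_set]
  have e2 : ∀ x, x ≠ .D → x ≠ .free → s.v x = s4.v x := fun x h1 h2 => by
    simp [hs, exec_set, h1, h2]
  have e3 : s.v .D = s4.v .dst + 2 := by simp [hs, exec_set]
  have e4 : s.v .free = 1 := by simp [hs, exec_set]
  have e5 : s.tm = s4.tm + 3 := by simp [hs, exec_set]
  have e6 : s.out = s4.out := by simp [hs, exec_set]
  clear hs
  have hdst : s4.v .dst = G.ds := by
    rw [f3.v _ (by decide), f2.v _ (by decide)]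
    apply le_antisymm
    · rcases b4 with h | ⟨v, -, h⟩
      · omega
      · rw [← h]; exact G.d_le v
    · rcases hds with h | ⟨v, hv, h⟩
      · omega
      · rw [← h]; exact b3 v hv
  have hv0 : ∀ x ∈ [Var.qe, .rt], s.v x = 0 := by
    intro x hx
    have : x ≠ .D ∧ x ≠ .free ∧ x ∉ readTree.mv ∧ x ∉ readEdges.mv ∧ x ∉ readDemands.mv ∧ x ≠ .n ∧
        x ≠ .m ∧ x ≠ .N := by revert x; decide
    obtain ⟨h1, h2, h3, h4, h5, h6, h7, h8⟩ := this
    rw [e2 x h1 h2, f3.v x h3, f2.v x h4, f1.v x h5, a6 x h6 h7 h8]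
  refine ⟨⟨?_, ?_, ?_, ⟨?_, ?_, ?_, ?_⟩, ⟨fun k hk => ?_, fun k hk => ?_, fun k hk => ?_⟩,
    fun x hx => ?_, fun x hx => ?_, e4, hv0 _ (by simp), hv0 _ (by simp), fun A hA => ?_, ?_⟩, ?_⟩
  · rw [e2 _ (by decide) (by decide), f3.v _ (by decide), f2.v _ (by decide), f1.v _ (by decide), a1]
  · rw [e2 _ (by decide) (by decide), f3.v _ (by decide), f2.v _ (by decide), f1.v _ (by decide), a2]
  · rw [e2 _ (by decide) (by decide), f3.v _ (by decide), f2.v _ (by decide), f1.v _ (by decide), a3]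
  · rw [e2 _ (by decide) (by decide), hdst]
  · rw [e3, hdst]
  · rw [e1, f3.a _ (by decide), f2.a _ (by decide)]
    funext v
    rw [b2]
    split_ifs with h
    · rfl
    · exact (hd v (by omega)).symm
  · rw [e1, f3.a _ (by decide)]
    funext v
    rw [c3, sum_ends_eq_degA G v _ le_rfl, Net.dg]
  · rw [e1, f3.a _ (by decide)]; exact (c2 k hk).1
  · rw [e1, f3.a _ (by decide)]; exact (c2 k hk).2.1
  · rw [e1, f3.a _ (by decide)]; exact (c2 k hk).2.2
  · rw [e1, d1, ht1 x hx]
  · rw [e1, d2, ht2 x hx]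
  · have : A ∉ readTree.ma ∧ A ∉ readEdges.ma ∧ A ∉ readDemands.ma := by
      revert hA; cases A <;> decide
    rw [e1, f3.a A this.1, f2.a A this.2.1, f1.a A this.2.2, a5]
  · rw [e6, f3.out (by decide), f2.out (by decide), f1.out (by decide), a8]
  · omega

/-- Choosing every vertex of the support is feasible, and the boundary of the set of all edges is
empty. -/
theorem entry_pos {G : Net} {c : ℕ} {S : Finset ℕ} {σ : ℕ → ℕ}
    (h : G.EntryOK (Finset.range G.m) σ c S) : 0 < c := by
  refine (h.opt (G.supp (Finset.range G.m)) subset_rfl ⟨fun v hv => ?_, fun v hv => ?_,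
    fun v hv _ hS => absurd hv hS⟩).1
  · simp [Deco.bd_range] at hv
  · simp [Deco.bd_range] at hv

/-- Memory use is of the same order as the time for leaves and joins, since each adds a table of
size at most `J`; hence the final sweep costs no more than they do. -/
theorem algorithm_spec {G : Net} {T : Deco G} {J : ℕ} (hJ : Bound T J) {tu tv : ℕ → ℕ}
    (hd : ∀ v, G.n ≤ v → G.d v = 0) (hds : G.ds = 0 ∨ ∃ v < G.n, G.d v = G.ds)
    (ht1 : ∀ x < T.N, ∑ k ∈ Finset.range (T.N - 1), ((if x = tu k then 1 else 0) +
      (if x = tv k then 1 else 0)) = (T.nb (Finset.range T.N) x).card)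
    (ht2 : ∀ x < T.N, ∑ k ∈ Finset.range (T.N - 1), ((if x = tu k then tv k else 0) +
      (if x = tv k then tu k else 0)) = ∑ c ∈ T.nb (Finset.range T.N) x, c) :
    ∃ (S : Finset ℕ) (f : ℕ → Bool), G.EntryOK (Finset.range G.m) (fun _ => 0) (S.card + 1) S ∧
      (∀ v, f v = true ↔ 0 < G.dg v ∧ v ∈ S ∨ G.dg v = 0 ∧ 0 < G.d v) ∧
      (algorithm.exec (St.init (inputList T tu tv))).out = (List.range G.n).filter f ∧
      (algorithm.exec (St.init (inputList T tu tv))).tm ≤ 500 * (G.m * J + T.N * J) + 9 * G.n := by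
  have hst := started hd hds ht1 ht2 rfl
  simp only [exec_cons, exec_nil] at hst
  simp only [algorithm, exec_cons, exec_nil]
  generalize (Cmd.set .free (.c 1)).exec _ = s at *
  obtain ⟨h, htm⟩ := hst
  -- The shorter block ends with one more tick than the corresponding prefix of the algorithm; only
  -- the time differs.
  replace h : Started T s := ⟨h.n, h.m, h.N, ⟨h.inp.1, h.inp.2, h.inp.3, h.inp.4⟩,
    ⟨h.edges.1, h.edges.2, h.edges.3⟩, h.tdeg, h.tsum, h.free, h.qe, h.rt, h.zero, h.out⟩
  replace htm : s.tm + 1 ≤ 10 + 5 * G.n + 10 * G.m + 8 * (T.N - 1) := htm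
  have hz : ∀ A, A ∉ [Arr.dem, .eu, .ev, .et, .deg, .tdeg, .tsum] → ∀ i, s.a A i = 0 :=
    fun A hA i => by rw [h.zero A hA]
  obtain ⟨a1, a2, a3, a4⟩ := emptyTables_spec G (s := s) (fun p => by
    simp [St.ent, h.zero .cst (by decide), h.zero .el (by decide), h.zero .er (by decide),
      h.zero .eU (by decide), h.zero .eV (by decide)]) (hz _ (by decide)) (hz _ (by decide)) h.free
  have f1 := exec_frame emptyTables s
  generalize emptyTables.exec s = s1 at *
  rw [h.N] at a2 a3 a4
  obtain ⟨s2, hs2, sol, b1, b2, b3, b4⟩ := leafTables_spec (T := T) hJ.pow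
    ((f1.v _ (by decide)).trans h.m)
    ⟨(f1.v _ (by decide)).trans h.inp.dst, (f1.v _ (by decide)).trans h.inp.D,
      (f1.a _ (by decide)).trans h.inp.dem, (f1.a _ (by decide)).trans h.inp.deg⟩
    ⟨fun k hk => by rw [f1.a _ (by decide)]; exact h.edges.eu k hk,
      fun k hk => by rw [f1.a _ (by decide)]; exact h.edges.ev k hk,
      fun k hk => by rw [f1.a _ (by decide)]; exact h.edges.et k hk⟩ a1 a2
  have f2 := exec_frame leafTables s1
  rw [hs2] at f2 ⊢
  obtain ⟨c1, c2⟩ := startQueue_spec (s := s2)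
    (by rw [f2.v _ (by decide), f1.v _ (by decide), h.qe])
  have f3 := exec_frame startQueue s2
  generalize startQueue.exec s2 = s3 at *
  have hN2 : s2.v .N = T.N := by rw [f2.v _ (by decide), f1.v _ (by decide), h.N]
  have htd2 : s2.a .tdeg = s.a .tdeg := by rw [f2.a _ (by decide), f1.a _ (by decide)]
  rw [hN2] at c1 c2
  have ha3 : ∀ A, A ∉ startQueue.ma → A ∉ leafTables.ma → A ∉ emptyTables.ma → s3.a A = s.a A :=
    fun A h1 h2 h3 => by rw [f3.a A h1, f2.a A h2, f1.a A h3]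
  have hv3 : ∀ x, x ∉ startQueue.mv → x ∉ leafTables.mv → x ∉ emptyTables.mv → s3.v x = s.v x :=
    fun A h1 h2 h3 => by rw [f3.v A h1, f2.v A h2, f1.v A h3]
  have hjoin : Joined T s3 0 (Finset.range T.N) id sol {x | x < T.N ∧ s2.a .tdeg x = 1} := by
    refine ⟨Deco.Contracted.init, by simp, fun x hx => ?_, fun x hx => ?_, c1, fun x hx h1 => ?_,
      fun x hx => ?_, ?_, fun v => ?_, ⟨?_, ?_, ?_, ?_⟩, fun x hx => ?_, ?_⟩
    · rw [ha3 _ (by decide) (by decide) (by decide)]; exact h.tdeg x (Finset.mem_range.1 hx)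
    · rw [ha3 _ (by decide) (by decide) (by decide)]; exact h.tsum x (Finset.mem_range.1 hx)
    · rw [Finset.mem_range] at hx
      exact ⟨hx, by rw [htd2, h.tdeg x hx, h1]⟩
    · obtain ⟨hx, h1⟩ := hx
      rw [htd2, h.tdeg x hx] at h1
      exact ⟨Finset.mem_range.2 hx, h1.le⟩
    · refine b1.congr (f3.v _ (by decide)) fun p => ent_congr (fun A hA => f3.a A ?_) p
      revert A; decide
    · rw [ha3 _ (by decide) (by decide) (by decide), ha3 _ (by decide) (by decide) (by decide),
        ha3 _ (by decide) (by decide) (by decide), ha3 _ (by decide) (by decide) (by decide)]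
      exact ⟨hz _ (by decide) _, hz _ (by decide) _, hz _ (by decide) _, hz _ (by decide) _⟩
    · rw [hv3 _ (by decide) (by decide) (by decide)]; exact h.inp.dst
    · rw [hv3 _ (by decide) (by decide) (by decide)]; exact h.inp.D
    · rw [ha3 _ (by decide) (by decide) (by decide)]; exact h.inp.dem
    · rw [ha3 _ (by decide) (by decide) (by decide)]; exact h.inp.deg
    · refine (b2 x (Finset.mem_range.1 hx)).congr (f3.v _ (by decide)) (f3.v _ (by decide))
        fun A hA => f3.a A ?_
      revert A; decide
    · rw [hv3 _ (by decide) (by decide) (by decide), h.rt]; exact Finset.mem_range.2 T.N_pos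
  obtain ⟨s4, hs4, ⟨R, rep, sol', M, d1⟩, d2, d3⟩ := peel_spec hJ hjoin
    (by rw [hv3 _ (by decide) (by decide) (by decide), h.N])
  have f4 := exec_frame peel s3
  rw [hs4] at f4 ⊢
  have hNp := T.N_pos
  have hRc := d1.card
  -- After `N - 1` joins one node is left. Its part is the set of all edges, and its table has the
  -- single address `p₀`.
  obtain ⟨z, hz1⟩ := Finset.card_eq_one.1 (show R.card = 1 by omega)
  have hrt : s4.v .rt ∈ R := d1.rt
  have hnb : T.nb R (s4.v .rt) = ∅ := by
    ext c
    simp only [T.mem_nb, Finset.notMem_empty, iff_false, not_and]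
    intro hc hadj
    rw [hz1, Finset.mem_singleton] at hc hrt
    exact T.ne _ _ hadj (hrt.trans hc.symm)
  obtain ⟨str, sz, htab⟩ := d1.table _ hrt
  rw [d1.con.part_eq_range hrt hnb] at htab
  have hent := htab.entry (fun _ => 0) (fun _ => by omega)
  have hadd := htab.addr_lt (σ := fun _ => 0) (fun _ => by omega)
  simp only [Deco.bd_range, Finset.sum_empty, add_zero] at hent hadd
  set p₀ := s4.a .base (s4.v .rt) with hp₀
  have hpos := entry_pos hent
  have hcard := hent.card hpos
  generalize hs5 : (Cmd.put .mark (.a .base (.v .rt)) (.c 1)).exec s4 = s5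
  have e1 : s5.v = s4.v := by simp [← hs5, exec_put]
  have e2 : ∀ A, A ≠ .mark → s5.a A = s4.a A := fun A hA => by simp [← hs5, exec_put, hA]
  have e3 : s5.a .mark = Function.update (s4.a .mark) p₀ 1 := by simp [← hs5, exec_put, hp₀]
  have e4 : s5.tm = s4.tm + 1 := by simp [← hs5, exec_put]
  have e5 : s5.out = s4.out := by simp [← hs5, exec_put]
  clear hs5
  have hmark4 : ∀ p, s4.a .mark p = 0 := fun p => by
    rw [f4.a _ (by decide), ha3 _ (by decide) (by decide) (by decide)]; exact hz _ (by decide) _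
  have hins4 : ∀ p, s4.a .ins p = 0 := fun p => by
    rw [f4.a _ (by decide), ha3 _ (by decide) (by decide) (by decide)]; exact hz _ (by decide) _
  obtain ⟨g1, g2⟩ := trace_spec (s := s5) (sol := sol') (p₀ := p₀)
    (d1.mem.congr (by rw [e1]) (ent_congr fun A hA => e2 A (by revert A; decide)))
    (by rw [e1]; exact hadd) (fun p => by
      rw [e3, Function.update_apply]
      split_ifs with hp <;> simp [hp, hmark4])
    (fun v => by rw [e2 _ (by decide)]; exact hins4 v)
  have f5 := exec_frame trace s5
  generalize trace.exec s5 = s6 at *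
  have hdeg6 : s6.a .deg = G.dg := by
    rw [f5.a _ (by decide), e2 _ (by decide)]; exact d1.inp.deg
  have hdem6 : s6.a .dem = G.d := by
    rw [f5.a _ (by decide), e2 _ (by decide)]; exact d1.inp.dem
  have hn6 : s6.v .n = G.n := by
    rw [f5.v _ (by decide), e1, f4.v _ (by decide), hv3 _ (by decide) (by decide) (by decide), h.n]
  classical
  obtain ⟨k1, k2⟩ := output_spec s6
    (fun v => decide (0 < G.dg v ∧ v ∈ sol' p₀ ∨ G.dg v = 0 ∧ 0 < G.d v)) (fun v => by
      rw [decide_eq_true_iff, hdeg6, hdem6, g1])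
  refine ⟨sol' p₀, fun v => decide (0 < G.dg v ∧ v ∈ sol' p₀ ∨ G.dg v = 0 ∧ 0 < G.d v), ?_,
    fun v => decide_eq_true_iff, ?_, ?_⟩
  · rw [hcard]; exact hent
  · rw [tick_out, k1, hn6, f5.out (by decide), e5, f4.out (by decide), f3.out (by decide),
      f2.out (by decide), f1.out (by decide), h.out, List.nil_append]
  · have hJ1 : 1 ≤ J := (Nat.one_le_pow _ _ (by omega)).trans hJ.pow
    rw [e1] at g2
    rw [hn6] at k2
    have hf3 : s3.v .free = s2.v .free := f3.v _ (by decide)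
    obtain ⟨N, hN⟩ : ∃ N, T.N = N + 1 := ⟨T.N - 1, by omega⟩
    rw [hN, Nat.add_sub_cancel] at d2 d3 htm
    rw [hN] at a3 a4 c2 ⊢
    have m1 : G.m ≤ G.m * J := Nat.le_mul_of_pos_right _ hJ1
    have m2 : N ≤ N * J := Nat.le_mul_of_pos_right _ hJ1
    have m3 : G.m * (1 + 220 * J) = G.m + 220 * (G.m * J) := by ring
    have m4 : N * (21 + 300 * J) = 21 * N + 300 * (N * J) := by ring
    rw [m3] at b4
    rw [m4] at d3
    rw [Nat.add_one_mul N]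
    simp only [tick_tm]
    omega

/-! ### Graphs given by lists of edges -/

/-- The pairs `eu k, ev k` for `k < M` list the edges of a graph on `0, …, n - 1`, each edge
once. -/
structure EdgeList (n M : ℕ) (adj : ℕ → ℕ → Prop) (eu ev : ℕ → ℕ) : Prop where
  lt : ∀ a c, adj a c → a < n
  symm : ∀ a c, adj a c → adj c a
  ne : ∀ a c, adj a c → a ≠ c
  edge : ∀ k < M, adj (eu k) (ev k)
  cov : ∀ a c, adj a c → ∃ k < M, eu k = a ∧ ev k = c ∨ eu k = c ∧ ev k = a
  inj : ∀ k < M, ∀ l < M, (eu k = eu l ∧ ev k = ev l ∨ eu k = ev l ∧ ev k = eu l) → k = l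

/-- Double counting: each neighbour of `x` corresponds to exactly one listed edge. Used with `F`
constant for degrees, the identity for sums of neighbours, and an indicator function for neighbours
in a set. -/
theorem EdgeList.sum {n M : ℕ} {adj : ℕ → ℕ → Prop} {eu ev : ℕ → ℕ} (h : EdgeList n M adj eu ev)
    (F : ℕ → ℕ) (x : ℕ) [DecidablePred (adj x)] :
    ∑ k ∈ Finset.range M, ((if x = eu k then F (ev k) else 0) + (if x = ev k then F (eu k) else 0)) =
      ∑ c ∈ (Finset.range n).filter (adj x), F c := by
  have h1 : ∀ c ∈ (Finset.range n).filter (adj x), F c = ∑ k ∈ Finset.range M,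
      if eu k = x ∧ ev k = c ∨ eu k = c ∧ ev k = x then F c else 0 := by
    intro c hc
    obtain ⟨k, hk, hkc⟩ := h.cov x c (Finset.mem_filter.1 hc).2
    rw [Finset.sum_eq_single k, if_pos hkc]
    · intro l hl hlk
      rw [if_neg]
      intro hlc
      exact hlk (h.inj l (Finset.mem_range.1 hl) k hk (by omega))
    · intro hk'; exact absurd (Finset.mem_range.2 hk) hk'
  rw [Finset.sum_congr rfl h1, Finset.sum_comm]
  refine Finset.sum_congr rfl fun k hk => ?_
  have hadj := h.edge k (Finset.mem_range.1 hk)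
  have hne := h.ne _ _ hadj
  by_cases hu : x = eu k
  · subst hu
    have hv : eu k ≠ ev k := hne
    rw [if_pos rfl, if_neg hv, add_zero, Finset.sum_eq_single (ev k)]
    · simp
    · intro c _ hc; rw [if_neg (by omega)]
    · intro hn
      exact absurd (Finset.mem_filter.2 ⟨Finset.mem_range.2 (h.lt _ _ (h.symm _ _ hadj)), hadj⟩) hn
  · by_cases hv : x = ev k
    · subst hv
      rw [if_neg hu, if_pos rfl, zero_add, Finset.sum_eq_single (eu k)]
      · simp
      · intro c _ hc; rw [if_neg (by omega)]
      · intro hn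
        exact absurd (Finset.mem_filter.2 ⟨Finset.mem_range.2 (h.lt _ _ hadj), h.symm _ _ hadj⟩) hn
    · rw [if_neg hu, if_neg hv]
      refine (Finset.sum_eq_zero fun c _ => ?_).symm
      rw [if_neg (by omega)]

/-- Adjacency in a graph on `Fin n`, as a relation on the natural numbers. -/
def natAdj {n : ℕ} (G : SimpleGraph (Fin n)) (a c : ℕ) : Prop :=
  ∃ (ha : a < n) (hc : c < n), G.Adj ⟨a, ha⟩ ⟨c, hc⟩

theorem natAdj_val {n : ℕ} {G : SimpleGraph (Fin n)} {a c : Fin n} :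
    natAdj G a c ↔ G.Adj a c := ⟨fun ⟨_, _, h⟩ => h, fun h => ⟨a.2, c.2, h⟩⟩

/-- The value of a function at the element `k` of a list, as a natural number. -/
def nth {α : Type*} {N : ℕ} (L : List α) (f : α → Fin N) (k : ℕ) : ℕ :=
  if h : k < L.length then (f L[k] : ℕ) else 0

theorem nth_of_lt {α : Type*} {N : ℕ} {L : List α} {f : α → Fin N} {k : ℕ} (h : k < L.length) :
    nth L f k = f L[k] := dif_pos h

theorem ListsEdges.adj {n : ℕ} {G : SimpleGraph (Fin n)} {L : List (Fin n × Fin n)}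
    (h : ListsEdges G L) {k : ℕ} (hk : k < L.length) : G.Adj L[k].1 L[k].2 := by
  rw [← SimpleGraph.mem_edgeSet, ← h.2]
  exact List.mem_map.2 ⟨_, List.getElem_mem hk, rfl⟩

theorem ListsEdges.exists_of_adj {n : ℕ} {G : SimpleGraph (Fin n)} {L : List (Fin n × Fin n)}
    (h : ListsEdges G L) {a c : Fin n} (hac : G.Adj a c) :
    ∃ (k : ℕ) (hk : k < L.length), s(L[k].1, L[k].2) = s(a, c) := by
  rw [← SimpleGraph.mem_edgeSet, ← h.2] at hac
  obtain ⟨p, hp, he⟩ := List.mem_map.1 hac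
  obtain ⟨k, hk, rfl⟩ := List.mem_iff_getElem.1 hp
  exact ⟨k, hk, he⟩

theorem ListsEdges.inj {n : ℕ} {G : SimpleGraph (Fin n)} {L : List (Fin n × Fin n)}
    (h : ListsEdges G L) {k l : ℕ} (hk : k < L.length) (hl : l < L.length)
    (he : s(L[k].1, L[k].2) = s(L[l].1, L[l].2)) : k = l := by
  refine (List.Nodup.getElem_inj_iff h.1 (i := k) (j := l) (hi := by simpa using hk)
    (hj := by simpa using hl)).1 ?_
  simpa only [List.getElem_map] using he

theorem ListsEdges.edgeList {n : ℕ} {G : SimpleGraph (Fin n)} {L : List (Fin n × Fin n)}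
    (h : ListsEdges G L) : EdgeList n L.length (natAdj G) (nth L Prod.fst) (nth L Prod.snd) where
  lt a c := fun ⟨ha, _, _⟩ => ha
  symm a c := fun ⟨ha, hc, h⟩ => ⟨hc, ha, h.symm⟩
  ne a c := fun ⟨ha, hc, h⟩ he => h.ne (Fin.ext he)
  edge k hk := by rw [nth_of_lt hk, nth_of_lt hk, natAdj_val]; exact h.adj hk
  cov a c := by
    rintro ⟨ha, hc, hac⟩
    obtain ⟨k, hk, he⟩ := h.exists_of_adj hac
    refine ⟨k, hk, ?_⟩
    rw [nth_of_lt hk, nth_of_lt hk]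
    rw [Sym2.eq_iff] at he
    rcases he with ⟨e1, e2⟩ | ⟨e1, e2⟩
    · left; rw [e1, e2]; exact ⟨rfl, rfl⟩
    · right; rw [e1, e2]; exact ⟨rfl, rfl⟩
  inj k hk l hl he := by
    rw [nth_of_lt hk, nth_of_lt hk, nth_of_lt hl, nth_of_lt hl] at he
    refine h.inj hk hl (Sym2.eq_iff.2 ?_)
    rcases he with ⟨e1, e2⟩ | ⟨e1, e2⟩
    · exact Or.inl ⟨Fin.ext e1, Fin.ext e2⟩
    · exact Or.inr ⟨Fin.ext e1, Fin.ext e2⟩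

theorem flatMap_eq_range {α : Type*} (L : List α) (f : α → List ℕ) (g : ℕ → List ℕ)
    (h : ∀ (k : ℕ) (hk : k < L.length), f L[k] = g k) :
    L.flatMap f = (List.range L.length).flatMap g := by
  rw [List.flatMap_def, List.flatMap_def]
  congr 1
  refine List.ext_getElem (by simp) fun k h1 h2 => ?_
  simp only [List.getElem_map, List.getElem_range]
  exact h k (by simpa using h1)

theorem ListsEdges.length_eq {n : ℕ} {G : SimpleGraph (Fin n)} {L : List (Fin n × Fin n)}
    (h : ListsEdges G L) : L.length = G.edgeSet.ncard := by
  classical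
  have : G.edgeSet = ((L.map fun p => s(p.1, p.2)).toFinset : Set (Sym2 (Fin n))) := by
    ext e; rw [List.coe_toFinset, Set.mem_ofPred_eq, h.2]
  rw [this, Set.ncard_coe_finset, List.toFinset_card_of_nodup h.1, List.length_map]

open Classical in
theorem ncard_eq_card_filter {n : ℕ} (X : Set (Fin n)) :
    X.ncard = ((Finset.range n).filter fun c => ∃ h : c < n, (⟨c, h⟩ : Fin n) ∈ X).card := by
  rw [← Set.ncard_image_of_injective X Fin.val_injective, ← Set.ncard_coe_finset]
  congr 1
  ext c
  simp only [Set.mem_image, Finset.coe_filter, Finset.mem_range, Set.mem_ofPred_eq]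
  constructor
  · rintro ⟨a, ha, rfl⟩; exact ⟨a.2, a.2, ha⟩
  · rintro ⟨_, h, hc⟩; exact ⟨_, hc, rfl⟩

open Classical in
theorem ncard_neighborSet {n : ℕ} (G : SimpleGraph (Fin n)) (v : Fin n) :
    (G.neighborSet v).ncard = ((Finset.range n).filter (natAdj G v)).card := by
  rw [ncard_eq_card_filter]
  congr 1
  refine Finset.filter_congr fun c hc => ?_
  exact ⟨fun ⟨h, hc⟩ => ⟨v.2, h, hc⟩, fun ⟨_, h, hc⟩ => ⟨h, hc⟩⟩

/-- The net of a graph with demands. -/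
def netOf {n : ℕ} (G : SimpleGraph (Fin n)) (d : Fin n → ℕ) (L : List (Fin n × Fin n))
    (h : ListsEdges G L) : Net where
  n := n
  m := L.length
  ds := maxDemand d
  d v := if h : v < n then d ⟨v, h⟩ else 0
  eu := nth L Prod.fst
  ev := nth L Prod.snd
  eu_lt k hk := by rw [nth_of_lt hk]; exact Fin.is_lt _
  ev_lt k hk := by rw [nth_of_lt hk]; exact Fin.is_lt _
  ne k hk := h.edgeList.ne _ _ (h.edgeList.edge k hk)
  d_le v := by
    split_ifs with h
    · exact Finset.le_sup (f := d) (Finset.mem_univ _)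
    · exact Nat.zero_le _

/-! ### From the net back to the graph -/

section netOf

variable {n : ℕ} {G : SimpleGraph (Fin n)} {d : Fin n → ℕ} {L : List (Fin n × Fin n)}
  (h : ListsEdges G L)
include h

open Classical in
theorem dg_netOf (v : ℕ) :
    (netOf G d L h).dg v = ((Finset.range n).filter (natAdj G v)).card := by
  rw [Net.dg, ← sum_ends_eq_degA _ _ _ le_rfl, Finset.card_eq_sum_ones,
    ← h.edgeList.sum (fun _ => 1) v]
  rfl

-- An instance of `EdgeList.sum` for the indicator of `S`. Agreement of `S` and `S'` is required
-- only on neighbours, because isolated vertices are chosen independently of the table.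
open Classical in
theorem cnt_netOf (v : Fin n) (S : Finset ℕ) (S' : Finset (Fin n))
    (hS : ∀ w : Fin n, G.Adj v w → ((w : ℕ) ∈ S ↔ w ∈ S')) :
    (netOf G d L h).cnt (Finset.range (netOf G d L h).m) S v =
      (G.neighborSet v ∩ (S' : Set (Fin n))).ncard := by
  have h1 : (netOf G d L h).cnt (Finset.range (netOf G d L h).m) S v =
      ∑ c ∈ (Finset.range n).filter (natAdj G v), if c ∈ S then 1 else 0 := by
    rw [← h.edgeList.sum (fun c => if c ∈ S then 1 else 0) v, Net.cnt, Finset.card_filter]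
    refine Finset.sum_congr rfl fun k hk => ?_
    have hne := (netOf G d L h).ne k (Finset.mem_range.1 hk)
    change nth L Prod.fst k ≠ nth L Prod.snd k at hne
    change (if nth L Prod.fst k = v ∧ nth L Prod.snd k ∈ S ∨
      nth L Prod.snd k = v ∧ nth L Prod.fst k ∈ S then 1 else 0) = _
    by_cases hu : nth L Prod.fst k = v
    · have hv : nth L Prod.snd k ≠ v := fun hv => hne (hu.trans hv.symm)
      rw [if_neg (show ¬ (v : ℕ) = nth L Prod.snd k from fun h' => hv h'.symm), if_pos hu.symm]
      simp [hu, hv]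
    · rw [if_neg (show ¬ (v : ℕ) = nth L Prod.fst k from fun h' => hu h'.symm)]
      by_cases hv : nth L Prod.snd k = v
      · rw [if_pos hv.symm]; simp [hu, hv]
      · rw [if_neg (show ¬ (v : ℕ) = nth L Prod.snd k from fun h' => hv h'.symm)]; simp [hu, hv]
  rw [h1, ncard_eq_card_filter, ← Finset.card_filter, Finset.filter_filter]
  congr 1
  ext c
  simp only [Finset.mem_filter]
  refine and_congr_right fun _ => ⟨?_, ?_⟩
  · rintro ⟨⟨ha, hb, hadj⟩, hcS⟩
    exact ⟨hb, hadj, (hS ⟨c, hb⟩ hadj).1 hcS⟩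
  · rintro ⟨hb, hadj, hcS⟩
    exact ⟨⟨v.2, hb, hadj⟩, (hS ⟨c, hb⟩ hadj).2 hcS⟩

theorem dg_netOf_pos (v : Fin n) : 0 < (netOf G d L h).dg v ↔ ∃ w, G.Adj v w := by
  classical
  rw [dg_netOf, Finset.card_pos]
  constructor
  · rintro ⟨c, hc⟩
    obtain ⟨_, _, _, hadj⟩ := Finset.mem_filter.1 hc
    exact ⟨_, hadj⟩
  · rintro ⟨w, hw⟩
    exact ⟨w, Finset.mem_filter.2 ⟨Finset.mem_range.2 w.2, natAdj_val.2 hw⟩⟩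

theorem mem_supp_netOf (v : Fin n) :
    (v : ℕ) ∈ (netOf G d L h).supp (Finset.range (netOf G d L h).m) ↔ ∃ w, G.Adj v w := by
  rw [Net.mem_supp subset_rfl, ← dg_netOf_pos h (d := d)]; rfl

/-- A correct entry for the whole net gives a minimum vector dominating set. -/
theorem isMinimum_of_entry {S : Finset ℕ} {f : ℕ → Bool}
    (hS : (netOf G d L h).EntryOK (Finset.range (netOf G d L h).m) (fun _ => 0) (S.card + 1) S)
    (hf : ∀ v, f v = true ↔ 0 < (netOf G d L h).dg v ∧ v ∈ S ∨
      (netOf G d L h).dg v = 0 ∧ 0 < (netOf G d L h).d v) (X : Finset (Fin n))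
    (hX : ∀ v : Fin n, v ∈ X ↔ f v = true) : IsMinimumVectorDominating G d X := by
  classical
  have hsub := hS.sub (by omega)
  have hfeas := hS.feas (by omega)
  have hd : ∀ v : Fin n, (netOf G d L h).d v = d v := fun v => dif_pos v.2
  have hdg := dg_netOf_pos h (d := d)
  have hsupp := mem_supp_netOf h (d := d)
  have hbd := Deco.bd_range (netOf G d L h)
  refine ⟨fun v hv => ?_, fun X' hX' => ?_⟩
  · rw [hX, hf, not_or] at hv
    rcases Nat.eq_zero_or_pos ((netOf G d L h).dg v) with h0 | hpos
    · have := hv.2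
      rw [hd] at this
      omega
    · have hvS : (v : ℕ) ∉ S := fun h' => hv.1 ⟨hpos, h'⟩
      have := hfeas.inner v ((hsupp v).2 ((hdg v).1 hpos)) (by simp [hbd]) hvS
      rw [hd, cnt_netOf h v S X fun w hw => ?_] at this
      · exact this
      · have hw0 : 0 < (netOf G d L h).dg w := (hdg w).2 ⟨v, hw.symm⟩
        rw [hX, hf]
        constructor
        · exact fun hwS => Or.inl ⟨hw0, hwS⟩
        · rintro (h' | h')
          · exact h'.2
          · omega
  · set Z : Finset (Fin n) := Finset.univ.filter fun v => ¬ ∃ w, G.Adj v w with hZ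
    set Y : Finset (Fin n) := X'.filter fun v => ∃ w, G.Adj v w with hY
    -- The competitor is stripped of its isolated vertices, which are nobody's neighbours; what
    -- remains is feasible for the table.
    have hopt := (hS.opt (Y.image Fin.val) (fun v hv => by
      obtain ⟨w, hw, rfl⟩ := Finset.mem_image.1 hv
      exact (hsupp w).2 (Finset.mem_filter.1 hw).2) ⟨by simp [hbd], by simp [hbd],
        fun v hv _ hvY => by
          have hvn : v < n := Finset.mem_range.1 (Finset.mem_filter.1 hv).1
          have hnb := (hsupp ⟨v, hvn⟩).1 hv
          have hvX : (⟨v, hvn⟩ : Fin n) ∉ X' := fun h' => hvY (Finset.mem_image.2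
            ⟨_, Finset.mem_filter.2 ⟨h', hnb⟩, rfl⟩)
          have := hX' _ hvX
          rw [← cnt_netOf h (d := d) ⟨v, hvn⟩ (Y.image Fin.val) X' fun w hw => ?_] at this
          · rw [← hd] at this; exact this
          · constructor
            · intro hwY
              obtain ⟨w', hw', he⟩ := Finset.mem_image.1 hwY
              rw [Fin.val_injective he] at hw'
              exact (Finset.mem_filter.1 hw').1
            · exact fun hwX => Finset.mem_image.2
                ⟨w, Finset.mem_filter.2 ⟨hwX, ⟨_, hw.symm⟩⟩, rfl⟩⟩).2
    rw [Finset.card_image_of_injective _ Fin.val_injective] at hopt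
    -- An isolated vertex with positive demand belongs to every dominating set.
    have h1 : X.filter (fun v => ¬ ∃ w, G.Adj v w) ⊆ X'.filter fun v => ¬ ∃ w, G.Adj v w := by
      intro v hv
      rw [Finset.mem_filter] at hv ⊢
      refine ⟨?_, hv.2⟩
      by_contra hvX'
      have := hX' v hvX'
      rw [show G.neighborSet v = ∅ from Set.eq_empty_of_forall_notMem fun w hw => hv.2 ⟨w, hw⟩,
        Set.empty_inter, Set.ncard_empty] at this
      rw [hX, hf, hdg, hd] at hv
      rcases hv.1 with h' | h'
      · exact hv.2 h'.1
      · omega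
    have h2 : (X.filter fun v => ∃ w, G.Adj v w).image Fin.val ⊆ S := by
      intro v hv
      obtain ⟨w, hw, rfl⟩ := Finset.mem_image.1 hv
      rw [Finset.mem_filter, hX, hf] at hw
      have := (hdg w).2 hw.2
      rcases hw.1 with h' | h'
      · exact h'.2
      · omega
    have c1 := Finset.card_le_card h1
    have c2 := Finset.card_le_card h2
    rw [Finset.card_image_of_injective _ Fin.val_injective] at c2
    have c3 := Finset.card_filter_add_card_filter_not (s := X) fun v => ∃ w, G.Adj v w
    have c4 := Finset.card_filter_add_card_filter_not (s := X') fun v => ∃ w, G.Adj v w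
    rw [← hY] at c4
    omega

/-- Every vertex is isolated or one of the at most `2m` ends of edges. -/
theorem card_le_two_mul_length_add : n ≤ 2 * L.length + numIsolated G := by
  classical
  have h1 : (Finset.univ : Finset (Fin n)) ⊆ ((L.map Prod.fst).toFinset ∪ (L.map Prod.snd).toFinset) ∪
      Finset.univ.filter fun v => G.neighborSet v = ∅ := by
    intro v _
    by_cases hv : G.neighborSet v = ∅
    · exact Finset.mem_union_right _ (Finset.mem_filter.2 ⟨Finset.mem_univ _, hv⟩)
    · refine Finset.mem_union_left _ ?_
      obtain ⟨w, hw⟩ := Set.nonempty_iff_ne_empty.2 hv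
      obtain ⟨k, hk, he⟩ := h.exists_of_adj hw
      rw [Sym2.eq_iff] at he
      rw [Finset.mem_union, List.mem_toFinset, List.mem_toFinset, List.mem_map, List.mem_map]
      rcases he with ⟨e1, -⟩ | ⟨-, e2⟩
      · exact Or.inl ⟨_, List.getElem_mem hk, e1⟩
      · exact Or.inr ⟨_, List.getElem_mem hk, e2⟩
  have h2 := Finset.card_le_card h1
  have h3 := Finset.card_union_le ((L.map Prod.fst).toFinset ∪ (L.map Prod.snd).toFinset)
    (Finset.univ.filter fun v => G.neighborSet v = ∅)
  have h4 := Finset.card_union_le (L.map Prod.fst).toFinset (L.map Prod.snd).toFinset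
  have h5 := List.toFinset_card_le (L.map Prod.fst)
  have h6 := List.toFinset_card_le (L.map Prod.snd)
  rw [List.length_map] at h5 h6
  have h7 : numIsolated G = (Finset.univ.filter fun v => G.neighborSet v = ∅).card := by
    rw [numIsolated, ← Set.ncard_coe_finset]
    congr 1
    ext v; simp
  rw [Finset.card_univ, Fintype.card_fin] at h2
  omega

end netOf

theorem reachable_mem {V : Type*} {H : SimpleGraph V} {D : Set V}
    (hD : ∀ a ∈ D, ∀ c, H.Adj a c → c ∈ D) {x c : V} (hx : x ∈ D) (h : H.Reachable x c) : c ∈ D := by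
  obtain ⟨w⟩ := h
  induction w with
  | nil => exact hx
  | cons hadj _ ih => exact ih (hD _ hx _ hadj)

theorem exists_of_degA_pos {G : Net} {A : Finset ℕ} {v : ℕ} (h : 0 < G.degA A v) :
    ∃ k ∈ A, G.eu k = v ∨ G.ev k = v := by
  obtain ⟨k, hk⟩ := Finset.card_pos.1 h
  exact ⟨k, (Finset.mem_filter.1 hk).1, (Finset.mem_filter.1 hk).2⟩

theorem exists_of_degA_lt {G : Net} {A : Finset ℕ} {v : ℕ} (h : G.degA A v < G.dg v) :
    ∃ k < G.m, k ∉ A ∧ (G.eu k = v ∨ G.ev k = v) := by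
  by_contra! hne
  have : G.dg v ≤ G.degA A v := by
    unfold Net.dg Net.degA
    refine Finset.card_le_card fun k hk => ?_
    obtain ⟨h1, h2⟩ := Finset.mem_filter.1 hk
    refine Finset.mem_filter.2 ⟨?_, h2⟩
    by_contra hA
    have := hne k (Finset.mem_range.1 h1) hA
    tauto
  omega

/-! ### Branch decompositions of a graph and of its net -/

namespace BranchDecomposition

variable {n N : ℕ} {G : SimpleGraph (Fin n)} (B : BranchDecomposition G (Fin N))

theorem ncard_order_le (f : Sym2 (Fin N)) (hf : f ∈ B.T.edgeSet) : (B.order f).ncard ≤ B.width :=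
  le_ciSup (f := fun f : B.T.edgeSet => (B.order f).ncard) (Set.finite_range _).bddAbove ⟨f, hf⟩

/-- The degree sum formula, with `N - 1` edges in a tree. -/
theorem sum_degrees_add_two [DecidableRel (natAdj B.T)] :
    ∑ x ∈ Finset.range N, ((Finset.range N).filter (natAdj B.T x)).card + 2 = 2 * N := by
  classical
  have h1 := B.T.sum_degrees_eq_twice_card_edges
  have h2 := B.isTree.card_edgeFinset
  rw [Fintype.card_fin] at h2
  have h3 : ∑ x ∈ Finset.range N, ((Finset.range N).filter (natAdj B.T x)).card =
      ∑ x, B.T.degree x := by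
    rw [Finset.sum_range]
    refine Finset.sum_congr rfl fun x _ => ?_
    rw [← SimpleGraph.card_neighborSet_eq_degree, ← Nat.card_eq_fintype_card,
      Nat.card_coe_set_eq, ncard_neighborSet]
    congr
  omega

variable {d : Fin n → ℕ} {L : List (Fin n × Fin n)} (h : ListsEdges G L)

/-- The node of the tree that corresponds to an edge of the list. -/
def leafOf (p : Fin n × Fin n) : Fin N := B.τ s(p.1, p.2)

-- The set `D` is identified with a component of the tree without `xy`. A vertex meeting an edge
-- inside and an edge outside the corresponding part then belongs to the order of `xy`.
include h in
theorem card_bd_le_width {D : Set ℕ} {x y : ℕ} (hx : x ∈ D) (hy : y ∉ D) (hxy : natAdj B.T x y)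
    (hcut : ∀ a ∈ D, ∀ c, c ∉ D → natAdj B.T a c → a = x ∧ c = y)
    (hconn : ∀ D' : Set ℕ, x ∈ D' → (∀ a ∈ D', ∀ c ∈ D, a ∈ D → natAdj B.T a c → c ∈ D') → D ⊆ D')
    {A : Finset ℕ} (hA : ∀ k, k ∈ A ↔ k < L.length ∧ nth L B.leafOf k ∈ D) :
    ((netOf G d L h).bd A).card ≤ B.width := by
  classical
  obtain ⟨hxN, hyN, hadj⟩ := hxy
  set f : Sym2 (Fin N) := s(⟨x, hxN⟩, ⟨y, hyN⟩) with hf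
  have hne : x ≠ y := fun he => hy (he ▸ hx)
  set K := (B.T.deleteEdges {f}).connectedComponentMk ⟨x, hxN⟩ with hK
  -- No walk leaves `D` once `xy` is deleted; conversely the nodes of `D` are reached from `x`
  -- within `D`, where `xy` is not used because `y ∉ D`.
  have hKD : ∀ a : Fin N, a ∈ K.supp ↔ (a : ℕ) ∈ D := by
    intro a
    rw [SimpleGraph.ConnectedComponent.mem_supp_iff, hK, SimpleGraph.ConnectedComponent.eq]
    constructor
    · intro hr
      refine reachable_mem (D := {a : Fin N | (a : ℕ) ∈ D}) (fun a ha c hac => ?_) hx hr.symm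
      rw [SimpleGraph.deleteEdges_adj] at hac
      by_contra hc
      obtain ⟨e1, e2⟩ := hcut a ha c hc (natAdj_val.2 hac.1)
      refine hac.2 ?_
      rw [Set.mem_singleton_iff, hf, show a = ⟨x, hxN⟩ from Fin.ext e1,
        show c = ⟨y, hyN⟩ from Fin.ext e2]
    · intro ha
      have := hconn {a | ∃ ha : a < N, (B.T.deleteEdges {f}).Reachable ⟨x, hxN⟩ ⟨a, ha⟩}
        ⟨hxN, SimpleGraph.Reachable.refl _⟩ (fun a ⟨haN, har⟩ c hc haD hac => ?_) ha
      · obtain ⟨_, hr⟩ := this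
        exact hr.symm
      · obtain ⟨_, hcN, hac⟩ := hac
        refine ⟨hcN, har.trans (SimpleGraph.Adj.reachable ?_)⟩
        rw [SimpleGraph.deleteEdges_adj]
        refine ⟨hac, fun he => ?_⟩
        rw [Set.mem_singleton_iff, hf, Sym2.eq_iff] at he
        rcases he with ⟨-, he⟩ | ⟨he, -⟩
        · exact hy (by rwa [← Fin.mk.inj he])
        · exact hy (by rwa [← Fin.mk.inj he])
  refine le_trans ?_ (B.ncard_order_le f hadj)
  rw [← Set.ncard_image_of_injective _ Fin.val_injective, ← Set.ncard_coe_finset]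
  refine Set.ncard_le_ncard (fun v hv => ?_) (Set.toFinite _)
  obtain ⟨hv1, hv2, hv3⟩ := Finset.mem_filter.1 (Finset.mem_coe.1 hv)
  have hvn : v < n := Finset.mem_range.1 hv1
  obtain ⟨k, hkA, hk⟩ := exists_of_degA_pos hv2
  obtain ⟨l, hl, hlA, hl'⟩ := exists_of_degA_lt hv3
  have hinc : ∀ k (hk : k < L.length), (netOf G d L h).eu k = v ∨ (netOf G d L h).ev k = v →
      (⟨v, hvn⟩ : Fin n) ∈ s(L[k].1, L[k].2) := by
    intro k hk hkv
    change nth L Prod.fst k = v ∨ nth L Prod.snd k = v at hkv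
    rw [nth_of_lt hk, nth_of_lt hk] at hkv
    rw [Sym2.mem_iff]
    rcases hkv with rfl | rfl
    · exact Or.inl rfl
    · exact Or.inr rfl
  have hmem : ∀ k (hk : k < L.length), s(L[k].1, L[k].2) ∈ B.edgesOn f K ↔ k ∈ A := by
    intro k hk
    rw [hA, nth_of_lt hk]
    exact ⟨fun h' => ⟨hk, (hKD _).1 h'.2⟩, fun h' => ⟨h.adj hk, (hKD _).2 h'.2⟩⟩
  have hkL := ((hA k).1 hkA).1
  exact ⟨⟨v, hvn⟩, ⟨K, ⟨_, (hmem k hkL).2 hkA, hinc k hkL hk⟩,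
    ⟨_, ⟨h.adj hl, fun h' => hlA ((hmem l hl).1 h')⟩, hinc l hl hl'⟩⟩, rfl⟩

/-- A branch decomposition of a graph as a branch decomposition of its net. -/
noncomputable def deco : Deco (netOf G d L h) where
  N := N
  b := B.width
  adj := natAdj B.T
  et := nth L B.leafOf
  N_pos := by
    have := B.isTree.connected.nonempty
    exact Fin.pos this.some
  symm a c := fun ⟨ha, hc, h⟩ => ⟨hc, ha, h.symm⟩
  ne a c := fun ⟨ha, hc, h⟩ he => h.ne (Fin.ext he)
  lt a c := fun ⟨ha, _, _⟩ => ha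
  et_lt k hk := by rw [nth_of_lt hk]; exact Fin.is_lt _
  et_inj k hk l hl he := by
    rw [nth_of_lt hk, nth_of_lt hl] at he
    exact h.inj hk hl (B.bijOn.injOn (h.adj hk) (h.adj hl) (Fin.ext he))
  conn D a ha haN hcl c hc := by
    have := B.isTree.connected.preconnected ⟨a, haN⟩ ⟨c, hc⟩
    exact reachable_mem (D := {a : Fin N | (a : ℕ) ∈ D})
      (fun a ha c hac => hcl a ha c (natAdj_val.2 hac)) ha this
  sum := by classical convert B.sum_degrees_add_two
  deg x hx := by
    classical
    have hxN : x < N := by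
      obtain ⟨c, hc⟩ := Finset.card_pos.1 (lt_of_lt_of_le two_pos hx)
      obtain ⟨h, _, _⟩ := (Finset.mem_filter.1 hc).2
      exact h
    have hcard := ncard_neighborSet B.T ⟨x, hxN⟩
    have hleaf : ¬ IsLeaf B.T ⟨x, hxN⟩ := by
      unfold IsLeaf
      rw [hcard]
      exact not_le.2 (lt_of_lt_of_le one_lt_two (le_of_le_of_eq hx (by congr)))
    refine ⟨?_, fun k (hk : k < L.length) he => hleaf ?_⟩
    · rw [← B.degree_eq_three _ hleaf, hcard]
    · rw [nth_of_lt hk] at he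
      have : IsLeaf B.T (B.leafOf L[k]) :=
        B.bijOn.mapsTo (show s(L[k].1, L[k].2) ∈ G.edgeSet from h.adj hk)
      rwa [show B.leafOf L[k] = ⟨x, hxN⟩ from Fin.ext he] at this
  width D x y hx hy hxy _ hcut hconn := B.card_bd_le_width h hx hy hxy hcut hconn (by
    classical
    intro k; rw [Finset.mem_filter, Finset.mem_range]; rfl)

-- All nodes except at most `m` leaves have degree three, while the degrees sum to `2N - 2`; so `3
-- (N - m) ≤ 2N - 2`.
include B in
theorem card_le_three_mul_length (hL : ListsEdges G L) : N ≤ 3 * L.length := by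
  classical
  have h1 := B.sum_degrees_add_two
  set E := (Finset.range L.length).image (nth L B.leafOf) with hE
  have h2 : ∀ x ∈ Finset.range N \ E, 3 ≤ ((Finset.range N).filter (natAdj B.T x)).card := by
    intro x hx
    rw [Finset.mem_sdiff, Finset.mem_range] at hx
    have hleaf : ¬ IsLeaf B.T ⟨x, hx.1⟩ := by
      intro hl
      obtain ⟨e, he, hex⟩ := B.bijOn.surjOn hl
      refine hx.2 (Finset.mem_image.2 ?_)
      induction e using Sym2.ind with
      | _ u w =>
        obtain ⟨k, hk, hks⟩ := hL.exists_of_adj he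
        refine ⟨k, Finset.mem_range.2 hk, ?_⟩
        rw [nth_of_lt hk, leafOf, hks, hex]
    rw [← B.degree_eq_three _ hleaf, ncard_neighborSet]
  have h3 := Finset.sum_le_sum h2
  have h4 := Finset.sum_le_sum_of_subset (f := fun x => ((Finset.range N).filter (natAdj B.T x)).card)
    (Finset.sdiff_subset : Finset.range N \ E ⊆ Finset.range N)
  have h5 : E.card ≤ L.length := Finset.card_image_le.trans (by simp)
  have h6 := Finset.le_card_sdiff E (Finset.range N)
  rw [Finset.sum_const, smul_eq_mul] at h3
  rw [Finset.card_range] at h6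
  have h7 : ∑ x ∈ Finset.range N, ((Finset.range N).filter (natAdj B.T x)).card + 2 = 2 * N := by
    convert h1
  omega

end BranchDecomposition

/-! ### The running time -/

/-- First `2c` is raised to `2b - r = (b - r) + b`, then `b - r` factors `R` are exchanged for the
larger `D`. -/
theorem pow_mul_pow_le {D R : ℝ} {b r c : ℕ} (hR : 1 ≤ R) (hRD : R ≤ D) (h1 : r ≤ b)
    (h2 : r + 2 * c ≤ 2 * b) : D ^ r * R ^ (2 * c) ≤ D ^ b * R ^ b := by
  have hD : 0 ≤ D := by linarith
  have hR0 : 0 ≤ R := by linarith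
  calc D ^ r * R ^ (2 * c) ≤ D ^ r * (R ^ (b - r) * R ^ b) := by
        rw [← pow_add]
        exact mul_le_mul_of_nonneg_left (pow_le_pow_right₀ hR (by omega)) (by positivity)
    _ ≤ D ^ r * (D ^ (b - r) * R ^ b) := by gcongr
    _ = D ^ b * R ^ b := by rw [← mul_assoc, ← pow_add, Nat.add_sub_cancel' h1]

/-- The time bound per edge. -/
noncomputable def rate (ds b : ℕ) : ℝ :=
  ((ds : ℝ) + 2) ^ b * (((ds : ℝ) + 1) ^ 2 + 1) ^ ((b : ℝ) / 2)

theorem rate_eq (ds b : ℕ) :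
    rate ds b = ((ds : ℝ) + 2) ^ b * √(((ds : ℝ) + 1) ^ 2 + 1) ^ b := by
  rw [rate, Real.sqrt_eq_rpow, ← Real.rpow_natCast (_ ^ (1 / 2 : ℝ)), ← Real.rpow_mul (by positivity)]
  congr 2
  ring

/-- The quantities to be bounded are natural numbers, so the floor of the real bound serves.
`pow_mul_pow_le` is applied with `D = d* + 2` and `R = √((d* + 1)^2 + 1)`. -/
theorem bound_floor {G : Net} (T : Deco G) : Bound T ⌊rate G.ds T.b⌋₊ := by
  have hR1 : (1 : ℝ) ≤ √(((G.ds : ℝ) + 1) ^ 2 + 1) := by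
    rw [Real.one_le_sqrt]; nlinarith [sq_nonneg ((G.ds : ℝ) + 1)]
  have hRD : √(((G.ds : ℝ) + 1) ^ 2 + 1) ≤ (G.ds : ℝ) + 2 := by
    rw [Real.sqrt_le_left (by positivity)]
    nlinarith [Nat.cast_nonneg (α := ℝ) G.ds]
  have hsq : √(((G.ds : ℝ) + 1) ^ 2 + 1) ^ 2 = ((G.ds : ℝ) + 1) ^ 2 + 1 :=
    Real.sq_sqrt (by positivity)
  refine ⟨Nat.le_floor ?_, fun A B hA hB hAB hA' hB' hd => Nat.le_floor ?_⟩
  · rw [rate_eq]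
    push_cast
    exact le_mul_of_one_le_right (by positivity) (one_le_pow₀ hR1)
  · set U := G.bd A ∪ G.bd B
    set C := G.bd A ∩ G.bd B with hC
    have hCU : C ⊆ U := Finset.inter_subset_union
    have hprod : ∏ v ∈ U, G.fac A B v = (G.ds + 2) ^ (U \ C).card * ((G.ds + 1) ^ 2 + 1) ^ C.card := by
      rw [← Finset.prod_sdiff hCU, Finset.prod_congr rfl (g := fun _ => G.ds + 2),
        Finset.prod_congr rfl (s₁ := C) (g := fun _ => (G.ds + 1) ^ 2 + 1), Finset.prod_const,
        Finset.prod_const]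
      · intro v hv
        exact if_pos (Finset.mem_inter.1 hv)
      · intro v hv
        exact if_neg fun h => (Finset.mem_sdiff.1 hv).2 (Finset.mem_inter.2 h)
    -- Only vertices common to both boundaries can disappear from the boundary in a join.
    have h1 : U \ C ⊆ G.bd (A ∪ B) := by
      intro v hv
      simp only [U, hC, Finset.mem_sdiff, Finset.mem_union, Finset.mem_inter] at hv
      by_cases hvA : v ∈ G.bd A
      · exact Net.mem_bd_union_of_left hA' hB' hd hvA fun h => hv.2 ⟨hvA, h⟩
      · rw [Finset.union_comm]
        exact Net.mem_bd_union_of_left hB' hA' hd.symm (hv.1.resolve_left hvA) hvA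
    have h2 := Finset.card_le_card h1
    have h3 := Finset.card_union_add_card_inter (G.bd A) (G.bd B)
    have h4 := Finset.card_sdiff_add_card_eq_card hCU
    -- The left side equals `|bd A| + |bd B|`.
    have h5 : (U \ C).card + 2 * C.card ≤ 2 * T.b := by
      change U.card + C.card = _ at h3
      omega
    have h6 := pow_mul_pow_le hR1 hRD (h2.trans hAB) h5
    rw [hprod, rate_eq]
    push_cast
    rwa [pow_mul √_, hsq] at h6

namespace BranchDecomposition

variable {n N : ℕ} {G : SimpleGraph (Fin n)} {d : Fin n → ℕ} (B : BranchDecomposition G (Fin N))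
  {LG : List (Fin n × Fin n)} {LT : List (Fin N × Fin N)} (hG : ListsEdges G LG)
  (hT : ListsEdges B.T LT)

include hT in
theorem length_eq_pred : LT.length = N - 1 := by
  classical
  have h1 := B.isTree.card_edgeFinset
  rw [Fintype.card_fin] at h1
  rw [hT.length_eq, ← SimpleGraph.coe_edgeFinset, Set.ncard_coe_finset]
  omega

include hT in
theorem inputList_deco : [n, LG.length, N] ++ List.ofFn d
      ++ (LG.flatMap fun p => [(p.1 : ℕ), (p.2 : ℕ), (B.τ s(p.1, p.2) : ℕ)])
      ++ (LT.flatMap fun p => [(p.1 : ℕ), (p.2 : ℕ)]) =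
    inputList (B.deco (d := d) hG) (nth LT Prod.fst) (nth LT Prod.snd) := by
  have h1 : List.ofFn d = (List.range n).map (netOf G d LG hG).d := by
    refine List.ext_getElem (by simp) fun k h1 h2 => ?_
    rw [List.length_ofFn] at h1
    simp only [List.getElem_ofFn, List.getElem_map, List.getElem_range]
    exact (show (netOf G d LG hG).d k = d ⟨k, h1⟩ from dif_pos h1).symm
  rw [inputList, h1, flatMap_eq_range LG _ (fun k => [nth LG Prod.fst k, nth LG Prod.snd k,
      nth LG B.leafOf k]) fun k hk => by simp only [nth_of_lt hk]; rfl,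
    flatMap_eq_range LT _ (fun k => [nth LT Prod.fst k, nth LT Prod.snd k])
      fun k hk => by simp only [nth_of_lt hk], B.length_eq_pred hT]
  rfl

-- With `F = 1` and `F` the identity this yields the initial values of the two arrays that drive the
-- dismantling of the tree.
include hT in
theorem sum_nb_deco (F : ℕ → ℕ) (x : ℕ) :
    ∑ k ∈ Finset.range (N - 1), ((if x = nth LT Prod.fst k then F (nth LT Prod.snd k) else 0) +
      (if x = nth LT Prod.snd k then F (nth LT Prod.fst k) else 0)) =
    ∑ c ∈ (B.deco (d := d) hG).nb (Finset.range N) x, F c := by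
  classical
  rw [← B.length_eq_pred hT, hT.edgeList.sum F x]
  refine Finset.sum_congr ?_ fun _ _ => rfl
  ext c
  rw [Finset.mem_filter, Deco.mem_nb]
  rfl

end BranchDecomposition

theorem exists_eq_maxDemand {n : ℕ} (d : Fin n → ℕ) : maxDemand d = 0 ∨ ∃ v, d v = maxDemand d := by
  rcases (Finset.univ : Finset (Fin n)).eq_empty_or_nonempty with h | h
  · left; rw [maxDemand, h, Finset.sup_empty]; rfl
  · obtain ⟨v, _, hv⟩ := Finset.exists_mem_eq_sup _ h d
    exact Or.inr ⟨v, hv.symm⟩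

/-- The algorithm prints a minimum vector dominating set in the claimed time. -/
theorem algorithm_correct {n N : ℕ} {G : SimpleGraph (Fin n)} {d : Fin n → ℕ}
    {B : BranchDecomposition G (Fin N)} {I : List ℕ} (h : Encodes G d B I) :
    ∃ S : List (Fin n), (algorithm.exec (St.init I)).out = S.map (fun v : Fin n => (v : ℕ)) ∧
      S.Nodup ∧ IsMinimumVectorDominating G d S.toFinset ∧
      ((algorithm.exec (St.init I)).tm : ℝ) ≤
        2018 * (rate (maxDemand d) B.width * (G.edgeSet.ncard : ℝ) + (numIsolated G : ℝ)) := by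
  classical
  obtain ⟨LG, LT, hG, hT, rfl⟩ := h
  have hJ := bound_floor (B.deco (d := d) hG)
  rw [B.inputList_deco hG hT]
  obtain ⟨S, f, hS, hf, hout, htm⟩ := algorithm_spec hJ (tu := nth LT Prod.fst)
    (tv := nth LT Prod.snd) (fun v hv => dif_neg (not_lt.2 hv))
    ((exists_eq_maxDemand d).imp_right fun ⟨v, hv⟩ => ⟨v, v.2, (dif_pos v.2).trans hv⟩)
    (fun x _ => by rw [Finset.card_eq_sum_ones]; exact B.sum_nb_deco hG hT (fun _ => 1) x)
    (fun x _ => B.sum_nb_deco hG hT (fun c => c) x)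
  refine ⟨(List.finRange n).filter fun v => f v, ?_, (List.nodup_finRange n).filter _,
    isMinimum_of_entry hG hS hf _ fun v => by simp, ?_⟩
  · rw [hout]
    change (List.range n).filter f = _
    rw [← List.map_coe_finRange_eq_range, List.filter_map]
    rfl
  · have h1 := B.card_le_three_mul_length hG
    have h2 := card_le_two_mul_length_add hG
    rw [hG.length_eq] at h1 h2
    set ρ := rate (maxDemand d) B.width with hρ
    change _ ≤ 500 * (LG.length * ⌊ρ⌋₊ + N * ⌊ρ⌋₊) + 9 * n at htm
    rw [hG.length_eq] at htm
    have hρ1 : 1 ≤ ρ := by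
      rw [hρ, rate_eq]
      refine one_le_mul_of_one_le_of_one_le (one_le_pow₀ ?_) (one_le_pow₀ ?_)
      · linarith [Nat.cast_nonneg (α := ℝ) (maxDemand d)]
      · rw [Real.one_le_sqrt]; nlinarith [sq_nonneg ((maxDemand d : ℝ) + 1)]
    have hfl : (⌊ρ⌋₊ : ℝ) ≤ ρ := Nat.floor_le (by linarith)
    have htm' : ((algorithm.exec (St.init (inputList (B.deco (d := d) hG) (nth LT Prod.fst)
        (nth LT Prod.snd)))).tm : ℝ) ≤
        500 * (G.edgeSet.ncard * ⌊ρ⌋₊ + N * ⌊ρ⌋₊) + 9 * n := by exact_mod_cast htm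
    have h1' : (N : ℝ) ≤ 3 * G.edgeSet.ncard := by exact_mod_cast h1
    have h2' : (n : ℝ) ≤ 2 * G.edgeSet.ncard + numIsolated G := by exact_mod_cast h2
    have hm : (0 : ℝ) ≤ G.edgeSet.ncard := Nat.cast_nonneg _
    have hi : (0 : ℝ) ≤ numIsolated G := Nat.cast_nonneg _
    have h3 : (N : ℝ) * ⌊ρ⌋₊ ≤ 3 * G.edgeSet.ncard * ρ :=
      mul_le_mul h1' hfl (Nat.cast_nonneg _) (by positivity)
    have h4 : (G.edgeSet.ncard : ℝ) * ⌊ρ⌋₊ ≤ G.edgeSet.ncard * ρ := mul_le_mul_of_nonneg_left hfl hm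
    have h5 : (G.edgeSet.ncard : ℝ) ≤ G.edgeSet.ncard * ρ := le_mul_of_one_le_right hm hρ1
    -- From `N ≤ 3m` the first term is at most `2000 m ρ`, and `9n ≤ 18m + 9i`; as `ρ ≥ 1`, the
    -- constant `2018 = 2000 + 18` suffices.
    linarith

end VectorDomination

/-- There is one random access machine program which, given any graph `G` with demands `d` and a
branch decomposition of `G`, prints a minimum `d`-vector dominating set of `G` (each of its members
once) in time `O((d* + 2) ^ b * ((d* + 1) ^ 2 + 1) ^ (b / 2) * m + i)`, where `d*` is the maximum
demand, `b` the width of the decomposition, `m` the number of edges of `G`, and `i` the number of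
isolated vertices of `G`. -/
theorem theorem1 :
    ∃ (P : VectorDomination.Program) (C : ℝ),
      ∀ (n N : ℕ) (G : SimpleGraph (Fin n)) (d : Fin n → ℕ)
        (B : VectorDomination.BranchDecomposition G (Fin N)) (I : List ℕ),
        VectorDomination.Encodes G d B I →
        ∃ (t : ℕ) (S : List (Fin n)),
          (t : ℝ) ≤ C * (((VectorDomination.maxDemand d : ℝ) + 2) ^ B.width
              * (((VectorDomination.maxDemand d : ℝ) + 1) ^ 2 + 1) ^ ((B.width : ℝ) / 2)
              * (G.edgeSet.ncard : ℝ)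
            + (VectorDomination.numIsolated G : ℝ)) ∧
          P.HaltsWithin I t (S.map (fun v : Fin n => (v : ℕ))) ∧
          S.Nodup ∧
          VectorDomination.IsMinimumVectorDominating G d S.toFinset := by
  obtain ⟨P, K, hP⟩ := VectorDomination.exists_program VectorDomination.algorithm
  refine ⟨P, K * 2018, fun n N G d B I hI => ?_⟩
  obtain ⟨S, hout, hnd, hmin, htm⟩ := VectorDomination.algorithm_correct hI
  obtain ⟨t, ht, hhalt⟩ := hP I
  refine ⟨t, S, ?_, hout ▸ hhalt, hnd, hmin⟩
  have ht' : (t : ℝ) ≤ K * ((VectorDomination.algorithm.exec (VectorDomination.St.init I)).tm : ℝ) := by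
    exact_mod_cast ht
  rw [mul_assoc]
  exact ht'.trans (mul_le_mul_of_nonneg_left htm (Nat.cast_nonneg _))
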